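/- Let $E/F$ be a quadratic extension of local fields of characteristic zero (Archimedean or not), let $\psi'$ be a nontrivial unitary additive character of $F$ and let $\psi$ be a nontrivial unitary additive character of $E$ which is trivial on $F$. Let $\tau\in E$ be the unique element of trace zero such that $\psi(z)=\psi'(\mathrm{Tr}_{E/F}(\tau z))$ for all $z\in E$, and let $|\cdot|_F$, $|\cdot|_E$ be the normalized absolute values. Equip $F$ with the Haar measure self-dual with respect to $\psi'$ and $E$ with the Haar measure self-dual with respect to $\psi'\circ\mathrm{Tr}_{E/F}$. Let $n\geqslant 1$. For $K\in\{F,E\}$ let $N_n(K)\subset \mathrm{GL}_n(K)$ be the subgroup of upper triangular unipotent matrices, with the Haar measure $du=\prod_{i<j}du_{i,j}$. Let $P_n(F)\subset \mathrm{GL}_n(F)$ be the mirabolic subgroup of matrices with last row $(0,\ldots,0,1)$. Equip $\mathrm{GL}_n(F)$ with the Haar measure $dh=|\det h|_F^{-n}\prod_{i,j}dh_{i,j}$, and $P_n(F)$ with the right Haar measure $dp=|\det p|_F^{-(n-1)}\prod_{1\leqslant i\leqslant n-1,\,1\leqslant j\leqslant n}dp_{i,j}$; equip $N_n(F)\backslash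 \mathrm{GL}_n(F)$ and $N_n(F)\backslash P_n(F)$ with the quotient measures. Let $\psi_n(u)=\psi\big((-1)^n\sum_{i=1}^{n-1}u_{i,i+1}\big)$ for $u\in N_n(E)$. Let $\mathcal S(\mathrm{GL}_n(E))$ be the space of Schwartz functions: locally constant compactly supported functions in the non-Archimedean case; in the Archimedean case, smooth functions $f$ such that for all $u,v$ in the enveloping algebra of the complexified real Lie algebra of $\mathrm{GL}_n(E)$ and all $N\geqslant 1$ the function $\|g\|^N\,|(R(u)L(v)f)(g)|$ is bounded, where $\|g\|=1+\sum_{i,j}|g_{i,j}|+|\det g|^{-1}$ and $|\cdot|$ is the usual absolute value. For $f\in\mathcal S(\mathrm{GL}_n(E))$ and $g_1,g_2\in \mathrm{GL}_n(E)$ set $$W_f(g_1,g_2)=\int_{N_n(E)}f(g_1^{-1}ug_2)\,\psi_n(u)^{-1}\,du .$$ Then, for every $f\in\mathcal S(\mathrm{GL}_n(E))$, $$\int_{\mathrm{GL}_n(F)}f(h)\,dh=|\tau|_E^{n(n-1)/4}\int_{N_n(F)\backslash P_n(F)}\int_{N_n(F)\backslash \mathrm{GL}_n(F)}W_f(p,h)\,dh\,dp,$$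 where $f$ is integrable on $\mathrm{GL}_n(F)$, the integrals defining $W_f$ converge absolutely, and the double integral on the right-hand side is absolutely convergent, i.e. $W_f$ is integrable on $(N_n(F)\backslash P_n(F))\times(N_n(F)\backslash \mathrm{GL}_n(F))$. -/

import Mathlib

open MeasureTheory
open scoped ENNReal ContDiff

noncomputable section

/-! ## Local fields, absolute values, self-dual measures -/

/-- A local field: a non-archimedean local field, or a topological field isomorphic to `ℝ` or to
`ℂ`. -/
class IsLocalField (K : Type*) [Field K] [TopologicalSpace K] : Prop
    extends IsTopologicalRing K, LocallyCompactSpace K where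
  nonarchimedean_or_real_or_complex :
    (∃ _ : ValuativeRel K, IsNonarchimedeanLocalField K) ∨
      (∃ e : K ≃+* ℝ, IsHomeomorph e) ∨ (∃ e : K ≃+* ℂ, IsHomeomorph e)

/-- The normalized absolute value `|x|_K`: the factor by which multiplication by `x` scales the
additive Haar measures of `K`. -/
def normAbs {K : Type*} [Field K] [TopologicalSpace K] [IsLocalField K] (x : K) : ℝ :=
  open Classical in
  if h : x = 0 then 0 else (distribHaarChar K (Units.mk0 x h) : ℝ)

/-- `μ` is the Haar measure on `K` which is self-dual with respect to the character `ψ`: the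
Fourier transform `φ ↦ (y ↦ ∫ φ(x) ψ(-xy) dμ(x))` satisfies the inversion formula
`(φ^)^(x) = φ(-x)`. -/
structure IsSelfDual {K : Type*} [Field K] [TopologicalSpace K] [MeasurableSpace K]
    (ψ : AddChar K Circle) (μ : Measure K) : Prop where
  isAddHaarMeasure : μ.IsAddHaarMeasure
  inversion : ∀ φ : K → ℂ, Continuous φ → Integrable φ μ →
    Integrable (Fourier.fourierIntegral ψ μ φ) μ →
    ∀ x, Fourier.fourierIntegral ψ μ (Fourier.fourierIntegral ψ μ φ) x = φ (-x)

/-! ## The groups -/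

instance generalLinearGroupMeasurableSpace (n : ℕ) (K : Type*) [Field K] [TopologicalSpace K] :
    MeasurableSpace (GL (Fin n) K) := borel _

instance generalLinearGroupBorelSpace (n : ℕ) (K : Type*) [Field K] [TopologicalSpace K] :
    BorelSpace (GL (Fin n) K) := ⟨rfl⟩

/-- `N_n(K)`: upper triangular matrices with ones on the diagonal. -/
def unipotentSubgroup (n : ℕ) (K : Type*) [Field K] : Subgroup (GL (Fin n) K) where
  carrier := {g | ∀ i j : Fin n, j ≤ i → (g : Matrix (Fin n) (Fin n) K) i j = if i = j then 1 else 0}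
  one_mem' := by
    intro i j _
    simp [Matrix.one_apply]
  mul_mem' := by
    intro a b ha hb i j hij
    rw [Units.val_mul, Matrix.mul_apply]
    rw [Finset.sum_eq_single i]
    · rw [ha i i le_rfl, if_pos rfl, one_mul, hb i j hij]
    · intro k _ hk
      rcases lt_or_gt_of_ne hk with h | h
      · rw [ha i k h.le, if_neg h.ne', zero_mul]
      · rw [hb k j (hij.trans h.le), if_neg (hij.trans_lt h).ne', mul_zero]
    · simp
  inv_mem' := by
    intro a ha
    have key : ∀ (m : ℕ) (i j : Fin n), n - (i : ℕ) = m → j ≤ i →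
        ((a⁻¹ : GL (Fin n) K) : Matrix (Fin n) (Fin n) K) i j = if i = j then 1 else 0 := by
      intro m
      induction m using Nat.strong_induction_on with
      | _ m ih =>
        intro i j hm hij
        have h1 : ((a * a⁻¹ : GL (Fin n) K) : Matrix (Fin n) (Fin n) K) i j =
            if i = j then 1 else 0 := by
          rw [mul_inv_cancel, Units.val_one, Matrix.one_apply]
        rw [Units.val_mul, Matrix.mul_apply, Finset.sum_eq_single i] at h1
        · rwa [ha i i le_rfl, if_pos rfl, one_mul] at h1
        · intro k _ hk
          rcases lt_or_gt_of_ne hk with h | h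
          · rw [ha i k h.le, if_neg h.ne', zero_mul]
          · have hlt : (i : ℕ) < k := h
            have hkn : (k : ℕ) < n := k.2
            rw [ih (n - k) (by omega) k j rfl (hij.trans h.le), if_neg (hij.trans_lt h).ne',
              mul_zero]
        · simp
    intro i j hij
    exact key _ i j rfl hij

/-- The mirabolic subgroup `P_n(K)`: matrices with last row `(0, …, 0, 1)`. -/
def mirabolicSubgroup (n : ℕ) (K : Type*) [Field K] : Subgroup (GL (Fin n) K) where
  carrier := {g | ∀ i j : Fin n, (i : ℕ) + 1 = n →
    (g : Matrix (Fin n) (Fin n) K) i j = if i = j then 1 else 0}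
  one_mem' := by
    intro i j _
    simp [Matrix.one_apply]
  mul_mem' := by
    intro a b ha hb i j hi
    rw [Units.val_mul, Matrix.mul_apply, Finset.sum_eq_single i]
    · rw [ha i i hi, if_pos rfl, one_mul, hb i j hi]
    · intro k _ hk
      rw [ha i k hi, if_neg hk.symm, zero_mul]
    · simp
  inv_mem' := by
    intro a ha i j hi
    have h1 : ((a * a⁻¹ : GL (Fin n) K) : Matrix (Fin n) (Fin n) K) i j =
        if i = j then 1 else 0 := by
      rw [mul_inv_cancel, Units.val_one, Matrix.one_apply]
    rw [Units.val_mul, Matrix.mul_apply, Finset.sum_eq_single i] at h1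
    · rwa [ha i i hi, if_pos rfl, one_mul] at h1
    · intro k _ hk
      rw [ha i k hi, if_neg hk.symm, zero_mul]
    · simp

theorem unipotentSubgroup_le_mirabolicSubgroup (n : ℕ) (K : Type*) [Field K] :
    unipotentSubgroup n K ≤ mirabolicSubgroup n K := by
  intro g hg i j hi
  exact hg i j (Fin.le_def.2 (by have := j.2; omega))

/-! ## Measures on the groups -/

section Measures

variable {K : Type*} [Field K] [TopologicalSpace K] [MeasurableSpace K]

/-- The measure `∏_{(i,j) ∈ S} dg_{i,j}` on a space `X` of invertible matrices which is
parametrized by the entries with index in `S`, `dg_{i,j}` being the measure `μ` on `K`. -/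
def entryMeasure {n : ℕ} {X : Type*} [MeasurableSpace X] (ι : X → GL (Fin n) K)
    (S : Finset (Fin n × Fin n)) (μ : Measure K) : Measure X :=
  Measure.comap (fun (x : X) (ij : S) => (ι x : Matrix (Fin n) (Fin n) K) ij.1.1 ij.1.2)
    (Measure.pi fun _ : S => μ)

/-- The Haar measure `∏_{i<j} du_{i,j}` on `N_n(K)`. -/
def unipotentMeasure (n : ℕ) (μ : Measure K) : Measure (unipotentSubgroup n K) :=
  entryMeasure (unipotentSubgroup n K).subtype
    (Finset.univ.filter fun ij : Fin n × Fin n => ij.1 < ij.2) μ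

variable [IsLocalField K]

/-- The Haar measure `|det g|⁻ⁿ ∏_{i,j} dg_{i,j}` on `GL_n(K)`. -/
def generalLinearMeasure (n : ℕ) (μ : Measure K) : Measure (GL (Fin n) K) :=
  (entryMeasure (id : GL (Fin n) K → GL (Fin n) K) Finset.univ μ).withDensity fun g =>
    ENNReal.ofReal ((normAbs (g : Matrix (Fin n) (Fin n) K).det ^ n)⁻¹)

/-- The right Haar measure `|det p|^{-(n-1)} ∏_{i<n} dp_{i,j}` on `P_n(K)` (the product runs over
the entries outside of the last row). Writing `p = v g` with `v ∈ U_n(K)` and `g ∈ GL_{n-1}(K)`, it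
is the product of the measures `∏ dv_{i,n}` and `|det g|^{-(n-1)} ∏ dg_{i,j}`. -/
def mirabolicMeasure (n : ℕ) (μ : Measure K) : Measure (mirabolicSubgroup n K) :=
  (entryMeasure (mirabolicSubgroup n K).subtype
    (Finset.univ.filter fun ij : Fin n × Fin n => (ij.1 : ℕ) + 1 < n) μ).withDensity fun p =>
      ENNReal.ofReal ((normAbs ((p : GL (Fin n) K) : Matrix (Fin n) (Fin n) K).det ^ (n - 1))⁻¹)

end Measures

/-! ## Quotients -/

/-- The set `N\H` of cosets `N h`, for a group `N` embedded in `H` through `ι`, with the quotient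
`σ`-algebra. -/
abbrev LeftQuotient {N H : Type*} [Group N] [Group H] (ι : N →* H) : Type _ :=
  Quotient (QuotientGroup.rightRel ι.range)

instance leftQuotientMeasurableSpace {N H : Type*} [Group N] [Group H] [MeasurableSpace H]
    (ι : N →* H) : MeasurableSpace (LeftQuotient ι) :=
  MeasurableSpace.map (Quotient.mk _) inferInstance

/-- `ν` is the quotient of the measure `μH` on `H` by the measure `μN` on `N`:
`∫_H φ(h) dh = ∫_{N\H} ∫_N φ(n h) dn dh` for every measurable `φ ≥ 0` on `H`. The inner integral
only depends on the coset of `h` as soon as `μN` is right invariant. -/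
def IsQuotientMeasure {N H : Type*} [Group N] [Group H] [MeasurableSpace N] [MeasurableSpace H]
    (ι : N →* H) (μN : Measure N) (μH : Measure H) (ν : Measure (LeftQuotient ι)) : Prop :=
  ∀ φ : H → ℝ≥0∞, Measurable φ →
    ∫⁻ h, φ h ∂μH = ∫⁻ x : LeftQuotient ι, ∫⁻ u : N, φ (ι u * x.out) ∂μN ∂ν

/-- The inclusion `N_n(K) → P_n(K)`. -/
def unipotentToMirabolic (n : ℕ) (K : Type*) [Field K] :
    unipotentSubgroup n K →* mirabolicSubgroup n K :=
  Subgroup.inclusion (unipotentSubgroup_le_mirabolicSubgroup n K)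

/-! ## Schwartz functions -/

section Schwartz

variable {n : ℕ}

/-- The exponential map of `GL_n(ℂ)`. -/
def expGL (X : Matrix (Fin n) (Fin n) ℂ) : GL (Fin n) ℂ := (Matrix.isUnit_exp X).unit

/-- `(R(X)f)(g) = d/dt f(g exp(tX))` at `t = 0`. -/
def rightDeriv (X : Matrix (Fin n) (Fin n) ℂ) (f : GL (Fin n) ℂ → ℂ) : GL (Fin n) ℂ → ℂ :=
  fun g => deriv (fun t : ℝ => f (g * expGL (t • X))) 0

/-- `(L(X)f)(g) = d/dt f(exp(-tX) g)` at `t = 0`. -/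
def leftDeriv (X : Matrix (Fin n) (Fin n) ℂ) (f : GL (Fin n) ℂ → ℂ) : GL (Fin n) ℂ → ℂ :=
  fun g => deriv (fun t : ℝ => f (expGL (-(t • X)) * g)) 0

/-- The norm of the affine variety `GL_n` over `ℂ`. -/
def glNorm (g : GL (Fin n) ℂ) : ℝ :=
  1 + ∑ i, ∑ j, ‖(g : Matrix (Fin n) (Fin n) ℂ) i j‖ + ‖(g : Matrix (Fin n) (Fin n) ℂ).det‖⁻¹

/-- `f` is `C^∞` on `GL_n(ℂ)`, seen as an open subset of the real vector space of matrices. -/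
def IsSmoothGL (f : GL (Fin n) ℂ → ℂ) : Prop :=
  open Classical in
  ContDiffOn ℝ ∞
    (fun M : Fin n → Fin n → ℂ => if h : IsUnit (Matrix.of M) then f h.unit else 0)
    {M | IsUnit (Matrix.of M)}

/-- `f ∈ S(GL_n(ℂ))`, where `GL_n(ℂ)` is seen as a real group: `f` is smooth and
`R(u)L(v)f` decays faster than any power of the norm, for all `u`, `v` in the enveloping algebra
(it is enough to take for `u = X₁⋯X_k` and `v = Y₁⋯Y_l` products of elements of the real Lie
algebra of `GL_n(ℂ)`, as they span). -/
def IsSchwartzComplex (f : GL (Fin n) ℂ → ℂ) : Prop :=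
  IsSmoothGL f ∧ ∀ (Xs Ys : List (Matrix (Fin n) (Fin n) ℂ)) (N : ℕ), ∃ C : ℝ,
    ∀ g, ‖(Xs.foldr rightDeriv (Ys.foldr leftDeriv f)) g‖ * glNorm g ^ N ≤ C

/-- `f ∈ S(GL_n(E))`: locally constant with compact support if `E` is non-archimedean, and as above
if `E` is isomorphic to `ℂ`. -/
def IsSchwartzGL {E : Type*} [Field E] [TopologicalSpace E] (f : GL (Fin n) E → ℂ) : Prop :=
  ((∃ _ : ValuativeRel E, IsNonarchimedeanLocalField E) ∧ IsLocallyConstant f ∧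
      HasCompactSupport f) ∨
    ∃ e : E ≃+* ℂ, IsHomeomorph e ∧
      IsSchwartzComplex fun g => f (Matrix.GeneralLinearGroup.map (e.symm : ℂ →+* E) g)

end Schwartz

/-! ## The function `W_f` -/

section Whittaker

variable {n : ℕ} {E : Type*} [Field E]

/-- The character `ψ_n(u) = ψ((-1)^n ∑_{i=1}^{n-1} u_{i,i+1})` of `N_n(E)`. -/
def unipotentChar (ψ : AddChar E Circle) (u : unipotentSubgroup n E) : Circle :=
  ψ ((-1) ^ n * ∑ i : Fin n, if h : (i : ℕ) + 1 < n then
    ((u : GL (Fin n) E) : Matrix (Fin n) (Fin n) E) i ⟨(i : ℕ) + 1, h⟩ else 0)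

/-- The integrand `f(g₁⁻¹ u g₂) ψ_n(u)⁻¹` of `W_f(g₁, g₂)`. -/
def whittakerIntegrand (ψ : AddChar E Circle) (f : GL (Fin n) E → ℂ) (g₁ g₂ : GL (Fin n) E)
    (u : unipotentSubgroup n E) : ℂ :=
  f (g₁⁻¹ * (u : GL (Fin n) E) * g₂) * (((unipotentChar ψ u)⁻¹ : Circle) : ℂ)

/-- `W_f(g₁, g₂) = ∫_{N_n(E)} f(g₁⁻¹ u g₂) ψ_n(u)⁻¹ du`, with `E` carrying the measure `μ`. -/
def whittaker [TopologicalSpace E] [MeasurableSpace E] (ψ : AddChar E Circle) (μ : Measure E)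
    (f : GL (Fin n) E → ℂ) (g₁ g₂ : GL (Fin n) E) : ℂ :=
  ∫ u, whittakerIntegrand ψ f g₁ g₂ u ∂(unipotentMeasure n μ)

end Whittaker

/-- The embedding `GL_n(F) → GL_n(E)`. -/
def baseChangeGL (n : ℕ) (F E : Type*) [Field F] [Field E] [Algebra F E] :
    GL (Fin n) F →* GL (Fin n) E :=
  Matrix.GeneralLinearGroup.map (algebraMap F E)

/-- `W_f` as a function on `(N_n(F)\P_n(F)) × (N_n(F)\GL_n(F))`. It is evaluated at
representatives; when `ψ` is trivial on `F`, `W_f` is invariant under left translation of either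
variable by `N_n(F)`, so that their choice does not matter. -/
def whittakerOnQuotients {n : ℕ} {F E : Type*} [Field F] [Field E] [Algebra F E]
    [TopologicalSpace E] [MeasurableSpace E] (ψ : AddChar E Circle) (μ : Measure E)
    (f : GL (Fin n) E → ℂ) (p : LeftQuotient (unipotentToMirabolic n F))
    (h : LeftQuotient (unipotentSubgroup n F).subtype) : ℂ :=
  whittaker ψ μ f (baseChangeGL n F E (p.out : mirabolicSubgroup n F)) (baseChangeGL n F E h.out)

end

/-!
The identity is an inverse Fourier transform at the origin over the space of matrices strictly above
the diagonal, once the double integral has been unfolded.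

*Coordinates on `N_n(E)`.* Since `E = F ⊕ τ F`, every element of `N_n(E)` is uniquely `σ(s) u` with
`u ∈ N_n(F)` and `s` a family of `D = n (n - 1) / 2` elements of `F`; the Haar measure becomes
`c ^ D ds du` (`IsTraceZeroGenerator.uniMeasure_eq`). As `ψ` is trivial on `F`, the function
`W_f(p, h)` is `c ^ D` times the integral over `u ∈ N_n(F)` of `V(p, u h)`, where `V(p, h)` is the integral of
`f(p⁻¹ σ(s) h)` against a character of the superdiagonal sum of `s`
(`IsDecayingGL.whittaker_eq_sliceIntegral`). Integrating over `N_n(F) \ GL_n(F)` therefore yields the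
integral of `c ^ D V(p, h)` over all of `GL_n(F)`.

*Coordinates on `N_n(F) \ P_n(F)`.* Outside a null set, this quotient has representatives `p_Y`, with
`Y` again a family of `D` elements of `F`: in each size, the block of `Y` is the last row of an element
of `GL_{n-1}(F)` (`RowSection.quotientMeasure_eq`). Replacing `h` by `p_Y g`, and changing variables in
`s`, the matrix `p_Y⁻¹ σ(s) p_Y` becomes a matrix `A_Y(s)`, and the superdiagonal sum becomes the
pairing `∑ Y_t s_t`, the Jacobian cancelling the density of `dY` (`lintegral_conj_point`). The double
integral is thus `c ^ D` times the integral over `(Y, g)` of the Fourier coefficient at `Y` of the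
function `s ↦ f(A_Y(s) g)`.

*Absolute convergence.* The variable `Y` enters `A_Y(s)` only through bounded matrices, so that
`f(A_Y(s) g)` decays rapidly in `s` and `g`, uniformly in `Y`. The decay of the Fourier coefficient in
`Y` is obtained from finite differences, which make sense over every local field. Schwartz functions
have small differences along lines of unipotent matrices (`IsSchwartzGL.exists_isRapidGL`), and a
difference with step of size `|Y_t|⁻¹` in the direction of the largest coordinate `Y_t` multiplies the
coefficient by a constant (`IsRapidGL.exists_norm_integral_twist_le`,
`IsRapidGL.integrable_twistIntegral`).

*Inversion.* The function which is transformed depends on the dual variable `Y`, but in a triangular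
way: only the blocks `j > i` of `Y` act on the block `i` of `s`. Inverting one block at a time gives
`f(A_Y(0) g) = f(g)` times a power of `|2 τ²|⁻¹` (`IsDecayingGL.integral_integral_twist`). The constants
cancel because the measure of `E` is self-dual (`IsTraceZeroGenerator.mul_eq_one`).

All types of local fields are treated together, by means of an absolute value whose balls are compact
(`IsProperAbs`) and of the resulting heights on `GL_n`.
-/

open MeasureTheory Filter Topology
open scoped ENNReal ContDiff

noncomputable section

set_option linter.unusedSectionVars false

/-! ### Absolute values of local fields -/

/-- An absolute value on a topological field which defines a proper, non-discrete topology: it is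
continuous, its closed balls are compact, and it takes values greater than `1`. -/
structure IsProperAbs {K : Type*} [Field K] [TopologicalSpace K] (N : AbsoluteValue K ℝ) :
    Prop where
  continuous : Continuous N
  isCompact_ball : ∀ r : ℝ, IsCompact {x | N x ≤ r}
  exists_one_lt : ∃ a, 1 < N a

/-- The valuation has rank at most one, hence embeds in the non-negative reals. -/
theorem exists_isProperAbs_of_nonarchimedean (K : Type*) [Field K] [TopologicalSpace K]
    [ValuativeRel K] [IsNonarchimedeanLocalField K] :
    ∃ N : AbsoluteValue K ℝ, IsProperAbs N ∧ ∀ x y, N (x + y) ≤ max (N x) (N y) := by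
  classical
  let e := (ValuativeRel.IsRankLeOne.nonempty (R := K)).some.emb
  have he : StrictMono e := (ValuativeRel.IsRankLeOne.nonempty (R := K)).some.strictMono
  let v := ValuativeRel.valuation K
  have hmax : ∀ x y, ((e (v (x + y)) : NNReal) : ℝ) ≤ max (e (v x) : ℝ) (e (v y) : ℝ) := by
    intro x y
    have h1 := he.monotone (v.map_add x y)
    rw [he.monotone.map_max] at h1
    exact_mod_cast h1
  let N : AbsoluteValue K ℝ :=
    { toFun := fun x => (e (v x) : ℝ)
      map_mul' := by intro x y; simp
      nonneg' := by intro x; positivity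
      eq_zero' := by intro x; simp
      add_le' := by
        intro x y
        exact (hmax x y).trans (max_le_add_of_nonneg (by positivity) (by positivity)) }
  have hN : ∀ x, N x = (e (v x) : ℝ) := fun _ => rfl
  have hle : ∀ x y, N x ≤ N y ↔ v x ≤ v y := by
    intro x y
    rw [hN, hN, NNReal.coe_le_coe, he.le_iff_le]
  have hlt : ∀ x y, N x < N y ↔ v x < v y := by
    intro x y
    rw [hN, hN, NNReal.coe_lt_coe, he.lt_iff_lt]
  obtain ⟨r, hr0, hr1⟩ := Valuation.IsNontrivial.exists_lt_one (v := v)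
  have hr0' : r ≠ 0 := by
    rintro rfl
    simp at hr0
  have hNr1 : N r < 1 := by
    have := (hlt r 1).2 (by simpa using hr1)
    simpa using this
  have hcont : Continuous N := by
    have h0 : ContinuousAt N 0 := by
      rw [ContinuousAt, map_zero, Metric.tendsto_nhds]
      intro ε hε
      obtain ⟨n, hn⟩ := exists_pow_lt_of_lt_one hε hNr1
      have := (IsValuativeTopology.hasBasis_nhds_zero' K).mem_of_mem
        (i := v (r ^ n)) (by simpa using fun h => absurd h hr0')
      filter_upwards [this] with x hx
      rw [Real.dist_eq, sub_zero, abs_of_nonneg (N.nonneg x)]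
      refine lt_trans ((hlt x (r ^ n)).2 hx) ?_
      rwa [map_pow]
    rw [continuous_iff_continuousAt]
    intro x
    rw [ContinuousAt, tendsto_iff_dist_tendsto_zero]
    have h1 : Tendsto (fun y => N (y - x)) (𝓝 x) (𝓝 0) := by
      have h2 : Tendsto (fun y => y - x) (𝓝 x) (𝓝 0) := by
        have : Continuous fun y : K => y - x := by fun_prop
        simpa using this.tendsto x
      simpa [Function.comp_def] using h0.tendsto.comp h2
    refine squeeze_zero (fun _ => dist_nonneg) (fun y => ?_) h1
    rw [Real.dist_eq]
    exact N.abs_abv_sub_le_abv_sub y x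
  refine ⟨N, ⟨hcont, ?_, ⟨r⁻¹, ?_⟩⟩, hmax⟩
  · intro R
    have h1 : 1 < N r⁻¹ := by
      rw [map_inv₀]
      exact (one_lt_inv₀ (N.pos hr0')).2 hNr1
    obtain ⟨n, hn⟩ := pow_unbounded_of_one_lt R h1
    refine (IsNonarchimedeanLocalField.isCompact_closedBall K (v (r⁻¹ ^ n))).of_isClosed_subset
      (isClosed_le hcont continuous_const) ?_
    intro x hx
    refine (hle _ _).1 ?_
    rw [map_pow]
    exact le_trans hx hn.le
  · rw [map_inv₀]
    exact (one_lt_inv₀ (N.pos hr0')).2 hNr1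

theorem exists_isProperAbs_of_normed {K L : Type*} [Field K] [TopologicalSpace K]
    [NontriviallyNormedField L] [ProperSpace L] (e : K ≃+* L) (he : IsHomeomorph e) :
    ∃ N : AbsoluteValue K ℝ, IsProperAbs N ∧ ∀ x, N x = ‖e x‖ := by
  let N : AbsoluteValue K ℝ :=
    { toFun := fun x => ‖e x‖
      map_mul' := by intro x y; simp
      nonneg' := by intro x; positivity
      eq_zero' := by intro x; simp
      add_le' := by intro x y; simpa using norm_add_le (e x) (e y) }
  refine ⟨N, ⟨?_, ?_, ?_⟩, fun _ => rfl⟩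
  · exact continuous_norm.comp he.continuous
  · intro r
    have h1 : IsCompact (Metric.closedBall (0 : L) r) := isCompact_closedBall 0 r
    have h2 := h1.image (he.homeomorph).symm.continuous
    convert h2 using 1
    ext x
    constructor
    · intro hx
      have hx' : ‖e x‖ ≤ r := hx
      exact ⟨e x, by simpa using hx', (he.homeomorph).symm_apply_apply x⟩
    · rintro ⟨y, hy, rfl⟩
      have : e ((he.homeomorph).symm y) = y := (he.homeomorph).apply_symm_apply y
      show ‖e _‖ ≤ r
      rw [this]
      simpa using hy
  · obtain ⟨x, hx⟩ := NormedField.exists_one_lt_norm L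
    exact ⟨e.symm x, by simpa [N] using hx⟩

theorem exists_isProperAbs (K : Type*) [Field K] [TopologicalSpace K] [IsLocalField K] :
    ∃ N : AbsoluteValue K ℝ, IsProperAbs N := by
  rcases IsLocalField.nonarchimedean_or_real_or_complex (K := K) with ⟨_, _⟩ | ⟨e, he⟩ | ⟨e, he⟩
  · obtain ⟨N, h, -⟩ := exists_isProperAbs_of_nonarchimedean K
    exact ⟨N, h⟩
  · obtain ⟨N, h, -⟩ := exists_isProperAbs_of_normed e he
    exact ⟨N, h⟩
  · obtain ⟨N, h, -⟩ := exists_isProperAbs_of_normed e he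
    exact ⟨N, h⟩

namespace IsProperAbs

variable {K : Type*} [Field K] [TopologicalSpace K] {N : AbsoluteValue K ℝ}

theorem t2Space [IsTopologicalRing K] (hN : IsProperAbs N) : T2Space K := by
  have : IsClosed ({0} : Set K) := by
    convert isClosed_singleton (x := (0 : ℝ)).preimage hN.continuous using 1
    ext x; simp
  have := (IsTopologicalAddGroup.t1Space K this)
  infer_instance

theorem sigmaCompactSpace (hN : IsProperAbs N) : SigmaCompactSpace K := by
  refine ⟨⟨fun n => {x | N x ≤ n}, fun n => hN.isCompact_ball n, ?_⟩⟩
  ext x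
  simpa using exists_nat_ge (N x)

theorem exists_ball_subset [IsTopologicalRing K] (hN : IsProperAbs N) {U : Set K}
    (hU : U ∈ 𝓝 (0 : K)) : ∃ ε > 0, {x | N x < ε} ⊆ U := by
  have := hN.t2Space
  obtain ⟨V, hVU, hV, h0⟩ := mem_nhds_iff.1 hU
  have hc : IsCompact ({x | N x ≤ 1} \ V) := (hN.isCompact_ball 1).diff hV
  rcases ({x | N x ≤ 1} \ V).eq_empty_or_nonempty with he | hne
  · refine ⟨1, one_pos, fun x hx => hVU ?_⟩
    by_contra h
    have : x ∈ {x | N x ≤ 1} \ V := ⟨(le_of_lt hx : N x ≤ 1), h⟩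
    rw [he] at this
    exact this
  · obtain ⟨x, hx, hmin⟩ := hc.exists_isMinOn hne hN.continuous.continuousOn
    have hx0 : x ≠ 0 := by
      rintro rfl
      exact hx.2 h0
    refine ⟨min 1 (N x), lt_min one_pos (N.pos hx0), fun y hy => hVU ?_⟩
    by_contra h
    have h1 : y ∈ {x | N x ≤ 1} \ V := ⟨((lt_of_lt_of_le hy (min_le_left _ _)).le : N y ≤ 1), h⟩
    have h2 : N x ≤ N y := hmin h1
    exact absurd (lt_of_lt_of_le hy (min_le_right _ _)) (not_lt.2 h2)

theorem ball_mem_nhds (hN : IsProperAbs N) {ε : ℝ} (hε : 0 < ε) : {x | N x < ε} ∈ 𝓝 (0 : K) :=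
  (isOpen_lt hN.continuous continuous_const).mem_nhds (by simpa using hε)

theorem secondCountableTopology [IsTopologicalRing K] (hN : IsProperAbs N) :
    SecondCountableTopology K := by
  have := hN.sigmaCompactSpace
  let := IsTopologicalAddGroup.rightUniformSpace K
  have := isUniformAddGroup_of_addCommGroup (G := K)
  have hb : (𝓝 (0 : K)).HasBasis (fun _ : ℕ => True) fun n => {x | N x < 1 / ((n : ℝ) + 1)} := by
    refine ⟨fun U => ⟨fun hU => ?_, ?_⟩⟩
    · obtain ⟨ε, hε, h⟩ := hN.exists_ball_subset hU
      obtain ⟨n, hn⟩ := exists_nat_one_div_lt hε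
      exact ⟨n, trivial, fun x hx => h (lt_trans hx hn)⟩
    · rintro ⟨n, -, h⟩
      exact mem_of_superset (hN.ball_mem_nhds (by positivity)) h
  have : (𝓝 (0 : K)).IsCountablyGenerated := hb.isCountablyGenerated
  have := IsUniformAddGroup.uniformity_countably_generated (α := K)
  let := UniformSpace.pseudoMetricSpace K
  exact EMetric.secondCountable_of_sigmaCompact K

theorem neBot_nhdsNE (hN : IsProperAbs N) [IsTopologicalRing K] : (𝓝[≠] (0 : K)).NeBot := by
  obtain ⟨a, ha⟩ := hN.exists_one_lt
  have ha0 : a ≠ 0 := by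
    rintro rfl
    simp at ha
    linarith
  rw [← mem_closure_iff_nhdsWithin_neBot, mem_closure_iff_nhds]
  intro U hU
  obtain ⟨ε, hε, h⟩ := hN.exists_ball_subset hU
  obtain ⟨n, hn⟩ := exists_pow_lt_of_lt_one hε (inv_lt_one_of_one_lt₀ ha)
  refine ⟨a⁻¹ ^ n, h ?_, ?_⟩
  · simpa using hn
  · simp [ha0]

end IsProperAbs

/-! ### Haar measures of local fields -/

instance (priority := 50) IsLocalField.instT2Space (K : Type*) [Field K] [TopologicalSpace K]
    [IsLocalField K] : T2Space K :=
  (exists_isProperAbs K).choose_spec.t2Space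

instance (priority := 50) IsLocalField.instSecondCountableTopology (K : Type*) [Field K]
    [TopologicalSpace K] [IsLocalField K] : SecondCountableTopology K :=
  (exists_isProperAbs K).choose_spec.secondCountableTopology

instance (priority := 50) IsLocalField.instSigmaCompactSpace (K : Type*) [Field K]
    [TopologicalSpace K] [IsLocalField K] : SigmaCompactSpace K :=
  (exists_isProperAbs K).choose_spec.sigmaCompactSpace

section NormAbs

variable {K : Type*} [Field K] [TopologicalSpace K] [IsLocalField K]

theorem normAbs_zero : normAbs (0 : K) = 0 := by simp [normAbs]

theorem normAbs_of_ne {x : K} (h : x ≠ 0) : normAbs x = distribHaarChar K (Units.mk0 x h) := by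
  simp [normAbs, h]

theorem normAbs_pos {x : K} (h : x ≠ 0) : 0 < normAbs x := by
  rw [normAbs_of_ne h]
  exact_mod_cast distribHaarChar_pos

theorem normAbs_nonneg (x : K) : 0 ≤ normAbs x := by
  by_cases h : x = 0
  · simp [h, normAbs_zero]
  · exact (normAbs_pos h).le

theorem normAbs_mul (x y : K) : normAbs (x * y) = normAbs x * normAbs y := by
  by_cases hx : x = 0
  · simp [hx, normAbs_zero]
  by_cases hy : y = 0
  · simp [hy, normAbs_zero]
  rw [normAbs_of_ne hx, normAbs_of_ne hy, normAbs_of_ne (mul_ne_zero hx hy), Units.mk0_mul,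
    map_mul, NNReal.coe_mul]

theorem normAbs_one : normAbs (1 : K) = 1 := by
  rw [normAbs_of_ne one_ne_zero]
  simp

/-- The normalized absolute value as a homomorphism. -/
def normAbsHom : K →*₀ ℝ where
  toFun := normAbs
  map_zero' := normAbs_zero
  map_one' := normAbs_one
  map_mul' := normAbs_mul

theorem normAbs_pow (x : K) (n : ℕ) : normAbs (x ^ n) = normAbs x ^ n :=
  map_pow (normAbsHom (K := K)) x n

theorem normAbs_inv (x : K) : normAbs x⁻¹ = (normAbs x)⁻¹ :=
  map_inv₀ (normAbsHom (K := K)) x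

theorem normAbs_neg (x : K) : normAbs (-x) = normAbs x := by
  have h : normAbs (-1 : K) ^ 2 = 1 := by
    rw [← normAbs_pow]; simp [normAbs_one]
  have h1 : normAbs (-1 : K) = 1 := by
    nlinarith [normAbs_nonneg (-1 : K)]
  rw [← neg_one_mul, normAbs_mul, h1, one_mul]

theorem normAbs_prod {ι : Type*} (s : Finset ι) (x : ι → K) :
    normAbs (∏ i ∈ s, x i) = ∏ i ∈ s, normAbs (x i) :=
  map_prod (normAbsHom (K := K)) x s

variable [MeasurableSpace K] [BorelSpace K] (μ : Measure K) [μ.IsAddHaarMeasure]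

open scoped Pointwise in
theorem map_mul_left_eq_normAbs_smul {x : K} (hx : x ≠ 0) :
    μ.map (x * ·) = ENNReal.ofReal (normAbs x)⁻¹ • μ := by
  have hm : Measurable (x * · : K → K) := (continuous_const_mul x).measurable
  ext s hs
  rw [Measure.map_apply hm hs, Measure.smul_apply, smul_eq_mul]
  have h1 := distribHaarChar_mul μ (Units.mk0 x hx)⁻¹ s
  have h2 : (Units.mk0 x hx)⁻¹ • s = (x * ·) ⁻¹' s := by
    rw [← Set.preimage_smul]
    rfl
  rw [h2] at h1
  rw [← h1, map_inv, normAbs_of_ne hx, ← NNReal.coe_inv, ENNReal.ofReal_coe_nnreal]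

theorem lintegral_comp_mul_left_normAbs {x : K} (hx : x ≠ 0) {φ : K → ℝ≥0∞} (hφ : Measurable φ) :
    ∫⁻ v, φ (x * v) ∂μ = ENNReal.ofReal (normAbs x)⁻¹ * ∫⁻ v, φ v ∂μ := by
  have hm : Measurable (x * · : K → K) := (continuous_const_mul x).measurable
  rw [← lintegral_map hφ hm, map_mul_left_eq_normAbs_smul μ hx, lintegral_smul_measure, smul_eq_mul]

theorem integral_comp_mul_left_normAbs {x : K} (hx : x ≠ 0) (φ : K → ℂ) :
    ∫ v, φ (x * v) ∂μ = ((normAbs x)⁻¹ : ℝ) * ∫ v, φ v ∂μ := by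
  have he : MeasurableEmbedding (x * · : K → K) :=
    (Homeomorph.mulLeft₀ x hx).measurableEmbedding
  rw [← he.integral_map (g := φ), map_mul_left_eq_normAbs_smul μ hx,
    integral_smul_measure, ENNReal.toReal_ofReal (inv_nonneg.2 (normAbs_nonneg x))]
  simp

end NormAbs

section Proper

variable {K : Type*} [Field K] [TopologicalSpace K] [IsLocalField K] {N : AbsoluteValue K ℝ}
  [MeasurableSpace K] [BorelSpace K] (μ : Measure K) [μ.IsAddHaarMeasure]

namespace IsProperAbs

omit [IsLocalField K] [BorelSpace K] in
theorem measure_ball_pos (hN : IsProperAbs N) {r : ℝ} (hr : 0 < r) : 0 < μ {x | N x ≤ r} := by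
  refine Measure.measure_pos_of_mem_nhds μ (x := 0) ?_
  exact mem_of_superset (hN.ball_mem_nhds hr) fun x hx => (le_of_lt hx : N x ≤ r)

omit [IsLocalField K] [BorelSpace K] in
theorem measure_ball_lt_top (hN : IsProperAbs N) (r : ℝ) : μ {x | N x ≤ r} < ⊤ :=
  (hN.isCompact_ball r).measure_lt_top

theorem measure_ball_eq (hN : IsProperAbs N) {x : K} (hx : x ≠ 0) :
    μ {v | N v ≤ N x} = ENNReal.ofReal (normAbs x) * μ {v | N v ≤ 1} := by
  have hm : Measurable (x * · : K → K) := (continuous_const_mul x).measurable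
  have hs : MeasurableSet {v | N v ≤ N x} :=
    (isClosed_le hN.continuous continuous_const).measurableSet
  have h := congrArg (fun ν => ν {v | N v ≤ N x}) (map_mul_left_eq_normAbs_smul μ hx)
  simp only [Measure.smul_apply, smul_eq_mul] at h
  rw [Measure.map_apply hm hs] at h
  have h2 : (x * ·) ⁻¹' {v | N v ≤ N x} = {v | N v ≤ 1} := by
    ext v
    simp [N.pos hx]
  rw [h2] at h
  rw [h, ← mul_assoc, ← ENNReal.ofReal_mul (normAbs_nonneg x), mul_inv_cancel₀ (normAbs_pos hx).ne']
  simp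

end IsProperAbs

omit [MeasurableSpace K] [BorelSpace K] in
theorem IsProperAbs.normAbs_mono (hN : IsProperAbs N) {x y : K} (h : N x ≤ N y) :
    normAbs x ≤ normAbs y := by
  borelize K
  by_cases hx : x = 0
  · simpa [hx, normAbs_zero] using normAbs_nonneg y
  have hy : y ≠ 0 := by
    rintro rfl
    have := N.pos hx
    simp at h
    exact hx h
  let μ : Measure K := Measure.addHaar
  have h1 : μ {v | N v ≤ N x} ≤ μ {v | N v ≤ N y} :=
    measure_mono fun v hv => le_trans hv h
  rw [hN.measure_ball_eq μ hx, hN.measure_ball_eq μ hy,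
    ENNReal.mul_le_mul_iff_left (hN.measure_ball_pos μ one_pos).ne'
      (hN.measure_ball_lt_top μ 1).ne, ENNReal.ofReal_le_ofReal_iff (normAbs_nonneg y)] at h1
  exact h1

omit [MeasurableSpace K] [BorelSpace K] in
/-- The normalized absolute value is of polynomial growth: both absolute values are compared with the
powers of an element `a` such that `1 < N a`. -/
theorem IsProperAbs.exists_normAbs_le (hN : IsProperAbs N) :
    ∃ C > 0, ∃ r : ℕ, ∀ x : K, normAbs x ≤ C * max 1 (N x) ^ r := by
  obtain ⟨a, ha⟩ := hN.exists_one_lt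
  have ha0 : a ≠ 0 := by
    rintro rfl
    simp at ha
    linarith
  obtain ⟨r, hr⟩ := pow_unbounded_of_one_lt (normAbs a) ha
  refine ⟨max 1 (N a ^ r), by positivity, r, fun x => ?_⟩
  rcases le_or_gt (N x) 1 with hx | hx
  · have h1 := hN.normAbs_mono (x := x) (y := 1) (by simpa using hx)
    rw [normAbs_one] at h1
    calc normAbs x ≤ 1 * 1 := by simpa using h1
      _ ≤ _ := by
        gcongr
        · exact le_max_left _ _
        · exact one_le_pow₀ (le_max_left _ _)
  · obtain ⟨k, hk1, hk2⟩ := exists_nat_pow_near hx.le ha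
    have h1 := hN.normAbs_mono (x := x) (y := a ^ (k + 1)) (by simpa using hk2.le)
    rw [normAbs_pow] at h1
    calc normAbs x ≤ normAbs a ^ (k + 1) := h1
      _ ≤ (N a ^ r) ^ (k + 1) := by
        gcongr
        exact normAbs_nonneg a
      _ = N a ^ r * (N a ^ k) ^ r := by ring
      _ ≤ max 1 (N a ^ r) * max 1 (N x) ^ r := by
        gcongr
        · exact le_max_right _ _
        · exact hk1.trans (le_max_right _ _)

theorem measurable_normAbs : Measurable (normAbs : K → ℝ) := by
  obtain ⟨N, hN⟩ := exists_isProperAbs K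
  refine measurable_of_Iic fun c => ?_
  rcases Set.eq_empty_or_nonempty {x : K | c < normAbs x} with he | hne
  · convert MeasurableSet.univ
    ext x
    have : x ∉ {x : K | c < normAbs x} := by rw [he]; simp
    simpa using this
  · have hset : normAbs ⁻¹' Set.Iic c = (N ⁻¹' (N '' {x : K | c < normAbs x}))ᶜ := by
      ext x
      simp only [Set.mem_preimage, Set.mem_Iic, Set.mem_compl_iff, Set.mem_image, not_exists]
      constructor
      · rintro hx y ⟨hy, hxy⟩
        have hy' : c < normAbs y := hy
        have := hN.normAbs_mono hxy.le
        linarith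
      · intro h
        by_contra h'
        exact h x ⟨lt_of_not_ge h', rfl⟩
    rw [hset]
    -- the set of absolute values occurring is an upper set within the range, hence Borel after
    -- replacing it by its upward closure
    have h2 : N ⁻¹' (N '' {x : K | c < normAbs x}) =
        N ⁻¹' {r | ∃ y : K, c < normAbs y ∧ N y ≤ r} := by
      ext x
      constructor
      · rintro ⟨y, hy, hxy⟩
        exact ⟨y, hy, hxy.le⟩
      · rintro ⟨y, hy, hxy⟩
        exact ⟨x, lt_of_lt_of_le hy (hN.normAbs_mono hxy), rfl⟩
    rw [h2]
    refine (hN.continuous.measurable ?_).compl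
    refine IsUpperSet.ordConnected ?_ |>.measurableSet
    rintro r s hrs ⟨y, hy, hyr⟩
    exact ⟨y, hy, hyr.trans hrs⟩

/-- The standard integrable majorant on a local field: `max(1,|v|)⁻ᴹ`. -/
def decay (N : AbsoluteValue K ℝ) (M : ℕ) (v : K) : ℝ := (max 1 (N v) ^ M)⁻¹

omit [TopologicalSpace K] [IsLocalField K] [MeasurableSpace K] [BorelSpace K] in
theorem decay_pos (M : ℕ) (v : K) : 0 < decay N M v := by
  have : (0 : ℝ) < max 1 (N v) := lt_of_lt_of_le one_pos (le_max_left _ _)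
  unfold decay; positivity

omit [TopologicalSpace K] [IsLocalField K] [MeasurableSpace K] [BorelSpace K] in
theorem decay_le_one (M : ℕ) (v : K) : decay N M v ≤ 1 :=
  inv_le_one_of_one_le₀ (one_le_pow₀ (le_max_left _ _))

omit [TopologicalSpace K] [IsLocalField K] [MeasurableSpace K] [BorelSpace K] in
theorem decay_zero (M : ℕ) : decay N M 0 = 1 := by simp [decay]

omit [IsLocalField K] [MeasurableSpace K] [BorelSpace K] in
theorem IsProperAbs.continuous_decay (hN : IsProperAbs N) (M : ℕ) : Continuous (decay N M) := by
  have h : Continuous fun v => max 1 (N v) := continuous_const.max hN.continuous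
  refine (h.pow M).inv₀ fun v => ?_
  exact (pow_pos (lt_of_lt_of_le one_pos (le_max_left _ _)) M).ne'

/-- The ball `N v ≤ N (a ^ (k + 1))` has measure proportional to `|a| ^ (k + 1)`, so that the integral
is bounded by a geometric series as soon as `|a| < N a ^ M`. -/
theorem IsProperAbs.exists_integrable_decay (hN : IsProperAbs N) :
    ∃ M : ℕ, Integrable (decay N M) μ := by
  obtain ⟨a, ha⟩ := hN.exists_one_lt
  have ha0 : a ≠ 0 := by
    rintro rfl
    simp at ha
    linarith
  have hapos : 0 < N a := one_pos.trans ha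
  obtain ⟨M, hM⟩ := pow_unbounded_of_one_lt (normAbs a) ha
  refine ⟨M, (hN.continuous_decay M).aestronglyMeasurable, ?_⟩
  rw [hasFiniteIntegral_iff_ofReal (Eventually.of_forall fun v => (decay_pos M v).le)]
  let B : ℕ → Set K := fun k => {v | N v ≤ N (a ^ (k + 1))}
  have hB : ∀ k, MeasurableSet (B k) := fun k =>
    (isClosed_le hN.continuous continuous_const).measurableSet
  let c : ℕ → ℝ := fun k => ((N a ^ M) ^ k)⁻¹
  have h1 : ∀ v, ENNReal.ofReal (decay N M v) ≤
      ∑' k, (B k).indicator (fun _ => ENNReal.ofReal (c k)) v := by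
    intro v
    have hex : ∃ k : ℕ, v ∈ B k ∧ decay N M v ≤ c k := by
      rcases le_or_gt (N v) 1 with hv | hv
      · refine ⟨0, ?_, by simpa [c] using decay_le_one M v⟩
        show N v ≤ N (a ^ (0 + 1))
        simpa using hv.trans ha.le
      · obtain ⟨k, hk1, hk2⟩ := exists_nat_pow_near hv.le ha
        refine ⟨k, ?_, ?_⟩
        · show N v ≤ N (a ^ (k + 1))
          simpa using hk2.le
        · simp only [decay, c]
          gcongr
          rw [← pow_mul, mul_comm, pow_mul]
          gcongr
          exact hk1.trans (le_max_right _ _)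
    obtain ⟨k, hk, hkc⟩ := hex
    refine le_trans ?_ (ENNReal.le_tsum k)
    rw [Set.indicator_of_mem hk]
    exact ENNReal.ofReal_le_ofReal hkc
  refine lt_of_le_of_lt (lintegral_mono h1) ?_
  rw [lintegral_tsum fun k => (measurable_const.indicator (hB k)).aemeasurable]
  have h2 : ∀ k, ∫⁻ v, (B k).indicator (fun _ => ENNReal.ofReal (c k)) v ∂μ =
      ENNReal.ofReal (normAbs a * (normAbs a / N a ^ M) ^ k) * μ {v | N v ≤ 1} := by
    intro k
    rw [lintegral_indicator_const (hB k), hN.measure_ball_eq μ (pow_ne_zero _ ha0), ← mul_assoc,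
      ← ENNReal.ofReal_mul (by positivity), normAbs_pow]
    congr 2
    simp only [c, div_pow]
    field_simp
    ring
  simp_rw [h2]
  rw [ENNReal.tsum_mul_right]
  refine ENNReal.mul_lt_top ?_ (hN.measure_ball_lt_top μ 1)
  have hq : normAbs a / N a ^ M < 1 := by
    rw [div_lt_one (by positivity)]
    exact hM
  have hs : Summable fun k : ℕ => normAbs a * (normAbs a / N a ^ M) ^ k :=
    (summable_geometric_of_lt_one (div_nonneg (normAbs_nonneg a) (by positivity)) hq).mul_left _
  exact hs.tsum_ofReal_lt_top

end Proper

/-! ### Linear changes of variables -/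

section Linear

variable {K : Type*} [Field K] [TopologicalSpace K] [IsLocalField K]
  [MeasurableSpace K] [BorelSpace K] (μ : Measure K) [μ.IsAddHaarMeasure]
  {ι : Type*} [Fintype ι] [DecidableEq ι]

open Matrix

omit [DecidableEq ι] in
theorem measurable_mulVec (M : Matrix ι ι K) : Measurable fun v : ι → K => M *ᵥ v :=
  (continuous_const.matrix_mulVec continuous_id).measurable

theorem measurePreserving_transvectionStruct (t : TransvectionStruct ι K) :
    MeasurePreserving (fun v : ι → K => t.toMatrix *ᵥ v) (Measure.pi fun _ => μ)
      (Measure.pi fun _ => μ) := by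
  have ht := measurable_mulVec t.toMatrix
  refine ⟨ht, ?_⟩
  refine (Measure.pi_eq fun s hs ↦ ?_).symm
  have h2s : MeasurableSet (Set.univ.pi s) := .pi Set.countable_univ fun i _ ↦ hs i
  simp_rw [← Measure.pi_pi, ← lintegral_indicator_one h2s]
  rw [lintegral_map (measurable_one.indicator h2s) ht]
  refine lintegral_eq_of_lmarginal_eq {t.i} ((measurable_one.indicator h2s).comp ht)
    (measurable_one.indicator h2s) ?_
  simp_rw [lmarginal_singleton]
  ext x
  cases t with | mk t_i t_j t_hij t_c =>
  simp [transvection, add_mulVec, single_mulVec, t_hij.symm, ← Function.update_add,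
    lintegral_add_right_eq_self fun xᵢ ↦ Set.indicator (Set.univ.pi s) 1 (Function.update x t_i xᵢ)]

theorem map_diagonal_mulVec {D : ι → K} (hD : ∀ i, D i ≠ 0) :
    (Measure.pi fun _ : ι => μ).map (fun v => diagonal D *ᵥ v) =
      ENNReal.ofReal (normAbs (diagonal D).det)⁻¹ • Measure.pi fun _ : ι => μ := by
  have h1 : (fun v : ι → K => diagonal D *ᵥ v) = fun v i => D i * v i := by
    ext v i
    exact mulVec_diagonal D v i
  have h0 : ∀ i, μ.map (D i * ·) = ENNReal.ofReal (normAbs (D i))⁻¹ • μ := fun i =>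
    map_mul_left_eq_normAbs_smul μ (hD i)
  have hsf : ∀ i, SigmaFinite (μ.map (D i * ·)) := fun i =>
    (Homeomorph.mulLeft₀ (D i) (hD i)).toMeasurableEquiv.sigmaFinite_map
  rw [h1, Measure.pi_map_pi (hμ := hsf) fun i => (continuous_const_mul (D i)).aemeasurable]
  refine Measure.pi_eq fun s hs => ?_
  simp_rw [Measure.smul_apply, Measure.pi_pi, h0, Measure.smul_apply, smul_eq_mul,
    Finset.prod_mul_distrib]
  congr 1
  rw [det_diagonal, normAbs_prod, ← Finset.prod_inv_distrib, ENNReal.ofReal_prod_of_nonneg]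
  exact fun i _ => inv_nonneg.2 (normAbs_nonneg _)

/-- An invertible matrix scales the product Haar measure on column vectors by the normalized
absolute value of its determinant. -/
theorem map_mulVec_eq_normAbs_smul {M : Matrix ι ι K} (hM : M.det ≠ 0) :
    (Measure.pi fun _ : ι => μ).map (fun v => M *ᵥ v) =
      ENNReal.ofReal (normAbs M.det)⁻¹ • Measure.pi fun _ : ι => μ := by
  apply diagonal_transvection_induction_of_det_ne_zero _ M hM
  · intro D hD
    refine map_diagonal_mulVec μ fun i => ?_
    rw [det_diagonal, Finset.prod_ne_zero_iff] at hD
    exact hD i (Finset.mem_univ i)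
  · intro t
    rw [(measurePreserving_transvectionStruct μ t).map_eq]
    simp [normAbs_one]
  · intro A B _ _ hA hB
    have h : (fun v => (A * B) *ᵥ v) = (fun v : ι → K => A *ᵥ v) ∘ fun v => B *ᵥ v := by
      ext v
      simp
    rw [h, ← Measure.map_map (measurable_mulVec A) (measurable_mulVec B), hB, Measure.map_smul, hA,
      smul_smul, ← ENNReal.ofReal_mul (inv_nonneg.2 (normAbs_nonneg _)), det_mul, normAbs_mul,
      mul_inv, mul_comm]

theorem lintegral_comp_mulVec {M : Matrix ι ι K} (hM : M.det ≠ 0) {φ : (ι → K) → ℝ≥0∞}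
    (hφ : Measurable φ) :
    ∫⁻ v, φ (M *ᵥ v) ∂(Measure.pi fun _ => μ) =
      ENNReal.ofReal (normAbs M.det)⁻¹ * ∫⁻ v, φ v ∂(Measure.pi fun _ => μ) := by
  rw [← lintegral_map hφ (measurable_mulVec M), map_mulVec_eq_normAbs_smul μ hM,
    lintegral_smul_measure, smul_eq_mul]

end Linear

/-! ### The affine embedding of matrices of size `n` in matrices of size `n + 1` -/

section Affine

open Matrix

variable {n : ℕ} {R S : Type*} [CommRing R] [CommRing S]

/-- The block matrix with rows `(A, v)` and `(0, 1)`. -/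
def affMat (A : Matrix (Fin n) (Fin n) R) (v : Fin n → R) : Matrix (Fin (n + 1)) (Fin (n + 1)) R :=
  Matrix.of fun i j => Fin.lastCases (motive := fun _ => R)
    (Fin.lastCases (motive := fun _ => R) 1 (fun _ => 0) j)
    (fun i => Fin.lastCases (motive := fun _ => R) (v i) (fun j => A i j) j) i

variable (A B : Matrix (Fin n) (Fin n) R) (v w : Fin n → R)

@[simp] theorem affMat_castSucc_castSucc (i j : Fin n) :
    affMat A v i.castSucc j.castSucc = A i j := by simp [affMat]

@[simp] theorem affMat_castSucc_last (i : Fin n) :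
    affMat A v i.castSucc (Fin.last n) = v i := by simp [affMat]

@[simp] theorem affMat_last_castSucc (j : Fin n) :
    affMat A v (Fin.last n) j.castSucc = 0 := by simp [affMat]

@[simp] theorem affMat_last_last : affMat A v (Fin.last n) (Fin.last n) = 1 := by simp [affMat]

theorem affMat_mul : affMat A v * affMat B w = affMat (A * B) (A *ᵥ w + v) := by
  ext i j
  rw [mul_apply, Fin.sum_univ_castSucc]
  refine Fin.lastCases ?_ (fun i => ?_) i <;> refine Fin.lastCases ?_ (fun j => ?_) j <;>
    simp [mul_apply, mulVec, dotProduct]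

theorem affMat_one_zero : affMat (1 : Matrix (Fin n) (Fin n) R) 0 = 1 := by
  ext i j
  refine Fin.lastCases ?_ (fun i => ?_) i <;> refine Fin.lastCases ?_ (fun j => ?_) j <;>
    simp [one_apply, Fin.ext_iff, (Fin.is_lt _).ne, (Fin.is_lt _).ne']

theorem affMat_map (f : R →+* S) : (affMat A v).map f = affMat (A.map f) (f ∘ v) := by
  ext i j
  refine Fin.lastCases ?_ (fun i => ?_) i <;> refine Fin.lastCases ?_ (fun j => ?_) j <;> simp

theorem det_affMat : (affMat A v).det = A.det := by
  have h : affMat A v = (fromBlocks A (replicateCol (Fin 1) v) 0 1).submatrix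
      (finSumFinEquiv (m := n) (n := 1)).symm (finSumFinEquiv (m := n) (n := 1)).symm := by
    ext i j
    refine Fin.lastCases ?_ (fun i => ?_) i <;> refine Fin.lastCases ?_ (fun j => ?_) j
    · have : finSumFinEquiv.symm (Fin.last n) = Sum.inr (0 : Fin 1) :=
        finSumFinEquiv_symm_last
      simp [this]
    · have : finSumFinEquiv.symm (Fin.last n) = Sum.inr (0 : Fin 1) :=
        finSumFinEquiv_symm_last
      have h2 : finSumFinEquiv.symm (Fin.castSucc j) = (Sum.inl j : Fin n ⊕ Fin 1) :=
        finSumFinEquiv_symm_apply_castAdd j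
      simp [this, h2]
    · have : finSumFinEquiv.symm (Fin.last n) = Sum.inr (0 : Fin 1) :=
        finSumFinEquiv_symm_last
      have h2 : finSumFinEquiv.symm (Fin.castSucc i) = (Sum.inl i : Fin n ⊕ Fin 1) :=
        finSumFinEquiv_symm_apply_castAdd i
      simp [this, h2]
    · have h2 : ∀ i, finSumFinEquiv.symm (Fin.castSucc i) = (Sum.inl i : Fin n ⊕ Fin 1) :=
        fun i => finSumFinEquiv_symm_apply_castAdd i
      simp [h2]
  rw [h, det_submatrix_equiv_self, det_fromBlocks_zero₂₁]
  simp

/-- The element `(g, v; 0, 1)` of `GL_{n+1}`. -/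
def aff (g : GL (Fin n) R) (v : Fin n → R) : GL (Fin (n + 1)) R where
  val := affMat g v
  inv := affMat (g⁻¹ : GL (Fin n) R) (-((g⁻¹ : GL (Fin n) R) : Matrix _ _ R) *ᵥ v)
  val_inv := by
    rw [affMat_mul, ← Units.val_mul, mul_inv_cancel, mulVec_mulVec, mul_neg, ← Units.val_mul,
      mul_inv_cancel, Units.val_one, neg_mulVec, one_mulVec, neg_add_cancel, affMat_one_zero]
  inv_val := by
    rw [affMat_mul, ← Units.val_mul, inv_mul_cancel, neg_mulVec, add_neg_cancel, Units.val_one,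
      affMat_one_zero]

variable (g h : GL (Fin n) R)

@[simp] theorem coe_aff : (aff g v : Matrix _ _ R) = affMat g v := rfl

theorem aff_mul : aff g v * aff h w = aff (g * h) ((g : Matrix _ _ R) *ᵥ w + v) :=
  Units.ext (affMat_mul _ _ _ _)

theorem aff_one_zero : aff (1 : GL (Fin n) R) 0 = 1 := Units.ext affMat_one_zero

theorem aff_inv : (aff g v)⁻¹ = aff g⁻¹ (-((g⁻¹ : GL (Fin n) R) : Matrix _ _ R) *ᵥ v) :=
  Units.ext rfl

theorem aff_inv_zero : (aff g 0)⁻¹ = aff g⁻¹ 0 := by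
  rw [aff_inv, mulVec_zero]

theorem aff_map (f : R →+* S) :
    GeneralLinearGroup.map f (aff g v) = aff (GeneralLinearGroup.map f g) (f ∘ v) :=
  Units.ext (affMat_map _ _ f)

end Affine

/-! ### Heights of invertible matrices -/

section Height

open Matrix

variable {K : Type*} [Field K] (N : AbsoluteValue K ℝ)

/-- The sum of the absolute values of the coordinates of a vector. -/
def vecNorm {ι : Type*} [Fintype ι] (v : ι → K) : ℝ := ∑ i, N (v i)

/-- The sum of the absolute values of the entries of a matrix. -/
def entryNorm {m n : Type*} [Fintype m] [Fintype n] (X : Matrix m n K) : ℝ :=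
  ∑ i, ∑ j, N (X i j)

/-- A submultiplicative measure of the size of an invertible matrix and of its inverse. -/
def height {n : ℕ} (g : GL (Fin n) K) : ℝ :=
  (1 + entryNorm N (g : Matrix (Fin n) (Fin n) K)) *
    (1 + entryNorm N ((g⁻¹ : GL (Fin n) K) : Matrix (Fin n) (Fin n) K))

variable {N} {l m k ι : Type*} [Fintype l] [Fintype m] [Fintype k] [Fintype ι]

theorem vecNorm_nonneg (v : ι → K) : 0 ≤ vecNorm N v :=
  Finset.sum_nonneg fun _ _ => N.nonneg _

theorem entryNorm_nonneg (X : Matrix l m K) : 0 ≤ entryNorm N X :=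
  Finset.sum_nonneg fun _ _ => Finset.sum_nonneg fun _ _ => N.nonneg _

theorem le_vecNorm (v : ι → K) (i : ι) : N (v i) ≤ vecNorm N v :=
  Finset.single_le_sum (f := fun i => N (v i)) (fun _ _ => N.nonneg _) (Finset.mem_univ i)

theorem le_entryNorm (X : Matrix l m K) (i : l) (j : m) : N (X i j) ≤ entryNorm N X :=
  (le_vecNorm (N := N) (X i) j).trans <|
    Finset.single_le_sum (f := fun i => ∑ j, N (X i j))
      (fun _ _ => Finset.sum_nonneg fun _ _ => N.nonneg _) (Finset.mem_univ i)

theorem entryNorm_smul (a : K) (X : Matrix l m K) : entryNorm N (a • X) = N a * entryNorm N X := by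
  simp [entryNorm, Finset.mul_sum]

theorem entryNorm_add_le (X Y : Matrix l m K) :
    entryNorm N (X + Y) ≤ entryNorm N X + entryNorm N Y := by
  simp_rw [entryNorm, ← Finset.sum_add_distrib]
  exact Finset.sum_le_sum fun i _ => Finset.sum_le_sum fun j _ => N.add_le _ _

theorem entryNorm_zero : entryNorm N (0 : Matrix l m K) = 0 := by simp [entryNorm]

theorem vecNorm_mulVec_le (X : Matrix l m K) (v : m → K) :
    vecNorm N (X *ᵥ v) ≤ entryNorm N X * vecNorm N v := by
  rw [vecNorm, entryNorm, Finset.sum_mul]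
  refine Finset.sum_le_sum fun i _ => ?_
  calc N ((X *ᵥ v) i) ≤ ∑ j, N (X i j * v j) := N.sum_le _ _
    _ ≤ ∑ j, N (X i j) * vecNorm N v := by
      refine Finset.sum_le_sum fun j _ => ?_
      rw [map_mul]
      exact mul_le_mul_of_nonneg_left (le_vecNorm v j) (N.nonneg _)
    _ = _ := by rw [Finset.sum_mul]

theorem entryNorm_mul_le (X : Matrix l m K) (Y : Matrix m k K) :
    entryNorm N (X * Y) ≤ entryNorm N X * entryNorm N Y := by
  calc entryNorm N (X * Y) ≤ ∑ i, ∑ j, ∑ p, N (X i p) * N (Y p j) := by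
        refine Finset.sum_le_sum fun i _ => Finset.sum_le_sum fun j _ => ?_
        rw [mul_apply]
        refine (N.sum_le _ _).trans (Finset.sum_le_sum fun p _ => ?_)
        rw [map_mul]
    _ = ∑ i, ∑ p, N (X i p) * ∑ j, N (Y p j) := by
        refine Finset.sum_congr rfl fun i _ => ?_
        rw [Finset.sum_comm]
        simp_rw [Finset.mul_sum]
    _ ≤ ∑ i, ∑ p, N (X i p) * entryNorm N Y := by
        refine Finset.sum_le_sum fun i _ => Finset.sum_le_sum fun p _ => ?_
        refine mul_le_mul_of_nonneg_left ?_ (N.nonneg _)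
        exact Finset.single_le_sum (f := fun p => ∑ j, N (Y p j))
          (fun _ _ => Finset.sum_nonneg fun _ _ => N.nonneg _) (Finset.mem_univ p)
    _ = _ := by simp_rw [entryNorm, Finset.sum_mul]

theorem one_add_entryNorm_mul_le (X : Matrix l m K) (Y : Matrix m k K) :
    1 + entryNorm N (X * Y) ≤ (1 + entryNorm N X) * (1 + entryNorm N Y) := by
  nlinarith [entryNorm_mul_le (N := N) X Y, entryNorm_nonneg (N := N) X,
    entryNorm_nonneg (N := N) Y]

theorem entryNorm_one (n : ℕ) : entryNorm N (1 : Matrix (Fin n) (Fin n) K) = n := by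
  have h : ∀ i j : Fin n, N ((1 : Matrix (Fin n) (Fin n) K) i j) = if i = j then 1 else 0 := by
    intro i j
    rw [one_apply]
    split_ifs <;> simp
  simp [entryNorm, h]

variable {n : ℕ}

theorem height_mul_le (g h : GL (Fin n) K) : height N (g * h) ≤ height N g * height N h := by
  rw [height, height, height, _root_.mul_inv_rev, Units.val_mul, Units.val_mul]
  have h1 := one_add_entryNorm_mul_le (N := N) (g : Matrix (Fin n) (Fin n) K)
    (h : Matrix (Fin n) (Fin n) K)
  have h2 := one_add_entryNorm_mul_le (N := N) ((h⁻¹ : GL (Fin n) K) : Matrix (Fin n) (Fin n) K)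
    ((g⁻¹ : GL (Fin n) K) : Matrix (Fin n) (Fin n) K)
  refine (mul_le_mul h1 h2 (add_nonneg zero_le_one (entryNorm_nonneg _)) ?_).trans (le_of_eq ?_)
  · exact mul_nonneg (add_nonneg zero_le_one (entryNorm_nonneg _))
      (add_nonneg zero_le_one (entryNorm_nonneg _))
  · ring

theorem height_inv (g : GL (Fin n) K) : height N g⁻¹ = height N g := by
  rw [height, height, inv_inv, mul_comm]

theorem one_le_height (g : GL (Fin n) K) : 1 ≤ height N g := by
  rw [height]
  nlinarith [entryNorm_nonneg (N := N) (g : Matrix (Fin n) (Fin n) K),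
    entryNorm_nonneg (N := N) ((g⁻¹ : GL (Fin n) K) : Matrix (Fin n) (Fin n) K)]

theorem height_pos (g : GL (Fin n) K) : 0 < height N g := one_pos.trans_le (one_le_height g)

theorem one_add_entryNorm_le_height (g : GL (Fin n) K) :
    1 + entryNorm N (g : Matrix (Fin n) (Fin n) K) ≤ height N g := by
  rw [height]
  nlinarith [entryNorm_nonneg (N := N) (g : Matrix (Fin n) (Fin n) K),
    entryNorm_nonneg (N := N) ((g⁻¹ : GL (Fin n) K) : Matrix (Fin n) (Fin n) K)]

theorem abs_det_le {M : Matrix (Fin n) (Fin n) K} {c : ℝ} (hc : ∀ i j, N (M i j) ≤ c) :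
    N M.det ≤ n.factorial * c ^ n := by
  rw [det_apply]
  refine (N.sum_le _ _).trans ?_
  have h : ∀ σ : Equiv.Perm (Fin n), N (Equiv.Perm.sign σ • ∏ i, M (σ i) i) ≤ c ^ n := by
    intro σ
    have h1 : N (Equiv.Perm.sign σ • ∏ i, M (σ i) i) = N (∏ i, M (σ i) i) := by
      rcases Int.units_eq_one_or (Equiv.Perm.sign σ) with h | h <;> simp [h, Units.smul_def]
    rw [h1, map_prod]
    calc ∏ i, N (M (σ i) i) ≤ ∏ _i : Fin n, c :=
          Finset.prod_le_prod (fun _ _ => N.nonneg _) fun i _ => hc _ _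
      _ = c ^ n := by simp
  refine (Finset.sum_le_sum fun σ _ => h σ).trans ?_
  simp [Fintype.card_perm]

theorem abs_det_le_height (g : GL (Fin n) K) :
    N (g : Matrix (Fin n) (Fin n) K).det ≤ n.factorial * height N g ^ n :=
  abs_det_le fun i j => (le_entryNorm _ i j).trans
    (by linarith [one_add_entryNorm_le_height (N := N) g])

theorem abs_det_inv_le_height (g : GL (Fin n) K) :
    (N (g : Matrix (Fin n) (Fin n) K).det)⁻¹ ≤ n.factorial * height N g ^ n := by
  have h := abs_det_le_height (N := N) g⁻¹
  rw [height_inv] at h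
  have h2 : ((g⁻¹ : GL (Fin n) K) : Matrix (Fin n) (Fin n) K).det =
      ((g : Matrix (Fin n) (Fin n) K).det)⁻¹ := by
    rw [coe_units_inv, det_nonsing_inv, Ring.inverse_eq_inv']
  rwa [h2, map_inv₀] at h

/-- Cramer's rule bounds the height polynomially in terms of the entries and of `|det g|⁻¹`. -/
theorem height_le_of_det (g : GL (Fin n) K) :
    height N g ≤ (1 + n * n * n.factorial) *
      (1 + entryNorm N (g : Matrix (Fin n) (Fin n) K) +
        (N (g : Matrix (Fin n) (Fin n) K).det)⁻¹) ^ (n + 2) := by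
  set e := entryNorm N (g : Matrix (Fin n) (Fin n) K) with he
  set d := (N (g : Matrix (Fin n) (Fin n) K).det)⁻¹ with hd
  have he0 : 0 ≤ e := entryNorm_nonneg _
  have hd0 : 0 ≤ d := inv_nonneg.2 (N.nonneg _)
  have h1 : entryNorm N ((g⁻¹ : GL (Fin n) K) : Matrix (Fin n) (Fin n) K) ≤
      n * n * (d * (n.factorial * (1 + e) ^ n)) := by
    have h2 : ∀ i j, N (((g⁻¹ : GL (Fin n) K) : Matrix (Fin n) (Fin n) K) i j) ≤
        d * (n.factorial * (1 + e) ^ n) := by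
      intro i j
      rw [coe_units_inv, inv_def, Ring.inverse_eq_inv', Matrix.smul_apply, smul_eq_mul, map_mul, map_inv₀]
      refine mul_le_mul_of_nonneg_left ?_ hd0
      rw [adjugate_apply]
      refine abs_det_le fun a b => ?_
      rw [updateRow_apply]
      split_ifs with hab
      · rw [Pi.single_apply]
        split_ifs <;> simp <;> linarith
      · linarith [le_entryNorm (N := N) (g : Matrix (Fin n) (Fin n) K) a b]
    refine (Finset.sum_le_sum fun i _ => Finset.sum_le_sum fun j _ => h2 i j).trans ?_
    simp [mul_assoc]
  have h3 : 1 + e ≤ 1 + e + d := by linarith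
  have h4 : d ≤ 1 + e + d := by linarith
  have h5 : 1 ≤ 1 + e + d := by linarith
  have hf : (0 : ℝ) ≤ n * n * n.factorial := by positivity
  calc height N g ≤ (1 + e) * (1 + n * n * (d * (n.factorial * (1 + e) ^ n))) := by
        rw [height]
        gcongr
    _ ≤ (1 + e + d) * ((1 + e + d) ^ (n + 1) +
        n * n * ((1 + e + d) * (n.factorial * (1 + e + d) ^ n))) := by
        gcongr
        exact one_le_pow₀ h5
    _ = _ := by ring

theorem entryNorm_affMat (A : Matrix (Fin n) (Fin n) K) (v : Fin n → K) :
    entryNorm N (affMat A v) = entryNorm N A + vecNorm N v + 1 := by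
  simp [entryNorm, vecNorm, Fin.sum_univ_castSucc, Finset.sum_add_distrib, add_assoc]

theorem height_le_height_aff (g : GL (Fin n) K) (v : Fin n → K) :
    height N g ≤ height N (aff g v) := by
  rw [height, height, aff_inv, coe_aff, coe_aff, entryNorm_affMat, entryNorm_affMat]
  refine mul_le_mul ?_ ?_ (add_nonneg zero_le_one (entryNorm_nonneg _)) ?_
  · linarith [vecNorm_nonneg (N := N) v]
  · linarith [vecNorm_nonneg (N := N) (-((g⁻¹ : GL (Fin n) K) : Matrix (Fin n) (Fin n) K) *ᵥ v)]
  · linarith [vecNorm_nonneg (N := N) v, entryNorm_nonneg (N := N) (g : Matrix (Fin n) (Fin n) K)]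

theorem vecNorm_le_height_aff (g : GL (Fin n) K) (v : Fin n → K) :
    1 + vecNorm N v ≤ height N (aff g v) := by
  refine le_trans ?_ (one_add_entryNorm_le_height _)
  rw [coe_aff, entryNorm_affMat]
  linarith [entryNorm_nonneg (N := N) (g : Matrix (Fin n) (Fin n) K)]

theorem height_aff_zero_le (g : GL (Fin n) K) : height N (aff g 0) ≤ 4 * height N g := by
  rw [height, height, aff_inv_zero, coe_aff, coe_aff, entryNorm_affMat, entryNorm_affMat]
  have h0 : vecNorm N (0 : Fin n → K) = 0 := by simp [vecNorm]
  rw [h0]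
  nlinarith [entryNorm_nonneg (N := N) (g : Matrix (Fin n) (Fin n) K),
    entryNorm_nonneg (N := N) ((g⁻¹ : GL (Fin n) K) : Matrix (Fin n) (Fin n) K)]

theorem height_aff_one_le (v : Fin n → K) :
    height N (aff 1 v) ≤ (n + 2 + vecNorm N v) ^ 2 := by
  have h0 : vecNorm N (-v) = vecNorm N v := by simp [vecNorm]
  rw [height, aff_inv, inv_one, coe_aff, coe_aff, entryNorm_affMat, entryNorm_affMat,
    Units.val_one, neg_mulVec, one_mulVec, h0, entryNorm_one]
  apply le_of_eq
  ring

end Height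

/-! ### Topology and measurability of matrix groups -/

section GLTopology

open Matrix

variable {K : Type*} [Field K] [TopologicalSpace K] [IsLocalField K] {n : ℕ}

theorem IsProperAbs.tendsto_iff {N : AbsoluteValue K ℝ} (hN : IsProperAbs N) {X : Type*}
    {l : Filter X} {f : X → K} {x : K} :
    Tendsto f l (𝓝 x) ↔ Tendsto (fun y => N (f y - x)) l (𝓝 0) := by
  constructor
  · intro h
    have := (hN.continuous.tendsto (x - x)).comp (h.sub_const x)
    simpa [Function.comp_def] using this
  · intro h
    have h1 : Tendsto (fun y => f y - x) l (𝓝 0) := by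
      intro U hU
      obtain ⟨ε, hε, hsub⟩ := hN.exists_ball_subset hU
      have := h.eventually_lt_const hε
      rw [mem_map]
      filter_upwards [this] with y hy
      exact hsub hy
    simpa using h1.add_const x

instance (priority := 50) IsLocalField.instContinuousInv (K : Type*) [Field K]
    [TopologicalSpace K] [IsLocalField K] : ContinuousInv₀ K := by
  obtain ⟨N, hN⟩ := exists_isProperAbs K
  refine ⟨fun x hx => ?_⟩
  rw [ContinuousAt, hN.tendsto_iff]
  have h1 : Tendsto (fun y => N (x - y) / (N y * N x)) (𝓝 x) (𝓝 0) := by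
    have h2 : ContinuousAt (fun y => N (x - y) / (N y * N x)) x := by
      refine ContinuousAt.div ?_ ?_ (mul_ne_zero (N.pos hx).ne' (N.pos hx).ne')
      · exact (hN.continuous.comp (continuous_const.sub continuous_id)).continuousAt
      · exact (hN.continuous.mul continuous_const).continuousAt
    have := h2.tendsto
    simpa using this
  refine h1.congr' ?_
  have h3 : ∀ᶠ y in 𝓝 x, y ≠ 0 := isOpen_ne.mem_nhds hx
  filter_upwards [h3] with y hy
  rw [inv_sub_inv hy hx, map_div₀, map_mul]

theorem isEmbedding_GL_val : IsEmbedding (Units.val : GL (Fin n) K → Matrix (Fin n) (Fin n) K) := by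
  refine Units.isEmbedding_val_mk' (f := fun M => M⁻¹) ?_ fun u => (coe_units_inv u).symm
  have h1 : ∀ M : Matrix (Fin n) (Fin n) K, M⁻¹ = M.det⁻¹ • M.adjugate := fun M => by
    rw [inv_def, Ring.inverse_eq_inv']
  have hid : Continuous fun M : Matrix (Fin n) (Fin n) K => M := continuous_id
  have h2 : ContinuousOn (fun M : Matrix (Fin n) (Fin n) K => M.det⁻¹) {M | IsUnit M} :=
    hid.matrix_det.continuousOn.inv₀ fun M hM =>
      ((Matrix.isUnit_iff_isUnit_det _).1 hM).ne_zero
  exact (h2.smul hid.matrix_adjugate.continuousOn).congr fun M _ => h1 M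

theorem range_GL_val :
    Set.range (Units.val : GL (Fin n) K → Matrix (Fin n) (Fin n) K) = {M | M.det ≠ 0} := by
  ext M
  constructor
  · rintro ⟨g, rfl⟩
    exact ((Matrix.isUnit_iff_isUnit_det _).1 g.isUnit).ne_zero
  · intro hM
    have h : IsUnit M := (Matrix.isUnit_iff_isUnit_det _).2 (isUnit_iff_ne_zero.2 hM)
    exact ⟨h.unit, rfl⟩

theorem isOpenEmbedding_GL_val :
    IsOpenEmbedding (Units.val : GL (Fin n) K → Matrix (Fin n) (Fin n) K) := by
  refine ⟨isEmbedding_GL_val, ?_⟩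
  rw [range_GL_val]
  exact isOpen_ne_fun continuous_id.matrix_det continuous_const

instance instSecondCountableTopologyGL : SecondCountableTopology (GL (Fin n) K) := by
  have : SecondCountableTopology (Matrix (Fin n) (Fin n) K) :=
    inferInstanceAs (SecondCountableTopology (Fin n → Fin n → K))
  exact isEmbedding_GL_val.secondCountableTopology

variable [MeasurableSpace K] [BorelSpace K]

/-- The entries of an invertible matrix, as a point of `K^{n × n}`. -/
def entries (g : GL (Fin n) K) : Fin n → Fin n → K := fun i j => (g : Matrix (Fin n) (Fin n) K) i j

theorem isOpenEmbedding_entries : IsOpenEmbedding (entries : GL (Fin n) K → Fin n → Fin n → K) :=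
  isOpenEmbedding_GL_val

theorem measurableEmbedding_entries :
    MeasurableEmbedding (entries : GL (Fin n) K → Fin n → Fin n → K) :=
  isOpenEmbedding_entries.measurableEmbedding

theorem measurable_GL_iff {X : Type*} [MeasurableSpace X] {f : X → GL (Fin n) K} :
    Measurable f ↔ ∀ i j, Measurable fun x => (f x : Matrix (Fin n) (Fin n) K) i j := by
  rw [← measurableEmbedding_entries.measurable_comp_iff, measurable_pi_iff]
  simp_rw [measurable_pi_iff]
  rfl

theorem measurable_GL_apply (i j : Fin n) :
    Measurable fun g : GL (Fin n) K => (g : Matrix (Fin n) (Fin n) K) i j :=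
  measurable_GL_iff.1 measurable_id i j

omit [MeasurableSpace K] [BorelSpace K] in
theorem continuous_GL_iff {X : Type*} [TopologicalSpace X] {f : X → GL (Fin n) K} :
    Continuous f ↔ ∀ i j, Continuous fun x => (f x : Matrix (Fin n) (Fin n) K) i j := by
  rw [isEmbedding_GL_val.continuous_iff]
  constructor
  · intro h i j
    exact h.matrix_elem i j
  · intro h
    exact continuous_matrix h

omit [MeasurableSpace K] [BorelSpace K] in
theorem continuous_GL_apply (i j : Fin n) :
    Continuous fun g : GL (Fin n) K => (g : Matrix (Fin n) (Fin n) K) i j :=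
  continuous_GL_iff.1 continuous_id i j

omit [MeasurableSpace K] [BorelSpace K] in
theorem continuous_aff :
    Continuous fun p : GL (Fin n) K × (Fin n → K) => aff p.1 p.2 := by
  rw [continuous_GL_iff]
  intro i j
  refine Fin.lastCases ?_ (fun i => ?_) i <;> refine Fin.lastCases ?_ (fun j => ?_) j
  · simpa using continuous_const
  · simpa using continuous_const
  · simp only [coe_aff, affMat_castSucc_last]
    fun_prop
  · simp only [coe_aff, affMat_castSucc_castSucc]
    exact (continuous_GL_apply i j).comp continuous_fst

omit [MeasurableSpace K] [BorelSpace K] in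
theorem _root_.Continuous.aff {X : Type*} [TopologicalSpace X] {f : X → GL (Fin n) K}
    {v : X → Fin n → K} (hf : Continuous f) (hv : Continuous v) :
    Continuous fun x => aff (f x) (v x) :=
  continuous_aff.comp (hf.prodMk hv)

theorem _root_.Measurable.aff {X : Type*} [MeasurableSpace X] {f : X → GL (Fin n) K}
    {v : X → Fin n → K} (hf : Measurable f) (hv : Measurable v) :
    Measurable fun x => aff (f x) (v x) :=
  continuous_aff.measurable.comp (hf.prodMk hv)

theorem measurable_GL_det : Measurable fun g : GL (Fin n) K => (g : Matrix (Fin n) (Fin n) K).det :=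
  (Continuous.matrix_det isEmbedding_GL_val.continuous).measurable

omit [MeasurableSpace K] [BorelSpace K] in
theorem IsProperAbs.continuous_entryNorm {N : AbsoluteValue K ℝ} (hN : IsProperAbs N) :
    Continuous fun X : Matrix (Fin n) (Fin n) K => entryNorm N X := by
  unfold entryNorm
  refine continuous_finsetSum _ fun i _ => continuous_finsetSum _ fun j _ => ?_
  exact hN.continuous.comp (continuous_id.matrix_elem i j)

omit [MeasurableSpace K] [BorelSpace K] in
theorem IsProperAbs.continuous_height {N : AbsoluteValue K ℝ} (hN : IsProperAbs N) :
    Continuous fun g : GL (Fin n) K => height N g := by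
  unfold height
  refine (continuous_const.add ?_).mul (continuous_const.add ?_)
  · exact hN.continuous_entryNorm.comp isEmbedding_GL_val.continuous
  · exact hN.continuous_entryNorm.comp (isEmbedding_GL_val.continuous.comp continuous_inv)

end GLTopology

/-! ### The entry measures in coordinates -/

section EntryMeasure

open Matrix

variable {K : Type*} [Field K] [TopologicalSpace K] [IsLocalField K]
  [MeasurableSpace K] [BorelSpace K] (μ : Measure K) [μ.IsAddHaarMeasure] {n : ℕ}

/-- An integral against `entryMeasure` is an integral over the range of the coordinates. -/
theorem lintegral_entryMeasure {X : Type*} [MeasurableSpace X] {ι : X → GL (Fin n) K}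
    {S : Finset (Fin n × Fin n)}
    (he : MeasurableEmbedding fun (x : X) (ij : S) => (ι x : Matrix _ _ K) ij.1.1 ij.1.2)
    (ψ : (S → K) → ℝ≥0∞) {φ : X → ℝ≥0∞} (hφ : ∀ x, φ x = ψ fun ij => (ι x : Matrix _ _ K) ij.1.1 ij.1.2) :
    ∫⁻ x, φ x ∂(entryMeasure ι S μ) =
      ∫⁻ y in Set.range fun (x : X) (ij : S) => (ι x : Matrix _ _ K) ij.1.1 ij.1.2, ψ y
        ∂(Measure.pi fun _ => μ) := by
  rw [entryMeasure, ← he.map_comap, he.lintegral_map]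
  simp_rw [hφ]

theorem measurePreserving_piReindex {ι κ : Type*} [Fintype ι] [Fintype κ] (e : ι ≃ κ) :
    MeasurePreserving (fun (x : κ → K) i => x (e i)) (Measure.pi fun _ : κ => μ)
      (Measure.pi fun _ : ι => μ) := by
  have h := measurePreserving_piCongrLeft (fun _ : ι => μ) e.symm
  convert h using 1
  ext x i
  have := MeasurableEquiv.piCongrLeft_apply_apply (β := fun _ : ι => K) e.symm x (e i)
  simp only [Equiv.symm_apply_apply] at this
  exact this.symm

end EntryMeasure

/-! ### Triangular coordinates -/

/-- The index set of the strictly upper triangular entries of a matrix of size `n`: those of the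
upper left block of size `n - 1`, and those of the last column. -/
def TriIdx : ℕ → Type
  | 0 => Empty
  | n + 1 => TriIdx n ⊕ Fin n

instance TriIdx.instFintype : ∀ n, Fintype (TriIdx n)
  | 0 => inferInstanceAs (Fintype Empty)
  | n + 1 => @instFintypeSum (TriIdx n) (Fin n) (TriIdx.instFintype n) _

instance TriIdx.instDecidableEq : ∀ n, DecidableEq (TriIdx n)
  | 0 => inferInstanceAs (DecidableEq Empty)
  | n + 1 => @instDecidableEqSum (TriIdx n) (Fin n) (TriIdx.instDecidableEq n) _

instance : IsEmpty (TriIdx 0) := inferInstanceAs (IsEmpty Empty)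

theorem TriIdx.card_eq : ∀ n, Fintype.card (TriIdx (n + 1)) = Fintype.card (TriIdx n) + n
  | n => by
    have h := Fintype.card_sum (α := TriIdx n) (β := Fin n)
    rwa [Fintype.card_fin] at h

theorem TriIdx.two_mul_card (n : ℕ) : 2 * Fintype.card (TriIdx n) = n * (n - 1) := by
  induction n with
  | zero => simp
  | succ n ih =>
    rw [TriIdx.card_eq, mul_add, ih]
    cases n with
    | zero => simp
    | succ n => simp; ring

section Tri

variable {R : Type*} {n : ℕ}

/-- Adjoin a last column to triangular coordinates. -/
def triSnoc (x : TriIdx n → R) (v : Fin n → R) : TriIdx (n + 1) → R := Sum.elim x v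

/-- Triangular coordinates without their last column. -/
def triInit (x : TriIdx (n + 1) → R) : TriIdx n → R := fun t => x (Sum.inl t)

/-- The last column of triangular coordinates. -/
def triLast (x : TriIdx (n + 1) → R) : Fin n → R := fun i => x (Sum.inr i)

@[simp] theorem triInit_triSnoc (x : TriIdx n → R) (v : Fin n → R) :
    triInit (triSnoc x v) = x := rfl

@[simp] theorem triLast_triSnoc (x : TriIdx n → R) (v : Fin n → R) :
    triLast (triSnoc x v) = v := rfl

@[simp] theorem triSnoc_init_last (x : TriIdx (n + 1) → R) :
    triSnoc (triInit x) (triLast x) = x := by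
  funext t
  rcases t with t | i <;> rfl

theorem sum_triIdx_succ {M : Type*} [AddCommMonoid M] (f : TriIdx (n + 1) → M) :
    ∑ t, f t = ∑ t : TriIdx n, f (Sum.inl t) + ∑ i : Fin n, f (Sum.inr i) :=
  Fintype.sum_sum_type f

variable [MeasurableSpace R]

theorem measurable_triSnoc :
    Measurable fun p : (TriIdx n → R) × (Fin n → R) => triSnoc p.1 p.2 :=
  (MeasurableEquiv.sumPiEquivProdPi fun _ : TriIdx n ⊕ Fin n => R).symm.measurable

theorem _root_.Measurable.triSnoc {X : Type*} [MeasurableSpace X] {f : X → TriIdx n → R}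
    {v : X → Fin n → R} (hf : Measurable f) (hv : Measurable v) :
    Measurable fun x => triSnoc (f x) (v x) := measurable_triSnoc.comp (hf.prodMk hv)

theorem measurable_triInit : Measurable (triInit : (TriIdx (n + 1) → R) → TriIdx n → R) :=
  measurable_pi_lambda _ fun t => measurable_pi_apply (Sum.inl t : TriIdx (n + 1))

theorem measurable_triLast : Measurable (triLast : (TriIdx (n + 1) → R) → Fin n → R) :=
  measurable_pi_lambda _ fun i => measurable_pi_apply (Sum.inr i : TriIdx (n + 1))

/-- The product measure in triangular coordinates. -/
abbrev triMeasure (μ : Measure R) (n : ℕ) : Measure (TriIdx n → R) := Measure.pi fun _ => μ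

theorem measurePreserving_triSnoc (μ : Measure R) [SigmaFinite μ] :
    MeasurePreserving (fun p : (TriIdx n → R) × (Fin n → R) => triSnoc p.1 p.2)
      ((triMeasure μ n).prod (Measure.pi fun _ => μ)) (triMeasure μ (n + 1)) :=
  (measurePreserving_sumPiEquivProdPi fun _ : TriIdx n ⊕ Fin n => μ).symm

theorem lintegral_tri_succ (μ : Measure R) [SigmaFinite μ] {φ : (TriIdx (n + 1) → R) → ℝ≥0∞}
    (hφ : Measurable φ) :
    ∫⁻ x, φ x ∂(triMeasure μ (n + 1)) =
      ∫⁻ x, ∫⁻ v, φ (triSnoc x v) ∂(Measure.pi fun _ => μ) ∂(triMeasure μ n) := by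
  rw [← (measurePreserving_triSnoc μ).lintegral_comp hφ, lintegral_prod]
  exact (hφ.comp measurable_triSnoc).aemeasurable

end Tri

/-! ### Unipotent matrices -/

section Unipotent

open Matrix

variable {R : Type*} [CommRing R]

/-- The upper triangular unipotent matrix with given triangular coordinates. -/
def uni : ∀ n, (TriIdx n → R) → GL (Fin n) R
  | 0, _ => 1
  | n + 1, x => aff (uni n (triInit x)) (triLast x)

theorem uni_succ {n : ℕ} (x : TriIdx n → R) (v : Fin n → R) :
    uni (n + 1) (triSnoc x v) = aff (uni n x) v := rfl

theorem map_uni {S : Type*} [CommRing S] (f : R →+* S) :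
    ∀ (n : ℕ) (x : TriIdx n → R), GeneralLinearGroup.map f (uni n x) = uni n (f ∘ x)
  | 0, _ => by ext i; exact i.elim0
  | n + 1, x => by
    rw [uni, aff_map, map_uni f n]
    rfl

/-- The position of a triangular coordinate in the matrix. -/
def TriIdx.pos : ∀ n, TriIdx n → Fin n × Fin n
  | 0, t => t.elim
  | _ + 1, Sum.inl t => ((TriIdx.pos _ t).1.castSucc, (TriIdx.pos _ t).2.castSucc)
  | _ + 1, Sum.inr i => (i.castSucc, Fin.last _)

theorem TriIdx.pos_lt : ∀ (n : ℕ) (t : TriIdx n), (TriIdx.pos n t).1 < (TriIdx.pos n t).2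
  | 0, t => t.elim
  | n + 1, Sum.inl t => by
    have := TriIdx.pos_lt n t
    simpa [TriIdx.pos] using this
  | n + 1, Sum.inr i => by
    simp [TriIdx.pos]

theorem TriIdx.pos_injective : ∀ n, Function.Injective (TriIdx.pos n)
  | 0, t, _, _ => t.elim
  | n + 1, Sum.inl t, Sum.inl s, h => by
    have h' : TriIdx.pos n t = TriIdx.pos n s := by
      simp only [TriIdx.pos, Prod.mk.injEq, Fin.castSucc_inj] at h
      exact Prod.ext h.1 h.2
    rw [TriIdx.pos_injective n h']
  | n + 1, Sum.inl t, Sum.inr j, h => by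
    simp only [TriIdx.pos, Prod.mk.injEq] at h
    exact absurd h.2 (Fin.castSucc_lt_last _).ne
  | n + 1, Sum.inr i, Sum.inl s, h => by
    simp only [TriIdx.pos, Prod.mk.injEq] at h
    exact absurd h.2 (Fin.castSucc_lt_last _).ne'
  | n + 1, Sum.inr i, Sum.inr j, h => by
    simp only [TriIdx.pos, Prod.mk.injEq, Fin.castSucc_inj, and_true] at h
    rw [h]

theorem TriIdx.exists_pos_eq :
    ∀ (n : ℕ) (i j : Fin n), i < j → ∃ t, TriIdx.pos n t = (i, j)
  | 0, i, _, _ => i.elim0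
  | n + 1, i, j, h => by
    induction j using Fin.lastCases with
    | last =>
      induction i using Fin.lastCases with
      | last => exact absurd h (lt_irrefl _)
      | cast i => exact ⟨Sum.inr i, rfl⟩
    | cast j =>
      induction i using Fin.lastCases with
      | last => exact absurd (h.trans (Fin.castSucc_lt_last j)) (lt_irrefl _)
      | cast i =>
        obtain ⟨t, ht⟩ := TriIdx.exists_pos_eq n i j (by simpa using h)
        exact ⟨Sum.inl t, by simp [TriIdx.pos, ht]⟩

/-- Triangular coordinates are indexed by the positions above the diagonal. -/
def TriIdx.equivPos (n : ℕ) :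
    TriIdx n ≃ (Finset.univ.filter fun ij : Fin n × Fin n => ij.1 < ij.2) :=
  Equiv.ofBijective (fun t => ⟨TriIdx.pos n t, by simpa using TriIdx.pos_lt n t⟩) <| by
    constructor
    · intro t s h
      exact TriIdx.pos_injective n (congrArg Subtype.val h)
    · rintro ⟨⟨i, j⟩, h⟩
      obtain ⟨t, ht⟩ := TriIdx.exists_pos_eq n i j (by simpa using h)
      exact ⟨t, Subtype.ext ht⟩

theorem uni_apply_pos : ∀ (n : ℕ) (x : TriIdx n → R) (t : TriIdx n),
    (uni n x : Matrix _ _ R) (TriIdx.pos n t).1 (TriIdx.pos n t).2 = x t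
  | 0, _, t => t.elim
  | n + 1, x, Sum.inl t => by
    simp only [uni, TriIdx.pos, coe_aff, affMat_castSucc_castSucc]
    exact uni_apply_pos n (triInit x) t
  | n + 1, x, Sum.inr i => by
    simp [uni, TriIdx.pos, triLast]

theorem uni_apply_of_le : ∀ (n : ℕ) (x : TriIdx n → R) (i j : Fin n), j ≤ i →
    (uni n x : Matrix _ _ R) i j = if i = j then 1 else 0
  | 0, _, i, _, _ => i.elim0
  | n + 1, x, i, j, h => by
    induction j using Fin.lastCases with
    | last =>
      have : i = Fin.last n := le_antisymm (Fin.le_last i) h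
      subst this
      simp [uni]
    | cast j =>
      induction i using Fin.lastCases with
      | last => simp [uni, (Fin.castSucc_lt_last j).ne']
      | cast i =>
        simpa [uni] using uni_apply_of_le n (triInit x) i j (by simpa using h)

end Unipotent

section UnipotentMeasure

open Matrix

variable {K : Type*} [Field K]

theorem uni_mem (n : ℕ) (x : TriIdx n → K) : uni n x ∈ unipotentSubgroup n K :=
  uni_apply_of_le n x

/-- The triangular coordinates of a matrix. -/
def triCoord {n : ℕ} (g : GL (Fin n) K) : TriIdx n → K := fun t =>
  (g : Matrix (Fin n) (Fin n) K) (TriIdx.pos n t).1 (TriIdx.pos n t).2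

theorem uni_triCoord {n : ℕ} {g : GL (Fin n) K} (hg : g ∈ unipotentSubgroup n K) :
    uni n (triCoord g) = g := by
  ext i j
  rcases lt_or_ge i j with h | h
  · obtain ⟨t, ht⟩ := TriIdx.exists_pos_eq n i j h
    have := uni_apply_pos n (triCoord g) t
    rw [ht] at this
    rw [this, triCoord, ht]
  · rw [uni_apply_of_le n _ i j h, hg i j h]

variable [TopologicalSpace K] [IsLocalField K]
  [MeasurableSpace K] [BorelSpace K] (μ : Measure K) [μ.IsAddHaarMeasure]

theorem continuous_uni : ∀ n, Continuous (uni n : (TriIdx n → K) → GL (Fin n) K)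
  | 0 => continuous_const
  | n + 1 => by
    have h1 : Continuous (triInit : (TriIdx (n + 1) → K) → TriIdx n → K) :=
      continuous_pi fun t => continuous_apply (Sum.inl t : TriIdx (n + 1))
    have h2 : Continuous (triLast : (TriIdx (n + 1) → K) → Fin n → K) :=
      continuous_pi fun i => continuous_apply (Sum.inr i : TriIdx (n + 1))
    exact ((continuous_uni n).comp h1).aff h2

theorem measurable_uni (n : ℕ) : Measurable (uni n : (TriIdx n → K) → GL (Fin n) K) :=
  (continuous_uni n).measurable

/-- The Haar measure of `N_n` in triangular coordinates. -/
theorem map_unipotentMeasure (n : ℕ) :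
    (unipotentMeasure n μ).map Subtype.val = (triMeasure μ n).map (uni n) := by
  set S := Finset.univ.filter fun ij : Fin n × Fin n => ij.1 < ij.2 with hS
  let ρ : unipotentSubgroup n K → S → K := fun u ij =>
    ((u : GL (Fin n) K) : Matrix _ _ K) ij.1.1 ij.1.2
  let e := TriIdx.equivPos n
  let g : (S → K) → unipotentSubgroup n K := fun x => ⟨uni n fun t => x (e t), uni_mem n _⟩
  have hρ : Measurable ρ := measurable_pi_lambda _ fun ij =>
    (measurable_GL_apply ij.1.1 ij.1.2).comp measurable_subtype_coe
  have hg : Measurable g := by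
    refine Measurable.subtype_mk ((measurable_uni n).comp ?_)
    exact measurable_pi_lambda _ fun t => measurable_pi_apply (e t)
  have hleft : Function.LeftInverse g ρ := fun u => Subtype.ext (uni_triCoord u.2)
  have hright : Function.RightInverse g ρ := by
    intro x
    ext ij
    obtain ⟨t, rfl⟩ := e.surjective ij
    exact uni_apply_pos n _ t
  have hemb : MeasurableEmbedding ρ :=
    MeasurableEmbedding.of_measurable_inverse hρ
      (by rw [hright.surjective.range_eq]; exact MeasurableSet.univ) hg hleft
  have h1 : (unipotentMeasure n μ).map ρ = Measure.pi fun _ : S => μ := by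
    have := hemb.map_comap (Measure.pi fun _ : S => μ)
    rw [hright.surjective.range_eq, Measure.restrict_univ] at this
    exact this
  have h2 : (Subtype.val : unipotentSubgroup n K → GL (Fin n) K) =
      uni n ∘ (fun x t => x (e t)) ∘ ρ := by
    funext u
    exact (uni_triCoord u.2).symm
  have hre := measurePreserving_piReindex μ e
  rw [h2, ← Measure.map_map (measurable_uni n) (hre.measurable.comp hρ),
    ← Measure.map_map hre.measurable hρ, h1, hre.map_eq]

theorem lintegral_unipotentMeasure (n : ℕ) {φ : GL (Fin n) K → ℝ≥0∞} (hφ : Measurable φ) :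
    ∫⁻ u, φ u ∂(unipotentMeasure n μ) = ∫⁻ x, φ (uni n x) ∂(triMeasure μ n) := by
  rw [← lintegral_map hφ (measurable_uni n), ← map_unipotentMeasure, lintegral_map hφ
    measurable_subtype_coe]

/-- `du` is right invariant. -/
theorem lintegral_uni_mul_right : ∀ (n : ℕ) (x₀ : TriIdx n → K) {φ : GL (Fin n) K → ℝ≥0∞},
    Measurable φ → ∫⁻ x, φ (uni n x * uni n x₀) ∂(triMeasure μ n) =
      ∫⁻ x, φ (uni n x) ∂(triMeasure μ n)
  | 0, x₀, φ, _ => by simp [uni]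
  | n + 1, x₀, φ, hφ => by
    have hm : Measurable fun p : GL (Fin n) K × (Fin n → K) => φ (aff p.1 p.2) :=
      hφ.comp (measurable_fst.aff measurable_snd)
    rw [lintegral_tri_succ μ (φ := fun x => φ (uni (n + 1) x * uni (n + 1) x₀))
        (hφ.comp ((measurable_uni _).mul_const _)),
      lintegral_tri_succ μ (φ := fun x => φ (uni (n + 1) x)) (hφ.comp (measurable_uni _))]
    have h1 : ∀ x v, φ (uni (n + 1) (triSnoc x v) * uni (n + 1) x₀) =
        φ (aff (uni n x * uni n (triInit x₀)) (((uni n x : GL (Fin n) K) : Matrix _ _ K) *ᵥ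
          triLast x₀ + v)) := by
      intro x v
      rw [uni_succ, ← triSnoc_init_last x₀, uni_succ, aff_mul]
      simp
    have h2 : ∀ x, ∫⁻ v, φ (uni (n + 1) (triSnoc x v) * uni (n + 1) x₀) ∂(Measure.pi fun _ => μ) =
        ∫⁻ v, φ (aff (uni n x * uni n (triInit x₀)) v) ∂(Measure.pi fun _ => μ) := by
      intro x
      simp_rw [h1]
      exact lintegral_add_left_eq_self (μ := Measure.pi fun _ : Fin n => μ)
        (fun v => φ (aff (uni n x * uni n (triInit x₀)) v)) _
    simp_rw [h2]
    exact lintegral_uni_mul_right n (triInit x₀)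
      (φ := fun g => ∫⁻ v, φ (aff g v) ∂(Measure.pi fun _ => μ)) hm.lintegral_prod_right'

instance sigmaFinite_unipotentMeasure (n : ℕ) : SigmaFinite (unipotentMeasure n μ) := by
  have h : SigmaFinite ((unipotentMeasure n μ).map Subtype.val) := by
    have hemb : MeasurableEmbedding (uni n : (TriIdx n → K) → GL (Fin n) K) := by
      refine MeasurableEmbedding.of_measurable_inverse (g := triCoord) (measurable_uni n) ?_ ?_ ?_
      · have : Set.range (uni n : (TriIdx n → K) → GL (Fin n) K) = unipotentSubgroup n K := by
          ext g
          exact ⟨by rintro ⟨x, rfl⟩; exact uni_mem n x, fun h => ⟨_, uni_triCoord h⟩⟩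
        rw [this]
        have h2 : (unipotentSubgroup n K : Set (GL (Fin n) K)) =
            {g | uni n (triCoord g) = g} := by
          ext g
          exact ⟨uni_triCoord, fun h => h ▸ uni_mem n _⟩
        rw [h2]
        refine measurableSet_eq_fun ((measurable_uni n).comp ?_) measurable_id
        exact measurable_pi_lambda _ fun t => measurable_GL_apply _ _
      · exact measurable_pi_lambda _ fun t => measurable_GL_apply _ _
      · intro x
        funext t
        exact uni_apply_pos n x t
    rw [map_unipotentMeasure]
    exact hemb.sigmaFinite_map
  exact SigmaFinite.of_map _ measurable_subtype_coe.aemeasurable h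

end UnipotentMeasure

/-! ### Haar measures of `GL_n` and of the mirabolic subgroup -/

section MatrixMeasure

open Matrix

variable {K : Type*} [Field K] {n m : ℕ}

/-- The invertible matrix `M`, or `1` if `M` is singular. -/
def toGL (M : Matrix (Fin n) (Fin n) K) : GL (Fin n) K :=
  open Classical in if h : M.det ≠ 0 then GeneralLinearGroup.mkOfDetNeZero M h else 1

theorem coe_toGL {M : Matrix (Fin n) (Fin n) K} (h : M.det ≠ 0) :
    (toGL M : Matrix (Fin n) (Fin n) K) = M := by
  rw [toGL, dif_pos h]
  rfl

theorem det_GL_ne_zero (g : GL (Fin n) K) : (g : Matrix (Fin n) (Fin n) K).det ≠ 0 :=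
  ((Matrix.isUnit_iff_isUnit_det _).1 g.isUnit).ne_zero

theorem toGL_coe (g : GL (Fin n) K) : toGL (g : Matrix (Fin n) (Fin n) K) = g :=
  Units.ext (coe_toGL (det_GL_ne_zero g))

theorem toGL_mul_coe {M : Matrix (Fin n) (Fin n) K} (h : M.det ≠ 0) (g : GL (Fin n) K) :
    toGL (M * (g : Matrix (Fin n) (Fin n) K)) = toGL M * g := by
  rw [← toGL_coe (toGL M * g), Units.val_mul, coe_toGL h]

theorem toGL_coe_mul {M : Matrix (Fin n) (Fin n) K} (h : M.det ≠ 0) (g : GL (Fin n) K) :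
    toGL ((g : Matrix (Fin n) (Fin n) K) * M) = g * toGL M := by
  rw [← toGL_coe (g * toGL M), Units.val_mul, coe_toGL h]

variable [TopologicalSpace K] [IsLocalField K]
  [MeasurableSpace K] [BorelSpace K] (μ : Measure K) [μ.IsAddHaarMeasure]

theorem measurable_matrix_det {X : Type*} [MeasurableSpace X] {M : X → Matrix (Fin n) (Fin n) K}
    (hM : ∀ i j, Measurable fun x => M x i j) : Measurable fun x => (M x).det := by
  have h1 : Continuous fun m : Fin n → Fin n → K => (Matrix.of m).det :=
    Continuous.matrix_det continuous_id
  have h2 : Measurable fun x => fun i j => M x i j :=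
    measurable_pi_lambda _ fun i => measurable_pi_lambda _ fun j => hM i j
  exact h1.measurable.comp h2

theorem measurableSet_det_ne_zero {X : Type*} [MeasurableSpace X]
    {M : X → Matrix (Fin n) (Fin n) K} (hM : ∀ i j, Measurable fun x => M x i j) :
    MeasurableSet {x | (M x).det ≠ 0} :=
  (measurable_matrix_det hM (measurableSet_singleton (0 : K))).compl

theorem measurable_toGL {X : Type*} [MeasurableSpace X] {M : X → Matrix (Fin n) (Fin n) K}
    (hM : ∀ i j, Measurable fun x => M x i j) : Measurable fun x => toGL (M x) := by
  classical
  rw [measurable_GL_iff]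
  intro i j
  have h1 : (fun x => (toGL (M x) : Matrix (Fin n) (Fin n) K) i j) =
      fun x => if (M x).det ≠ 0 then M x i j else (1 : Matrix (Fin n) (Fin n) K) i j := by
    funext x
    split_ifs with h
    · rw [coe_toGL h]
    · rw [toGL, dif_neg h]
      rfl
  rw [h1]
  exact Measurable.ite (measurableSet_det_ne_zero hM) (hM i j) measurable_const

/-- Integration over a space of invertible matrices in coordinates. The matrix with coordinates
`y` is `M y`. -/
theorem lintegral_entryMeasure_coord {X κ : Type*} [MeasurableSpace X] [Fintype κ]
    {ι : X → GL (Fin n) K} (hι : MeasurableEmbedding ι) {S : Finset (Fin n × Fin n)} (e : κ ≃ S)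
    {M : (κ → K) → Matrix (Fin n) (Fin n) K} (hM : ∀ i j, Measurable fun y => M y i j)
    (h1 : ∀ x, M (fun k => (ι x : Matrix (Fin n) (Fin n) K) (e k).1.1 (e k).1.2) = ι x)
    (h2 : ∀ y, (M y).det ≠ 0 → ∃ x, ι x = toGL (M y))
    (h3 : ∀ y k, M y (e k).1.1 (e k).1.2 = y k) {φ : GL (Fin n) K → ℝ≥0∞} (hφ : Measurable φ) :
    ∫⁻ x, φ (ι x) ∂(entryMeasure ι S μ) =
      ∫⁻ y, {y | (M y).det ≠ 0}.indicator (fun y => φ (toGL (M y))) y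
        ∂(Measure.pi fun _ : κ => μ) := by
  let ρ : X → S → K := fun x ij => (ι x : Matrix _ _ K) ij.1.1 ij.1.2
  let σ : (S → K) → κ → K := fun y k => y (e k)
  have hσ : MeasurePreserving σ (Measure.pi fun _ => μ) (Measure.pi fun _ => μ) :=
    measurePreserving_piReindex μ e
  have hMρ : ∀ x, M (σ (ρ x)) = ι x := h1
  have hρM : ∀ x y, (M (σ y)).det ≠ 0 → ι x = toGL (M (σ y)) → ρ x = y := by
    intro x y hy hx
    funext ij
    obtain ⟨k, rfl⟩ := e.surjective ij
    show (ι x : Matrix (Fin n) (Fin n) K) _ _ = _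
    rw [hx, coe_toGL hy, h3]
  have hmeas : ∀ i j, Measurable fun y => M (σ y) i j := fun i j => (hM i j).comp hσ.measurable
  have hρ : MeasurableEmbedding ρ := by
    refine ⟨fun x y hxy => hι.injective (Units.ext ?_), ?_, ?_⟩
    · rw [← hMρ, ← hMρ, hxy]
    · exact measurable_pi_lambda _ fun ij =>
        (measurable_GL_apply ij.1.1 ij.1.2).comp hι.measurable
    · intro s hs
      have h : ρ '' s = {y | (M (σ y)).det ≠ 0} ∩ (fun y => toGL (M (σ y))) ⁻¹' (ι '' s) := by
        ext y
        constructor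
        · rintro ⟨x, hx, rfl⟩
          refine ⟨?_, x, hx, ?_⟩
          · show (M (σ (ρ x))).det ≠ 0
            rw [hMρ]
            exact det_GL_ne_zero _
          · show ι x = toGL (M (σ (ρ x)))
            rw [hMρ, toGL_coe]
        · rintro ⟨hy, x, hx, hxy⟩
          exact ⟨x, hx, hρM x y hy hxy⟩
      rw [h]
      exact (measurableSet_det_ne_zero hmeas).inter
        (measurable_toGL hmeas (hι.measurableSet_image.2 hs))
  have hrange : Set.range ρ = {y | (M (σ y)).det ≠ 0} := by
    ext y
    constructor
    · rintro ⟨x, rfl⟩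
      show (M (σ (ρ x))).det ≠ 0
      rw [hMρ]
      exact det_GL_ne_zero _
    · intro hy
      obtain ⟨x, hx⟩ := h2 _ hy
      exact ⟨x, hρM x y hy hx⟩
  rw [lintegral_entryMeasure μ hρ (fun y => φ (toGL (M (σ y)))) (fun x => by
    show φ (ι x) = φ (toGL (M (σ (ρ x))))
    rw [hMρ, toGL_coe])]
  change ∫⁻ y in Set.range ρ, _ ∂_ = _
  rw [hrange, ← lintegral_indicator (measurableSet_det_ne_zero hmeas), ← hσ.lintegral_comp]
  · rfl
  · exact (hφ.comp (measurable_toGL hM)).indicator (measurableSet_det_ne_zero hM)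

/-- The integrand in coordinates for the density `|det|⁻ᵏ`. -/
def detWeighted (k : ℕ) (φ : GL (Fin n) K → ℝ≥0∞) (M : Matrix (Fin n) (Fin n) K) : ℝ≥0∞ :=
  open Classical in
  if M.det ≠ 0 then ENNReal.ofReal ((normAbs M.det ^ k)⁻¹) * φ (toGL M) else 0

theorem measurable_ofReal_normAbs_det_pow (k : ℕ) :
    Measurable fun g : GL (Fin n) K =>
      ENNReal.ofReal ((normAbs (g : Matrix (Fin n) (Fin n) K).det ^ k)⁻¹) :=
  (((measurable_normAbs.comp measurable_GL_det).pow_const k).inv).ennreal_ofReal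

theorem indicator_eq_detWeighted {X : Type*} (M : X → Matrix (Fin n) (Fin n) K) (k : ℕ)
    (φ : GL (Fin n) K → ℝ≥0∞) (y : X) :
    {y | (M y).det ≠ 0}.indicator (fun y =>
      (fun g : GL (Fin n) K => ENNReal.ofReal ((normAbs (g : Matrix (Fin n) (Fin n) K).det ^ k)⁻¹)
        * φ g) (toGL (M y))) y = detWeighted k φ (M y) := by
  classical
  by_cases h : (M y).det ≠ 0
  · rw [Set.indicator_of_mem (by exact h), detWeighted, if_pos h]
    simp only [coe_toGL h]
  · rw [Set.indicator_of_notMem (by exact h), detWeighted, if_neg h]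

theorem measurable_detWeighted {X : Type*} [MeasurableSpace X] {M : X → Matrix (Fin n) (Fin n) K}
    (hM : ∀ i j, Measurable fun x => M x i j) (k : ℕ) {φ : GL (Fin n) K → ℝ≥0∞}
    (hφ : Measurable φ) : Measurable fun x => detWeighted k φ (M x) := by
  simp_rw [← indicator_eq_detWeighted M k φ]
  exact (((measurable_ofReal_normAbs_det_pow k).mul hφ).comp (measurable_toGL hM)).indicator
    (measurableSet_det_ne_zero hM)

theorem detWeighted_coe (k : ℕ) (φ : GL (Fin n) K → ℝ≥0∞) (g : GL (Fin n) K) :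
    detWeighted k φ (g : Matrix (Fin n) (Fin n) K) =
      ENNReal.ofReal ((normAbs (g : Matrix (Fin n) (Fin n) K).det ^ k)⁻¹) * φ g := by
  rw [detWeighted, if_pos (det_GL_ne_zero g), toGL_coe]

/-- A family of scalars indexed by pairs, as a matrix. -/
def pairMat {ι κ : Type*} (x : ι × κ → K) : Matrix ι κ K := Matrix.of fun i j => x (i, j)

theorem lintegral_generalLinearMeasure {φ : GL (Fin n) K → ℝ≥0∞} (hφ : Measurable φ) :
    ∫⁻ g, φ g ∂(generalLinearMeasure n μ) =
      ∫⁻ x, detWeighted n φ (pairMat x) ∂(Measure.pi fun _ : Fin n × Fin n => μ) := by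
  have hd := measurable_ofReal_normAbs_det_pow (K := K) (n := n) n
  rw [generalLinearMeasure, lintegral_withDensity_eq_lintegral_mul _ hd hφ]
  let e : Fin n × Fin n ≃ (Finset.univ : Finset (Fin n × Fin n)) :=
    (Equiv.subtypeUnivEquiv fun x => Finset.mem_univ x).symm
  have h := lintegral_entryMeasure_coord μ (ι := (id : GL (Fin n) K → GL (Fin n) K))
    MeasurableEmbedding.id e (M := fun x => pairMat x)
    (fun i j => measurable_pi_apply (i, j)) (fun x => rfl) (fun y _ => ⟨_, rfl⟩)
    (fun y k => rfl) (hd.mul hφ)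
  refine h.trans (lintegral_congr fun y => ?_)
  exact indicator_eq_detWeighted (fun x => pairMat x) n φ y

theorem kronecker_one_mulVec (A : Matrix (Fin n) (Fin n) K) {κ : Type*} [Fintype κ] [DecidableEq κ]
    (x : Fin n × κ → K) :
    pairMat (kroneckerMap (· * ·) A (1 : Matrix κ κ K) *ᵥ x) = A * pairMat x := by
  ext i j
  simp [pairMat, mulVec, dotProduct, mul_apply, Fintype.sum_prod_type, one_apply]

theorem one_kronecker_mulVec (A : Matrix (Fin n) (Fin n) K) {κ : Type*} [Fintype κ] [DecidableEq κ]
    (x : κ × Fin n → K) :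
    pairMat (kroneckerMap (· * ·) (1 : Matrix κ κ K) Aᵀ *ᵥ x) = pairMat x * A := by
  ext i j
  simp [pairMat, mulVec, dotProduct, mul_apply, Fintype.sum_prod_type, one_apply, mul_comm]

/-- The measure on `GL_n` is left invariant. -/
theorem lintegral_generalLinearMeasure_mul_left (g : GL (Fin n) K) {φ : GL (Fin n) K → ℝ≥0∞}
    (hφ : Measurable φ) :
    ∫⁻ h, φ (g * h) ∂(generalLinearMeasure n μ) = ∫⁻ h, φ h ∂(generalLinearMeasure n μ) := by
  have hg := det_GL_ne_zero g
  set A := (g : Matrix (Fin n) (Fin n) K) with hA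
  have hm : Measurable fun x : Fin n × Fin n → K => detWeighted n φ (pairMat x) :=
    measurable_detWeighted (fun i j => measurable_pi_apply (i, j)) n hφ
  rw [lintegral_generalLinearMeasure μ hφ,
    lintegral_generalLinearMeasure μ (φ := fun h => φ (g * h)) (hφ.comp (measurable_const_mul g))]
  have hdet : (kroneckerMap (· * ·) A (1 : Matrix (Fin n) (Fin n) K)).det = A.det ^ n := by
    rw [det_kronecker]
    simp
  have h1 := lintegral_comp_mulVec μ (M := kroneckerMap (· * ·) A (1 : Matrix (Fin n) (Fin n) K))
    (by rw [hdet]; exact pow_ne_zero _ hg) hm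
  simp_rw [kronecker_one_mulVec, hdet, normAbs_pow] at h1
  have hc : ENNReal.ofReal (normAbs A.det ^ n) * ENNReal.ofReal (normAbs A.det ^ n)⁻¹ = 1 := by
    rw [← ENNReal.ofReal_mul (by have := normAbs_nonneg A.det; positivity),
      mul_inv_cancel₀ (pow_pos (normAbs_pos hg) n).ne', ENNReal.ofReal_one]
  have h2 : ∀ x : Fin n × Fin n → K, detWeighted n (fun h => φ (g * h)) (pairMat x) =
      ENNReal.ofReal (normAbs A.det ^ n) * detWeighted n φ (A * pairMat x) := by
    intro x
    by_cases h : (pairMat x).det ≠ 0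
    · rw [detWeighted, if_pos h, detWeighted, if_pos (by rw [det_mul]; exact mul_ne_zero hg h),
        toGL_coe_mul h, det_mul, normAbs_mul, mul_pow, mul_inv,
        ENNReal.ofReal_mul (by have := normAbs_nonneg A.det; positivity), ← mul_assoc, ← mul_assoc,
        hc, one_mul]
    · rw [detWeighted, if_neg h, detWeighted, if_neg (by rw [det_mul]; simpa [hg] using h),
        mul_zero]
  calc _ = ∫⁻ x, ENNReal.ofReal (normAbs A.det ^ n) * detWeighted n φ (A * pairMat x)
        ∂(Measure.pi fun _ : Fin n × Fin n => μ) := lintegral_congr h2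
    _ = _ := by
      rw [lintegral_const_mul _ (measurable_detWeighted (fun i j => ?_) n hφ), h1, ← mul_assoc, hc,
        one_mul]
      simp_rw [mul_apply]
      exact Finset.measurable_fun_sum _ fun k _ => (measurable_pi_apply (k, j)).const_mul _

instance isMulLeftInvariant_generalLinearMeasure :
    (generalLinearMeasure n μ).IsMulLeftInvariant := by
  refine ⟨fun g => Measure.ext fun s hs => ?_⟩
  rw [Measure.map_apply (measurable_const_mul g) hs, ← lintegral_indicator_one hs,
    ← lintegral_generalLinearMeasure_mul_left μ g (measurable_one.indicator hs),
    ← lintegral_indicator_one (measurable_const_mul g hs)]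
  rfl

/-- The square matrix with given last row. -/
def rowMat (x : Fin m × Fin (m + 1) → K) (y : Fin (m + 1) → K) :
    Matrix (Fin (m + 1)) (Fin (m + 1)) K :=
  Matrix.of fun i j => Fin.lastCases (motive := fun _ => K) (y j) (fun i => x (i, j)) i

@[simp] theorem rowMat_castSucc (x : Fin m × Fin (m + 1) → K) (y : Fin (m + 1) → K) (i : Fin m)
    (j : Fin (m + 1)) : rowMat x y i.castSucc j = x (i, j) := by simp [rowMat]

@[simp] theorem rowMat_last (x : Fin m × Fin (m + 1) → K) (y : Fin (m + 1) → K)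
    (j : Fin (m + 1)) : rowMat x y (Fin.last m) j = y j := by simp [rowMat]

theorem measurable_rowMat (i j : Fin (m + 1)) :
    Measurable fun p : (Fin m × Fin (m + 1) → K) × (Fin (m + 1) → K) => rowMat p.1 p.2 i j := by
  refine Fin.lastCases ?_ (fun i => ?_) i
  · simp only [rowMat_last]
    fun_prop
  · simp only [rowMat_castSucc]
    fun_prop

theorem rowMat_mul (x : Fin m × Fin (m + 1) → K) (y : Fin (m + 1) → K)
    (g : Matrix (Fin (m + 1)) (Fin (m + 1)) K) :
    rowMat x y * g =
      rowMat (kroneckerMap (· * ·) (1 : Matrix (Fin m) (Fin m) K) gᵀ *ᵥ x) (y ᵥ* g) := by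
  ext i j
  refine Fin.lastCases ?_ (fun i => ?_) i
  · simp [mul_apply, vecMul, dotProduct]
  · have h := congrFun (congrFun (one_kronecker_mulVec g x) i) j
    rw [rowMat_castSucc]
    simp only [pairMat, of_apply] at h
    rw [h]
    simp [mul_apply]

theorem measurePreserving_sumElim {α β κ : Type*} [Fintype α] [Fintype β] [Fintype κ]
    (e : α ⊕ β ≃ κ) :
    MeasurePreserving (fun (p : (α → K) × (β → K)) k => Sum.elim p.1 p.2 (e.symm k))
      ((Measure.pi fun _ : α => μ).prod (Measure.pi fun _ : β => μ))
      (Measure.pi fun _ : κ => μ) :=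
  (measurePreserving_piReindex μ e.symm).comp
    (measurePreserving_sumPiEquivProdPi fun _ : α ⊕ β => μ).symm

/-- Split the last element off the first factor. -/
def finProdSplit (m : ℕ) (κ : Type*) : Fin m × κ ⊕ κ ≃ Fin (m + 1) × κ where
  toFun := Sum.elim (fun p => (p.1.castSucc, p.2)) fun j => (Fin.last m, j)
  invFun p := Fin.lastCases (motive := fun _ => Fin m × κ ⊕ κ) (Sum.inr p.2)
    (fun i => Sum.inl (i, p.2)) p.1
  left_inv := by rintro (⟨i, j⟩ | j) <;> simp
  right_inv := by
    rintro ⟨i, j⟩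
    refine Fin.lastCases ?_ (fun i => ?_) i <;> simp

theorem lintegral_generalLinearMeasure_succ {φ : GL (Fin (m + 1)) K → ℝ≥0∞} (hφ : Measurable φ) :
    ∫⁻ g, φ g ∂(generalLinearMeasure (m + 1) μ) =
      ∫⁻ y, ∫⁻ x, detWeighted (m + 1) φ (rowMat x y) ∂(Measure.pi fun _ => μ)
        ∂(Measure.pi fun _ => μ) := by
  have hp := measurePreserving_sumElim μ (finProdSplit m (Fin (m + 1)))
  have hm : Measurable fun x : Fin (m + 1) × Fin (m + 1) → K => detWeighted (m + 1) φ (pairMat x) :=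
    measurable_detWeighted (fun i j => measurable_pi_apply (i, j)) (m + 1) hφ
  rw [lintegral_generalLinearMeasure μ hφ, ← hp.lintegral_comp hm]
  have h1 : ∀ p : (Fin m × Fin (m + 1) → K) × (Fin (m + 1) → K),
      pairMat (fun k => Sum.elim p.1 p.2 ((finProdSplit m (Fin (m + 1))).symm k)) =
        rowMat p.1 p.2 := by
    intro p
    ext i j
    refine Fin.lastCases ?_ (fun i => ?_) i <;> simp [pairMat, finProdSplit]
  simp_rw [h1]
  rw [lintegral_prod_symm]
  exact (measurable_detWeighted measurable_rowMat _ hφ).aemeasurable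

/-- The last coordinate vector. -/
def lastVec (m : ℕ) : Fin (m + 1) → K := Pi.single (Fin.last m) 1

theorem isClosed_mirabolicSubgroup (n : ℕ) :
    IsClosed (mirabolicSubgroup n K : Set (GL (Fin n) K)) := by
  have h : (mirabolicSubgroup n K : Set (GL (Fin n) K)) = ⋂ i : Fin n, ⋂ j : Fin n,
      {g : GL (Fin n) K | (i : ℕ) + 1 = n → (g : Matrix (Fin n) (Fin n) K) i j = if i = j then 1 else 0} := by
    ext g
    simp only [Set.mem_iInter]
    rfl
  rw [h]
  refine isClosed_iInter fun i => isClosed_iInter fun j => ?_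
  by_cases hi : (i : ℕ) + 1 = n
  · simp only [hi, true_imp_iff]
    exact isClosed_eq (continuous_GL_apply i j) continuous_const
  · simp [hi]

theorem mem_mirabolicSubgroup_succ {g : GL (Fin (m + 1)) K} :
    g ∈ mirabolicSubgroup (m + 1) K ↔
      ∀ j, (g : Matrix _ _ K) (Fin.last m) j = if Fin.last m = j then 1 else 0 := by
  constructor
  · intro h j
    exact h (Fin.last m) j (by simp)
  · intro h i j hi
    have : i = Fin.last m := Fin.ext (by simpa using hi)
    subst this
    exact h j

theorem aff_mem_mirabolicSubgroup (g : GL (Fin m) K) (v : Fin m → K) :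
    aff g v ∈ mirabolicSubgroup (m + 1) K := by
  rw [mem_mirabolicSubgroup_succ]
  intro j
  refine Fin.lastCases ?_ (fun j => ?_) j
  · simp
  · simp [(Fin.castSucc_lt_last _).ne']

theorem lintegral_mirabolicMeasure_rowMat {φ : GL (Fin (m + 1)) K → ℝ≥0∞} (hφ : Measurable φ) :
    ∫⁻ p, φ p ∂(mirabolicMeasure (m + 1) μ) =
      ∫⁻ x, detWeighted m φ (rowMat x (lastVec m)) ∂(Measure.pi fun _ => μ) := by
  have hd := measurable_ofReal_normAbs_det_pow (K := K) (n := m + 1) m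
  refine (lintegral_withDensity_eq_lintegral_mul _
    (hd.comp measurable_subtype_coe) (hφ.comp measurable_subtype_coe)).trans ?_
  let e : Fin m × Fin (m + 1) ≃ (Finset.univ.filter fun ij : Fin (m + 1) × Fin (m + 1) =>
      (ij.1 : ℕ) + 1 < m + 1) :=
    { toFun := fun p => ⟨(p.1.castSucc, p.2), by simp⟩
      invFun := fun q => (⟨q.1.1, by have := q.2; simp at this; omega⟩, q.1.2)
      left_inv := fun p => rfl
      right_inv := fun q => rfl }
  have hM : ∀ i j, Measurable fun x : Fin m × Fin (m + 1) → K =>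
      rowMat x (lastVec m) i j := fun i j =>
    (measurable_rowMat i j).comp (measurable_id.prodMk measurable_const)
  have hιM : MeasurableEmbedding (mirabolicSubgroup (m + 1) K).subtype :=
    MeasurableEmbedding.subtype_coe (isClosed_mirabolicSubgroup (m + 1)).measurableSet
  have h := lintegral_entryMeasure_coord μ (ι := (mirabolicSubgroup (m + 1) K).subtype) hιM e
    (M := fun x => rowMat x (lastVec m)) hM ?_ ?_ ?_ (hd.mul hφ)
  · refine h.trans (lintegral_congr fun y => ?_)
    exact indicator_eq_detWeighted (fun x => rowMat x (lastVec m)) m φ y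
  · intro p
    ext i j
    refine Fin.lastCases ?_ (fun i => ?_) i
    · rw [rowMat_last]
      refine Eq.trans ?_ (mem_mirabolicSubgroup_succ.1 p.2 j).symm
      simp [lastVec, Pi.single_apply, eq_comm]
    · rw [rowMat_castSucc]
      rfl
  · intro y hy
    refine ⟨⟨toGL (rowMat y (lastVec m)), ?_⟩, rfl⟩
    rw [mem_mirabolicSubgroup_succ, coe_toGL hy]
    intro j
    rw [rowMat_last]
    simp [lastVec, Pi.single_apply, eq_comm]
  · intro y k
    exact rowMat_castSucc y _ k.1 k.2

/-- Split the last element off the second factor. -/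
def finProdSplitRight (m : ℕ) (κ : Type*) : κ × Fin m ⊕ κ ≃ κ × Fin (m + 1) where
  toFun := Sum.elim (fun p => (p.1, p.2.castSucc)) fun j => (j, Fin.last m)
  invFun p := Fin.lastCases (motive := fun _ => κ × Fin m ⊕ κ) (Sum.inr p.1)
    (fun i => Sum.inl (p.1, i)) p.2
  left_inv := by rintro (⟨i, j⟩ | j) <;> simp
  right_inv := by
    rintro ⟨i, j⟩
    refine Fin.lastCases ?_ (fun j => ?_) j <;> simp

/-- The decomposition of the mirabolic subgroup as `U ⋊ GL_m`. -/
theorem lintegral_mirabolicMeasure {φ : GL (Fin (m + 1)) K → ℝ≥0∞} (hφ : Measurable φ) :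
    ∫⁻ p, φ p ∂(mirabolicMeasure (m + 1) μ) =
      ∫⁻ g, ∫⁻ v, φ (aff g v) ∂(Measure.pi fun _ => μ) ∂(generalLinearMeasure m μ) := by
  have hp := measurePreserving_sumElim μ (finProdSplitRight m (Fin m))
  have hM : ∀ i j, Measurable fun x : Fin m × Fin (m + 1) → K =>
      rowMat x (lastVec m) i j := fun i j =>
    (measurable_rowMat i j).comp (measurable_id.prodMk measurable_const)
  have hφa : Measurable fun p : GL (Fin m) K × (Fin m → K) => φ (aff p.1 p.2) :=
    hφ.comp (measurable_fst.aff measurable_snd)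
  rw [lintegral_mirabolicMeasure_rowMat μ hφ,
    lintegral_generalLinearMeasure μ hφa.lintegral_prod_right',
    ← hp.lintegral_comp (measurable_detWeighted hM m hφ)]
  have h1 : ∀ p : (Fin m × Fin m → K) × (Fin m → K),
      rowMat (fun k => Sum.elim p.1 p.2 ((finProdSplitRight m (Fin m)).symm k)) (lastVec m) =
        affMat (pairMat p.1) p.2 := by
    intro p
    ext i j
    refine Fin.lastCases ?_ (fun i => ?_) i <;> refine Fin.lastCases ?_ (fun j => ?_) j <;>
      simp [pairMat, finProdSplitRight, lastVec, (Fin.castSucc_lt_last _).ne]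
  have hcoord : Measurable fun p : (Fin m × Fin m → K) × (Fin m → K) =>
      detWeighted m φ (affMat (pairMat p.1) p.2) := by
    simp_rw [← h1]
    exact (measurable_detWeighted hM m hφ).comp hp.measurable
  simp_rw [h1]
  rw [lintegral_prod _ hcoord.aemeasurable]
  refine lintegral_congr fun x => ?_
  by_cases h : (pairMat x).det ≠ 0
  · have h2 : ∀ v, detWeighted m φ (affMat (pairMat x) v) =
        ENNReal.ofReal ((normAbs (pairMat x).det ^ m)⁻¹) * φ (aff (toGL (pairMat x)) v) := by
      intro v
      have h3 : affMat (pairMat x) v = (aff (toGL (pairMat x)) v : Matrix _ _ K) := by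
        rw [coe_aff, coe_toGL h]
      rw [h3, detWeighted_coe, coe_aff, det_affMat, coe_toGL h]
    simp_rw [h2]
    rw [lintegral_const_mul' _ _ ENNReal.ofReal_ne_top, detWeighted, if_pos h]
  · have h2 : ∀ v, detWeighted m φ (affMat (pairMat x) v) = 0 := by
      intro v
      rw [detWeighted, if_neg (by rwa [det_affMat])]
    simp_rw [h2]
    rw [lintegral_zero, detWeighted, if_neg h]

theorem pi_singleton_zero (hm : 0 < m) : (Measure.pi fun _ : Fin m => μ) {0} = 0 := by
  obtain ⟨N, hN⟩ := exists_isProperAbs K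
  have := hN.neBot_nhdsNE
  have h : NullSingletonClass μ := inferInstance
  have h1 : ({0} : Set (Fin m → K)) = Set.univ.pi fun _ => {0} := by
    ext v
    simp [funext_iff]
  rw [h1, Measure.pi_pi, Finset.prod_eq_zero (Finset.mem_univ (⟨0, hm⟩ : Fin m))]
  exact measure_singleton 0

/-- The decomposition of `GL_{m+1}` according to the last row: every matrix with last row `y` is
`p s(y)` for a unique `p` in the mirabolic subgroup. -/
theorem lintegral_generalLinearMeasure_eq_mirabolic {φ : GL (Fin (m + 1)) K → ℝ≥0∞}
    (hφ : Measurable φ) {s : (Fin (m + 1) → K) → GL (Fin (m + 1)) K}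
    (hs : ∀ y, y ≠ 0 → lastVec m ᵥ* (s y : Matrix _ _ K) = y) :
    ∫⁻ g, φ g ∂(generalLinearMeasure (m + 1) μ) =
      ∫⁻ y, ∫⁻ p, ENNReal.ofReal ((normAbs ((p : GL (Fin (m + 1)) K) * s y :
        Matrix (Fin (m + 1)) (Fin (m + 1)) K).det)⁻¹) * φ (p * s y) ∂(mirabolicMeasure (m + 1) μ)
          ∂(Measure.pi fun _ => μ) := by
  rw [lintegral_generalLinearMeasure_succ μ hφ]
  refine lintegral_congr_ae ?_
  have h0 : ∀ᵐ y ∂(Measure.pi fun _ : Fin (m + 1) => μ), y ≠ 0 := by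
    rw [ae_iff]
    simpa using pi_singleton_zero μ m.succ_pos
  filter_upwards [h0] with y hy
  set g := (s y : Matrix (Fin (m + 1)) (Fin (m + 1)) K) with hg
  have hdg : g.det ≠ 0 := det_GL_ne_zero _
  let Φ : GL (Fin (m + 1)) K → ℝ≥0∞ := fun p =>
    ENNReal.ofReal ((normAbs ((p : Matrix (Fin (m + 1)) (Fin (m + 1)) K) * g).det)⁻¹) *
      φ (p * s y)
  have hΦ : Measurable Φ := by
    have h1 : Measurable fun p : GL (Fin (m + 1)) K =>
        normAbs (((p * s y : GL (Fin (m + 1)) K) : Matrix (Fin (m + 1)) (Fin (m + 1)) K).det) :=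
      (measurable_normAbs.comp measurable_GL_det).comp (measurable_mul_const (s y))
    exact h1.inv.ennreal_ofReal.mul (hφ.comp (measurable_mul_const (s y)))
  have hrow : Measurable fun x : Fin m × Fin (m + 1) → K => detWeighted (m + 1) φ (rowMat x y) :=
    measurable_detWeighted
      (fun i j => (measurable_rowMat i j).comp (measurable_id.prodMk measurable_const)) _ hφ
  rw [lintegral_mirabolicMeasure_rowMat μ hΦ]
  -- right multiplication of `m` rows by `g` is linear of determinant `det g ^ m`
  have hdet : (kroneckerMap (· * ·) (1 : Matrix (Fin m) (Fin m) K) gᵀ).det = g.det ^ m := by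
    rw [det_kronecker]
    simp
  have h1 := lintegral_comp_mulVec μ (M := kroneckerMap (· * ·) (1 : Matrix (Fin m) (Fin m) K) gᵀ)
    (by rw [hdet]; exact pow_ne_zero _ hdg) hrow
  have h2 : ∀ x, rowMat (kroneckerMap (· * ·) (1 : Matrix (Fin m) (Fin m) K) gᵀ *ᵥ x) y =
      rowMat x (lastVec m) * g := by
    intro x
    rw [rowMat_mul, hs y hy]
  simp_rw [h2, hdet, normAbs_pow] at h1
  have hc : ENNReal.ofReal (normAbs g.det ^ m) * ENNReal.ofReal (normAbs g.det ^ m)⁻¹ = 1 := by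
    rw [← ENNReal.ofReal_mul (by have := normAbs_nonneg g.det; positivity),
      mul_inv_cancel₀ (pow_pos (normAbs_pos hdg) m).ne', ENNReal.ofReal_one]
  have h3 : ∀ x, detWeighted m Φ (rowMat x (lastVec m)) =
      ENNReal.ofReal (normAbs g.det ^ m) * detWeighted (m + 1) φ (rowMat x (lastVec m) * g) := by
    intro x
    set X := rowMat x (lastVec m)
    by_cases h : X.det ≠ 0
    · have hX := normAbs_pos h
      have hG := normAbs_pos hdg
      rw [detWeighted, if_pos h, detWeighted, if_pos (by rw [det_mul]; exact mul_ne_zero h hdg),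
        toGL_mul_coe h]
      simp only [Φ, coe_toGL h]
      rw [← mul_assoc, ← mul_assoc, ← ENNReal.ofReal_mul (by positivity),
        ← ENNReal.ofReal_mul (by positivity), det_mul, normAbs_mul]
      congr 2
      field_simp
      ring
    · rw [detWeighted, if_neg h, detWeighted, if_neg (by rw [det_mul]; simpa [hdg] using h),
        mul_zero]
  simp_rw [h3]
  rw [lintegral_const_mul', h1, ← mul_assoc, hc, one_mul]
  exact ENNReal.ofReal_ne_top

end MatrixMeasure

/-! ### Quotient measures -/

theorem sigmaFinite_of_lintegral_lt_top {X : Type*} [MeasurableSpace X] {ν : Measure X}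
    {g : X → ℝ≥0∞} (hg : Measurable g) (hpos : ∀ x, 0 < g x) (hfin : ∫⁻ x, g x ∂ν < ⊤) :
    SigmaFinite ν := by
  refine ⟨⟨⟨fun n => {x | ((n : ℝ≥0∞) + 1)⁻¹ ≤ g x}, fun n => trivial, fun n => ?_, ?_⟩⟩⟩
  · have h := mul_meas_ge_le_lintegral (μ := ν) hg ((n : ℝ≥0∞) + 1)⁻¹
    have hne : ((n : ℝ≥0∞) + 1)⁻¹ ≠ 0 := by
      rw [ENNReal.inv_ne_zero]
      finiteness
    by_contra htop
    rw [not_lt, top_le_iff] at htop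
    rw [htop, ENNReal.mul_top hne] at h
    exact absurd hfin (not_lt.2 h)
  · rw [Set.eq_univ_iff_forall]
    intro x
    obtain ⟨n, hn⟩ := ENNReal.exists_inv_nat_lt (hpos x).ne'
    refine Set.mem_iUnion.2 ⟨n, ?_⟩
    refine le_trans (ENNReal.inv_le_inv.2 ?_) hn.le
    exact le_self_add

section Quotient

variable {N H : Type*} [Group N] [Group H] [MeasurableSpace N] [MeasurableSpace H]
  {ι : N →* H} {μN : Measure N} {μH : Measure H} {ν : Measure (LeftQuotient ι)}

theorem exists_out_eq (ι : N →* H) (h : H) :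
    ∃ u : N, (Quotient.mk (QuotientGroup.rightRel ι.range) h).out = ι u * h := by
  have h1 : QuotientGroup.rightRel ι.range (Quotient.mk (QuotientGroup.rightRel ι.range) h).out h :=
    Quotient.mk_out (s := QuotientGroup.rightRel ι.range) h
  rw [QuotientGroup.rightRel_apply] at h1
  obtain ⟨u, hu⟩ := h1
  exact ⟨u⁻¹, by rw [map_inv, hu]; group⟩

/-- A function on `H` which is left invariant under `N`. -/
def LeftInvariantUnder (ι : N →* H) {X : Type*} (L : H → X) : Prop := ∀ u h, L (ι u * h) = L h

theorem LeftInvariantUnder.out_eq {X : Type*} {L : H → X} (hL : LeftInvariantUnder ι L) (h : H) :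
    L (Quotient.mk (QuotientGroup.rightRel ι.range) h).out = L h := by
  obtain ⟨u, hu⟩ := exists_out_eq ι h
  rw [hu, hL]

theorem LeftInvariantUnder.measurable_out {X : Type*} [MeasurableSpace X] {L : H → X}
    (hL : LeftInvariantUnder ι L) (hm : Measurable L) :
    Measurable fun x : LeftQuotient ι => L x.out := by
  intro s hs
  show MeasurableSet ((fun h : H => (Quotient.mk (QuotientGroup.rightRel ι.range) h)) ⁻¹' _)
  have : ((fun h : H => (Quotient.mk (QuotientGroup.rightRel ι.range) h)) ⁻¹'
      ((fun x : LeftQuotient ι => L x.out) ⁻¹' s)) = L ⁻¹' s := by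
    ext h
    simp only [Set.mem_preimage, hL.out_eq]
  rw [this]
  exact hm hs

theorem measurable_leftQuotient_mk :
    Measurable fun h : H => (Quotient.mk (QuotientGroup.rightRel ι.range) h : LeftQuotient ι) :=
  fun _ hs => hs

section Fibre

variable [MeasurableMul₂ H] [MeasurableMul₂ N] [SFinite μN] [μN.IsMulRightInvariant]

/-- The sum of `φ` over the orbits of `N`. -/
def orbitSum (ι : N →* H) (μN : Measure N) (φ : H → ℝ≥0∞) (h : H) : ℝ≥0∞ :=
  ∫⁻ u, φ (ι u * h) ∂μN

theorem measurable_orbitSum (hι : Measurable ι) {φ : H → ℝ≥0∞} (hφ : Measurable φ) :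
    Measurable (orbitSum ι μN φ) := by
  have h : Measurable fun p : H × N => φ (ι p.2 * p.1) :=
    hφ.comp ((hι.comp measurable_snd).mul measurable_fst)
  exact h.lintegral_prod_right'

theorem leftInvariantUnder_orbitSum (φ : H → ℝ≥0∞) :
    LeftInvariantUnder ι (orbitSum ι μN φ) := by
  intro u h
  have := lintegral_mul_right_eq_self (μ := μN) (fun v => φ (ι v * h)) u
  simpa [orbitSum, mul_assoc] using this

/-- A cutoff function for `N\H`: a measurable function whose sum over every orbit of `N` is `1`. -/
structure IsCutoff (ι : N →* H) (μN : Measure N) (w : H → ℝ≥0∞) : Prop where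
  measurable : Measurable w
  orbitSum_eq : ∀ h, orbitSum ι μN w h = 1

theorem isCutoff_div (hι : Measurable ι) {φ : H → ℝ≥0∞} (hφ : Measurable φ)
    (h0 : ∀ h, orbitSum ι μN φ h ≠ 0) (hT : ∀ h, orbitSum ι μN φ h ≠ ⊤) :
    IsCutoff ι μN fun h => φ h / orbitSum ι μN φ h := by
  refine ⟨hφ.div (measurable_orbitSum hι hφ), fun h => ?_⟩
  have h1 : ∀ u, φ (ι u * h) / orbitSum ι μN φ (ι u * h) =
      φ (ι u * h) * (orbitSum ι μN φ h)⁻¹ := by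
    intro u
    rw [leftInvariantUnder_orbitSum, ENNReal.div_eq_inv_mul, mul_comm]
  rw [orbitSum]
  simp_rw [h1]
  rw [lintegral_mul_const' _ _ (ENNReal.inv_ne_top.2 (h0 h))]
  exact ENNReal.mul_inv_cancel (h0 h) (hT h)

namespace IsQuotientMeasure

theorem lintegral_orbitSum (hν : IsQuotientMeasure ι μN μH ν) {φ : H → ℝ≥0∞} (hφ : Measurable φ) :
    ∫⁻ x : LeftQuotient ι, orbitSum ι μN φ x.out ∂ν = ∫⁻ h, φ h ∂μH :=
  (hν φ hφ).symm

/-- A cutoff function expresses integrals over `N\H` as integrals over `H`. -/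
theorem lintegral_eq (hν : IsQuotientMeasure ι μN μH ν) {w : H → ℝ≥0∞} (hw : IsCutoff ι μN w)
    {L : H → ℝ≥0∞} (hm : Measurable L) (hL : LeftInvariantUnder ι L) (hι : Measurable ι) :
    ∫⁻ x : LeftQuotient ι, L x.out ∂ν = ∫⁻ h, w h * L h ∂μH := by
  rw [hν (fun h => w h * L h) (hw.measurable.mul hm)]
  refine lintegral_congr fun x => ?_
  simp_rw [hL _ _]
  rw [lintegral_mul_const]
  · have := hw.orbitSum_eq x.out
    rw [orbitSum] at this
    rw [this, one_mul]
  · exact hw.measurable.comp (hι.mul_const _)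

theorem sigmaFinite (hν : IsQuotientMeasure ι μN μH ν) (hι : Measurable ι) [SigmaFinite μH]
    [NeZero μN] : SigmaFinite ν := by
  obtain ⟨ρ, hρpos, hρm, hρ⟩ := exists_pos_lintegral_lt_of_sigmaFinite μH one_ne_zero
  have hρm' : Measurable fun h => (ρ h : ℝ≥0∞) := hρm.coe_nnreal_ennreal
  refine sigmaFinite_of_lintegral_lt_top (g := fun x => orbitSum ι μN (fun h => (ρ h : ℝ≥0∞)) x.out)
    ((leftInvariantUnder_orbitSum _).measurable_out (measurable_orbitSum hι hρm')) ?_ ?_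
  · intro x
    have hmeas : Measurable fun u => (ρ (ι u * x.out) : ℝ≥0∞) := hρm'.comp (hι.mul_const _)
    rw [orbitSum, lintegral_pos_iff_support hmeas]
    have : (Function.support fun u => (ρ (ι u * x.out) : ℝ≥0∞)) = Set.univ := by
      ext u
      simpa using (hρpos _).ne'
    rw [this]
    exact Measure.measure_univ_pos.2 (NeZero.ne μN)
  · rw [hν.lintegral_orbitSum hρm']
    exact hρ.trans ENNReal.one_lt_top

end IsQuotientMeasure

/-- The probability measure on the orbit `N h` defined by a cutoff function. -/
def orbitMeasure (ι : N →* H) (μN : Measure N) (w : H → ℝ≥0∞) (h : H) : Measure H :=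
  (μN.withDensity fun u => w (ι u * h)).map fun u => ι u * h

theorem orbitMeasure_apply (hι : Measurable ι) (w : H → ℝ≥0∞) (h : H)
    {s : Set H} (hs : MeasurableSet s) :
    orbitMeasure ι μN w h s = orbitSum ι μN (s.indicator w) h := by
  have hm : Measurable fun u => ι u * h := hι.mul_const h
  rw [orbitMeasure, Measure.map_apply hm hs, withDensity_apply _ (hm hs),
    ← lintegral_indicator (hm hs), orbitSum]
  rfl

/-- The orbit measures form a probability kernel from `N\H` to `H`. -/
def orbitKernel (hι : Measurable ι) {w : H → ℝ≥0∞} (hw : IsCutoff ι μN w) :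
    ProbabilityTheory.Kernel (LeftQuotient ι) H where
  toFun x := orbitMeasure ι μN w x.out
  measurable' := by
    refine Measure.measurable_of_measurable_coe _ fun s hs => ?_
    simp_rw [orbitMeasure_apply hι w _ hs]
    exact (leftInvariantUnder_orbitSum _).measurable_out
      (measurable_orbitSum hι (hw.measurable.indicator hs))

instance isMarkovKernel_orbitKernel (hι : Measurable ι) {w : H → ℝ≥0∞} (hw : IsCutoff ι μN w) :
    ProbabilityTheory.IsMarkovKernel (orbitKernel hι hw) := by
  refine ⟨fun x => ⟨?_⟩⟩
  show orbitMeasure ι μN w x.out Set.univ = 1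
  rw [orbitMeasure_apply hι w _ MeasurableSet.univ, Set.indicator_univ, hw.orbitSum_eq]

end Fibre

/-- Functions on `H₁ × H₂` which are invariant in both variables descend measurably to the product
of the quotients: the set where the function lies in `s` is the set where the orbit measure, which
depends measurably on the orbit, gives mass one to the preimage of `s`. -/
theorem measurable_out_prod {N₁ H₁ N₂ H₂ : Type*} [Group N₁] [Group H₁] [MeasurableSpace N₁]
    [MeasurableSpace H₁] [Group N₂] [Group H₂] [MeasurableSpace N₂] [MeasurableSpace H₂]
    [MeasurableMul₂ H₁] [MeasurableMul₂ N₁] [MeasurableMul₂ H₂] [MeasurableMul₂ N₂]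
    {ι₁ : N₁ →* H₁} {ι₂ : N₂ →* H₂} (hι₁ : Measurable ι₁) (hι₂ : Measurable ι₂)
    {μ₁ : Measure N₁} {μ₂ : Measure N₂} [SFinite μ₁] [SFinite μ₂] [μ₁.IsMulRightInvariant]
    [μ₂.IsMulRightInvariant] {w₁ : H₁ → ℝ≥0∞} {w₂ : H₂ → ℝ≥0∞} (hw₁ : IsCutoff ι₁ μ₁ w₁)
    (hw₂ : IsCutoff ι₂ μ₂ w₂) {X : Type*} [MeasurableSpace X] {L : H₁ → H₂ → X}
    (hm : Measurable (Function.uncurry L)) (h1 : ∀ b, LeftInvariantUnder ι₁ fun a => L a b)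
    (h2 : ∀ a, LeftInvariantUnder ι₂ (L a)) :
    Measurable fun p : LeftQuotient ι₁ × LeftQuotient ι₂ => L p.1.out p.2.out := by
  intro s hs
  have hκ := ProbabilityTheory.Kernel.measurable_coe
    (ProbabilityTheory.Kernel.parallelComp (orbitKernel hι₁ hw₁) (orbitKernel hι₂ hw₂)) (hm hs)
  have hval : ∀ p : LeftQuotient ι₁ × LeftQuotient ι₂,
      ProbabilityTheory.Kernel.parallelComp (orbitKernel hι₁ hw₁) (orbitKernel hι₂ hw₂) p
        (Function.uncurry L ⁻¹' s) = ((fun p : LeftQuotient ι₁ × LeftQuotient ι₂ =>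
          L p.1.out p.2.out) ⁻¹' s).indicator 1 p := by
    rintro ⟨x, y⟩
    have hx : Measurable fun u => ι₁ u * x.out := hι₁.mul_const _
    have hy : Measurable fun u => ι₂ u * y.out := hι₂.mul_const _
    have hP := ProbabilityTheory.IsMarkovKernel.isProbabilityMeasure
      (κ := ProbabilityTheory.Kernel.parallelComp (orbitKernel hι₁ hw₁) (orbitKernel hι₂ hw₂)) (x, y)
    have heq : ProbabilityTheory.Kernel.parallelComp (orbitKernel hι₁ hw₁) (orbitKernel hι₂ hw₂)
        (x, y) = ((μ₁.withDensity fun u => w₁ (ι₁ u * x.out)).prod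
          (μ₂.withDensity fun u => w₂ (ι₂ u * y.out))).map
            (Prod.map (fun u => ι₁ u * x.out) fun u => ι₂ u * y.out) := by
      rw [ProbabilityTheory.Kernel.parallelComp_apply, ← Measure.map_prod_map _ _ hx hy]
      rfl
    have hpre : (Prod.map (fun u => ι₁ u * x.out) fun u => ι₂ u * y.out) ⁻¹'
        (Function.uncurry L ⁻¹' s) = {_p : N₁ × N₂ | L x.out y.out ∈ s} := by
      ext ⟨u, v⟩
      have : L (ι₁ u * x.out) (ι₂ v * y.out) = L x.out y.out :=
        (h2 _ v y.out).trans (h1 y.out u x.out)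
      simp [this]
    by_cases hmem : L x.out y.out ∈ s
    · rw [Set.indicator_of_mem (by exact hmem), Pi.one_apply]
      have hu := hP.measure_univ
      rw [heq, Measure.map_apply (hx.prodMap hy) MeasurableSet.univ, Set.preimage_univ] at hu
      rw [heq, Measure.map_apply (hx.prodMap hy) (hm hs), hpre]
      simpa [hmem] using hu
    · rw [Set.indicator_of_notMem (by exact hmem), heq,
        Measure.map_apply (hx.prodMap hy) (hm hs), hpre]
      simp [hmem]
  have hset : (fun p : LeftQuotient ι₁ × LeftQuotient ι₂ => L p.1.out p.2.out) ⁻¹' s =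
      (fun p => ProbabilityTheory.Kernel.parallelComp (orbitKernel hι₁ hw₁) (orbitKernel hι₂ hw₂) p
        (Function.uncurry L ⁻¹' s)) ⁻¹' {1} := by
    ext p
    rw [Set.mem_preimage (f := fun p => ProbabilityTheory.Kernel.parallelComp _ _ p _),
      Set.mem_singleton_iff, hval]
    by_cases h : p ∈ (fun p : LeftQuotient ι₁ × LeftQuotient ι₂ => L p.1.out p.2.out) ⁻¹' s
    · rw [Set.indicator_of_mem h]
      exact ⟨fun _ => rfl, fun _ => h⟩
    · rw [Set.indicator_of_notMem h]
      exact ⟨fun h' => absurd h' h, fun h' => absurd h' zero_ne_one⟩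
  rw [hset]
  exact hκ (measurableSet_singleton 1)

section Bochner

variable [MeasurableMul₂ H] [MeasurableMul₂ N] [SFinite μN] [μN.IsMulRightInvariant]

namespace IsQuotientMeasure

theorem integral_orbit_real (hν : IsQuotientMeasure ι μN μH ν) (hι : Measurable ι) {V : H → ℝ}
    (hm : Measurable V) (hV : Integrable V μH) :
    Integrable (fun x : LeftQuotient ι => ∫ u, V (ι u * x.out) ∂μN) ν ∧
      ∫ x : LeftQuotient ι, ∫ u, V (ι u * x.out) ∂μN ∂ν = ∫ h, V h ∂μH := by
  let φp : H → ℝ≥0∞ := fun h => ENNReal.ofReal (V h)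
  let φn : H → ℝ≥0∞ := fun h => ENNReal.ofReal (-V h)
  have hp : Measurable φp := hm.ennreal_ofReal
  have hn : Measurable φn := hm.neg.ennreal_ofReal
  have hpT : ∫⁻ h, φp h ∂μH < ⊤ := lt_of_le_of_lt
    (lintegral_mono fun h => Real.ofReal_le_enorm _) hV.hasFiniteIntegral
  have hnT : ∫⁻ h, φn h ∂μH < ⊤ := by
    refine lt_of_le_of_lt (lintegral_mono fun h => ?_) hV.hasFiniteIntegral
    rw [← enorm_neg]
    exact Real.ofReal_le_enorm _
  have mp : Measurable fun x : LeftQuotient ι => orbitSum ι μN φp x.out :=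
    (leftInvariantUnder_orbitSum _).measurable_out (measurable_orbitSum hι hp)
  have mn : Measurable fun x : LeftQuotient ι => orbitSum ι μN φn x.out :=
    (leftInvariantUnder_orbitSum _).measurable_out (measurable_orbitSum hι hn)
  rw [← hν.lintegral_orbitSum hp] at hpT
  rw [← hν.lintegral_orbitSum hn] at hnT
  have ap := ae_lt_top mp hpT.ne
  have an := ae_lt_top mn hnT.ne
  have hae : (fun x : LeftQuotient ι => ∫ u, V (ι u * x.out) ∂μN) =ᵐ[ν]
      fun x => (orbitSum ι μN φp x.out).toReal - (orbitSum ι μN φn x.out).toReal := by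
    filter_upwards [ap, an] with x hx hx'
    have hVm : Measurable fun u => V (ι u * x.out) := hm.comp (hι.mul_const _)
    refine integral_eq_lintegral_pos_part_sub_lintegral_neg_part ⟨hVm.aestronglyMeasurable, ?_⟩
    have : ∀ u, ‖V (ι u * x.out)‖ₑ = φp (ι u * x.out) + φn (ι u * x.out) := by
      intro u
      rw [Real.enorm_eq_ofReal_abs]
      simp only [φp, φn]
      rcases le_total 0 (V (ι u * x.out)) with h | h
      · rw [abs_of_nonneg h, ENNReal.ofReal_of_nonpos (neg_nonpos.2 h), add_zero]
      · rw [abs_of_nonpos h, ENNReal.ofReal_of_nonpos h, zero_add]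
    rw [HasFiniteIntegral]
    simp_rw [this]
    have hp' : Measurable fun u => φp (ι u * x.out) := hp.comp (hι.mul_const _)
    rw [lintegral_add_left hp']
    exact ENNReal.add_lt_top.2 ⟨hx, hx'⟩
  have ip : Integrable (fun x : LeftQuotient ι => (orbitSum ι μN φp x.out).toReal) ν :=
    integrable_toReal_of_lintegral_ne_top mp.aemeasurable hpT.ne
  have im : Integrable (fun x : LeftQuotient ι => (orbitSum ι μN φn x.out).toReal) ν :=
    integrable_toReal_of_lintegral_ne_top mn.aemeasurable hnT.ne
  refine ⟨(ip.sub im).congr hae.symm, ?_⟩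
  rw [integral_congr_ae hae, integral_sub ip im, integral_toReal mp.aemeasurable ap,
    integral_toReal mn.aemeasurable an, hν.lintegral_orbitSum hp, hν.lintegral_orbitSum hn,
    integral_eq_lintegral_pos_part_sub_lintegral_neg_part hV]

/-- The quotient integral formula for integrable functions. -/
theorem integral_orbit (hν : IsQuotientMeasure ι μN μH ν) (hι : Measurable ι) {V : H → ℂ}
    (hm : Measurable V) (hV : Integrable V μH) :
    ∫ x : LeftQuotient ι, ∫ u, V (ι u * x.out) ∂μN ∂ν = ∫ h, V h ∂μH := by
  obtain ⟨ir, er⟩ := hν.integral_orbit_real hι (Complex.measurable_re.comp hm) hV.re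
  obtain ⟨ii, ei⟩ := hν.integral_orbit_real hι (Complex.measurable_im.comp hm) hV.im
  have hnorm : Measurable fun h => ‖V h‖ₑ := hm.enorm
  have hT : ∫⁻ x : LeftQuotient ι, orbitSum ι μN (fun h => ‖V h‖ₑ) x.out ∂ν < ⊤ := by
    rw [hν.lintegral_orbitSum hnorm]
    exact hV.hasFiniteIntegral
  have hfin := ae_lt_top ((leftInvariantUnder_orbitSum _).measurable_out
    (measurable_orbitSum hι hnorm)) hT.ne
  have hae : (fun x : LeftQuotient ι => ∫ u, V (ι u * x.out) ∂μN) =ᵐ[ν]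
      fun x => ((∫ u, (V (ι u * x.out)).re ∂μN : ℝ) : ℂ) +
        ((∫ u, (V (ι u * x.out)).im ∂μN : ℝ) : ℂ) * Complex.I := by
    filter_upwards [hfin] with x hx
    have hi : Integrable (fun u => V (ι u * x.out)) μN :=
      ⟨(hm.comp (hι.mul_const _)).aestronglyMeasurable, hx⟩
    exact (integral_re_add_im (𝕜 := ℂ) hi).symm
  rw [integral_congr_ae hae, integral_add ir.ofReal (ii.ofReal.mul_const _),
    integral_mul_const, integral_complex_ofReal, integral_complex_ofReal]
  have er' := er
  have ei' := ei
  simp only [Function.comp_def] at er' ei'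
  rw [er', ei']
  exact integral_re_add_im (𝕜 := ℂ) hV

end IsQuotientMeasure

end Bochner

end Quotient

/-! ### Integrability of powers of the height -/

open Matrix in
/-- A negative power of the height. -/
def heightDecay {K : Type*} [Field K] {n : ℕ} (N : AbsoluteValue K ℝ) (M : ℕ) (g : GL (Fin n) K) :
    ℝ := (height N g ^ M)⁻¹

section HeightDecay

variable {K : Type*} [Field K] {N : AbsoluteValue K ℝ} {n m : ℕ}

theorem heightDecay_pos (M : ℕ) (g : GL (Fin n) K) : 0 < heightDecay N M g :=
  inv_pos.2 (pow_pos (height_pos g) M)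

theorem heightDecay_le_one (M : ℕ) (g : GL (Fin n) K) : heightDecay N M g ≤ 1 :=
  inv_le_one_of_one_le₀ (one_le_pow₀ (one_le_height g))

theorem heightDecay_anti {M M' : ℕ} (h : M ≤ M') (g : GL (Fin n) K) :
    heightDecay N M' g ≤ heightDecay N M g :=
  inv_anti₀ (pow_pos (height_pos g) M) (pow_le_pow_right₀ (one_le_height g) h)

theorem heightDecay_add (M M' : ℕ) (g : GL (Fin n) K) :
    heightDecay N (M + M') g = heightDecay N M g * heightDecay N M' g := by
  rw [heightDecay, pow_add, mul_inv]
  rfl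

theorem heightDecay_mul_le_left (M : ℕ) (g h : GL (Fin n) K) :
    heightDecay N M (g * h) ≤ height N g ^ M * heightDecay N M h := by
  have h1 : height N h ≤ height N g * height N (g * h) := by
    have := height_mul_le (N := N) g⁻¹ (g * h)
    rwa [inv_mul_cancel_left, height_inv] at this
  have h2 := pow_le_pow_left₀ (height_pos h).le h1 M
  rw [mul_pow] at h2
  rw [heightDecay, heightDecay, inv_le_iff_one_le_mul₀ (pow_pos (height_pos _) M)]
  have h3 := pow_pos (height_pos (N := N) h) M
  field_simp
  linarith

theorem heightDecay_mul_le_right (M : ℕ) (g h : GL (Fin n) K) :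
    heightDecay N M (g * h) ≤ heightDecay N M g * height N h ^ M := by
  have h1 : height N g ≤ height N (g * h) * height N h := by
    have := height_mul_le (N := N) (g * h) h⁻¹
    rwa [mul_inv_cancel_right, height_inv] at this
  have h2 := pow_le_pow_left₀ (height_pos g).le h1 M
  rw [mul_pow] at h2
  rw [heightDecay, heightDecay, inv_le_iff_one_le_mul₀ (pow_pos (height_pos _) M)]
  have h3 := pow_pos (height_pos (N := N) g) M
  field_simp
  linarith

theorem inv_pow_le_prod_decay {ι : Type*} [Fintype ι] {x : ι → K} {H : ℝ} (h1 : 1 ≤ H)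
    (hx : ∀ i, N (x i) ≤ H) (M : ℕ) :
    (H ^ (M * Fintype.card ι))⁻¹ ≤ ∏ i, decay N M (x i) := by
  have h : (H ^ (M * Fintype.card ι))⁻¹ = ∏ _i : ι, (H ^ M)⁻¹ := by
    rw [Finset.prod_const, Finset.card_univ, inv_pow, ← pow_mul]
  rw [h]
  refine Finset.prod_le_prod (fun _ _ => by positivity) fun i _ => ?_
  exact inv_anti₀ (by positivity) (pow_le_pow_left₀ (by positivity) (max_le h1 (hx i)) M)

variable [TopologicalSpace K] [IsLocalField K]

theorem IsProperAbs.continuous_heightDecay (hN : IsProperAbs N) (M : ℕ) :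
    Continuous (heightDecay N M : GL (Fin n) K → ℝ) :=
  ((hN.continuous_height).pow M).inv₀ fun g => (pow_pos (height_pos g) M).ne'

variable [MeasurableSpace K] [BorelSpace K] (μ : Measure K) [μ.IsAddHaarMeasure]

theorem IsProperAbs.exists_integrable_prod_decay (hN : IsProperAbs N) :
    ∃ M : ℕ, ∀ {ι : Type} [Fintype ι],
      Integrable (fun x : ι → K => ∏ i, decay N M (x i)) (Measure.pi fun _ => μ) := by
  obtain ⟨M, hM⟩ := hN.exists_integrable_decay μ
  exact ⟨M, fun {ι} _ => Integrable.fintype_prod fun _ => hM⟩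

theorem lintegral_lt_top_of_integrable {X : Type*} [MeasurableSpace X] {ν : Measure X}
    {g : X → ℝ} (hg : Integrable g ν) : ∫⁻ x, ENNReal.ofReal (g x) ∂ν < ⊤ :=
  lt_of_le_of_lt (lintegral_mono fun _ => Real.ofReal_le_enorm _) hg.hasFiniteIntegral

theorem IsProperAbs.measurable_heightDecay (hN : IsProperAbs N) (M : ℕ) :
    Measurable fun g : GL (Fin n) K => ENNReal.ofReal (heightDecay N M g) :=
  (hN.continuous_heightDecay M).measurable.ennreal_ofReal

theorem coord_le_height_uni (x : TriIdx n → K) (t : TriIdx n) : N (x t) ≤ height N (uni n x) := by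
  have h1 := le_entryNorm (N := N) (uni n x : Matrix (Fin n) (Fin n) K) (TriIdx.pos n t).1
    (TriIdx.pos n t).2
  rw [uni_apply_pos] at h1
  linarith [one_add_entryNorm_le_height (N := N) (uni n x)]

theorem IsProperAbs.exists_lintegral_heightDecay_uni (hN : IsProperAbs N) (n : ℕ) :
    ∃ M : ℕ, ∫⁻ x, ENNReal.ofReal (heightDecay N M (uni n x)) ∂(triMeasure μ n) < ⊤ := by
  obtain ⟨M, hM⟩ := hN.exists_integrable_prod_decay μ
  refine ⟨M * Fintype.card (TriIdx n), lt_of_le_of_lt (lintegral_mono fun x => ?_)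
    (lintegral_lt_top_of_integrable (hM (ι := TriIdx n)))⟩
  exact ENNReal.ofReal_le_ofReal
    (inv_pow_le_prod_decay (one_le_height _) (coord_le_height_uni x) M)

/-- The density `|det g|⁻ⁿ` is bounded by a power of the height, and the height dominates each entry;
so a large power of the height beats the density and a product of integrable functions of the
entries. -/
theorem IsProperAbs.exists_lintegral_heightDecay_generalLinear (hN : IsProperAbs N) (n : ℕ) :
    ∃ M : ℕ, ∫⁻ g, ENNReal.ofReal (heightDecay N M g) ∂(generalLinearMeasure n μ) < ⊤ := by
  obtain ⟨M, hM⟩ := hN.exists_integrable_prod_decay μ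
  obtain ⟨C, hC, r, hr⟩ := hN.exists_normAbs_le
  let D : ℝ := C ^ n * (n.factorial : ℝ) ^ (r * n)
  let k : ℕ := n * (r * n) + M * Fintype.card (Fin n × Fin n)
  refine ⟨k, ?_⟩
  rw [lintegral_generalLinearMeasure μ (hN.measurable_heightDecay k)]
  have hi : ∫⁻ x : Fin n × Fin n → K, ENNReal.ofReal (D * ∏ i, decay N M (x i))
      ∂(Measure.pi fun _ => μ) < ⊤ :=
    lintegral_lt_top_of_integrable ((hM (ι := Fin n × Fin n)).const_mul D)
  refine lt_of_le_of_lt (lintegral_mono fun x => ?_) hi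
  by_cases hdet : (pairMat x).det = 0
  · simp [detWeighted, hdet]
  obtain ⟨g, hg⟩ : ∃ g : GL (Fin n) K, (g : Matrix (Fin n) (Fin n) K) = pairMat x :=
    ⟨toGL (pairMat x), coe_toGL hdet⟩
  rw [← hg, detWeighted_coe, ← ENNReal.ofReal_mul (by positivity [normAbs_nonneg (g : Matrix (Fin n) (Fin n) K).det])]
  refine ENNReal.ofReal_le_ofReal ?_
  have h1 : ((normAbs (g : Matrix (Fin n) (Fin n) K).det) ^ n)⁻¹ ≤
      D * height N g ^ (n * (r * n)) := by
    rw [← inv_pow, ← normAbs_inv]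
    have h2 := hr (g : Matrix (Fin n) (Fin n) K).det⁻¹
    have h3 : max 1 (N (g : Matrix (Fin n) (Fin n) K).det⁻¹) ≤ n.factorial * height N g ^ n := by
      refine max_le ?_ ?_
      · exact one_le_mul_of_one_le_of_one_le (by exact_mod_cast n.factorial_pos)
          (one_le_pow₀ (one_le_height g))
      · rw [map_inv₀]
        exact abs_det_inv_le_height g
    calc normAbs (g : Matrix (Fin n) (Fin n) K).det⁻¹ ^ n
        ≤ (C * max 1 (N (g : Matrix (Fin n) (Fin n) K).det⁻¹) ^ r) ^ n :=
          pow_le_pow_left₀ (normAbs_nonneg _) h2 n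
      _ ≤ (C * (n.factorial * height N g ^ n) ^ r) ^ n := by gcongr
      _ = D * height N g ^ (n * (r * n)) := by
          simp only [D]
          rw [mul_pow, ← pow_mul, mul_pow, ← pow_mul, mul_assoc]
  have hx : ∀ i : Fin n × Fin n, N (x i) ≤ height N g := by
    rintro ⟨i, j⟩
    have h1 := le_entryNorm (N := N) (g : Matrix (Fin n) (Fin n) K) i j
    rw [hg] at h1
    have h2 := one_add_entryNorm_le_height (N := N) g
    rw [hg] at h2
    have : pairMat x i j = x (i, j) := rfl
    rw [this] at h1
    linarith
  have h4 := inv_pow_le_prod_decay (one_le_height g) hx M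
  have hpos : 0 < height N g ^ (n * (r * n)) := pow_pos (height_pos g) _
  calc _ ≤ D * height N g ^ (n * (r * n)) * heightDecay N k g :=
        mul_le_mul_of_nonneg_right h1 (heightDecay_pos _ _).le
    _ = D * (height N g ^ (M * Fintype.card (Fin n × Fin n)))⁻¹ := by
        simp only [k]
        rw [heightDecay_add, heightDecay, heightDecay, mul_assoc, mul_inv_cancel_left₀ hpos.ne']
    _ ≤ _ := mul_le_mul_of_nonneg_left h4 (by positivity)

theorem lintegral_mirabolicMeasure_one {φ : GL (Fin 1) K → ℝ≥0∞} (hφ : Measurable φ) :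
    ∫⁻ p, φ p ∂(mirabolicMeasure 1 μ) = φ 1 := by
  have hm : Measurable fun q : GL (Fin 0) K × (Fin 0 → K) => φ (aff q.1 q.2) :=
    hφ.comp (measurable_fst.aff measurable_snd)
  rw [lintegral_mirabolicMeasure μ hφ, lintegral_generalLinearMeasure μ hm.lintegral_prod_right']
  have h1 : ∀ M : Matrix (Fin 0) (Fin 0) K, M = ((1 : GL (Fin 0) K) : Matrix _ _ K) :=
    fun M => Subsingleton.elim _ _
  have h2 : ∀ x : Fin 0 × Fin 0 → K, detWeighted 0 (fun g : GL (Fin 0) K =>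
      ∫⁻ v, φ (aff g v) ∂(Measure.pi fun _ => μ)) (pairMat x) = φ 1 := by
    intro x
    rw [h1 (pairMat x), detWeighted_coe]
    simp only [pow_zero, inv_one, ENNReal.ofReal_one, one_mul]
    have h3 : ∀ v : Fin 0 → K, φ (aff 1 v) = φ 1 := by
      intro v
      rw [Subsingleton.elim v 0, aff_one_zero]
    simp_rw [h3]
    rw [lintegral_const, Measure.pi_univ]
    simp
  simp_rw [h2]
  rw [lintegral_const, Measure.pi_univ]
  simp

instance sigmaFinite_generalLinearMeasure (n : ℕ) : SigmaFinite (generalLinearMeasure n μ) := by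
  obtain ⟨N, hN⟩ := exists_isProperAbs K
  obtain ⟨M, hM⟩ := hN.exists_lintegral_heightDecay_generalLinear μ n
  exact sigmaFinite_of_lintegral_lt_top (hN.measurable_heightDecay M)
    (fun g => ENNReal.ofReal_pos.2 (heightDecay_pos M g)) hM

end HeightDecay

/-! ### The quotients by the unipotent group -/

section UnipotentQuotient

variable {K : Type*} [Field K] [TopologicalSpace K] [IsLocalField K] [MeasurableSpace K]
  [BorelSpace K] (μ : Measure K) [μ.IsAddHaarMeasure] {n : ℕ}

theorem isClosed_unipotentSubgroup (n : ℕ) :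
    IsClosed (unipotentSubgroup n K : Set (GL (Fin n) K)) := by
  have h : (unipotentSubgroup n K : Set (GL (Fin n) K)) =
      ⋂ i, ⋂ j, ⋂ _ : j ≤ i, {g : GL (Fin n) K | (g : Matrix (Fin n) (Fin n) K) i j = if i = j then 1 else 0} := by
    ext g
    simp only [Set.mem_iInter]
    rfl
  rw [h]
  exact isClosed_iInter fun i => isClosed_iInter fun j => isClosed_iInter fun _ =>
    isClosed_eq (continuous_GL_apply i j) continuous_const

instance measurableMul₂_subgroup (S : Subgroup (GL (Fin n) K)) : MeasurableMul₂ S :=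
  ⟨((measurable_subtype_coe.comp measurable_fst).mul
    (measurable_subtype_coe.comp measurable_snd)).subtype_mk⟩

instance isMulRightInvariant_unipotentMeasure :
    (unipotentMeasure n μ).IsMulRightInvariant := by
  refine ⟨fun u₀ => Measure.ext fun s hs => ?_⟩
  have hemb : MeasurableEmbedding (Subtype.val : unipotentSubgroup n K → GL (Fin n) K) :=
    MeasurableEmbedding.subtype_coe (isClosed_unipotentSubgroup n).measurableSet
  have hs' : MeasurableSet (Subtype.val '' s : Set (GL (Fin n) K)) := hemb.measurableSet_image.2 hs
  let φ : GL (Fin n) K → ℝ≥0∞ := (Subtype.val '' s : Set (GL (Fin n) K)).indicator 1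
  have hφ : Measurable φ := measurable_one.indicator hs'
  have h1 : ∀ t : Set (unipotentSubgroup n K), MeasurableSet t →
      unipotentMeasure n μ t = ∫⁻ u, t.indicator 1 u ∂(unipotentMeasure n μ) :=
    fun t ht => (lintegral_indicator_one ht).symm
  have hm : Measurable fun u : unipotentSubgroup n K => u * u₀ := measurable_mul_const u₀
  have h2 : ∀ u : unipotentSubgroup n K, s.indicator (1 : unipotentSubgroup n K → ℝ≥0∞) u = φ u := by
    intro u
    by_cases hu : u ∈ s
    · rw [Set.indicator_of_mem hu]
      exact (Set.indicator_of_mem (s := (Subtype.val '' s : Set (GL (Fin n) K)))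
        (f := (1 : GL (Fin n) K → ℝ≥0∞)) ⟨u, hu, rfl⟩).symm
    · rw [Set.indicator_of_notMem hu]
      refine (Set.indicator_of_notMem (s := (Subtype.val '' s : Set (GL (Fin n) K)))
        (f := (1 : GL (Fin n) K → ℝ≥0∞)) ?_).symm
      rintro ⟨v, hv, hvu⟩
      exact hu (Subtype.ext hvu ▸ hv)
  rw [Measure.map_apply hm hs, h1 _ (hm hs), h1 s hs]
  have h3 : ∀ u : unipotentSubgroup n K, ((fun u => u * u₀) ⁻¹' s).indicator (1 : unipotentSubgroup n K → ℝ≥0∞) u =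
      φ ((u : GL (Fin n) K) * u₀) := fun u => h2 (u * u₀)
  simp_rw [h3, h2]
  have hφ' : Measurable fun g => φ (g * (u₀ : GL (Fin n) K)) := hφ.comp (measurable_mul_const _)
  rw [lintegral_unipotentMeasure μ n hφ', lintegral_unipotentMeasure μ n hφ,
    ← uni_triCoord u₀.2, lintegral_uni_mul_right μ n _ hφ]

instance neZero_unipotentMeasure : NeZero (unipotentMeasure n μ) := by
  refine ⟨fun h => ?_⟩
  have h1 := map_unipotentMeasure μ n
  rw [h, Measure.map_zero] at h1
  have h2 : (triMeasure μ n).map (uni n) Set.univ = 0 := by rw [← h1]; rfl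
  rw [Measure.map_apply (measurable_uni n) MeasurableSet.univ, Set.preimage_univ] at h2
  exact (NeZero.ne (triMeasure μ n)) (Measure.measure_univ_eq_zero.1 h2)

/-- The cutoff is a negative power of the height, divided by its integral over the orbits. -/
theorem exists_isCutoff_generalLinear (n : ℕ) :
    ∃ w : GL (Fin n) K → ℝ≥0∞,
      IsCutoff (unipotentSubgroup n K).subtype (unipotentMeasure n μ) w := by
  obtain ⟨N, hN⟩ := exists_isProperAbs K
  obtain ⟨M, hM⟩ := hN.exists_lintegral_heightDecay_uni μ n
  have hι : Measurable (unipotentSubgroup n K).subtype := measurable_subtype_coe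
  have hφ := hN.measurable_heightDecay (n := n) M
  have hval : ∀ h : GL (Fin n) K, orbitSum (unipotentSubgroup n K).subtype (unipotentMeasure n μ)
      (fun g => ENNReal.ofReal (heightDecay N M g)) h =
        ∫⁻ x, ENNReal.ofReal (heightDecay N M (uni n x * h)) ∂(triMeasure μ n) := fun h =>
    lintegral_unipotentMeasure μ n (φ := fun g => ENNReal.ofReal (heightDecay N M (g * h)))
      (hφ.comp (measurable_mul_const h))
  refine ⟨_, isCutoff_div hι hφ (fun h => ?_) fun h => ?_⟩
  · rw [hval]
    have hmeas : Measurable fun x : TriIdx n → K =>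
        ENNReal.ofReal (heightDecay N M (uni n x * h)) :=
      (hφ.comp (measurable_mul_const h)).comp (measurable_uni n)
    refine ((lintegral_pos_iff_support hmeas).2 ?_).ne'
    have : (Function.support fun x : TriIdx n → K =>
        ENNReal.ofReal (heightDecay N M (uni n x * h))) = Set.univ := by
      ext x
      simpa using heightDecay_pos M (uni n x * h)
    rw [this]
    exact Measure.measure_univ_pos.2 (NeZero.ne _)
  · rw [hval]
    refine ne_of_lt ?_
    have h1 : ∀ x : TriIdx n → K, ENNReal.ofReal (heightDecay N M (uni n x * h)) ≤
        ENNReal.ofReal (heightDecay N M (uni n x)) * ENNReal.ofReal (height N h ^ M) := by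
      intro x
      rw [← ENNReal.ofReal_mul (heightDecay_pos _ _).le]
      exact ENNReal.ofReal_le_ofReal (heightDecay_mul_le_right M _ _)
    refine lt_of_le_of_lt (lintegral_mono h1) ?_
    rw [lintegral_mul_const' _ _ ENNReal.ofReal_ne_top]
    exact ENNReal.mul_lt_top hM ENNReal.ofReal_lt_top

theorem IsCutoff.mirabolic {w : GL (Fin n) K → ℝ≥0∞}
    (hw : IsCutoff (unipotentSubgroup n K).subtype (unipotentMeasure n μ) w) :
    IsCutoff (unipotentToMirabolic n K) (unipotentMeasure n μ)
      fun p : mirabolicSubgroup n K => w p :=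
  ⟨hw.measurable.comp measurable_subtype_coe, fun p => hw.orbitSum_eq p⟩

theorem measurable_unipotentToMirabolic : Measurable (unipotentToMirabolic n K) :=
  measurable_subtype_coe.subtype_mk

end UnipotentQuotient

/-! ### Coordinates on the mirabolic group modulo the unipotent group -/

section Sections

open Matrix

/-- For every non-zero row vector `y`, an invertible matrix with last row `y`, in the form of a
scalar `c y` times a matrix `k y` which stays, together with its inverse, in a bounded set. -/
structure RowSection {K : Type*} [Field K] [TopologicalSpace K] [IsLocalField K]
    [MeasurableSpace K] (N : AbsoluteValue K ℝ) where
  /-- The bounded matrix. -/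
  k : ∀ n, (Fin n → K) → GL (Fin n) K
  /-- The scalar. -/
  c : ∀ n, (Fin n → K) → Kˣ
  measurable_k : ∀ n, Measurable (k n)
  measurable_c : ∀ n, Measurable fun y => (c n y : K)
  height_le : ∀ n, ∃ C, ∀ y, height N (k n y) ≤ C
  last_row : ∀ m y, y ≠ 0 →
    lastVec m ᵥ* ((c (m + 1) y : K) • (k (m + 1) y : Matrix (Fin (m + 1)) (Fin (m + 1)) K)) = y

variable {K : Type*} [Field K] [TopologicalSpace K] [IsLocalField K] [MeasurableSpace K]
  [BorelSpace K] {N : AbsoluteValue K ℝ}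

theorem IsProperAbs.exists_measurable_argmax (hN : IsProperAbs N) :
    ∀ m : ℕ, ∃ i : (Fin (m + 1) → K) → Fin (m + 1), Measurable i ∧
      ∀ (y : Fin (m + 1) → K) (j : Fin (m + 1)), N (y j) ≤ N (y (i y))
  | 0 => ⟨fun _ => 0, measurable_const, fun y j => by
      rw [show j = 0 from Subsingleton.elim (α := Fin 1) j 0]⟩
  | m + 1 => by
    obtain ⟨i, hi, hmax⟩ := exists_measurable_argmax hN m
    let i₁ : (Fin (m + 1 + 1) → K) → Fin (m + 1 + 1) := fun y => (i fun j => y j.castSucc).castSucc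
    have h1 : Measurable i₁ := by
      refine (measurable_of_countable Fin.castSucc).comp (hi.comp ?_)
      exact measurable_pi_lambda _ fun j => measurable_pi_apply _
    have hN' : Measurable fun p : (Fin (m + 1 + 1) → K) × Fin (m + 1 + 1) => N (p.1 p.2) := by
      refine measurable_from_prod_countable_left fun j => ?_
      exact hN.continuous.measurable.comp (measurable_pi_apply j)
    have h2 : Measurable fun y : Fin (m + 1 + 1) → K => N (y (i₁ y)) := hN'.comp (measurable_id.prodMk h1)
    have h3 : Measurable fun y : Fin (m + 1 + 1) → K => N (y (Fin.last (m + 1))) :=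
      hN.continuous.measurable.comp (measurable_pi_apply _)
    refine ⟨fun y => if N (y (i₁ y)) ≤ N (y (Fin.last (m + 1))) then Fin.last (m + 1) else i₁ y,
      Measurable.ite (measurableSet_le h2 h3) measurable_const h1, fun y j => ?_⟩
    have hcast : ∀ j : Fin (m + 1), N (y j.castSucc) ≤ N (y (i₁ y)) := fun j =>
      hmax (fun j => y j.castSucc) j
    dsimp only
    split_ifs with h
    · refine Fin.lastCases le_rfl (fun j => (hcast j).trans h) j
    · refine Fin.lastCases (le_of_not_ge h) hcast j

omit [TopologicalSpace K] [IsLocalField K] [MeasurableSpace K] [BorelSpace K] in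
theorem det_updateRow_one_submatrix {n : ℕ} (σ : Equiv.Perm (Fin n)) (i : Fin n) (z : Fin n → K) :
    ((updateRow (1 : Matrix (Fin n) (Fin n) K) i z).submatrix σ id).det =
      Equiv.Perm.sign σ * z i := by
  rw [det_permute, ← cramer_transpose_apply, transpose_one, cramer_one]
  rfl

theorem IsProperAbs.exists_section (hN : IsProperAbs N) (m : ℕ) :
    ∃ (k : (Fin (m + 1) → K) → GL (Fin (m + 1)) K) (c : (Fin (m + 1) → K) → Kˣ), Measurable k ∧
      (Measurable fun y => (c y : K)) ∧ (∃ C, ∀ y, height N (k y) ≤ C) ∧ ∀ y, y ≠ 0 →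
        lastVec m ᵥ* ((c y : K) • (k y : Matrix (Fin (m + 1)) (Fin (m + 1)) K)) = y := by
  classical
  obtain ⟨i, hi, hmax⟩ := hN.exists_measurable_argmax m
  have hpos : ∀ y : Fin (m + 1) → K, y ≠ 0 → y (i y) ≠ 0 := by
    intro y hy h0
    refine hy (funext fun j => ?_)
    have h1 := hmax y j
    rw [h0, map_zero] at h1
    exact N.eq_zero.1 (le_antisymm h1 (N.nonneg _))
  have hev : Measurable fun y : Fin (m + 1) → K => y (i y) := by
    have : Measurable fun p : (Fin (m + 1) → K) × Fin (m + 1) => p.1 p.2 :=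
      measurable_from_prod_countable_left fun j => measurable_pi_apply j
    exact this.comp (measurable_id.prodMk hi)
  have h0 : MeasurableSet {y : Fin (m + 1) → K | y = 0} := measurableSet_eq
  -- the vector `y` divided by its largest coordinate
  let z : (Fin (m + 1) → K) → Fin (m + 1) → K := fun y =>
    if y = 0 then 1 else (y (i y))⁻¹ • y
  have hz1 : ∀ y, z y (i y) = 1 := by
    intro y
    simp only [z]
    split_ifs with h
    · rfl
    · simp [inv_mul_cancel₀ (hpos y h)]
  have hzN : ∀ y j, N (z y j) ≤ 1 := by
    intro y j
    simp only [z]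
    split_ifs with h
    · simp
    · rw [Pi.smul_apply, smul_eq_mul, map_mul, map_inv₀]
      have h1 : 0 < N (y (i y)) := N.pos (hpos y h)
      rw [inv_mul_le_iff₀ h1, mul_one]
      exact hmax y j
  have hzm : ∀ j, Measurable fun y => z y j := by
    intro j
    have h1 : (fun y => z y j) = fun y => if y = 0 then 1 else (y (i y))⁻¹ * y j := by
      funext y
      simp only [z]
      split_ifs <;> rfl
    rw [h1]
    exact Measurable.ite h0 measurable_const (hev.inv.mul (measurable_pi_apply j))
  -- the identity matrix with the row of the largest coordinate replaced by `z y` and moved to the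
  -- bottom: its determinant is `± 1`
  let M : (Fin (m + 1) → K) → Matrix (Fin (m + 1)) (Fin (m + 1)) K := fun y =>
    (updateRow (1 : Matrix (Fin (m + 1)) (Fin (m + 1)) K) (i y) (z y)).submatrix
      (Equiv.swap (i y) (Fin.last m)) id
  have hdet : ∀ y, (M y).det = Equiv.Perm.sign (Equiv.swap (i y) (Fin.last m)) := fun y => by
    simp only [M]
    rw [det_updateRow_one_submatrix, hz1, mul_one]
  have hNdet : ∀ y, N (M y).det = 1 := by
    intro y
    rw [hdet]
    rcases Int.units_eq_one_or (Equiv.Perm.sign (Equiv.swap (i y) (Fin.last m))) with h | h <;>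
      simp [h]
  have hdet0 : ∀ y, (M y).det ≠ 0 := fun y h => by
    have := hNdet y
    rw [h, map_zero] at this
    exact zero_ne_one this
  have hMm : ∀ a b, Measurable fun y => M y a b := by
    intro a b
    have h1 : Measurable fun p : (Fin (m + 1) → K) × Fin (m + 1) =>
        updateRow (1 : Matrix (Fin (m + 1)) (Fin (m + 1)) K) p.2 (z p.1)
          (Equiv.swap p.2 (Fin.last m) a) b := by
      refine measurable_from_prod_countable_left fun j => ?_
      by_cases h : Equiv.swap j (Fin.last m) a = j
      · simp only [h, updateRow_self]
        exact hzm b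
      · simp only [updateRow_ne h]
        exact measurable_const
    exact h1.comp (measurable_id.prodMk hi)
  refine ⟨fun y => toGL (M y), fun y => if h : y = 0 then 1 else Units.mk0 _ (hpos y h),
    measurable_toGL hMm, ?_, ?_, fun y hy => ?_⟩
  · have h1 : (fun y : Fin (m + 1) → K =>
        (((if h : y = 0 then 1 else Units.mk0 _ (hpos y h) : Kˣ)) : K)) =
        fun y => if y = 0 then 1 else y (i y) := by
      funext y
      split_ifs <;> rfl
    rw [h1]
    exact Measurable.ite h0 measurable_const hev
  · refine ⟨_, fun y => (height_le_of_det (toGL (M y))).trans (mul_le_mul_of_nonneg_left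
      (pow_le_pow_left₀ ?_ (b := 1 + ((m + 1 : ℕ) : ℝ) * ((m + 1 : ℕ) : ℝ) + 1) ?_ _)
        (by positivity))⟩
    · have := entryNorm_nonneg (N := N) (toGL (M y) : Matrix (Fin (m + 1)) (Fin (m + 1)) K)
      have h2 : 0 ≤ (N (toGL (M y) : Matrix (Fin (m + 1)) (Fin (m + 1)) K).det)⁻¹ :=
        inv_nonneg.2 (N.nonneg _)
      positivity
    · rw [coe_toGL (hdet0 y), hNdet, inv_one]
      have h1 : entryNorm N (M y) ≤ ((m + 1 : ℕ) : ℝ) * ((m + 1 : ℕ) : ℝ) := by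
        have hent : ∀ a b, N (M y a b) ≤ 1 := by
          intro a b
          simp only [M, submatrix_apply, id]
          by_cases h : Equiv.swap (i y) (Fin.last m) a = i y
          · rw [h, updateRow_self]
            exact hzN y b
          · rw [updateRow_ne h, one_apply]
            split_ifs <;> simp
        calc entryNorm N (M y) = ∑ a, ∑ b, N (M y a b) := rfl
          _ ≤ ∑ _a : Fin (m + 1), ∑ _b : Fin (m + 1), (1 : ℝ) :=
            Finset.sum_le_sum fun a _ => Finset.sum_le_sum fun b _ => hent a b
          _ = _ := by simp; ring
      linarith
  · dsimp only
    rw [coe_toGL (hdet0 y), dif_neg hy, lastVec, single_vecMul]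
    funext j
    simp only [M, row_apply, Matrix.smul_apply, submatrix_apply, id, Equiv.swap_apply_right,
      updateRow_self, z, if_neg hy, Units.val_mk0, smul_eq_mul, Pi.smul_apply]
    rw [mul_inv_cancel_left₀ (hpos y hy), one_mul]

theorem IsProperAbs.nonempty_rowSection (hN : IsProperAbs N) : Nonempty (RowSection N) := by
  have h : ∀ n, ∃ (k : (Fin n → K) → GL (Fin n) K) (c : (Fin n → K) → Kˣ), Measurable k ∧
      (Measurable fun y => (c y : K)) ∧ (∃ C, ∀ y, height N (k y) ≤ C) ∧
      ∀ m (e : n = m + 1) (y : Fin (m + 1) → K), y ≠ 0 →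
        lastVec m ᵥ* ((c (y ∘ Fin.cast e) : K) •
          (k (y ∘ Fin.cast e) : Matrix (Fin n) (Fin n) K).submatrix (Fin.cast e.symm)
            (Fin.cast e.symm)) = y := by
    intro n
    rcases n with _ | m
    · exact ⟨fun _ => 1, fun _ => 1, measurable_const, measurable_const, ⟨_, fun _ => le_rfl⟩,
        fun m e => by omega⟩
    · obtain ⟨k, c, hk, hc, hC, hs⟩ := hN.exists_section m
      refine ⟨k, c, hk, hc, hC, fun m' e y hy => ?_⟩
      obtain rfl : m = m' := by omega
      exact hs y hy
  choose k c hk hc hC hs using h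
  exact ⟨⟨k, c, hk, hc, hC, fun m y hy => hs (m + 1) m rfl y hy⟩⟩

namespace RowSection

variable (S : RowSection N)

/-- The matrix with last row `y`. -/
def g (n : ℕ) (y : Fin n → K) : GL (Fin n) K :=
  GeneralLinearGroup.scalar (Fin n) (S.c n y) * S.k n y

theorem coe_g (n : ℕ) (y : Fin n → K) :
    (S.g n y : Matrix (Fin n) (Fin n) K) = (S.c n y : K) • (S.k n y : Matrix (Fin n) (Fin n) K) := by
  rw [g, Units.val_mul, GeneralLinearGroup.coe_scalar, scalar_apply, ← smul_one_eq_diagonal,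
    smul_mul_assoc, one_mul]

theorem lastVec_vecMul_g (m : ℕ) (y : Fin (m + 1) → K) (hy : y ≠ 0) :
    lastVec m ᵥ* (S.g (m + 1) y : Matrix (Fin (m + 1)) (Fin (m + 1)) K) = y := by
  rw [coe_g]
  exact S.last_row m y hy

theorem measurable_g (n : ℕ) : Measurable (S.g n) := by
  refine measurable_GL_iff.2 fun i j => ?_
  simp only [coe_g, Matrix.smul_apply, smul_eq_mul]
  exact (S.measurable_c n).mul (measurable_GL_iff.1 (S.measurable_k n) i j)

/-- Representatives `p_Y` of the orbits of the unipotent group on the mirabolic group: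
`p_{(Y', y)} = diag(p_{Y'} g_y, 1)`. -/
def point : ∀ n, (TriIdx n → K) → GL (Fin n) K
  | 0, _ => 1
  | n + 1, Y => aff (point n (triInit Y) * S.g n (triLast Y)) 0

/-- The density of the measure `dY` on the orbits in the coordinates `p_Y`. -/
def dens : ∀ n, (TriIdx n → K) → ℝ
  | 0, _ => 1
  | n + 1, Y => dens n (triInit Y) *
      (normAbs (S.point n (triInit Y) * S.g n (triLast Y) : Matrix (Fin n) (Fin n) K).det)⁻¹

theorem point_succ (n : ℕ) (Y : TriIdx n → K) (y : Fin n → K) :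
    S.point (n + 1) (triSnoc Y y) = aff (S.point n Y * S.g n y) 0 := rfl

theorem dens_succ (n : ℕ) (Y : TriIdx n → K) (y : Fin n → K) :
    S.dens (n + 1) (triSnoc Y y) = S.dens n Y *
      (normAbs (S.point n Y * S.g n y : Matrix (Fin n) (Fin n) K).det)⁻¹ := rfl

theorem measurable_point : ∀ n, Measurable (S.point n)
  | 0 => measurable_const
  | n + 1 => Measurable.aff (((measurable_point n).comp measurable_triInit).mul
      ((S.measurable_g n).comp measurable_triLast)) measurable_const

theorem measurable_dens : ∀ n, Measurable (S.dens n)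
  | 0 => measurable_const
  | n + 1 => by
    have h : Measurable fun Y : TriIdx (n + 1) → K => S.point n (triInit Y) * S.g n (triLast Y) :=
      ((S.measurable_point n).comp measurable_triInit).mul
        ((S.measurable_g n).comp measurable_triLast)
    exact ((measurable_dens n).comp measurable_triInit).mul
      (measurable_normAbs.comp (measurable_GL_det.comp h)).inv

theorem dens_nonneg : ∀ n Y, 0 ≤ S.dens n Y
  | 0, _ => zero_le_one
  | n + 1, _ => mul_nonneg (dens_nonneg n _) (inv_nonneg.2 (normAbs_nonneg _))

theorem point_mem : ∀ (n : ℕ) (Y : TriIdx n → K), S.point n Y ∈ mirabolicSubgroup n K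
  | 0, _ => one_mem _
  | _ + 1, _ => aff_mem_mirabolicSubgroup _ _

variable (μ : Measure K) [μ.IsAddHaarMeasure]

omit [TopologicalSpace K] [IsLocalField K] [MeasurableSpace K] [BorelSpace K] in
theorem _root_.det_uni : ∀ (n : ℕ) (x : TriIdx n → K),
    (uni n x : Matrix (Fin n) (Fin n) K).det = 1
  | 0, _ => by simp
  | n + 1, x => by rw [uni, coe_aff, det_affMat, det_uni n]

/-- The integral over the mirabolic group in the coordinates `u(x) p_Y`: the mirabolic group of size
`m + 2` is decomposed as `U ⋊ GL_{m+1}`, and `GL_{m+1}` according to the last row. -/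
theorem lintegral_mirabolicMeasure_point : ∀ (m : ℕ) {φ : GL (Fin (m + 1)) K → ℝ≥0∞},
    Measurable φ → ∫⁻ p, φ p ∂(mirabolicMeasure (m + 1) μ) =
      ∫⁻ Y, ENNReal.ofReal (S.dens (m + 1) Y) * ∫⁻ x, φ (uni (m + 1) x * S.point (m + 1) Y)
        ∂(triMeasure μ (m + 1)) ∂(triMeasure μ (m + 1))
  | 0, φ, hφ => by
    rw [lintegral_mirabolicMeasure_one μ hφ]
    have : IsEmpty (TriIdx (0 + 1)) := ⟨fun t => t.elim (fun a => a.elim) fun a => a.elim0⟩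
    have h1 : ∀ Y, ENNReal.ofReal (S.dens (0 + 1) Y) * ∫⁻ x, φ (uni (0 + 1) x * S.point (0 + 1) Y)
        ∂(triMeasure μ (0 + 1)) = φ 1 := by
      intro Y
      have h2 : ∀ a : GL (Fin 0) K, a = 1 := fun a => Subsingleton.elim _ _
      have h3 : ∀ v : Fin 0 → K, v = 0 := fun v => Subsingleton.elim _ _
      have h4 : S.dens (0 + 1) Y = 1 := by simp [dens, normAbs_one]
      have h5 : ∀ x, φ (uni (0 + 1) x * S.point (0 + 1) Y) = φ 1 := by
        intro x
        congr 1
        rw [uni, point, h2 (uni 0 _), h3 (triLast x), h2 (_ * _), aff_one_zero, one_mul]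
      simp_rw [h4, h5]
      rw [lintegral_const, Measure.pi_univ]
      simp
    simp_rw [h1]
    rw [lintegral_const, Measure.pi_univ]
    simp
  | m + 1, φ, hφ => by
    have hA : Measurable fun q : GL (Fin (m + 1)) K × (Fin (m + 1) → K) => φ (aff q.1 q.2) :=
      hφ.comp (measurable_fst.aff measurable_snd)
    have hB : Measurable fun g : GL (Fin (m + 1)) K =>
        ∫⁻ v, φ (aff g v) ∂(Measure.pi fun _ => μ) := hA.lintegral_prod_right'
    have hD : Measurable fun g : GL (Fin (m + 1)) K =>
        ENNReal.ofReal ((normAbs (g : Matrix (Fin (m + 1)) (Fin (m + 1)) K).det)⁻¹) :=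
      (measurable_normAbs.comp measurable_GL_det).inv.ennreal_ofReal
    have hDB : Measurable fun g : GL (Fin (m + 1)) K =>
        ENNReal.ofReal ((normAbs (g : Matrix (Fin (m + 1)) (Fin (m + 1)) K).det)⁻¹) *
          ∫⁻ v, φ (aff g v) ∂(Measure.pi fun _ => μ) := hD.mul hB
    rw [lintegral_mirabolicMeasure μ hφ,
      lintegral_generalLinearMeasure_eq_mirabolic μ hB (S.lastVec_vecMul_g m)]
    have hstep : ∀ y, ∫⁻ p, ENNReal.ofReal ((normAbs ((p : GL (Fin (m + 1)) K) * S.g (m + 1) y :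
        Matrix (Fin (m + 1)) (Fin (m + 1)) K).det)⁻¹) * ∫⁻ v, φ (aff (p * S.g (m + 1) y) v)
          ∂(Measure.pi fun _ => μ) ∂(mirabolicMeasure (m + 1) μ) =
        ∫⁻ Y, ENNReal.ofReal (S.dens (m + 1) Y) * ∫⁻ x, ENNReal.ofReal
          ((normAbs (S.point (m + 1) Y * S.g (m + 1) y :
            Matrix (Fin (m + 1)) (Fin (m + 1)) K).det)⁻¹) *
          ∫⁻ v, φ (aff (uni (m + 1) x * S.point (m + 1) Y * S.g (m + 1) y) v)
            ∂(Measure.pi fun _ => μ) ∂(triMeasure μ (m + 1)) ∂(triMeasure μ (m + 1)) := by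
      intro y
      have hDBy : Measurable fun p : GL (Fin (m + 1)) K => ENNReal.ofReal
          ((normAbs (p * S.g (m + 1) y : Matrix (Fin (m + 1)) (Fin (m + 1)) K).det)⁻¹) *
            ∫⁻ v, φ (aff (p * S.g (m + 1) y) v) ∂(Measure.pi fun _ => μ) := by
        simpa only [Function.comp_def, Units.val_mul] using
          hDB.comp (measurable_mul_const (S.g (m + 1) y))
      rw [lintegral_mirabolicMeasure_point m hDBy]
      refine lintegral_congr fun Y => ?_
      congr 1
      refine lintegral_congr fun x => ?_
      rw [Units.val_mul, mul_assoc, det_mul, det_uni, one_mul]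
    simp_rw [hstep]
    have hG : Measurable fun Y : TriIdx (m + 1 + 1) → K => ENNReal.ofReal (S.dens (m + 1 + 1) Y) *
        ∫⁻ x, φ (uni (m + 1 + 1) x * S.point (m + 1 + 1) Y) ∂(triMeasure μ (m + 1 + 1)) := by
      refine ((S.measurable_dens _).ennreal_ofReal).mul ?_
      have : Measurable fun q : (TriIdx (m + 1 + 1) → K) × (TriIdx (m + 1 + 1) → K) =>
          φ (uni (m + 1 + 1) q.2 * S.point (m + 1 + 1) q.1) :=
        hφ.comp (((measurable_uni _).comp measurable_snd).mul
          ((S.measurable_point _).comp measurable_fst))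
      exact this.lintegral_prod_right'
    rw [lintegral_tri_succ μ hG]
    have hP : Measurable fun q : (Fin (m + 1) → K) × (TriIdx (m + 1) → K) =>
        S.point (m + 1) q.2 * S.g (m + 1) q.1 :=
      ((S.measurable_point _).comp measurable_snd).mul ((S.measurable_g _).comp measurable_fst)
    have hF : Measurable fun q : (Fin (m + 1) → K) × (TriIdx (m + 1) → K) =>
        ENNReal.ofReal (S.dens (m + 1) q.2) * ∫⁻ x, ENNReal.ofReal
          ((normAbs (S.point (m + 1) q.2 * S.g (m + 1) q.1 :
            Matrix (Fin (m + 1)) (Fin (m + 1)) K).det)⁻¹) *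
          ∫⁻ v, φ (aff (uni (m + 1) x * S.point (m + 1) q.2 * S.g (m + 1) q.1) v)
            ∂(Measure.pi fun _ => μ) ∂(triMeasure μ (m + 1)) := by
      refine ((S.measurable_dens _).comp measurable_snd).ennreal_ofReal.mul ?_
      have : Measurable fun r : ((Fin (m + 1) → K) × (TriIdx (m + 1) → K)) × (TriIdx (m + 1) → K) =>
          ENNReal.ofReal ((normAbs (S.point (m + 1) r.1.2 * S.g (m + 1) r.1.1 :
            Matrix (Fin (m + 1)) (Fin (m + 1)) K).det)⁻¹) *
          ∫⁻ v, φ (aff (uni (m + 1) r.2 * S.point (m + 1) r.1.2 * S.g (m + 1) r.1.1) v)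
            ∂(Measure.pi fun _ => μ) := by
        have hfst : Measurable (Prod.fst : ((Fin (m + 1) → K) × (TriIdx (m + 1) → K)) ×
          (TriIdx (m + 1) → K) → _) := measurable_fst
        have hDP := hD.comp (hP.comp hfst)
        simp only [Function.comp_def, Units.val_mul] at hDP
        refine hDP.mul (hB.comp ?_)
        simp_rw [mul_assoc]
        exact ((measurable_uni _).comp measurable_snd).mul (hP.comp measurable_fst)
      exact this.lintegral_prod_right'
    rw [lintegral_lintegral_swap hF.aemeasurable]
    refine lintegral_congr fun Y => lintegral_congr fun y => ?_
    rw [dens_succ, ENNReal.ofReal_mul (S.dens_nonneg _ _), mul_assoc]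
    congr 1
    have hmx : Measurable fun x : TriIdx (m + 1) → K =>
        ∫⁻ v, φ (aff (uni (m + 1) x * S.point (m + 1) Y * S.g (m + 1) y) v)
          ∂(Measure.pi fun _ => μ) :=
      hB.comp (((measurable_uni _).mul_const _).mul_const _)
    rw [lintegral_const_mul _ hmx]
    congr 1
    rw [lintegral_tri_succ μ (φ := fun x => φ (uni (m + 1 + 1) x * S.point (m + 1 + 1) (triSnoc Y y)))
      (hφ.comp ((measurable_uni _).mul_const _))]
    refine lintegral_congr fun x => lintegral_congr fun v => ?_
    rw [uni_succ, point_succ, aff_mul, mulVec_zero, zero_add, mul_assoc]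

end RowSection

end Sections

/-! ### The quadratic extension -/

/-- `τ` is a non-zero element of trace zero of the quadratic extension `E/F` and `σ` is the
conjugation of `E/F`. -/
structure IsTraceZeroGenerator {F E : Type*} [Field F] [Field E] [Algebra F E] (τ : E)
    (σ : E ≃ₐ[F] E) : Prop where
  ne_zero : τ ≠ 0
  map_eq : σ τ = -τ
  trace_eq : ∀ z, algebraMap F E (Algebra.trace F E z) = z + σ z

/-- The restriction to `F` of an absolute value of `E`. -/
abbrev AbsoluteValue.restrict {E : Type*} [Field E] (N : AbsoluteValue E ℝ) (F : Type*)
    [Field F] [Algebra F E] : AbsoluteValue F ℝ := N.comp (algebraMap F E).injective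

section Quadratic

variable {F E : Type*} [Field F] [Field E] [Algebra F E] {τ : E} {σ : E ≃ₐ[F] E}

theorem exists_isTraceZeroGenerator [CharZero F] [Algebra.IsQuadraticExtension F E] (hτ0 : τ ≠ 0)
    (hτ : Algebra.trace F E τ = 0) : ∃ σ : E ≃ₐ[F] E, IsTraceZeroGenerator τ σ := by
  classical
  have : FiniteDimensional F E := inferInstance
  have hcard : Fintype.card (E ≃ₐ[F] E) = 2 := by
    rw [← Nat.card_eq_fintype_card, IsGalois.card_aut_eq_finrank,
      Algebra.IsQuadraticExtension.finrank_eq_two]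
  obtain ⟨σ, hσ⟩ := Fintype.exists_ne_of_one_lt_card (by rw [hcard]; norm_num) (1 : E ≃ₐ[F] E)
  have huniv : (Finset.univ : Finset (E ≃ₐ[F] E)) = {1, σ} := by
    symm
    rw [Finset.eq_univ_iff_forall, ← Finset.eq_univ_iff_forall]
    apply Finset.eq_univ_of_card
    rw [hcard, Finset.card_pair hσ.symm]
  have htr : ∀ z, algebraMap F E (Algebra.trace F E z) = z + σ z := by
    intro z
    rw [trace_eq_sum_automorphisms, huniv, Finset.sum_pair hσ.symm]
    rfl
  refine ⟨σ, hτ0, ?_, htr⟩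
  have h := htr τ
  rw [hτ, map_zero] at h
  exact (neg_eq_of_add_eq_zero_right h.symm).symm

namespace IsTraceZeroGenerator

variable [CharZero F] (h : IsTraceZeroGenerator τ σ)

include h

omit h in
theorem two_ne_zero_ext (F : Type*) {E : Type*} [Field F] [Field E] [Algebra F E] [CharZero F] :
    (2 : E) ≠ 0 := by
  have h2 : (algebraMap F E) 2 = 2 := map_ofNat _ 2
  rw [← h2, Ne, map_eq_zero]
  exact two_ne_zero

theorem exists_algebraMap_eq {z : E} (hz : σ z = z) : ∃ a : F, algebraMap F E a = z := by
  refine ⟨Algebra.trace F E z / 2, ?_⟩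
  have h2 := two_ne_zero_ext F (E := E)
  rw [map_div₀, h.trace_eq, hz, map_ofNat]
  field_simp
  ring

theorem exists_sq : ∃ d : F, d ≠ 0 ∧ algebraMap F E d = τ ^ 2 := by
  obtain ⟨d, hd⟩ := h.exists_algebraMap_eq (z := τ ^ 2) (by rw [map_pow, h.map_eq, neg_sq])
  refine ⟨d, ?_, hd⟩
  rintro rfl
  rw [map_zero] at hd
  exact h.ne_zero (pow_eq_zero_iff two_ne_zero |>.1 hd.symm)

theorem trace_algebraMap (a : F) : Algebra.trace F E (algebraMap F E a) = 2 * a := by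
  apply (algebraMap F E).injective
  rw [h.trace_eq, AlgEquiv.commutes, map_mul, map_ofNat]
  ring

theorem trace_mul_tau (a : F) : Algebra.trace F E (algebraMap F E a * τ) = 0 := by
  apply (algebraMap F E).injective
  rw [h.trace_eq, map_mul, AlgEquiv.commutes, h.map_eq, map_zero]
  ring

/-- The coordinates `(a, b)` of `a + b τ`. -/
def addEquiv : F × F ≃+ E where
  toFun p := algebraMap F E p.1 + algebraMap F E p.2 * τ
  invFun z := (Algebra.trace F E z / 2, Algebra.trace F E (z * τ⁻¹) / 2)
  left_inv := by
    rintro ⟨a, b⟩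
    have h0 := h.ne_zero
    obtain ⟨d, hd0, hd⟩ := h.exists_sq
    have h1 : (algebraMap F E a + algebraMap F E b * τ) * τ⁻¹ =
        algebraMap F E (a / d) * τ + algebraMap F E b := by
      rw [map_div₀, hd]
      field_simp
    dsimp only
    rw [h1]
    simp only [map_add, h.trace_algebraMap, h.trace_mul_tau, add_zero, zero_add]
    rw [mul_div_cancel_left₀ _ two_ne_zero, mul_div_cancel_left₀ _ two_ne_zero]
  right_inv z := by
    have h0 := h.ne_zero
    have h2 := two_ne_zero_ext F (E := E)
    simp only [map_div₀, h.trace_eq, map_mul, map_inv₀, h.map_eq, map_ofNat]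
    field_simp
    ring
  map_add' p q := by
    simp only [Prod.fst_add, Prod.snd_add, map_add]
    ring

end IsTraceZeroGenerator

variable [TopologicalSpace F] [IsLocalField F] [TopologicalSpace E] [IsLocalField E]
  [ContinuousSMul F E] [CharZero F]

omit [CharZero F] in
theorem continuous_algebraMap_ext : Continuous (algebraMap F E) := by
  have h : (algebraMap F E : F → E) = fun a => a • (1 : E) := by
    funext a
    rw [Algebra.smul_def, mul_one]
  rw [h]
  exact continuous_id.smul continuous_const

namespace IsTraceZeroGenerator

variable (h : IsTraceZeroGenerator τ σ)

include h

theorem continuous_addEquiv : Continuous h.addEquiv := by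
  have h1 : Continuous (algebraMap F E) := continuous_algebraMap_ext
  exact (h1.comp continuous_fst).add ((h1.comp continuous_snd).mul continuous_const)

/-- The homeomorphism `(a, b) ↦ a + b τ` between `F × F` and `E`. -/
def homeomorph : F × F ≃ₜ E :=
  h.addEquiv.toEquiv.toHomeomorphOfContinuousOpen h.continuous_addEquiv
    (AddMonoidHom.isOpenMap_of_sigmaCompact h.addEquiv.toAddMonoidHom h.addEquiv.surjective
      h.continuous_addEquiv)

theorem homeomorph_apply (p : F × F) :
    h.homeomorph p = algebraMap F E p.1 + algebraMap F E p.2 * τ := rfl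

theorem conj_homeomorph (p : F × F) : σ (h.homeomorph p) = h.homeomorph (p.1, -p.2) := by
  simp only [h.homeomorph_apply, map_add, map_mul, AlgEquiv.commutes, h.map_eq, map_neg]
  ring

theorem continuous_conj : Continuous σ := by
  have h1 : (σ : E → E) = fun z => h.homeomorph ((h.homeomorph.symm z).1,
      -(h.homeomorph.symm z).2) := by
    funext z
    rw [← h.conj_homeomorph, Homeomorph.apply_symm_apply]
  rw [h1]
  have := h.homeomorph.symm.continuous
  exact h.homeomorph.continuous.comp ((continuous_fst.comp this).prodMk
    (continuous_snd.comp this).neg)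

theorem isClosedEmbedding_algebraMap : IsClosedEmbedding (algebraMap F E) := by
  have h1 : (algebraMap F E : F → E) = h.homeomorph ∘ fun a => (a, 0) := by
    funext a
    simp [h.homeomorph_apply]
  rw [h1]
  refine h.homeomorph.isClosedEmbedding.comp ?_
  refine ⟨isEmbedding_prodMkLeft (0 : F), ?_⟩
  have : Set.range (fun a : F => (a, (0 : F))) = {p : F × F | p.2 = 0} := by
    ext ⟨a, b⟩
    constructor
    · rintro ⟨c, hc⟩
      exact (congrArg Prod.snd hc).symm
    · intro hb
      exact ⟨a, Prod.ext rfl (Eq.symm hb)⟩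
  rw [this]
  exact isClosed_singleton.preimage continuous_snd

theorem isProperAbs_restrict {N : AbsoluteValue E ℝ} (hN : IsProperAbs N) :
    IsProperAbs (N.restrict F) := by
  have hcl := h.isClosedEmbedding_algebraMap
  have hcomp : ∀ r : ℝ, IsCompact {x : F | N (algebraMap F E x) ≤ r} := fun r =>
    hcl.isCompact_preimage (hN.isCompact_ball r)
  refine ⟨hN.continuous.comp hcl.continuous, hcomp, ?_⟩
  by_contra hno
  push Not at hno
  have huniv : {x : F | N (algebraMap F E x) ≤ 1} = Set.univ :=
    Set.eq_univ_of_forall fun x => hno x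
  have hc : IsCompact (Set.univ : Set F) := huniv ▸ hcomp 1
  obtain ⟨N', hN'⟩ := exists_isProperAbs F
  obtain ⟨a, ha⟩ := hN'.exists_one_lt
  obtain ⟨B, hB⟩ := (hc.image hN'.continuous).bddAbove
  obtain ⟨k, hk⟩ := pow_unbounded_of_one_lt B ha
  have := hB ⟨a ^ k, trivial, map_pow N' a k⟩
  linarith

theorem exists_conj_le {N : AbsoluteValue E ℝ} (hN : IsProperAbs N) :
    ∃ C, 1 ≤ C ∧ ∀ z, N (σ z) ≤ C * N z := by
  have hc : Continuous fun z => N (σ z) := hN.continuous.comp h.continuous_conj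
  have h0 : {z | N (σ z) < 1} ∈ 𝓝 (0 : E) := by
    refine hc.continuousAt.preimage_mem_nhds (Iio_mem_nhds ?_)
    simp
  obtain ⟨ε, hε, hsub⟩ := hN.exists_ball_subset h0
  obtain ⟨a, ha⟩ := (h.isProperAbs_restrict hN).exists_one_lt
  replace ha : 1 < N (algebraMap F E a) := ha
  set α := N (algebraMap F E a) with hα
  refine ⟨max 1 (α / ε), le_max_left _ _, fun z => ?_⟩
  rcases eq_or_ne z 0 with rfl | hz
  · simp
  have hNz : 0 < N z := N.pos hz
  -- rescale `z` by a power of `a` so that it lies just inside the ball of radius `ε`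
  obtain ⟨k, hk1, hk2⟩ := exists_mem_Ico_zpow (div_pos hNz hε) ha
  have hα0 : 0 < α := by linarith
  have hk3 : N (algebraMap F E a ^ (-(k + 1)) * z) < ε := by
    rw [map_mul, map_zpow₀, ← hα, zpow_neg, inv_mul_lt_iff₀ (zpow_pos hα0 _)]
    rwa [div_lt_iff₀ hε] at hk2
  have hk4 : N (σ (algebraMap F E a ^ (-(k + 1)) * z)) < 1 := hsub hk3
  rw [map_mul, map_zpow₀, AlgEquiv.commutes, map_mul, map_zpow₀, ← hα, zpow_neg,
    inv_mul_lt_iff₀ (zpow_pos hα0 _), mul_one] at hk4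
  have hk5 : α ^ (k + 1) ≤ α / ε * N z := by
    rw [zpow_add_one₀ hα0.ne']
    rw [le_div_iff₀ hε] at hk1
    rw [div_mul_eq_mul_div, le_div_iff₀ hε]
    nlinarith
  calc N (σ z) ≤ α / ε * N z := hk4.le.trans hk5
    _ ≤ _ := mul_le_mul_of_nonneg_right (le_max_right _ _) hNz.le

end IsTraceZeroGenerator

/-! ### Measures on the quadratic extension -/

variable [MeasurableSpace F] [BorelSpace F] [MeasurableSpace E] [BorelSpace E]

theorem normAbs_eq_of_lintegral {K : Type*} [Field K] [TopologicalSpace K] [IsLocalField K]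
    [MeasurableSpace K] [BorelSpace K] (μ : Measure K) [μ.IsAddHaarMeasure] {x : K} (hx : x ≠ 0)
    {r : ℝ} (hr : 0 < r) (hφ : ∀ φ : K → ℝ≥0∞, Measurable φ →
      ∫⁻ v, φ (x * v) ∂μ = ENNReal.ofReal r⁻¹ * ∫⁻ v, φ v ∂μ) : normAbs x = r := by
  obtain ⟨N, hN⟩ := exists_isProperAbs K
  have hB : MeasurableSet {v : K | N v ≤ 1} := (hN.isCompact_ball 1).isClosed.measurableSet
  have h1 := hφ _ ((measurable_const (a := (1 : ℝ≥0∞))).indicator hB)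
  have hm1 : Measurable ({v : K | N v ≤ 1}.indicator fun _ => (1 : ℝ≥0∞)) :=
    measurable_const.indicator hB
  rw [lintegral_comp_mul_left_normAbs μ hx hm1, lintegral_indicator_const hB, one_mul] at h1
  have h2 := (ENNReal.mul_left_inj (hN.measure_ball_pos μ one_pos).ne'
    (hN.measure_ball_lt_top μ 1).ne).1 h1
  rw [ENNReal.ofReal_eq_ofReal_iff (inv_nonneg.2 (normAbs_nonneg x)) (inv_nonneg.2 hr.le)] at h2
  exact inv_injective h2

namespace IsTraceZeroGenerator

variable (h : IsTraceZeroGenerator τ σ) (μF : Measure F) [μF.IsAddHaarMeasure] (μE : Measure E)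
  [μE.IsAddHaarMeasure]

include h

/-- The Haar measure of `E` is a multiple of that of `F × F`. -/
theorem exists_measure_eq : ∃ c : ℝ, 0 < c ∧
    μE = ENNReal.ofReal c • (μF.prod μF).map h.homeomorph := by
  have h1 : ((μF.prod μF).map h.homeomorph).IsAddHaarMeasure :=
    h.addEquiv.isAddHaarMeasure_map (μF.prod μF) h.homeomorph.continuous
      h.homeomorph.symm.continuous
  have h2 := Measure.isAddLeftInvariant_eq_smul μE ((μF.prod μF).map h.homeomorph)
  refine ⟨(μE.addHaarScalarFactor ((μF.prod μF).map h.homeomorph) : ℝ), ?_, h2.trans ?_⟩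
  · exact NNReal.coe_pos.2 (Measure.addHaarScalarFactor_pos_of_isAddHaarMeasure _ _)
  · rw [ENNReal.ofReal_coe_nnreal]
    rfl

theorem lintegral_ext {c : ℝ} (hc : μE = ENNReal.ofReal c • (μF.prod μF).map h.homeomorph)
    {φ : E → ℝ≥0∞} (hφ : Measurable φ) : ∫⁻ z, φ z ∂μE =
      ENNReal.ofReal c * ∫⁻ b, ∫⁻ a, φ (algebraMap F E a + algebraMap F E b * τ) ∂μF ∂μF := by
  have hm := h.homeomorph.continuous.measurable
  have hφm : Measurable fun p => φ (h.homeomorph p) := hφ.comp hm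
  rw [hc, lintegral_smul_measure, lintegral_map hφ hm, smul_eq_mul, lintegral_prod_symm' _ hφm]
  rfl

/-- Multiplication by `τ` maps `a + b τ` to `d b + a τ`, which scales the measure of `E` by `|d|`. -/
theorem normAbs_tau {d : F} (hd : algebraMap F E d = τ ^ 2) : normAbs τ = normAbs d := by
  have hd0 : d ≠ 0 := by
    rintro rfl
    rw [map_zero] at hd
    exact h.ne_zero (pow_eq_zero_iff two_ne_zero |>.1 hd.symm)
  obtain ⟨μF, hμF⟩ : ∃ μ : Measure F, μ.IsAddHaarMeasure := ⟨Measure.addHaar, inferInstance⟩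
  obtain ⟨μE, hμE⟩ : ∃ μ : Measure E, μ.IsAddHaarMeasure := ⟨Measure.addHaar, inferInstance⟩
  obtain ⟨c, hc0, hc⟩ := h.exists_measure_eq μF μE
  refine normAbs_eq_of_lintegral μE h.ne_zero (normAbs_pos hd0) fun φ hφ => ?_
  have hφx : Measurable fun z => φ (τ * z) := hφ.comp (measurable_const_mul τ)
  rw [h.lintegral_ext μF μE hc hφx, h.lintegral_ext μF μE hc hφ]
  have hm : Measurable fun p : F × F => φ (algebraMap F E p.2 + algebraMap F E p.1 * τ) :=
    hφ.comp (h.homeomorph.continuous.measurable.comp measurable_swap)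
  have h1 : ∀ a b, φ (τ * (algebraMap F E a + algebraMap F E b * τ)) =
      φ (algebraMap F E (d * b) + algebraMap F E a * τ) := by
    intro a b
    simp only [map_mul, hd]
    congr 1
    ring
  simp_rw [h1]
  rw [lintegral_comp_mul_left_normAbs μF hd0
    (φ := fun b => ∫⁻ a, φ (algebraMap F E b + algebraMap F E a * τ) ∂μF)
      (hm.comp measurable_swap).lintegral_prod_right', lintegral_lintegral_swap, mul_left_comm]
  exact (hm.comp measurable_swap).aemeasurable

end IsTraceZeroGenerator

end Quadratic

/-! ### Finite differences and the decay of Fourier transforms -/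

section FiniteDifferences

theorem norm_fwdDiff_iter_le {V G : Type*} [AddCommGroup V] [NormedAddCommGroup G] (x : V)
    {f : V → G} {s : V} {B : ℝ} : ∀ K : ℕ, (∀ j ≤ K, ‖f (s + j • x)‖ ≤ B) →
      ‖(fwdDiff x)^[K] f s‖ ≤ 2 ^ K * B
  | K, h => by
    rw [fwdDiff_iter_eq_sum_shift]
    refine (norm_sum_le _ _).trans ?_
    have h1 : ∀ j ∈ Finset.range (K + 1),
        ‖((-1 : ℤ) ^ (K - j) * (K.choose j : ℤ)) • f (s + j • x)‖ ≤ K.choose j * B := by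
      intro j hj
      refine (norm_zsmul_le _ _).trans ?_
      refine mul_le_mul ?_ (h j (Nat.lt_succ_iff.1 (Finset.mem_range.1 hj))) (norm_nonneg _)
        (by positivity)
      rw [Int.norm_eq_abs]
      push_cast
      rw [abs_mul, abs_pow, abs_neg, abs_one, one_pow, one_mul, Nat.abs_cast]
    refine (Finset.sum_le_sum h1).trans_eq ?_
    rw [← Finset.sum_mul]
    congr 1
    exact_mod_cast Nat.sum_range_choose K

variable {V : Type*} [AddCommGroup V] [MeasurableSpace V] [MeasurableAdd V] {ν : Measure V}
  [ν.IsAddRightInvariant]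

theorem integrable_fwdDiff_iter (x : V) {G : V → ℂ} (hG : Integrable G ν) :
    ∀ K : ℕ, Integrable ((fwdDiff x)^[K] G) ν
  | 0 => hG
  | K + 1 => by
    rw [Function.iterate_succ_apply']
    have := integrable_fwdDiff_iter x hG K
    exact (this.comp_add_right x).sub this

theorem integrable_mul_addChar {G : V → ℂ} (hG : Integrable G ν) {χ : AddChar V Circle}
    (hχ : Measurable fun s => (χ s : ℂ)) : Integrable (fun s => G s * (χ s : ℂ)) ν :=
  hG.mul_bdd (c := 1) hχ.aestronglyMeasurable (Eventually.of_forall fun _ => (Circle.norm_coe _).le)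

/-- Integration by parts for finite differences against a character. -/
theorem integral_fwdDiff_iter_mul_addChar (x : V) {G : V → ℂ} (hG : Integrable G ν)
    {χ : AddChar V Circle} (hχ : Measurable fun s => (χ s : ℂ)) : ∀ K : ℕ,
      ∫ s, (fwdDiff x)^[K] G s * (χ s : ℂ) ∂ν =
        ((χ (-x) : ℂ) - 1) ^ K * ∫ s, G s * (χ s : ℂ) ∂ν
  | 0 => by simp
  | K + 1 => by
    have hK := integrable_fwdDiff_iter x hG K
    rw [Function.iterate_succ_apply']
    set D := (fwdDiff x)^[K] G with hD
    have h1 : ∫ s, D (s + x) * (χ s : ℂ) ∂ν = (χ (-x) : ℂ) * ∫ s, D s * (χ s : ℂ) ∂ν := by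
      rw [← integral_const_mul, ← integral_add_right_eq_self
        (fun s => (χ (-x) : ℂ) * (D s * (χ s : ℂ))) x]
      refine integral_congr_ae (Eventually.of_forall fun s => ?_)
      have : (χ s : ℂ) = χ (-x) * χ (s + x) := by
        rw [← Circle.coe_mul, ← AddChar.map_add_eq_mul]
        congr 2
        abel
      dsimp only
      rw [this]
      ring
    have h2 : ∫ s, fwdDiff x D s * (χ s : ℂ) ∂ν =
        ∫ s, D (s + x) * (χ s : ℂ) ∂ν - ∫ s, D s * (χ s : ℂ) ∂ν := by
      rw [← integral_sub (integrable_mul_addChar (hK.comp_add_right x) hχ)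
        (integrable_mul_addChar hK hχ)]
      refine integral_congr_ae (Eventually.of_forall fun s => ?_)
      simp only [fwdDiff]
      ring
    rw [h2, h1, hD, integral_fwdDiff_iter_mul_addChar x hG hχ K]
    ring

theorem norm_integral_mul_addChar_le (x : V) {G : V → ℂ} (hG : Integrable G ν)
    {χ : AddChar V Circle} (hχ : Measurable fun s => (χ s : ℂ)) (K : ℕ) {w : V → ℝ}
    (hw : Integrable w ν) (hle : ∀ s, ‖(fwdDiff x)^[K] G s‖ ≤ w s) :
    ‖(χ (-x) : ℂ) - 1‖ ^ K * ‖∫ s, G s * (χ s : ℂ) ∂ν‖ ≤ ∫ s, w s ∂ν := by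
  rw [← norm_pow, ← norm_mul, ← integral_fwdDiff_iter_mul_addChar x hG hχ K]
  refine norm_integral_le_of_norm_le hw (Eventually.of_forall fun s => ?_)
  rw [norm_mul, Circle.norm_coe, mul_one]
  exact hle s

end FiniteDifferences

/-! ### Test functions -/

section TestFunctions

theorem fderiv_fwdDiff {L V : Type*} [NormedAddCommGroup L] [NormedSpace ℝ L]
    [NormedAddCommGroup V] [NormedSpace ℝ V] (x : L) {B : L → V} (hB : ContDiff ℝ ((⊤ : ℕ∞) : WithTop ℕ∞) B) :
    ∀ K : ℕ, ContDiff ℝ ((⊤ : ℕ∞) : WithTop ℕ∞) ((fwdDiff x)^[K] B) ∧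
      fderiv ℝ ((fwdDiff x)^[K] B) = (fwdDiff x)^[K] (fderiv ℝ B)
  | 0 => ⟨hB, rfl⟩
  | K + 1 => by
    obtain ⟨h1, h2⟩ := fderiv_fwdDiff x hB K
    rw [Function.iterate_succ_apply', Function.iterate_succ_apply']
    refine ⟨(h1.comp (contDiff_id.add contDiff_const)).sub h1, ?_⟩
    rw [← h2]
    funext s
    have hd : Differentiable ℝ ((fwdDiff x)^[K] B) := h1.differentiable (by simp)
    have h3 : DifferentiableAt ℝ (fun s => (fwdDiff x)^[K] B (s + x)) s :=
      (hd (s + x)).comp s (differentiableAt_id.add_const x)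
    have h4 : fderiv ℝ (fun s => (fwdDiff x)^[K] B (s + x) - (fwdDiff x)^[K] B s) s =
        fderiv ℝ (fun s => (fwdDiff x)^[K] B (s + x)) s - fderiv ℝ ((fwdDiff x)^[K] B) s :=
      fderiv_sub h3 (hd s)
    rw [fderiv_comp_add_right] at h4
    exact h4

/-- Finite differences of smooth functions with compact support. -/
theorem exists_norm_fwdDiff_iter_le {L : Type} [NormedAddCommGroup L] [NormedSpace ℝ L] :
    ∀ (K : ℕ) {V : Type} [NormedAddCommGroup V] [NormedSpace ℝ V] {B : L → V},
      ContDiff ℝ ((⊤ : ℕ∞) : WithTop ℕ∞) B → HasCompactSupport B →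
        ∃ C, 0 ≤ C ∧ ∀ x s, ‖(fwdDiff x)^[K] B s‖ ≤ C * ‖x‖ ^ K
  | 0, V, _, _, B, hB, hs => by
    obtain ⟨C, hC⟩ := hB.continuous.bounded_above_of_compact_support hs
    exact ⟨C, (norm_nonneg _).trans (hC 0), fun x s => by simpa using hC s⟩
  | K + 1, V, _, _, B, hB, hs => by
    obtain ⟨C, hC0, hC⟩ := exists_norm_fwdDiff_iter_le K
      (hB.fderiv_right (m := ((⊤ : ℕ∞) : WithTop ℕ∞)) (by simp)) (hs.fderiv ℝ)
    refine ⟨C, hC0, fun x s => ?_⟩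
    obtain ⟨h1, h2⟩ := fderiv_fwdDiff x hB K
    rw [Function.iterate_succ_apply']
    have h3 := (convex_univ (𝕜 := ℝ) (E := L)).norm_image_sub_le_of_norm_fderiv_le
      (f := (fwdDiff x)^[K] B) (C := C * ‖x‖ ^ K) (𝕜 := ℝ)
      (fun y _ => (h1.differentiable (by simp)) y)
      (fun y _ => by rw [h2]; exact hC x y) (Set.mem_univ s) (Set.mem_univ (s + x))
    rw [add_sub_cancel_left] at h3
    rw [pow_succ, ← mul_assoc]
    exact h3

variable {K : Type*} [Field K] [TopologicalSpace K] [IsLocalField K]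

/-- A continuous function with compact support whose finite differences are as small as those of a
smooth function. -/
structure IsTestFunction (N : AbsoluteValue K ℝ) (φ : K → ℂ) : Prop where
  continuous : Continuous φ
  exists_support : ∃ R, ∀ s, φ s ≠ 0 → N s ≤ R
  map_zero : φ 0 = 1
  fwdDiff_le : ∀ (k : ℕ), ∃ C, 0 ≤ C ∧ ∀ x s, ‖(fwdDiff x)^[k] φ s‖ ≤ C * N x ^ k

/-- The test function is a smooth bump. -/
theorem exists_isTestFunction_of_normed {L : Type} [NontriviallyNormedField L] [NormedSpace ℝ L]
    [FiniteDimensional ℝ L] [ProperSpace L] (e : K ≃+* L) (he : IsHomeomorph e) :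
    ∃ (N : AbsoluteValue K ℝ) (φ : K → ℂ), IsProperAbs N ∧ IsTestFunction N φ := by
  obtain ⟨N, hN, hNe⟩ := exists_isProperAbs_of_normed e he
  let b : ContDiffBump (0 : L) := ⟨1, 2, one_pos, one_lt_two⟩
  let B : L → ℂ := fun y => ((b y : ℝ) : ℂ)
  have hB : ContDiff ℝ ((⊤ : ℕ∞) : WithTop ℕ∞) B := Complex.ofRealCLM.contDiff.comp b.contDiff
  have hBs : HasCompactSupport B := b.hasCompactSupport.comp_left (g := fun r : ℝ => (r : ℂ)) (by simp)
  refine ⟨N, fun s => B (e s), hN, hB.continuous.comp he.continuous, ⟨2, fun s hs => ?_⟩, ?_, ?_⟩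
  · rw [hNe]
    have h1 : b (e s) ≠ 0 := fun h0 => hs (by simp [B, h0])
    have h2 : e s ∈ Function.support b := h1
    rw [b.support_eq] at h2
    exact (mem_ball_zero_iff.1 h2).le
  · have h1 : b (0 : L) = 1 := b.one_of_mem_closedBall (by simp [b])
    simp [B, h1]
  · intro k
    obtain ⟨C, hC0, hC⟩ := exists_norm_fwdDiff_iter_le k hB hBs
    refine ⟨C, hC0, fun x s => ?_⟩
    have h1 : (fwdDiff x)^[k] (fun s => B (e s)) s = (fwdDiff (e x))^[k] B (e s) := by
      rw [fwdDiff_iter_eq_sum_shift, fwdDiff_iter_eq_sum_shift]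
      simp
    rw [h1, hNe]
    exact hC _ _

/-- The test function is the indicator of the unit ball: its differences of positive order vanish when
the step is of absolute value at most `1`. -/
theorem exists_isTestFunction_of_nonarchimedean [ValuativeRel K] [IsNonarchimedeanLocalField K] :
    ∃ (N : AbsoluteValue K ℝ) (φ : K → ℂ), IsProperAbs N ∧ IsTestFunction N φ := by
  classical
  obtain ⟨N, hN, hmax⟩ := exists_isProperAbs_of_nonarchimedean K
  have hadd : ∀ x s, N x ≤ 1 → (N (s + x) ≤ 1 ↔ N s ≤ 1) := by
    intro x s hx
    refine ⟨fun h => ?_, fun h => (hmax s x).trans (max_le h hx)⟩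
    have h1 := hmax (s + x) (-x)
    rw [add_neg_cancel_right, N.map_neg] at h1
    exact h1.trans (max_le h hx)
  have hclopen : IsClopen {s : K | N s ≤ 1} := by
    refine ⟨(hN.isCompact_ball 1).isClosed, isOpen_iff_mem_nhds.2 fun s hs => ?_⟩
    have h1 : {x : K | N x < 1} ∈ 𝓝 (0 : K) := by
      refine hN.continuous.continuousAt.preimage_mem_nhds (Iio_mem_nhds ?_)
      simp
    have h2 : Tendsto (fun y => y - s) (𝓝 s) (𝓝 0) := by
      have : Continuous fun y : K => y - s := continuous_id.sub continuous_const
      simpa using this.tendsto s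
    filter_upwards [h2 h1] with y hy
    have h3 := (hadd (y - s) s (le_of_lt hy)).2 hs
    rwa [add_sub_cancel] at h3
  let φ : K → ℂ := {s : K | N s ≤ 1}.indicator 1
  have hφ : ∀ s, ‖φ s‖ ≤ 1 := fun s => by
    simp only [φ]
    rw [norm_indicator_eq_indicator_norm]
    exact Set.indicator_le_self' (fun _ _ => norm_nonneg _) s |>.trans (by simp)
  refine ⟨N, φ, hN, ?_, ⟨1, fun s hs => ?_⟩, ?_, fun k => ⟨2 ^ k, by positivity, fun x s => ?_⟩⟩
  · exact continuous_one.indicator fun a ha => by simp [hclopen.frontier_eq] at ha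
  · by_contra h
    exact hs (Set.indicator_of_notMem (show s ∉ {s : K | N s ≤ 1} from h) _)
  · exact Set.indicator_of_mem (show (0 : K) ∈ {s : K | N s ≤ 1} from (N.map_zero).trans_le zero_le_one) _
  · rcases Nat.eq_zero_or_pos k with rfl | hk
    · simpa using hφ s
    by_cases hx : N x ≤ 1
    · obtain ⟨k, rfl⟩ := Nat.exists_eq_succ_of_ne_zero hk.ne'
      have h0 : fwdDiff x φ = fun _ => 0 := by
        funext s
        have : φ (s + x) = φ s := by
          by_cases hs : N s ≤ 1
          · simp only [φ]
            rw [Set.indicator_of_mem (show s + x ∈ {s : K | N s ≤ 1} from (hadd x s hx).2 hs),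
              Set.indicator_of_mem (show s ∈ {s : K | N s ≤ 1} from hs)]
            rfl
          · simp only [φ]
            rw [Set.indicator_of_notMem (show s + x ∉ {s : K | N s ≤ 1} from
              fun h => hs ((hadd x s hx).1 h)),
              Set.indicator_of_notMem (show s ∉ {s : K | N s ≤ 1} from hs)]
        simp [fwdDiff, this]
      rw [Function.iterate_succ_apply, h0, fwdDiff_iter_eq_sum_shift]
      simp only [smul_zero, Finset.sum_const_zero, norm_zero]
      have := N.nonneg x
      positivity
    · push Not at hx
      calc _ ≤ 2 ^ k * 1 := norm_fwdDiff_iter_le x k fun j _ => hφ _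
        _ ≤ 2 ^ k * N x ^ k := by
          gcongr
          exact one_le_pow₀ hx.le

variable (K) in
theorem exists_isTestFunction :
    ∃ (N : AbsoluteValue K ℝ) (φ : K → ℂ), IsProperAbs N ∧ IsTestFunction N φ := by
  rcases IsLocalField.nonarchimedean_or_real_or_complex (K := K) with
    ⟨_, _⟩ | ⟨e, he⟩ | ⟨e, he⟩
  · exact exists_isTestFunction_of_nonarchimedean
  · exact exists_isTestFunction_of_normed e he
  · exact exists_isTestFunction_of_normed e he

variable [MeasurableSpace K] [BorelSpace K]

/-- The character `s ↦ ψ(y s)`. -/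
def mulChar (ψ : AddChar K Circle) (y : K) : AddChar K Circle :=
  ψ.compAddMonoidHom (AddMonoidHom.mulLeft y)

omit [TopologicalSpace K] [IsLocalField K] [MeasurableSpace K] [BorelSpace K] in
theorem mulChar_apply (ψ : AddChar K Circle) (y s : K) : mulChar ψ y s = ψ (y * s) := rfl

theorem measurable_coe_addChar {ψ : AddChar K Circle} (hψ : Continuous ψ) {X : Type*}
    [MeasurableSpace X] {g : X → K} (hg : Measurable g) : Measurable fun x => (ψ (g x) : ℂ) :=
  (continuous_induced_dom.comp hψ).measurable.comp hg

/-- There are functions to which the Fourier inversion formula applies and which do not vanish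
at `0`. -/
theorem exists_integrable_fourierIntegral {ψ : AddChar K Circle} (hψ : Continuous ψ) (hne : ψ ≠ 1)
    (μ : Measure K) [μ.IsAddHaarMeasure] :
    ∃ φ : K → ℂ, Continuous φ ∧ Integrable φ μ ∧
      Integrable (Fourier.fourierIntegral ψ μ φ) μ ∧ φ 0 = 1 := by
  obtain ⟨N, φ, hN, hφ⟩ := exists_isTestFunction K
  obtain ⟨R, hR⟩ := hφ.exists_support
  have hball : ∀ r, MeasurableSet {s : K | N s ≤ r} := fun r =>
    (hN.isCompact_ball r).isClosed.measurableSet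
  have hcs : HasCompactSupport φ := HasCompactSupport.of_support_subset_isCompact
    (hN.isCompact_ball R) fun s hs => hR s hs
  have hint : Integrable φ μ := hφ.continuous.integrable_of_hasCompactSupport hcs
  refine ⟨φ, hφ.continuous, hint, ?_, hφ.map_zero⟩
  obtain ⟨x₀, hx₀⟩ : ∃ x₀, ψ (-x₀) ≠ 1 := by
    obtain ⟨x, hx⟩ := AddChar.ne_one_iff.1 hne
    exact ⟨-x, by rwa [neg_neg]⟩
  obtain ⟨M, hM⟩ := hN.exists_integrable_decay μ
  obtain ⟨C, hC0, hC⟩ := hφ.fwdDiff_le M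
  set R' : ℝ := R + M * N x₀ with hR'
  set δ : ℝ := ‖(ψ (-x₀) : ℂ) - 1‖ ^ M with hδ
  have hδ0 : 0 < δ := by
    refine pow_pos (norm_pos_iff.2 fun h => hx₀ ?_) M
    rw [sub_eq_zero] at h
    exact Circle.ext (by simpa using h)
  set A : ℝ := μ.real {s : K | N s ≤ R'} with hA
  set B : ℝ := max (∫ s, ‖φ s‖ ∂μ) (δ⁻¹ * (C * N x₀ ^ M * A)) with hB
  have hmain : ∀ y, ‖∫ s, φ s * (mulChar ψ y s : ℂ) ∂μ‖ ≤ B * decay N M y := by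
    intro y
    rcases le_or_gt (N y) 1 with hy | hy
    · have h1 : decay N M y = 1 := by rw [decay, max_eq_left hy]; simp
      rw [h1, mul_one]
      refine (norm_integral_le_integral_norm _).trans ((le_of_eq ?_).trans (le_max_left _ _))
      simp_rw [norm_mul, Circle.norm_coe, mul_one]
    · have hy0 : y ≠ 0 := by
        rintro rfl
        simp at hy
        linarith
      have hNy : 0 < N y := by linarith
      -- difference with a step on which the character takes the fixed value `ψ(x₀) ≠ 1`
      set x := y⁻¹ * x₀ with hx
      have hNx : N x = (N y)⁻¹ * N x₀ := by rw [hx, map_mul, map_inv₀]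
      have hNx' : N x ≤ N x₀ := by
        rw [hNx]
        exact mul_le_of_le_one_left (N.nonneg _) (inv_le_one_of_one_le₀ hy.le)
      have hle : ∀ s, ‖(fwdDiff x)^[M] φ s‖ ≤
          {s : K | N s ≤ R'}.indicator (fun _ => C * N x ^ M) s := by
        intro s
        by_cases hs : N s ≤ R'
        · rw [Set.indicator_of_mem (by exact hs)]
          exact hC x s
        · rw [Set.indicator_of_notMem (by exact hs)]
          have h2 : ∀ j ≤ M, ‖φ (s + j • x)‖ ≤ 0 := by
            intro j hj
            by_contra hne
            have h3 := hR (s + j • x) (fun h => hne (by rw [h, norm_zero]))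
            have h4 : N s ≤ N (s + j • x) + N (j • x) := by
              have := N.add_le (s + j • x) (-(j • x))
              rwa [add_neg_cancel_right, N.map_neg] at this
            have h5 : N (j • x) ≤ M * N x₀ := by
              have h6 : ∀ j : ℕ, N (j • x) ≤ j * N x := by
                intro j
                induction j with
                | zero => simp
                | succ j ih =>
                  rw [succ_nsmul]
                  push_cast
                  linarith [N.add_le (j • x) x]
              calc N (j • x) ≤ j * N x := h6 j
                _ ≤ M * N x₀ := mul_le_mul (by exact_mod_cast hj) hNx' (N.nonneg _) (by positivity)
            exact hs (by linarith)
          simpa using norm_fwdDiff_iter_le x M h2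
      have hiw : Integrable ({s : K | N s ≤ R'}.indicator fun _ => C * N x ^ M) μ :=
        (integrable_indicator_iff (hball _)).2
          (integrableOn_const (hN.measure_ball_lt_top μ R').ne)
      have h3 := norm_integral_mul_addChar_le x hint (χ := mulChar ψ y)
        (measurable_coe_addChar hψ (measurable_const_mul y)) M hiw hle
      rw [integral_indicator (hball _), setIntegral_const, smul_eq_mul] at h3
      have h4 : mulChar ψ y (-x) = ψ (-x₀) := by
        rw [mulChar_apply, hx, mul_neg, mul_inv_cancel_left₀ hy0]
      rw [h4, ← hδ] at h3
      have h5 : decay N M y = (N y ^ M)⁻¹ := by rw [decay, max_eq_right hy.le]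
      rw [h5]
      calc ‖∫ s, φ s * (mulChar ψ y s : ℂ) ∂μ‖ ≤ δ⁻¹ * (A * (C * N x ^ M)) := by
            rw [le_inv_mul_iff₀ hδ0]
            exact h3
        _ = δ⁻¹ * (C * N x₀ ^ M * A) * (N y ^ M)⁻¹ := by
            rw [hNx, mul_pow, inv_pow]
            ring
        _ ≤ _ := by
            refine mul_le_mul_of_nonneg_right (le_max_right _ _) (by positivity)
  have hFT : ∀ y, Fourier.fourierIntegral ψ μ φ y = ∫ s, φ s * (mulChar ψ (-y) s : ℂ) ∂μ := by
    intro y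
    rw [Fourier.fourierIntegral_def]
    refine integral_congr_ae (Eventually.of_forall fun s => ?_)
    dsimp only
    rw [mulChar_apply, Circle.smul_def, smul_eq_mul, mul_comm, neg_mul, mul_comm y s]
  have hmeas : StronglyMeasurable (Fourier.fourierIntegral ψ μ φ) := by
    have h1 : StronglyMeasurable fun p : K × K => φ p.2 * (ψ (-p.1 * p.2) : ℂ) :=
      ((hφ.continuous.measurable.comp measurable_snd).mul
        (measurable_coe_addChar hψ (measurable_fst.neg.mul measurable_snd))).stronglyMeasurable
    have h2 := h1.integral_prod_right' (ν := μ)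
    have h3 : Fourier.fourierIntegral ψ μ φ = fun y => ∫ s, φ s * (ψ (-y * s) : ℂ) ∂μ :=
      funext hFT
    rw [h3]
    exact h2
  refine (hM.const_mul B).mono' hmeas.aestronglyMeasurable (Eventually.of_forall fun y => ?_)
  rw [hFT]
  have := hmain (-y)
  rwa [show decay N M (-y) = decay N M y by rw [decay, decay, N.map_neg]] at this

end TestFunctions

/-! ### Fourier inversion -/

section Inversion

variable {K : Type*} [Field K] [TopologicalSpace K] [IsLocalField K] [MeasurableSpace K]
  [BorelSpace K] {ψ : AddChar K Circle} {μ : Measure K}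

theorem integrable_comp_mul_left_normAbs (μ : Measure K) [μ.IsAddHaarMeasure] {x : K} (hx : x ≠ 0)
    {φ : K → ℂ} (hφ : Integrable φ μ) : Integrable (fun v => φ (x * v)) μ := by
  have hemb : MeasurableEmbedding fun v : K => x * v :=
    (Homeomorph.mulLeft₀ x hx).measurableEmbedding
  have h1 : Integrable φ (μ.map fun v => x * v) := by
    rw [map_mul_left_eq_normAbs_smul μ hx]
    exact hφ.smul_measure ENNReal.ofReal_ne_top
  exact hemb.integrable_map_iff.1 h1

theorem fourierIntegral_zero (ψ : AddChar K Circle) (μ : Measure K) (φ : K → ℂ) :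
    Fourier.fourierIntegral ψ μ φ 0 = ∫ v, φ v ∂μ := by
  simp [Fourier.fourierIntegral_def]

theorem IsSelfDual.integral_fourierIntegral (h : IsSelfDual ψ μ) {φ : K → ℂ} (hc : Continuous φ)
    (hi : Integrable φ μ) (hF : Integrable (Fourier.fourierIntegral ψ μ φ) μ) :
    ∫ y, Fourier.fourierIntegral ψ μ φ y ∂μ = φ 0 := by
  have := h.inversion φ hc hi hF 0
  rwa [fourierIntegral_zero, neg_zero] at this

/-- Fourier inversion at the origin for the character `s ↦ ψ(d s)`. -/
theorem IsSelfDual.integral_integral (h : IsSelfDual ψ μ) {d : K} (hd : d ≠ 0) {G : K → ℂ}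
    (hc : Continuous G) (hi : Integrable G μ)
    (hH : Integrable (fun y => ∫ s, G s * (ψ (d * (y * s)) : ℂ) ∂μ) μ) :
    ∫ y, ∫ s, G s * (ψ (d * (y * s)) : ℂ) ∂μ ∂μ = ((normAbs d)⁻¹ : ℝ) * G 0 := by
  have := h.isAddHaarMeasure
  have hnd : -d ≠ 0 := neg_ne_zero.2 hd
  have h1 : ∀ y, ∫ s, G s * (ψ (d * (y * s)) : ℂ) ∂μ =
      Fourier.fourierIntegral ψ μ G (-d * y) := by
    intro y
    rw [Fourier.fourierIntegral_def]
    refine integral_congr_ae (Eventually.of_forall fun s => ?_)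
    dsimp only
    rw [Circle.smul_def, smul_eq_mul, mul_comm, show d * (y * s) = -(s * (-d * y)) by ring]
  simp_rw [h1] at hH ⊢
  have h2 : Integrable (Fourier.fourierIntegral ψ μ G) μ := by
    have := integrable_comp_mul_left_normAbs μ (inv_ne_zero hnd) hH
    refine this.congr (Eventually.of_forall fun y => ?_)
    dsimp only
    rw [mul_inv_cancel_left₀ hnd]
  rw [integral_comp_mul_left_normAbs μ hnd, h.integral_fourierIntegral hc hi h2, normAbs_neg]

variable {N : AbsoluteValue K ℝ}

theorem continuous_coe_addChar (hψ : Continuous ψ) {X : Type*} [TopologicalSpace X] {g : X → K}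
    (hg : Continuous g) : Continuous fun x => (ψ (g x) : ℂ) :=
  (continuous_induced_dom.comp hψ).comp hg

theorem measurePreserving_finCons (μ : Measure K) [SigmaFinite μ] (n : ℕ) :
    MeasurePreserving (fun p : K × (Fin n → K) => (Fin.cons p.1 p.2 : Fin (n + 1) → K))
      (μ.prod (Measure.pi fun _ => μ)) (Measure.pi fun _ => μ) := by
  have h := (measurePreserving_piFinSuccAbove (fun _ : Fin (n + 1) => μ) 0).symm
  refine ⟨?_, ?_⟩
  · refine measurable_pi_lambda _ fun i => ?_
    refine Fin.cases ?_ (fun i => ?_) i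
    · simpa using measurable_fst
    · simp only [Fin.cons_succ]
      exact (measurable_pi_apply i).comp measurable_snd
  · have h2 := h.map_eq
    have h3 : (fun p : K × (Fin n → K) => (Fin.cons p.1 p.2 : Fin (n + 1) → K)) =
        (MeasurableEquiv.piFinSuccAbove (fun _ : Fin (n + 1) => K) 0).symm := by
      funext p
      exact (Fin.insertNth_zero' p.1 p.2).symm
    rw [h3]
    exact h2

/-- The class of rapidly decreasing continuous functions to which the inversion formula is
applied. -/
structure IsRapid (N : AbsoluteValue K ℝ) (M : ℕ) {ι : Type*} [Fintype ι] (G : (ι → K) → ℂ) :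
    Prop where
  continuous : Continuous G
  exists_le : ∃ C, 0 ≤ C ∧ ∀ s, ‖G s‖ ≤ C * ∏ i, decay N M (s i)

theorem IsRapid.integrable [μ.IsAddHaarMeasure] {M : ℕ} (hM : Integrable (decay N M) μ) {ι : Type*}
    [Fintype ι] {G : (ι → K) → ℂ} (hG : IsRapid N M G) :
    Integrable G (Measure.pi fun _ => μ) := by
  obtain ⟨C, -, hC⟩ := hG.exists_le
  have h1 : Integrable (fun s : ι → K => C * ∏ i, decay N M (s i)) (Measure.pi fun _ => μ) :=
    (Integrable.fintype_prod fun _ => hM).const_mul C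
  exact h1.mono' hG.continuous.aestronglyMeasurable (Eventually.of_forall hC)

/-- Fourier inversion at `0` in several variables, for functions of rapid decay: one variable is
inverted at a time. -/
theorem IsSelfDual.integral_integral_pi (h : IsSelfDual ψ μ) (hψ : Continuous ψ) {d : K}
    (hd : d ≠ 0) {M : ℕ} (hM : Integrable (decay N M) μ) (hN : IsProperAbs N) :
    ∀ (n : ℕ) {G : (Fin n → K) → ℂ}, IsRapid N M G →
      Integrable (fun y : Fin n → K => ∫ s, G s * (ψ (d * ∑ i, y i * s i) : ℂ)
        ∂(Measure.pi fun _ => μ)) (Measure.pi fun _ => μ) →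
      ∫ y : Fin n → K, ∫ s, G s * (ψ (d * ∑ i, y i * s i) : ℂ)
        ∂(Measure.pi fun _ => μ) ∂(Measure.pi fun _ => μ) =
          (((normAbs d)⁻¹ : ℝ) : ℂ) ^ n * G 0
  | 0, G, _, _ => by
    rw [Measure.pi_of_empty _ 0]
    simp
  | n + 1, G, hG, hH => by
    have hHaar := h.isAddHaarMeasure
    obtain ⟨C, hC0, hC⟩ := hG.exists_le
    have hmp := measurePreserving_finCons μ n
    have hcons : Continuous fun p : K × (Fin n → K) => (Fin.cons p.1 p.2 : Fin (n + 1) → K) := by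
      refine continuous_pi fun i => ?_
      refine Fin.cases ?_ (fun i => ?_) i
      · simpa using continuous_fst
      · simp only [Fin.cons_succ]
        exact (continuous_apply i).comp continuous_snd
    have hemb : MeasurableEmbedding
        fun p : K × (Fin n → K) => (Fin.cons p.1 p.2 : Fin (n + 1) → K) := by
      refine MeasurableEmbedding.of_measurable_inverse (g := fun f => (f 0, fun i => f i.succ))
        hmp.measurable ?_ ?_ fun p => ?_
      · have : Set.range (fun p : K × (Fin n → K) => (Fin.cons p.1 p.2 : Fin (n + 1) → K)) =
            Set.univ := Set.eq_univ_of_forall fun f => ⟨(f 0, fun i => f i.succ), Fin.cons_self_tail f⟩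
        rw [this]
        exact MeasurableSet.univ
      · exact (measurable_pi_apply 0).prodMk (measurable_pi_lambda _ fun i => measurable_pi_apply _)
      · simp
    set θ : K → ℂ := fun a => (ψ (d * a) : ℂ) with hθ
    have hθc : Continuous θ := continuous_coe_addChar hψ (continuous_const.mul continuous_id)
    have hθ1 : ∀ a, ‖θ a‖ = 1 := fun a => Circle.norm_coe _
    have hθadd : ∀ a b, θ (a + b) = θ a * θ b := fun a b => by
      simp only [hθ]
      rw [mul_add, AddChar.map_add_eq_mul, Circle.coe_mul]
    have hdot : ∀ n : ℕ, ∀ y : Fin n → K, Continuous fun s : Fin n → K => ∑ i, y i * s i :=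
      fun n y => continuous_finsetSum _ fun i _ => continuous_const.mul (continuous_apply i)
    -- the partial Fourier transform in all variables but the first
    let G₁ : (Fin n → K) → K → ℂ := fun y s₀ =>
      ∫ s : Fin n → K, G (Fin.cons s₀ s) * θ (∑ i, y i * s i) ∂(Measure.pi fun _ => μ)
    have hbound : ∀ s₀ (y s : Fin n → K), ‖G (Fin.cons s₀ s) * θ (∑ i, y i * s i)‖ ≤
        C * decay N M s₀ * ∏ i, decay N M (s i) := by
      intro s₀ y s
      rw [norm_mul, hθ1, mul_one]
      refine (hC _).trans_eq ?_
      rw [Fin.prod_univ_succ, mul_assoc]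
      simp
    have hprod : Integrable (fun s : Fin n → K => ∏ i, decay N M (s i)) (Measure.pi fun _ => μ) :=
      Integrable.fintype_prod fun _ => hM
    have hG₁c : ∀ y, Continuous (G₁ y) := by
      intro y
      refine continuous_of_dominated (bound := fun s => C * ∏ i, decay N M (s i))
        (fun s₀ => ?_) (fun s₀ => Eventually.of_forall fun s => ?_) (hprod.const_mul C)
        (Eventually.of_forall fun s => ?_)
      · exact ((hG.continuous.comp (hcons.comp (Continuous.prodMk_right s₀))).mul
          (hθc.comp (hdot n y))).aestronglyMeasurable
      · refine (hbound s₀ y s).trans ?_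
        have h1 := decay_le_one (N := N) M s₀
        have h2 : 0 ≤ ∏ i, decay N M (s i) := Finset.prod_nonneg fun i _ => (decay_pos M _).le
        rw [mul_assoc]
        exact mul_le_mul_of_nonneg_left (mul_le_of_le_one_left h2 h1) hC0
      · exact (hG.continuous.comp (hcons.comp (Continuous.prodMk_left s))).mul continuous_const
    have hG₁i : ∀ y, Integrable (G₁ y) μ := by
      intro y
      refine (hM.const_mul (C * ∫ s : Fin n → K, ∏ i, decay N M (s i)
        ∂(Measure.pi fun _ => μ))).mono' (hG₁c y).aestronglyMeasurable
          (Eventually.of_forall fun s₀ => ?_)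
      refine (norm_integral_le_of_norm_le (hprod.const_mul (C * decay N M s₀))
        (Eventually.of_forall fun s => hbound s₀ y s)).trans_eq ?_
      rw [integral_const_mul]
      ring
    have hH' : ∀ y₀ (y : Fin n → K), ∫ s, G s * θ (∑ i, (Fin.cons y₀ y : Fin (n + 1) → K) i * s i)
        ∂(Measure.pi fun _ => μ) = ∫ s₀, G₁ y s₀ * θ (y₀ * s₀) ∂μ := by
      intro y₀ y
      have hint : Integrable (fun s : Fin (n + 1) → K =>
          G s * θ (∑ i, (Fin.cons y₀ y : Fin (n + 1) → K) i * s i)) (Measure.pi fun _ => μ) := by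
        refine (hG.integrable hM).mul_bdd (c := 1)
          (hθc.comp (hdot (n + 1) _)).aestronglyMeasurable
          (Eventually.of_forall fun s => (hθ1 _).le)
      rw [← hmp.integral_comp hemb]
      have hint' : Integrable (fun p : K × (Fin n → K) => G (Fin.cons p.1 p.2) *
          θ (∑ i, (Fin.cons y₀ y : Fin (n + 1) → K) i * (Fin.cons p.1 p.2 : Fin (n + 1) → K) i))
          (μ.prod (Measure.pi fun _ => μ)) := (hmp.integrable_comp_emb hemb).2 hint
      rw [integral_prod _ hint']
      refine integral_congr_ae (Eventually.of_forall fun s₀ => ?_)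
      dsimp only [G₁]
      rw [← integral_mul_const]
      refine integral_congr_ae (Eventually.of_forall fun s => ?_)
      dsimp only
      rw [Fin.sum_univ_succ, hθadd]
      simp only [Fin.cons_zero, Fin.cons_succ]
      ring
    have hHp : Integrable (fun p : K × (Fin n → K) => ∫ s₀, G₁ p.2 s₀ * θ (p.1 * s₀) ∂μ)
        (μ.prod (Measure.pi fun _ => μ)) := by
      have h1 := (hmp.integrable_comp_emb hemb).2 hH
      refine h1.congr (Eventually.of_forall fun p => ?_)
      exact hH' p.1 p.2
    have hinner : ∀ᵐ y ∂(Measure.pi fun _ : Fin n => μ),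
        ∫ y₀, ∫ s₀, G₁ y s₀ * θ (y₀ * s₀) ∂μ ∂μ = ((normAbs d)⁻¹ : ℝ) * G₁ y 0 := by
      filter_upwards [hHp.prod_left_ae] with y hy
      exact h.integral_integral hd (hG₁c y) (hG₁i y) hy
    have hG₀ : IsRapid N M fun s : Fin n → K => G (Fin.cons 0 s) := by
      refine ⟨hG.continuous.comp (hcons.comp (Continuous.prodMk_right 0)), C, hC0, fun s => ?_⟩
      refine (hC _).trans_eq ?_
      rw [Fin.prod_univ_succ]
      simp [decay_zero]
    have hκ : (((normAbs d)⁻¹ : ℝ) : ℂ) ≠ 0 :=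
      Complex.ofReal_ne_zero.2 (inv_ne_zero (normAbs_pos hd).ne')
    have hI : Integrable (fun y : Fin n → K => G₁ y 0) (Measure.pi fun _ => μ) := by
      have h1 := (hHp.integral_prod_right.congr hinner).const_mul (((normAbs d)⁻¹ : ℝ) : ℂ)⁻¹
      refine h1.congr (Eventually.of_forall fun y => ?_)
      exact inv_mul_cancel_left₀ hκ _
    have hfin := integral_integral_pi h hψ hd hM hN n hG₀ hI
    rw [← hmp.integral_comp hemb]
    have h2 : ∫ p : K × (Fin n → K), (∫ s, G s * (ψ (d * ∑ i, (Fin.cons p.1 p.2 :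
        Fin (n + 1) → K) i * s i) : ℂ) ∂(Measure.pi fun _ => μ)) ∂(μ.prod (Measure.pi fun _ => μ)) =
        ∫ p : K × (Fin n → K), (∫ s₀, G₁ p.2 s₀ * θ (p.1 * s₀) ∂μ)
          ∂(μ.prod (Measure.pi fun _ => μ)) :=
      integral_congr_ae (Eventually.of_forall fun p => hH' p.1 p.2)
    rw [h2, integral_prod_symm _ hHp, integral_congr_ae hinner, integral_const_mul]
    have h3 : ∫ y : Fin n → K, G₁ y 0 ∂(Measure.pi fun _ => μ) =
        (((normAbs d)⁻¹ : ℝ) : ℂ) ^ n * G 0 := by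
      have h4 : (Fin.cons 0 0 : Fin (n + 1) → K) = 0 := by
        funext i
        refine Fin.cases rfl (fun i => rfl) i
      have h5 := hfin
      rw [h4] at h5
      exact h5
    rw [h3, pow_succ]
    ring

end Inversion

/-! ### Comparison of self-dual measures -/

section Constant

variable {F E : Type*} [Field F] [TopologicalSpace F] [IsLocalField F] [MeasurableSpace F]
  [BorelSpace F] [Field E] [TopologicalSpace E] [IsLocalField E] [MeasurableSpace E]
  [BorelSpace E] [Algebra F E] [ContinuousSMul F E] [CharZero F] {τ : E} {σ : E ≃ₐ[F] E}
  {ψ : AddChar F Circle} {μF : Measure F} {μE : Measure E}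

/-- The self-dual measure of `E` in the coordinates `a + b τ`: the constant is found by inverting the
Fourier transform at `0` for a function `φ(a) φ(b)`. -/
theorem IsTraceZeroGenerator.sq_eq (h : IsTraceZeroGenerator τ σ) (hψ : Continuous ψ)
    (hne : ψ ≠ 1) (hF : IsSelfDual ψ μF)
    (hE : IsSelfDual (ψ.compAddMonoidHom (Algebra.trace F E).toAddMonoidHom) μE) {d : F}
    (hd : algebraMap F E d = τ ^ 2) {c : ℝ} (hc0 : 0 < c)
    (hc : μE = ENNReal.ofReal c • (μF.prod μF).map h.homeomorph) :
    c ^ 2 = normAbs (2 : F) * normAbs (2 * d) := by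
  have hHF := hF.isAddHaarMeasure
  have hd0 : d ≠ 0 := by
    rintro rfl
    rw [map_zero] at hd
    exact h.ne_zero (pow_eq_zero_iff two_ne_zero |>.1 hd.symm)
  have h2 : (2 : F) ≠ 0 := two_ne_zero
  have h2d : 2 * d ≠ 0 := mul_ne_zero h2 hd0
  obtain ⟨φ, hφc, hφi, hφF, hφ0⟩ := exists_integrable_fourierIntegral hψ hne μF
  set φF := Fourier.fourierIntegral ψ μF φ with hφFdef
  have htot : ∫ y, φF y ∂μF = 1 := by rw [hF.integral_fourierIntegral hφc hφi hφF, hφ0]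
  let e := h.homeomorph
  have hemb : MeasurableEmbedding e := e.measurableEmbedding
  have hintE : ∀ g : E → ℂ, ∫ z, g z ∂μE = (c : ℂ) * ∫ p, g (e p) ∂(μF.prod μF) := by
    intro g
    rw [hc, integral_smul_measure, hemb.integral_map, ENNReal.toReal_ofReal hc0.le]
    rfl
  have hIE : ∀ g : E → ℂ, Integrable (fun p => g (e p)) (μF.prod μF) → Integrable g μE := by
    intro g hg
    rw [hc]
    exact (hemb.integrable_map_iff.2 hg).smul_measure ENNReal.ofReal_ne_top
  let Φ : E → ℂ := fun z => φ (e.symm z).1 * φ (e.symm z).2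
  have hΦc : Continuous Φ := (hφc.comp (continuous_fst.comp e.symm.continuous)).mul
    (hφc.comp (continuous_snd.comp e.symm.continuous))
  have hΦe : ∀ p, Φ (e p) = φ p.1 * φ p.2 := fun p => by simp [Φ]
  have hΦi : Integrable Φ μE := hIE _ (by simpa only [hΦe] using hφi.mul_prod hφi)
  set ψE := ψ.compAddMonoidHom (Algebra.trace F E).toAddMonoidHom with hψE
  have htr : ∀ p q : F × F, Algebra.trace F E (e p * e q) = p.1 * (2 * q.1) + p.2 * (2 * d * q.2) := by
    intro p q
    have h1 : e p * e q = algebraMap F E (p.1 * q.1 + d * (p.2 * q.2)) +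
        algebraMap F E (p.1 * q.2 + p.2 * q.1) * τ := by
      simp only [e, h.homeomorph_apply, map_add, map_mul, hd]
      ring
    rw [h1, map_add, h.trace_algebraMap, h.trace_mul_tau]
    ring
  have hFE : ∀ q : F × F, Fourier.fourierIntegral ψE μE Φ (e q) =
      c * (φF (2 * q.1) * φF (2 * d * q.2)) := by
    intro q
    rw [Fourier.fourierIntegral_def, hintE, hφFdef, Fourier.fourierIntegral_def,
      Fourier.fourierIntegral_def, ← integral_prod_mul]
    congr 1
    refine integral_congr_ae (Eventually.of_forall fun p => ?_)
    dsimp only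
    have h1 : ψE (-(e p * e q)) = ψ (-(p.1 * (2 * q.1))) * ψ (-(p.2 * (2 * d * q.2))) := by
      rw [← AddChar.map_add_eq_mul, ← neg_add, ← htr, ← map_neg]
      rfl
    rw [h1, hΦe]
    simp only [Circle.smul_def, smul_eq_mul, Circle.coe_mul]
    ring
  have hprod : Integrable (fun q : F × F => φF (2 * q.1) * φF (2 * d * q.2)) (μF.prod μF) :=
    (integrable_comp_mul_left_normAbs μF h2 hφF).mul_prod
      (integrable_comp_mul_left_normAbs μF h2d hφF)
  have hFi : Integrable (Fourier.fourierIntegral ψE μE Φ) μE := by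
    refine hIE _ ?_
    simp_rw [hFE]
    exact hprod.const_mul _
  have hinv := hE.integral_fourierIntegral hΦc hΦi hFi
  rw [hintE] at hinv
  simp_rw [hFE] at hinv
  rw [integral_const_mul, integral_prod_mul (fun a => φF (2 * a)) fun a => φF (2 * d * a),
    integral_comp_mul_left_normAbs μF h2, integral_comp_mul_left_normAbs μF h2d, htot] at hinv
  have hΦ0 : Φ 0 = 1 := by
    have h0 : e 0 = 0 := by simp [e, h.homeomorph_apply]
    rw [← h0, hΦe]
    simp [hφ0]
  rw [hΦ0] at hinv
  have hinv' : c * (c * ((normAbs (2 : F))⁻¹ * (normAbs (2 * d))⁻¹)) = 1 := by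
    have : ((c * (c * ((normAbs (2 : F))⁻¹ * (normAbs (2 * d))⁻¹)) : ℝ) : ℂ) = 1 := by
      rw [← hinv]
      push_cast
      ring
    exact_mod_cast this
  have hp1 := normAbs_pos h2
  have hp2 := normAbs_pos h2d
  field_simp at hinv'
  linarith

/-- The constants of the two measures and of the inversion formula cancel. -/
theorem IsTraceZeroGenerator.mul_eq_one (h : IsTraceZeroGenerator τ σ) (hψ : Continuous ψ)
    (hne : ψ ≠ 1) (hF : IsSelfDual ψ μF)
    (hE : IsSelfDual (ψ.compAddMonoidHom (Algebra.trace F E).toAddMonoidHom) μE) {d : F}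
    (hd : algebraMap F E d = τ ^ 2) {c : ℝ} (hc0 : 0 < c)
    (hc : μE = ENNReal.ofReal c • (μF.prod μF).map h.homeomorph) :
    c * (normAbs (2 * d))⁻¹ * Real.sqrt (normAbs τ) = 1 := by
  have hd0 : d ≠ 0 := by
    rintro rfl
    rw [map_zero] at hd
    exact h.ne_zero (pow_eq_zero_iff two_ne_zero |>.1 hd.symm)
  have h1 := h.sq_eq hψ hne hF hE hd hc0 hc
  have hp1 := normAbs_pos (two_ne_zero : (2 : F) ≠ 0)
  have hp2 := normAbs_pos hd0
  rw [h.normAbs_tau hd]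
  rw [normAbs_mul] at h1 ⊢
  have h3 : c = normAbs (2 : F) * Real.sqrt (normAbs d) := by
    rw [← Real.sqrt_sq hc0.le, h1, ← mul_assoc, Real.sqrt_mul (by positivity),
      Real.sqrt_mul_self hp1.le]
  have h4 := Real.mul_self_sqrt hp2.le
  have h5 : 0 < Real.sqrt (normAbs d) := Real.sqrt_pos.2 hp2
  rw [h3]
  field_simp
  rw [sq, h4]

end Constant

/-! ### Unipotent matrices over the quadratic extension -/

section Twist

open Matrix

theorem aff_conj {R : Type*} [CommRing R] {n : ℕ} (q g : GL (Fin n) R) (t : Fin n → R) :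
    (aff q 0)⁻¹ * (aff g 0 * aff 1 ((q : Matrix (Fin n) (Fin n) R) *ᵥ t)) * aff q 0 =
      aff (q⁻¹ * g * q) 0 * aff 1 t := by
  rw [aff_inv_zero, aff_mul, aff_mul, aff_mul, aff_mul]
  simp only [mulVec_zero, zero_add, add_zero, mul_one, Units.val_mul, mulVec_mulVec, mul_assoc]

/-- The vector `τ v`. -/
def tauVec {F E : Type*} [Field F] [Field E] [Algebra F E] (τ : E) {n : ℕ} (v : Fin n → F) :
    Fin n → E := fun i => algebraMap F E (v i) * τ

/-- The last coordinate of a vector, or zero for the empty vector. -/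
def lastCoord {R : Type*} [Zero R] : ∀ {n : ℕ}, (Fin n → R) → R
  | 0, _ => 0
  | _ + 1, v => v (Fin.last _)

/-- The sum of the superdiagonal coordinates. -/
def superSum {R : Type*} [AddZeroClass R] : ∀ n, (TriIdx n → R) → R
  | 0, _ => 0
  | n + 1, s => superSum n (triInit s) + lastCoord (triLast s)

section Defs

variable {F E : Type*} [Field F] [Field E] [Algebra F E] (k : ∀ n, (Fin n → F) → GL (Fin n) F)
  (τ : E)

/-- The matrices `A_Y(s)`: `A_{(Y', y)}(s', v)` is the product of `diag(k_y⁻¹ A_{Y'}(s') k_y, 1)` and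
of the unipotent matrix with last column `τ v`. -/
def twist : ∀ n, (TriIdx n → F) → (TriIdx n → F) → GL (Fin n) E
  | 0, _, _ => 1
  | n + 1, Y, s =>
    aff ((baseChangeGL n F E (k n (triLast Y)))⁻¹ * twist n (triInit Y) (triInit s) *
      baseChangeGL n F E (k n (triLast Y))) 0 * aff 1 (tauVec τ (triLast s))

/-- Representatives `σ(s)` of `N_n(E)/N_n(F)`. -/
def slice (n : ℕ) (s : TriIdx n → F) : GL (Fin n) E := twist (fun _ _ => 1) τ n 0 s

theorem twist_succ (n : ℕ) (Y s : TriIdx n → F) (y v : Fin n → F) :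
    twist k τ (n + 1) (triSnoc Y y) (triSnoc s v) =
      aff ((baseChangeGL n F E (k n y))⁻¹ * twist k τ n Y s * baseChangeGL n F E (k n y)) 0 *
        aff 1 (tauVec τ v) := rfl

theorem slice_succ (n : ℕ) (s : TriIdx n → F) (v : Fin n → F) :
    slice τ (n + 1) (triSnoc s v) = aff (slice τ n s) 0 * aff 1 (tauVec τ v) := by
  have h : (0 : TriIdx (n + 1) → F) = triSnoc 0 0 := by
    funext t
    rcases t with t | t <;> rfl
  rw [slice, h, twist_succ]
  simp only [map_one, inv_one, one_mul, mul_one]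
  rfl

theorem superSum_succ {R : Type*} [AddZeroClass R] (n : ℕ) (s : TriIdx n → R) (v : Fin n → R) :
    superSum (n + 1) (triSnoc s v) = superSum n s + lastCoord v := rfl

theorem tauVec_zero {n : ℕ} : tauVec τ (0 : Fin n → F) = 0 := by
  funext i
  simp [tauVec]

theorem baseChangeGL_mulVec_tauVec {n : ℕ} (g : GL (Fin n) F) (v : Fin n → F) :
    (baseChangeGL n F E g : Matrix (Fin n) (Fin n) E) *ᵥ tauVec τ v =
      tauVec τ ((g : Matrix (Fin n) (Fin n) F) *ᵥ v) := by
  funext i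
  simp only [mulVec, dotProduct, tauVec, map_sum, map_mul, Finset.sum_mul, baseChangeGL,
    GeneralLinearGroup.map_apply]
  exact Finset.sum_congr rfl fun j _ => by ring

theorem baseChangeGL_aff {n : ℕ} (g : GL (Fin n) F) (v : Fin n → F) :
    baseChangeGL (n + 1) F E (aff g v) =
      aff (baseChangeGL n F E g) (algebraMap F E ∘ v) := aff_map _ _ _

theorem baseChangeGL_aff_zero {n : ℕ} (g : GL (Fin n) F) :
    baseChangeGL (n + 1) F E (aff g 0) = aff (baseChangeGL n F E g) 0 := by
  rw [baseChangeGL_aff]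
  congr 1
  funext i
  simp

theorem baseChangeGL_uni {n : ℕ} (x : TriIdx n → F) :
    baseChangeGL n F E (uni n x) = uni n (algebraMap F E ∘ x) := map_uni _ _ _

theorem det_slice : ∀ (n : ℕ) (s : TriIdx n → F),
    (slice τ n s : Matrix (Fin n) (Fin n) E).det = 1
  | 0, _ => by simp
  | n + 1, s => by
    rw [← triSnoc_init_last s, slice_succ, Units.val_mul, det_mul, coe_aff, coe_aff, det_affMat,
      det_affMat, det_slice n, Units.val_one, det_one, one_mul]

/-- The sum of the superdiagonal entries of a matrix. -/
def superdiag {R : Type*} [AddCommMonoid R] {n : ℕ} (A : Matrix (Fin n) (Fin n) R) : R :=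
  ∑ i : Fin n, if h : (i : ℕ) + 1 < n then A i ⟨(i : ℕ) + 1, h⟩ else 0

theorem superdiag_affMat {R : Type*} [CommRing R] : ∀ {n : ℕ} (A : Matrix (Fin n) (Fin n) R)
    (v : Fin n → R), superdiag (affMat A v) = superdiag A + lastCoord v
  | 0, A, v => by simp [superdiag, lastCoord]
  | n + 1, A, v => by
    have hl : superdiag A = ∑ i : Fin n, A i.castSucc i.succ := by
      rw [superdiag, Fin.sum_univ_castSucc]
      simp only [Fin.val_last, lt_irrefl, dite_false, add_zero]
      refine Finset.sum_congr rfl fun i _ => ?_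
      rw [dif_pos (by simp)]
      rfl
    rw [hl, superdiag, Fin.sum_univ_castSucc]
    simp only [Fin.val_last, lt_irrefl, dite_false, add_zero]
    rw [Fin.sum_univ_castSucc]
    congr 1
    · refine Finset.sum_congr rfl fun i _ => ?_
      rw [dif_pos (by simp)]
      have : (⟨(i.castSucc.castSucc : Fin (n + 2)) + 1, by simp⟩ : Fin (n + 2)) =
          i.succ.castSucc := by
        ext
        simp
      rw [this, affMat_castSucc_castSucc]
    · rw [dif_pos (by simp)]
      have : (⟨((Fin.last n).castSucc : Fin (n + 2)) + 1, by simp⟩ : Fin (n + 2)) =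
          Fin.last (n + 1) := by
        ext
        simp
      rw [this, affMat_castSucc_last]
      rfl

/-- The last row of an element of the mirabolic group. -/
theorem lastCoord_mulVec {K : Type*} [Field K] : ∀ {n : ℕ} {g : GL (Fin n) K},
    g ∈ mirabolicSubgroup n K → ∀ v : Fin n → K,
      lastCoord ((g : Matrix (Fin n) (Fin n) K) *ᵥ v) = lastCoord v
  | 0, _, _, _ => rfl
  | n + 1, g, hg, v => by
    have h1 : ∀ j, (g : Matrix (Fin (n + 1)) (Fin (n + 1)) K) (Fin.last n) j =
        if Fin.last n = j then 1 else 0 := fun j => hg (Fin.last n) j rfl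
    simp [lastCoord, mulVec, dotProduct, h1]

theorem slice_mul_aff {n : ℕ} (s : TriIdx n → F) (v : Fin n → F) (X : GL (Fin n) E)
    (a : Fin n → E) :
    slice τ (n + 1) (triSnoc s v) * aff X a =
      aff (slice τ n s * X) ((slice τ n s : Matrix (Fin n) (Fin n) E) *ᵥ (a + tauVec τ v)) := by
  rw [slice_succ, aff_mul, aff_mul]
  simp only [mul_one, add_zero, mulVec_add]

theorem slice_mem_unipotent : ∀ (n : ℕ) (s : TriIdx n → F), ∃ x, slice τ n s = uni n x
  | 0, _ => ⟨0, Subsingleton.elim _ _⟩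
  | n + 1, s => by
    obtain ⟨x, hx⟩ := slice_mem_unipotent n (triInit s)
    have h := slice_mul_aff τ (triInit s) (triLast s) 1 0
    rw [aff_one_zero, mul_one, mul_one, triSnoc_init_last] at h
    rw [h, hx]
    exact ⟨triSnoc x _, (uni_succ _ _).symm⟩

theorem slice_mem : ∀ (n : ℕ) (s : TriIdx n → F), slice τ n s ∈ mirabolicSubgroup n E
  | 0, _ => one_mem _
  | n + 1, s => by
    obtain ⟨x, hx⟩ := slice_mem_unipotent τ (n + 1) s
    rw [hx]
    exact unipotentSubgroup_le_mirabolicSubgroup _ _ (uni_mem _ x)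

theorem superdiag_slice_mul : ∀ (n : ℕ) (s a : TriIdx n → F),
    superdiag (slice τ n s * baseChangeGL n F E (uni n a) : Matrix (Fin n) (Fin n) E) =
      algebraMap F E (superSum n s) * τ + algebraMap F E (superSum n a)
  | 0, _, _ => by simp [superdiag, superSum]
  | n + 1, s, a => by
    rw [← triSnoc_init_last s, ← triSnoc_init_last a, uni_succ, baseChangeGL_aff, ← Units.val_mul,
      slice_mul_aff, coe_aff, superdiag_affMat, Units.val_mul, superdiag_slice_mul n,
      lastCoord_mulVec (slice_mem τ n _), superSum_succ, superSum_succ]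
    have h : lastCoord ((algebraMap F E ∘ triLast a) + tauVec τ (triLast s)) =
        algebraMap F E (lastCoord (triLast s)) * τ + algebraMap F E (lastCoord (triLast a)) := by
      rcases n with _ | n
      · simp [lastCoord]
      · simp only [lastCoord, Pi.add_apply, Function.comp_apply, tauVec]
        ring
    rw [h, map_add, map_add]
    ring

end Defs

section Topology

variable {F E : Type*} [Field F] [TopologicalSpace F] [IsLocalField F] [Field E]
  [TopologicalSpace E] [IsLocalField E] [Algebra F E] [ContinuousSMul F E]
  {k : ∀ n, (Fin n → F) → GL (Fin n) F} (τ : E)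

theorem continuous_tauVec {n : ℕ} : Continuous (tauVec τ : (Fin n → F) → Fin n → E) := by
  have h1 : Continuous (algebraMap F E) := continuous_algebraMap_ext
  exact continuous_pi fun i => (h1.comp (continuous_apply i)).mul continuous_const

theorem continuous_baseChangeGL (n : ℕ) : Continuous (baseChangeGL n F E) := by
  have h1 : Continuous (algebraMap F E) := continuous_algebraMap_ext
  exact continuous_GL_iff.2 fun i j => h1.comp (continuous_GL_apply i j)

theorem continuous_triInit {R : Type*} [TopologicalSpace R] {n : ℕ} :
    Continuous (triInit : (TriIdx (n + 1) → R) → TriIdx n → R) :=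
  continuous_pi fun _ => continuous_apply _

theorem continuous_triLast {R : Type*} [TopologicalSpace R] {n : ℕ} :
    Continuous (triLast : (TriIdx (n + 1) → R) → Fin n → R) :=
  continuous_pi fun _ => continuous_apply _

theorem continuous_twist : ∀ (n : ℕ) (Y : TriIdx n → F), Continuous (twist k τ n Y)
  | 0, _ => continuous_const
  | n + 1, Y => by
    refine Continuous.mul (Continuous.aff ((continuous_const.mul
      ((continuous_twist n _).comp continuous_triInit)).mul continuous_const) continuous_const) ?_
    exact continuous_const.aff ((continuous_tauVec τ).comp continuous_triLast)

theorem continuous_slice (n : ℕ) : Continuous (slice τ n : (TriIdx n → F) → GL (Fin n) E) :=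
  continuous_twist τ n 0

variable [MeasurableSpace F] [BorelSpace F] [MeasurableSpace E] [BorelSpace E]

theorem measurable_baseChangeGL (n : ℕ) : Measurable (baseChangeGL n F E) :=
  (continuous_baseChangeGL n).measurable

theorem measurable_twist (hk : ∀ n, Measurable (k n)) : ∀ n : ℕ,
    Measurable fun p : (TriIdx n → F) × (TriIdx n → F) => twist k τ n p.1 p.2
  | 0 => measurable_const
  | n + 1 => by
    have h1 : Measurable fun p : (TriIdx (n + 1) → F) × (TriIdx (n + 1) → F) =>
        baseChangeGL n F E (k n (triLast p.1)) :=
      (measurable_baseChangeGL n).comp ((hk n).comp (measurable_triLast.comp measurable_fst))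
    have h2 : Measurable fun p : (TriIdx (n + 1) → F) × (TriIdx (n + 1) → F) =>
        twist k τ n (triInit p.1) (triInit p.2) :=
      (measurable_twist hk n).comp ((measurable_triInit.comp measurable_fst).prodMk
        (measurable_triInit.comp measurable_snd))
    have h3 : Measurable fun p : (TriIdx (n + 1) → F) × (TriIdx (n + 1) → F) =>
        tauVec τ (triLast p.2) :=
      (continuous_tauVec τ).measurable.comp (measurable_triLast.comp measurable_snd)
    exact (Measurable.aff ((h1.inv.mul h2).mul h1) measurable_const).mul (measurable_const.aff h3)

theorem measurable_slice (n : ℕ) : Measurable (slice τ n : (TriIdx n → F) → GL (Fin n) E) :=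
  (continuous_slice τ n).measurable

theorem measurable_lastCoord : ∀ {n : ℕ}, Measurable (lastCoord : (Fin n → F) → F)
  | 0 => measurable_const
  | _ + 1 => measurable_pi_apply _

theorem measurable_superSum : ∀ n : ℕ, Measurable (superSum n : (TriIdx n → F) → F)
  | 0 => measurable_const
  | n + 1 => ((measurable_superSum n).comp measurable_triInit).add
      (measurable_lastCoord.comp measurable_triLast)

end Topology

/-! ### Decomposition of the measure of the unipotent group -/

section Decomposition

variable {F E : Type*} [Field F] [TopologicalSpace F] [IsLocalField F] [MeasurableSpace F]
  [BorelSpace F] [Field E] [TopologicalSpace E] [IsLocalField E] [MeasurableSpace E]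
  [BorelSpace E] [Algebra F E] [ContinuousSMul F E] [CharZero F] {τ : E} {σ : E ≃ₐ[F] E}
  (h : IsTraceZeroGenerator τ σ) (μF : Measure F) [μF.IsAddHaarMeasure] (μE : Measure E)
  [μE.IsAddHaarMeasure] {c : ℝ} (hc : μE = ENNReal.ofReal c • (μF.prod μF).map h.homeomorph)

include h hc

theorem IsTraceZeroGenerator.lintegral_pi (n : ℕ) {φ : (Fin n → E) → ℝ≥0∞} (hφ : Measurable φ) :
    ∫⁻ v, φ v ∂(Measure.pi fun _ => μE) = ENNReal.ofReal c ^ n *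
      ∫⁻ b : Fin n → F, ∫⁻ a : Fin n → F, φ (algebraMap F E ∘ a + tauVec τ b)
        ∂(Measure.pi fun _ => μF) ∂(Measure.pi fun _ => μF) := by
  have hem := h.homeomorph.continuous.measurable
  set ν := (μF.prod μF).map h.homeomorph with hν
  have hνH : ν.IsAddHaarMeasure :=
    h.addEquiv.isAddHaarMeasure_map (μF.prod μF) h.homeomorph.continuous
      h.homeomorph.symm.continuous
  have h1 : (Measure.pi fun _ : Fin n => μE) =
      ENNReal.ofReal c ^ n • Measure.pi fun _ : Fin n => ν := by
    refine Measure.pi_eq fun s hs => ?_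
    rw [Measure.smul_apply, Measure.pi_pi, smul_eq_mul, hc]
    simp only [Measure.smul_apply, smul_eq_mul]
    rw [Finset.prod_mul_distrib, Finset.prod_const, Finset.card_univ, Fintype.card_fin]
  have h2 : MeasurePreserving (fun (p : Fin n → F × F) i => h.homeomorph (p i))
      (Measure.pi fun _ => μF.prod μF) (Measure.pi fun _ : Fin n => ν) :=
    measurePreserving_pi _ _ fun _ => ⟨hem, rfl⟩
  have h3 := (measurePreserving_arrowProdEquivProdArrow F F (Fin n) (fun _ => μF) fun _ => μF).symm
  have h4 := h2.comp h3
  have h5 : Measurable fun p : (Fin n → F) × (Fin n → F) =>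
      φ (algebraMap F E ∘ p.1 + tauVec τ p.2) := hφ.comp h4.measurable
  rw [h1, lintegral_smul_measure, smul_eq_mul, ← h4.lintegral_comp hφ, ← lintegral_prod_symm' _ h5]
  rfl

theorem IsTraceZeroGenerator.lintegral_slice_aff {n : ℕ} {φ : GL (Fin (n + 1)) E → ℝ≥0∞}
    (hφ : Measurable φ) (s a : TriIdx n → F) :
    ∫⁻ v, φ (aff (slice τ n s * baseChangeGL n F E (uni n a)) v) ∂(Measure.pi fun _ => μE) =
      ENNReal.ofReal c ^ n * ∫⁻ b, ∫⁻ w,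
        φ (slice τ (n + 1) (triSnoc s b) * baseChangeGL (n + 1) F E (uni (n + 1) (triSnoc a w)))
          ∂(Measure.pi fun _ => μF) ∂(Measure.pi fun _ => μF) := by
  have hdet : (slice τ n s : Matrix (Fin n) (Fin n) E).det ≠ 0 := by
    rw [det_slice]
    exact one_ne_zero
  have hm : Measurable fun v => φ (aff (slice τ n s * baseChangeGL n F E (uni n a)) v) :=
    hφ.comp (measurable_const.aff measurable_id)
  have h1 := lintegral_comp_mulVec μE hdet hm
  rw [det_slice, normAbs_one, inv_one, ENNReal.ofReal_one, one_mul] at h1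
  have hm' : Measurable fun v => φ (aff (slice τ n s * baseChangeGL n F E (uni n a))
      ((slice τ n s : Matrix (Fin n) (Fin n) E) *ᵥ v)) := hm.comp (measurable_mulVec _)
  rw [← h1, h.lintegral_pi μF μE hc n hm']
  simp only [uni_succ, baseChangeGL_aff, slice_mul_aff]

/-- The measure of `N_n(E)` in the coordinates `σ(s) u` with `u ∈ N_n(F)`. -/
theorem IsTraceZeroGenerator.lintegral_slice (n : ℕ) {φ : GL (Fin n) E → ℝ≥0∞}
    (hφ : Measurable φ) : ∫⁻ x, φ (uni n x) ∂(triMeasure μE n) =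
      ENNReal.ofReal c ^ Fintype.card (TriIdx n) * ∫⁻ s, ∫⁻ a,
        φ (slice τ n s * baseChangeGL n F E (uni n a)) ∂(triMeasure μF n) ∂(triMeasure μF n) := by
  induction n with
  | zero =>
    have h0 : ∀ g : GL (Fin 0) E, φ g = φ 1 := fun g => by rw [Subsingleton.elim g 1]
    simp [h0]
  | succ n ih =>
    have hA : Measurable fun q : GL (Fin n) E × (Fin n → E) => φ (aff q.1 q.2) :=
      hφ.comp (measurable_fst.aff measurable_snd)
    have hB : Measurable fun g : GL (Fin n) E => ∫⁻ v, φ (aff g v) ∂(Measure.pi fun _ => μE) :=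
      hA.lintegral_prod_right'
    have hS : Measurable fun p : (TriIdx (n + 1) → F) × (TriIdx (n + 1) → F) =>
        φ (slice τ (n + 1) p.1 * baseChangeGL (n + 1) F E (uni (n + 1) p.2)) :=
      hφ.comp (((measurable_slice τ _).comp measurable_fst).mul
        ((measurable_baseChangeGL _).comp ((measurable_uni _).comp measurable_snd)))
    generalize hG : (fun p q : TriIdx (n + 1) → F => φ (slice τ (n + 1) p * baseChangeGL (n + 1) F E (uni (n + 1) q))) =
      G
    have hstep := h.lintegral_slice_aff μF μE hc hφ
    have hGe : ∀ p q, φ (slice τ (n + 1) p * baseChangeGL (n + 1) F E (uni (n + 1) q)) = G p q :=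
      fun p q => congrFun (congrFun hG p) q
    simp only [hGe] at hS hstep
    rw [lintegral_tri_succ μE (φ := fun x => φ (uni (n + 1) x)) (hφ.comp (measurable_uni _))]
    simp only [uni_succ]
    have hm5 : Measurable fun p => ∫⁻ q, G p q ∂(triMeasure μF (n + 1)) := hS.lintegral_prod_right'
    rw [ih hB]
    simp only [hGe]
    rw [lintegral_tri_succ μF hm5, TriIdx.card_eq, pow_add, mul_assoc]
    refine congrArg (fun z => _ * z) ?_
    rw [← lintegral_const_mul' _ _ (by finiteness)]
    refine lintegral_congr fun s => ?_
    have hm3 : Measurable fun r : ((TriIdx n → F) × (Fin n → F)) × (Fin n → F) =>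
        G (triSnoc s r.1.2) (triSnoc r.1.1 r.2) := by
      have h1 : Measurable fun r : ((TriIdx n → F) × (Fin n → F)) × (Fin n → F) =>
          triSnoc s r.1.2 := measurable_const.triSnoc (measurable_snd.comp measurable_fst)
      have h2 : Measurable fun r : ((TriIdx n → F) × (Fin n → F)) × (Fin n → F) =>
          triSnoc r.1.1 r.2 := (measurable_fst.comp measurable_fst).triSnoc measurable_snd
      exact hS.comp (h1.prodMk h2)
    rw [lintegral_congr fun a => hstep s a, lintegral_const_mul' _ _ (by finiteness)]
    refine congrArg (fun z => _ * z) ?_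
    rw [lintegral_lintegral_swap hm3.lintegral_prod_right'.aemeasurable]
    refine lintegral_congr fun b => ?_
    have hm4 : Measurable fun a => G (triSnoc s b) a := hS.comp measurable_prodMk_left
    rw [lintegral_tri_succ μF hm4]

end Decomposition

/-! ### Conjugation by the representatives -/

section Conjugation

variable {F E : Type*} [Field F] [TopologicalSpace F] [IsLocalField F] [MeasurableSpace F]
  [BorelSpace F] [Field E] [TopologicalSpace E] [IsLocalField E] [MeasurableSpace E]
  [BorelSpace E] [Algebra F E] [ContinuousSMul F E] {N : AbsoluteValue F ℝ} (S : RowSection N)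
  (τ : E) (μF : Measure F) [μF.IsAddHaarMeasure]

/-- All non-empty blocks of `Y` are non-zero. -/
def BlocksNonzero : ∀ n, (TriIdx n → F) → Prop
  | 0, _ => True
  | n + 1, Y => BlocksNonzero n (triInit Y) ∧ (0 < n → triLast Y ≠ 0)

theorem measurableSet_blocksNonzero : ∀ n : ℕ, MeasurableSet {Y : TriIdx n → F | BlocksNonzero n Y}
  | 0 => MeasurableSet.univ
  | n + 1 => by
    have h1 : MeasurableSet {Y : TriIdx (n + 1) → F | 0 < n → triLast Y ≠ 0} := by
      by_cases hn : 0 < n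
      · have : {Y : TriIdx (n + 1) → F | 0 < n → triLast Y ≠ 0} = (triLast ⁻¹' {0})ᶜ := by
          ext Y
          simp [hn]
        rw [this]
        exact ((measurableSet_singleton 0).preimage measurable_triLast).compl
      · simp [hn]
    exact ((measurableSet_blocksNonzero n).preimage measurable_triInit).inter h1

theorem ae_blocksNonzero : ∀ n : ℕ, ∀ᵐ Y ∂(triMeasure μF n), BlocksNonzero n Y
  | 0 => Eventually.of_forall fun _ => trivial
  | n + 1 => by
    have hmp := measurePreserving_triSnoc (n := n) μF
    rw [← hmp.map_eq, ae_map_iff hmp.measurable.aemeasurable (measurableSet_blocksNonzero _)]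
    have h1 : ∀ᵐ y ∂(Measure.pi fun _ : Fin n => μF), 0 < n → y ≠ 0 := by
      rcases Nat.eq_zero_or_pos n with hn | hn
      · exact Eventually.of_forall fun y h => absurd h (by omega)
      · have : ∀ᵐ y ∂(Measure.pi fun _ : Fin n => μF), y ≠ 0 := by
          rw [ae_iff]
          simpa using pi_singleton_zero μF hn
        filter_upwards [this] with y hy _ using hy
    have h2 : ∀ᵐ p ∂(triMeasure μF n).prod (Measure.pi fun _ : Fin n => μF),
        BlocksNonzero n p.1 := Measure.quasiMeasurePreserving_fst.ae (ae_blocksNonzero n)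
    have h3 : ∀ᵐ p ∂(triMeasure μF n).prod (Measure.pi fun _ : Fin n => μF),
        0 < n → p.2 ≠ 0 := Measure.quasiMeasurePreserving_snd.ae h1
    filter_upwards [h2, h3] with p hp1 hp2
    exact ⟨hp1, hp2⟩

/-- The step of the recursion which defines `twist`. -/
def twistStep {n : ℕ} (y : Fin n → F) (X : GL (Fin n) E) (w : Fin n → F) : GL (Fin (n + 1)) E :=
  aff ((baseChangeGL n F E (S.k n y))⁻¹ * X * baseChangeGL n F E (S.k n y)) 0 * aff 1 (tauVec τ w)

theorem Measurable.twistStep {α : Type*} [MeasurableSpace α] {n : ℕ} (y : Fin n → F)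
    {X : α → GL (Fin n) E} {w : α → Fin n → F} (hX : Measurable X) (hw : Measurable w) :
    Measurable fun a => twistStep S τ y (X a) (w a) :=
  (Measurable.aff ((measurable_const.mul hX).mul measurable_const) measurable_const).mul
    (measurable_const.aff ((continuous_tauVec τ).measurable.comp hw))

theorem RowSection.lastCoord_mulVec_point_mul_g {n : ℕ} (Y : TriIdx n → F) {y : Fin n → F}
    (hy : 0 < n → y ≠ 0) (w : Fin n → F) :
    lastCoord (((S.point n Y * S.g n y : GL (Fin n) F) : Matrix (Fin n) (Fin n) F) *ᵥ w) =
      ∑ i, y i * w i := by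
  rw [Units.val_mul, ← mulVec_mulVec, lastCoord_mulVec (S.point_mem n Y)]
  rcases n with _ | m
  · simp [lastCoord]
  · have h1 := S.lastVec_vecMul_g m y (hy m.succ_pos)
    have h2 : ∀ j, (S.g (m + 1) y : Matrix (Fin (m + 1)) (Fin (m + 1)) F) (Fin.last m) j = y j := by
      intro j
      have := congrFun h1 j
      rw [lastVec, single_one_vecMul] at this
      exact this
    simp [lastCoord, mulVec, dotProduct, h2]

/-- Conjugation by `g_y` agrees with conjugation by `k_y`. -/
theorem RowSection.conj_baseChangeGL_g {n : ℕ} (y : Fin n → F) (X : GL (Fin n) E) :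
    (baseChangeGL n F E (S.g n y))⁻¹ * X * baseChangeGL n F E (S.g n y) =
      (baseChangeGL n F E (S.k n y))⁻¹ * X * baseChangeGL n F E (S.k n y) := by
  have hc : ∀ x : GL (Fin n) E, baseChangeGL n F E
      (GeneralLinearGroup.scalar (Fin n) (S.c n y)) * x =
      x * baseChangeGL n F E (GeneralLinearGroup.scalar (Fin n) (S.c n y)) := by
    intro x
    ext i j
    simp [baseChangeGL, ← smul_one_eq_diagonal, Matrix.map_smul']
  rw [RowSection.g, map_mul, _root_.mul_inv_rev, mul_assoc, mul_assoc, ← mul_assoc X,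
    ← hc X, mul_assoc, inv_mul_cancel_left, mul_assoc]

theorem conj_slice_succ {n : ℕ} (Y s : TriIdx n → F) (y w : Fin n → F) :
    (baseChangeGL (n + 1) F E (S.point (n + 1) (triSnoc Y y)))⁻¹ *
        slice τ (n + 1) (triSnoc s
          (((S.point n Y * S.g n y : GL (Fin n) F) : Matrix (Fin n) (Fin n) F) *ᵥ w)) *
        baseChangeGL (n + 1) F E (S.point (n + 1) (triSnoc Y y)) =
      twistStep S τ y ((baseChangeGL n F E (S.point n Y))⁻¹ * slice τ n s *
        baseChangeGL n F E (S.point n Y)) w := by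
  rw [RowSection.point_succ, baseChangeGL_aff_zero, slice_succ, ← baseChangeGL_mulVec_tauVec,
    aff_conj, twistStep, ← S.conj_baseChangeGL_g, map_mul, _root_.mul_inv_rev]
  simp only [mul_assoc]

/-- Conjugation by `p_Y` turns `σ(s)` into `A_Y(s)` and the superdiagonal sum of `s` into the
pairing of `Y` and `s`. -/
theorem lintegral_conj_point (n : ℕ) (Y : TriIdx n → F) (hY : BlocksNonzero n Y)
    {φ : GL (Fin n) E × F → ℝ≥0∞} (hφ : Measurable φ) :
    ENNReal.ofReal (S.dens n Y) * ∫⁻ s, φ ((baseChangeGL n F E (S.point n Y))⁻¹ *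
        slice τ n s * baseChangeGL n F E (S.point n Y), superSum n s) ∂(triMeasure μF n) =
      ∫⁻ s, φ (twist S.k τ n Y s, ∑ t, Y t * s t) ∂(triMeasure μF n) := by
  induction n with
  | zero =>
    have h0 : ∀ g : GL (Fin 0) E, g = 1 := fun g => Subsingleton.elim g 1
    have h1 : ∀ s : TriIdx 0 → F, φ ((baseChangeGL 0 F E (S.point 0 Y))⁻¹ * slice τ 0 s *
        baseChangeGL 0 F E (S.point 0 Y), superSum 0 s) =
        φ (twist S.k τ 0 Y s, ∑ t, Y t * s t) := fun s => by
      rw [h0 (_ * _ * _), h0 (twist S.k τ 0 Y s)]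
      simp [superSum]
    simp_rw [h1]
    simp [RowSection.dens]
  | succ n ih =>
    obtain ⟨Y, y, rfl⟩ : ∃ Y' y, Y = triSnoc Y' y := ⟨_, _, (triSnoc_init_last Y).symm⟩
    obtain ⟨hY', hy⟩ := hY
    rw [triInit_triSnoc] at hY'
    rw [triLast_triSnoc] at hy
    have hdet : ((S.point n Y * S.g n y : GL (Fin n) F) : Matrix (Fin n) (Fin n) F).det ≠ 0 :=
      det_GL_ne_zero _
    have hpos := normAbs_pos hdet
    -- both sides are integrals of functions of the blocks
    generalize hG : (fun s : TriIdx (n + 1) → F =>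
      φ ((baseChangeGL (n + 1) F E (S.point (n + 1) (triSnoc Y y)))⁻¹ * slice τ (n + 1) s *
        baseChangeGL (n + 1) F E (S.point (n + 1) (triSnoc Y y)), superSum (n + 1) s)) = G
    generalize hΨ : (fun (X : GL (Fin n) E) (w : Fin n → F) (t : F) =>
      φ (twistStep S τ y X w, t + ∑ i, y i * w i)) = Ψ
    have hΨe : ∀ X w t, φ (twistStep S τ y X w, t + ∑ i, y i * w i) = Ψ X w t := fun X w t => by
      rw [← hΨ]
    have hΨm : Measurable fun r : (GL (Fin n) E × F) × (Fin n → F) => Ψ r.1.1 r.2 r.1.2 := by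
      have h1 : Measurable fun r : (GL (Fin n) E × F) × (Fin n → F) => twistStep S τ y r.1.1 r.2 :=
        Measurable.twistStep S τ y (measurable_fst.comp measurable_fst) measurable_snd
      have h2 : Measurable fun r : (GL (Fin n) E × F) × (Fin n → F) =>
          r.1.2 + ∑ i, y i * r.2 i :=
        (measurable_snd.comp measurable_fst).add (Finset.measurable_sum _ fun i _ =>
          measurable_const.mul ((measurable_pi_apply i).comp measurable_snd))
      have h3 := hφ.comp (h1.prodMk h2)
      rw [← hΨ]
      exact h3
    have hGm : Measurable G := by
      have h1 : Measurable fun s : TriIdx (n + 1) → F => (baseChangeGL (n + 1) F E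
          (S.point (n + 1) (triSnoc Y y)))⁻¹ * slice τ (n + 1) s *
            baseChangeGL (n + 1) F E (S.point (n + 1) (triSnoc Y y)) :=
        (measurable_const.mul (measurable_slice τ _)).mul measurable_const
      have h2 := hφ.comp (h1.prodMk (measurable_superSum (n + 1)))
      rw [← hG]
      exact h2
    have hGΨ : ∀ (s : TriIdx n → F) (w : Fin n → F), G (triSnoc s
        (((S.point n Y * S.g n y : GL (Fin n) F) : Matrix (Fin n) (Fin n) F) *ᵥ w)) =
        Ψ ((baseChangeGL n F E (S.point n Y))⁻¹ * slice τ n s * baseChangeGL n F E (S.point n Y))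
          w (superSum n s) := fun s w => by
      rw [← hG, ← hΨ]
      dsimp only
      rw [conj_slice_succ, superSum_succ, S.lastCoord_mulVec_point_mul_g Y hy]
    have hinner : ∀ s : TriIdx n → F, ∫⁻ v, G (triSnoc s v) ∂(Measure.pi fun _ => μF) =
        ENNReal.ofReal (normAbs
            ((S.point n Y * S.g n y : GL (Fin n) F) : Matrix (Fin n) (Fin n) F).det) *
          ∫⁻ w, Ψ ((baseChangeGL n F E (S.point n Y))⁻¹ * slice τ n s *
            baseChangeGL n F E (S.point n Y)) w (superSum n s) ∂(Measure.pi fun _ => μF) := by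
      intro s
      have hm : Measurable fun v => G (triSnoc s v) :=
        hGm.comp (measurable_const.triSnoc measurable_id)
      have h1 := lintegral_comp_mulVec μF hdet hm
      rw [← lintegral_congr fun w => hGΨ s w, h1, ← mul_assoc,
        ← ENNReal.ofReal_mul (normAbs_nonneg _), mul_inv_cancel₀ hpos.ne', ENNReal.ofReal_one,
        one_mul]
    have hdens : ENNReal.ofReal (S.dens (n + 1) (triSnoc Y y)) * ENNReal.ofReal (normAbs
        ((S.point n Y * S.g n y : GL (Fin n) F) : Matrix (Fin n) (Fin n) F).det) =
          ENNReal.ofReal (S.dens n Y) := by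
      rw [← ENNReal.ofReal_mul (S.dens_nonneg _ _), RowSection.dens_succ, mul_assoc,
        ← Units.val_mul, inv_mul_cancel₀ hpos.ne', mul_one]
    have hsw : Measurable fun r : (TriIdx n → F) × (Fin n → F) =>
        Ψ ((baseChangeGL n F E (S.point n Y))⁻¹ * slice τ n r.1 *
            baseChangeGL n F E (S.point n Y)) r.2 (superSum n r.1) := by
      have h1 : Measurable fun r : (TriIdx n → F) × (Fin n → F) =>
          (baseChangeGL n F E (S.point n Y))⁻¹ * slice τ n r.1 *
            baseChangeGL n F E (S.point n Y) :=
        (measurable_const.mul ((measurable_slice τ n).comp measurable_fst)).mul measurable_const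
      exact hΨm.comp ((h1.prodMk ((measurable_superSum n).comp measurable_fst)).prodMk
        measurable_snd)
    have hsw2 : Measurable fun r : (Fin n → F) × (TriIdx n → F) =>
        Ψ (twist S.k τ n Y r.2) r.1 (∑ t, Y t * r.2 t) := by
      have h1 : Measurable fun r : (Fin n → F) × (TriIdx n → F) => twist S.k τ n Y r.2 :=
        (continuous_twist τ n Y).measurable.comp measurable_snd
      have h2 : Measurable fun r : (Fin n → F) × (TriIdx n → F) => ∑ t, Y t * r.2 t :=
        Finset.measurable_sum _ fun t _ =>
          measurable_const.mul ((measurable_pi_apply t).comp measurable_snd)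
      exact hΨm.comp ((h1.prodMk h2).prodMk measurable_fst)
    have hIH : ∀ w : Fin n → F, ENNReal.ofReal (S.dens n Y) * ∫⁻ s,
        Ψ ((baseChangeGL n F E (S.point n Y))⁻¹ * slice τ n s * baseChangeGL n F E (S.point n Y))
          w (superSum n s) ∂(triMeasure μF n) =
        ∫⁻ s, Ψ (twist S.k τ n Y s) w (∑ t, Y t * s t) ∂(triMeasure μF n) := fun w => by
      have h1 : Measurable fun r : GL (Fin n) E × F => Ψ r.1 w r.2 :=
        hΨm.comp (measurable_id.prodMk measurable_const)
      exact ih Y hY' h1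
    have hR : ∀ (s : TriIdx n → F) (v : Fin n → F),
        φ (twist S.k τ (n + 1) (triSnoc Y y) (triSnoc s v),
          ∑ t, triSnoc Y y t * triSnoc s v t) = Ψ (twist S.k τ n Y s) v (∑ t, Y t * s t) := by
      intro s v
      rw [← hΨ, twist_succ, sum_triIdx_succ]
      rfl
    have hRm : Measurable fun s =>
        φ (twist S.k τ (n + 1) (triSnoc Y y) s, ∑ t, triSnoc Y y t * s t) := by
      have h2 : Measurable fun s : TriIdx (n + 1) → F => ∑ t, triSnoc Y y t * s t :=
        Finset.measurable_sum _ fun t _ => measurable_const.mul (measurable_pi_apply t)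
      exact hφ.comp ((continuous_twist τ _ _).measurable.prodMk h2)
    rw [lintegral_tri_succ μF hGm, lintegral_tri_succ μF hRm, lintegral_congr hinner,
      lintegral_const_mul' _ _ ENNReal.ofReal_ne_top, ← mul_assoc, hdens,
      lintegral_lintegral_swap hsw.aemeasurable, ← lintegral_const_mul' _ _ ENNReal.ofReal_ne_top,
      lintegral_congr hIH, lintegral_lintegral_swap hsw2.aemeasurable]
    exact lintegral_congr fun s => lintegral_congr fun v => (hR s v).symm

end Conjugation

end Twist

/-! ### Size of the twisted unipotent matrices -/

section ProdHeight

variable {K : Type*} [Field K] {N : AbsoluteValue K ℝ} {ι : Type*} [Fintype ι]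

/-- The size `∏ max(1, N(xᵢ))` of a vector. -/
def prodHeight (N : AbsoluteValue K ℝ) (x : ι → K) : ℝ := ∏ i, max 1 (N (x i))

theorem one_le_prodHeight (x : ι → K) : 1 ≤ prodHeight N x :=
  Finset.one_le_prod fun _ _ => le_max_left _ _

theorem prodHeight_pos (x : ι → K) : 0 < prodHeight N x :=
  one_pos.trans_le (one_le_prodHeight x)

theorem le_prodHeight (x : ι → K) (i : ι) : N (x i) ≤ prodHeight N x := by
  classical
  rw [prodHeight, ← Finset.mul_prod_erase _ _ (Finset.mem_univ i)]
  have h : 1 ≤ ∏ j ∈ Finset.univ.erase i, max 1 (N (x j)) :=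
    Finset.one_le_prod fun _ _ => le_max_left _ _
  exact (le_max_right 1 (N (x i))).trans (le_mul_of_one_le_right (by positivity) h)

theorem prodHeight_le {x : ι → K} {c : ℝ} (hc : ∀ i, max 1 (N (x i)) ≤ c) :
    prodHeight N x ≤ c ^ Fintype.card ι :=
  (Finset.prod_le_prod (fun _ _ => by positivity) fun i _ => hc i).trans_eq (by simp)

theorem prod_decay_eq (M : ℕ) (x : ι → K) : ∏ i, decay N M (x i) = (prodHeight N x ^ M)⁻¹ := by
  simp only [decay, prodHeight, Finset.prod_inv_distrib, Finset.prod_pow]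

theorem prodHeight_triSnoc {n : ℕ} (s : TriIdx n → K) (v : Fin n → K) :
    prodHeight N (triSnoc s v) = prodHeight N s * prodHeight N v :=
  Fintype.prod_sum_type _

end ProdHeight

section Size

open Matrix

variable {F E : Type*} [Field F] [Field E] [Algebra F E] {N : AbsoluteValue E ℝ}

theorem height_baseChangeGL {n : ℕ} (g : GL (Fin n) F) :
    height N (baseChangeGL n F E g) = height (N.restrict F) g := by
  rw [height, ← map_inv]
  rfl

theorem height_conj_le {n : ℕ} (k X : GL (Fin n) E) :
    height N (k⁻¹ * X * k) ≤ height N k ^ 2 * height N X := by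
  have h1 := height_mul_le (N := N) (k⁻¹ * X) k
  have h2 := height_mul_le (N := N) k⁻¹ X
  rw [height_inv] at h2
  nlinarith [height_pos (N := N) k]

theorem vecNorm_tauVec_le (τ : E) {n : ℕ} (v : Fin n → F) :
    vecNorm N (tauVec τ v) ≤ n * N τ * prodHeight (N.restrict F) v := by
  have h : ∀ i ∈ Finset.univ, N (tauVec τ v i) ≤
      N τ * prodHeight (N.restrict F) v := fun i _ => by
    rw [tauVec, map_mul, mul_comm]
    exact mul_le_mul_of_nonneg_left
      (le_prodHeight (N := N.restrict F) v i) (N.nonneg _)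
  refine (Finset.sum_le_card_nsmul _ _ _ h).trans ?_
  rw [Finset.card_univ, Fintype.card_fin, nsmul_eq_mul, mul_assoc]

variable [TopologicalSpace F] [IsLocalField F] [MeasurableSpace F]
  (S : RowSection (N.restrict F)) (τ : E)

theorem RowSection.exists_height_baseChangeGL_le (n : ℕ) :
    ∃ C, 1 ≤ C ∧ ∀ y, height N (baseChangeGL n F E (S.k n y)) ≤ C := by
  obtain ⟨C, hC⟩ := S.height_le n
  exact ⟨max 1 C, le_max_left _ _, fun y => (height_baseChangeGL _).trans_le
    ((hC y).trans (le_max_right _ _))⟩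

theorem exists_height_twist_le (n : ℕ) : ∃ C, 1 ≤ C ∧ ∃ r : ℕ, ∀ Y s : TriIdx n → F,
    height N (twist S.k τ n Y s) ≤
      C * prodHeight (N.restrict F) s ^ r := by
  induction n with
  | zero =>
    refine ⟨max 1 (height N (1 : GL (Fin 0) E)), le_max_left _ _, 0, fun Y s => ?_⟩
    rw [pow_zero, mul_one, Subsingleton.elim (twist S.k τ 0 Y s) 1]
    exact le_max_right _ _
  | succ n ih =>
    obtain ⟨C, hC, r, hr⟩ := ih
    obtain ⟨B, hB, hk⟩ := S.exists_height_baseChangeGL_le n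
    have hτ := N.nonneg τ
    refine ⟨4 * (B ^ 2 * C) * (n + 2 + n * N τ) ^ 2, ?_, r + 2, fun Y s => ?_⟩
    · have h1 : 1 ≤ B ^ 2 * C := one_le_mul_of_one_le_of_one_le (one_le_pow₀ hB) hC
      have h2 : (1 : ℝ) ≤ (n + 2 + n * N τ) ^ 2 := one_le_pow₀ (by
        have : (0 : ℝ) ≤ n * N τ := by positivity
        have : (0 : ℝ) ≤ n := by positivity
        linarith)
      nlinarith
    obtain ⟨Y, y, rfl⟩ : ∃ Y' y, Y = triSnoc Y' y := ⟨_, _, (triSnoc_init_last Y).symm⟩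
    obtain ⟨s, v, rfl⟩ : ∃ s' v, s = triSnoc s' v := ⟨_, _, (triSnoc_init_last s).symm⟩
    rw [twist_succ, prodHeight_triSnoc]
    set P := prodHeight (N.restrict F) s
    set Q := prodHeight (N.restrict F) v with hQ
    have hP1 : 1 ≤ P := one_le_prodHeight s
    have hQ1 : 1 ≤ Q := one_le_prodHeight v
    have h1 : height N ((baseChangeGL n F E (S.k n y))⁻¹ * twist S.k τ n Y s *
        baseChangeGL n F E (S.k n y)) ≤ B ^ 2 * (C * P ^ r) :=
      (height_conj_le _ _).trans (mul_le_mul (pow_le_pow_left₀ (height_pos _).le (hk y) 2)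
        (hr Y s) (height_pos _).le (by positivity))
    have h2 : n + 2 + vecNorm N (tauVec τ v) ≤ (n + 2 + n * N τ) * Q := by
      have := vecNorm_tauVec_le (N := N) τ v
      rw [← hQ] at this
      have hn : (0 : ℝ) ≤ n := by positivity
      nlinarith
    have h3 : 0 ≤ vecNorm N (tauVec τ v) := vecNorm_nonneg _
    calc _ ≤ _ := height_mul_le _ _
      _ ≤ (4 * (B ^ 2 * (C * P ^ r))) * ((n + 2 + n * N τ) * Q) ^ 2 := by
          refine mul_le_mul ((height_aff_zero_le _).trans (by linarith))
            ((height_aff_one_le _).trans (pow_le_pow_left₀ (by positivity) h2 2))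
              (height_pos _).le (by positivity)
      _ = 4 * (B ^ 2 * C) * (n + 2 + n * N τ) ^ 2 * (P ^ r * Q ^ 2) := by ring
      _ ≤ 4 * (B ^ 2 * C) * (n + 2 + n * N τ) ^ 2 * (P * Q) ^ (r + 2) := by
          refine mul_le_mul_of_nonneg_left ?_ (by positivity)
          rw [mul_pow, pow_add, pow_add]
          have h4 : 1 ≤ P ^ 2 := one_le_pow₀ hP1
          have h5 : 1 ≤ Q ^ r := one_le_pow₀ hQ1
          calc P ^ r * Q ^ 2 = P ^ r * 1 * (1 * Q ^ 2) := by ring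
            _ ≤ _ := by gcongr

variable (σ : E ≃ₐ[F] E)

/-- The action of the conjugation of `E/F` on `GL_n(E)`. -/
def conjGL (n : ℕ) : GL (Fin n) E →* GL (Fin n) E :=
  GeneralLinearGroup.map (σ : E →+* E)

theorem conjGL_baseChangeGL {n : ℕ} (g : GL (Fin n) F) :
    conjGL σ n (baseChangeGL n F E g) = baseChangeGL n F E g := by
  ext i j
  exact σ.commutes _

theorem conjGL_aff {n : ℕ} (g : GL (Fin n) E) (v : Fin n → E) :
    conjGL σ (n + 1) (aff g v) = aff (conjGL σ n g) (σ ∘ v) := aff_map _ _ _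

variable {τ σ}

theorem IsTraceZeroGenerator.comp_tauVec (h : IsTraceZeroGenerator τ σ) {n : ℕ} (v : Fin n → F) :
    σ ∘ tauVec τ v = -tauVec τ v := by
  funext i
  simp [tauVec, h.map_eq]

/-- The recursion for `A σ(A)⁻¹`, where `A = A_Y(s)`. -/
theorem IsTraceZeroGenerator.aff_mul_conjGL_inv (h : IsTraceZeroGenerator τ σ) {n : ℕ}
    (g : GL (Fin n) E) (v : Fin n → F) :
    aff g 0 * aff 1 (tauVec τ v) * (conjGL σ (n + 1) (aff g 0 * aff 1 (tauVec τ v)))⁻¹ =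
      aff (g * (conjGL σ n g)⁻¹) ((g : Matrix (Fin n) (Fin n) E) *ᵥ ((2 : E) • tauVec τ v)) := by
  have h0 : σ ∘ (0 : Fin n → E) = 0 := by
    funext i
    simp
  rw [map_mul, conjGL_aff, conjGL_aff, h.comp_tauVec, h0, map_one, mul_inv_eq_iff_eq_mul]
  simp only [aff_mul, mul_one, inv_mul_cancel_right, add_zero, mulVec_neg, mulVec_mulVec,
    ← Units.val_mul]
  congr 1
  rw [two_smul, mulVec_add]
  abel

variable [CharZero F]

/-- The parameter `s` is controlled by `A_Y(s)`: the quotient of `A_Y(s)` by its conjugate over `F`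
has last column `g (2 τ v)`, from which one recovers the last block `v` of `s`, the block `g` being
controlled by induction. -/
theorem IsTraceZeroGenerator.exists_prodHeight_le (h : IsTraceZeroGenerator τ σ) (n : ℕ) :
    ∃ C, 1 ≤ C ∧ ∃ r : ℕ, ∀ Y s : TriIdx n → F,
      prodHeight (N.restrict F) s ≤
        C * height N (twist S.k τ n Y s * (conjGL σ n (twist S.k τ n Y s))⁻¹) ^ r := by
  induction n with
  | zero =>
    refine ⟨1, le_rfl, 0, fun Y s => ?_⟩
    simp [prodHeight]
  | succ n ih =>
    obtain ⟨C, hC, r, hr⟩ := ih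
    obtain ⟨B, hB, hk⟩ := S.exists_height_baseChangeGL_le n
    obtain ⟨A, hA, q, hq⟩ := exists_height_twist_le S τ n
    have hτ : 0 < N τ := N.pos h.ne_zero
    have h2 : 0 < N (2 : E) := N.pos (two_ne_zero_ext F)
    set L := 1 + (N 2 * N τ)⁻¹ * (B ^ 2 * A) with hL
    have hL0 : 0 ≤ (N 2 * N τ)⁻¹ * (B ^ 2 * A) := by positivity
    have hL1 : 1 ≤ L := by linarith
    refine ⟨(C * (B ^ 2) ^ r) ^ (1 + q * n) * L ^ n, ?_, r * (1 + q * n) + n, fun Y s => ?_⟩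
    · refine one_le_mul_of_one_le_of_one_le (one_le_pow₀ ?_) (one_le_pow₀ hL1)
      exact one_le_mul_of_one_le_of_one_le hC (one_le_pow₀ (one_le_pow₀ hB))
    obtain ⟨Y, y, rfl⟩ : ∃ Y' y, Y = triSnoc Y' y := ⟨_, _, (triSnoc_init_last Y).symm⟩
    obtain ⟨s, v, rfl⟩ : ∃ s' v, s = triSnoc s' v := ⟨_, _, (triSnoc_init_last s).symm⟩
    rw [twist_succ, prodHeight_triSnoc, h.aff_mul_conjGL_inv]
    set k := baseChangeGL n F E (S.k n y)
    set X := twist S.k τ n Y s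
    set g := k⁻¹ * X * k with hg
    set P := prodHeight (N.restrict F) s
    set w := (g : Matrix (Fin n) (Fin n) E) *ᵥ ((2 : E) • tauVec τ v) with hw
    set D := height N (aff (g * (conjGL σ n g)⁻¹) w) with hD
    have hP1 : 1 ≤ P := one_le_prodHeight s
    have hD1 : 1 ≤ D := one_le_height _
    have hkB : height N k ^ 2 ≤ B ^ 2 := pow_le_pow_left₀ (height_pos _).le (hk y) 2
    have hX : height N (X * (conjGL σ n X)⁻¹) ≤ B ^ 2 * D := by
      have h1 : X * (conjGL σ n X)⁻¹ = (k⁻¹)⁻¹ * (g * (conjGL σ n g)⁻¹) * k⁻¹ := by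
        have hk0 : conjGL σ n k = k := conjGL_baseChangeGL σ _
        rw [hg, map_mul, map_mul, map_inv, hk0]
        group
      rw [h1]
      refine (height_conj_le _ _).trans ?_
      rw [height_inv]
      exact mul_le_mul hkB (height_le_height_aff _ _) (height_pos _).le (by positivity)
    have hP : P ≤ C * (B ^ 2) ^ r * D ^ r := by
      refine (hr Y s).trans ?_
      rw [mul_assoc, ← mul_pow]
      gcongr
      exact (height_pos _).le
    have hgH : height N g ≤ B ^ 2 * A * P ^ q := by
      refine (height_conj_le _ _).trans ?_
      rw [mul_assoc]
      exact mul_le_mul hkB (hq Y s) (height_pos _).le (by positivity)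
    have hv : ∀ i, max 1 (N.restrict F (v i)) ≤ L * (P ^ q * D) := by
      intro i
      have hPD : 1 ≤ P ^ q * D := one_le_mul_of_one_le_of_one_le (one_le_pow₀ hP1) hD1
      have h3 : (2 : E) • tauVec τ v =
          ((g⁻¹ : GL (Fin n) E) : Matrix (Fin n) (Fin n) E) *ᵥ w := by
        rw [hw, mulVec_mulVec, ← Units.val_mul, inv_mul_cancel, Units.val_one, one_mulVec]
      have h4 : N 2 * (N (algebraMap F E (v i)) * N τ) ≤ B ^ 2 * A * (P ^ q * D) := by
        calc N 2 * (N (algebraMap F E (v i)) * N τ) = N (((2 : E) • tauVec τ v) i) := by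
              simp [tauVec]
          _ ≤ vecNorm N ((2 : E) • tauVec τ v) := le_vecNorm _ _
          _ ≤ entryNorm N ((g⁻¹ : GL (Fin n) E) : Matrix (Fin n) (Fin n) E) * vecNorm N w := by
              rw [h3]
              exact vecNorm_mulVec_le _ _
          _ ≤ height N g * D := by
              refine mul_le_mul ?_ ?_ (vecNorm_nonneg _) (height_pos _).le
              · have := one_add_entryNorm_le_height (N := N) g⁻¹
                rw [height_inv] at this
                linarith
              · linarith [vecNorm_le_height_aff (N := N) (g * (conjGL σ n g)⁻¹) w]
          _ ≤ (B ^ 2 * A * P ^ q) * D := by gcongr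
          _ = _ := by ring
      refine max_le (one_le_mul_of_one_le_of_one_le hL1 hPD) ?_
      have h5 : N (algebraMap F E (v i)) ≤ (N 2 * N τ)⁻¹ * (B ^ 2 * A) * (P ^ q * D) := by
        rw [mul_assoc, le_inv_mul_iff₀ (by positivity)]
        calc _ = N 2 * (N (algebraMap F E (v i)) * N τ) := by ring
          _ ≤ _ := h4
      refine (show N (algebraMap F E (v i)) ≤ _ from h5).trans ?_
      exact mul_le_mul_of_nonneg_right (by linarith) (by positivity)
    have hQ := prodHeight_le hv
    rw [Fintype.card_fin] at hQ
    calc P * prodHeight _ v ≤ P * (L * (P ^ q * D)) ^ n := by gcongr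
      _ = P ^ (1 + q * n) * (L ^ n * D ^ n) := by
          rw [mul_pow, mul_pow, pow_add, pow_mul]
          ring
      _ ≤ (C * (B ^ 2) ^ r * D ^ r) ^ (1 + q * n) * (L ^ n * D ^ n) := by gcongr
      _ = _ := by
          rw [mul_pow _ (D ^ r), pow_add, ← pow_mul]
          ring

omit [TopologicalSpace F] [IsLocalField F] [MeasurableSpace F] [CharZero F] in
theorem exists_height_conjGL_le {C : ℝ} (hC : 1 ≤ C) (hσ : ∀ z, N (σ z) ≤ C * N z) {n : ℕ}
    (g : GL (Fin n) E) : height N (conjGL σ n g) ≤ C ^ 2 * height N g := by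
  have h1 : ∀ X : Matrix (Fin n) (Fin n) E,
      1 + entryNorm N (X.map σ) ≤ C * (1 + entryNorm N X) := fun X => by
    have : entryNorm N (X.map σ) ≤ C * entryNorm N X := by
      simp only [entryNorm, Finset.mul_sum]
      exact Finset.sum_le_sum fun i _ => Finset.sum_le_sum fun j _ => hσ _
    linarith
  have h2 := entryNorm_nonneg (N := N) (((g⁻¹ : GL (Fin n) E) : Matrix (Fin n) (Fin n) E).map σ)
  have h3 := entryNorm_nonneg (N := N) (g : Matrix (Fin n) (Fin n) E)
  calc height N (conjGL σ n g) = (1 + entryNorm N ((g : Matrix (Fin n) (Fin n) E).map σ)) *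
        (1 + entryNorm N (((g⁻¹ : GL (Fin n) E) : Matrix (Fin n) (Fin n) E).map σ)) := by
        rw [height, ← map_inv]
        rfl
    _ ≤ (C * (1 + entryNorm N (g : Matrix (Fin n) (Fin n) E))) *
        (C * (1 + entryNorm N ((g⁻¹ : GL (Fin n) E) : Matrix (Fin n) (Fin n) E))) :=
        mul_le_mul (h1 _) (h1 _) (by positivity) (by positivity)
    _ = _ := by
        rw [height]
        ring

/-- Along `A_Y(s) GL_n(F)`, both `s` and the element of `GL_n(F)` are controlled by the size of the
product: `A = A_Y(s) h` determines `A σ(A)⁻¹ = A_Y(s) σ(A_Y(s))⁻¹`, hence `s`. -/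
theorem IsTraceZeroGenerator.exists_prodHeight_mul_height_le (h : IsTraceZeroGenerator τ σ)
    {D : ℝ} (hD : 1 ≤ D) (hσ : ∀ z, N (σ z) ≤ D * N z) (n : ℕ) :
    ∃ C, 1 ≤ C ∧ ∃ r : ℕ, ∀ (Y s : TriIdx n → F) (g : GL (Fin n) F),
      prodHeight (N.restrict F) s * height N (baseChangeGL n F E g) ≤
        C * height N (twist S.k τ n Y s * baseChangeGL n F E g) ^ r := by
  obtain ⟨C, hC, r, hr⟩ := h.exists_prodHeight_le S (N := N) n
  obtain ⟨A, hA, q, hq⟩ := exists_height_twist_le S τ n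
  refine ⟨A * (C * (D ^ 2) ^ r) ^ (q + 1), ?_, 2 * r * (q + 1) + 1, fun Y s g => ?_⟩
  · refine one_le_mul_of_one_le_of_one_le hA (one_le_pow₀ ?_)
    exact one_le_mul_of_one_le_of_one_le hC (one_le_pow₀ (one_le_pow₀ hD))
  set X := twist S.k τ n Y s
  set b := baseChangeGL n F E g with hb
  set H := height N (X * b) with hH
  set P := prodHeight (N.restrict F) s
  have hP0 : 0 < P := prodHeight_pos s
  have hH0 : 0 < H := height_pos _
  have h1 : height N (X * (conjGL σ n X)⁻¹) ≤ D ^ 2 * H ^ 2 := by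
    have h2 : X * (conjGL σ n X)⁻¹ = X * b * (conjGL σ n (X * b))⁻¹ := by
      rw [map_mul, hb, conjGL_baseChangeGL]
      group
    rw [h2]
    refine (height_mul_le _ _).trans ?_
    rw [height_inv]
    have := exists_height_conjGL_le (σ := σ) hD hσ (X * b)
    calc _ ≤ H * (D ^ 2 * H) := by gcongr
      _ = _ := by ring
  have h2 : P ≤ C * (D ^ 2) ^ r * H ^ (2 * r) := by
    refine (hr Y s).trans ?_
    rw [mul_assoc, pow_mul, ← mul_pow]
    gcongr
    exact (height_pos _).le
  have h3 : height N b ≤ A * P ^ q * H := by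
    have h4 : b = X⁻¹ * (X * b) := by group
    calc height N b = height N (X⁻¹ * (X * b)) := by rw [← h4]
      _ ≤ height N X * H := by
          rw [← height_inv X]
          exact height_mul_le _ _
      _ ≤ _ := mul_le_mul_of_nonneg_right (hq Y s) hH0.le
  calc P * height N b ≤ P * (A * P ^ q * H) := by gcongr
    _ = A * P ^ (q + 1) * H := by ring
    _ ≤ A * (C * (D ^ 2) ^ r * H ^ (2 * r)) ^ (q + 1) * H := by gcongr
    _ = _ := by
        rw [mul_pow _ (H ^ (2 * r)), ← pow_mul, pow_succ H]
        ring

omit [CharZero F] [TopologicalSpace F] [IsLocalField F] [MeasurableSpace F] in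
/-- The matrix with blocks `A`, `v` and last row zero. -/
def topMat {n : ℕ} (A : Matrix (Fin n) (Fin n) E) (v : Fin n → E) :
    Matrix (Fin (n + 1)) (Fin (n + 1)) E :=
  Matrix.of fun i j => Fin.lastCases (motive := fun _ => E) 0
    (fun i => Fin.lastCases (motive := fun _ => E) (v i) (fun j => A i j) j) i

omit [CharZero F] [TopologicalSpace F] [IsLocalField F] [MeasurableSpace F] in
theorem topMat_mul {n : ℕ} (A B : Matrix (Fin n) (Fin n) E) (v w : Fin n → E) :
    topMat A v * topMat B w = topMat (A * B) (A *ᵥ w) := by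
  ext i j
  rw [mul_apply, Fin.sum_univ_castSucc]
  refine Fin.lastCases ?_ (fun i => ?_) i <;> refine Fin.lastCases ?_ (fun j => ?_) j <;>
    simp [topMat, mul_apply, mulVec, dotProduct]

omit [CharZero F] [TopologicalSpace F] [IsLocalField F] [MeasurableSpace F] in
theorem topMat_zero {n : ℕ} : topMat (0 : Matrix (Fin n) (Fin n) E) 0 = 0 := by
  ext i j
  refine Fin.lastCases ?_ (fun i => ?_) i <;> refine Fin.lastCases ?_ (fun j => ?_) j <;>
    simp [topMat]

omit [CharZero F] [TopologicalSpace F] [IsLocalField F] [MeasurableSpace F] in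
theorem one_add_smul_topMat {n : ℕ} (x : E) (A : Matrix (Fin n) (Fin n) E) (v : Fin n → E) :
    1 + x • topMat A v = affMat (1 + x • A) (x • v) := by
  ext i j
  refine Fin.lastCases ?_ (fun i => ?_) i <;> refine Fin.lastCases ?_ (fun j => ?_) j <;>
    simp [topMat, one_apply, Fin.ext_iff, (Fin.is_lt _).ne, (Fin.is_lt _).ne']

omit [CharZero F] [TopologicalSpace F] [IsLocalField F] [MeasurableSpace F] in
theorem entryNorm_topMat {n : ℕ} (A : Matrix (Fin n) (Fin n) E) (v : Fin n → E) :
    entryNorm N (topMat A v) = entryNorm N A + vecNorm N v := by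
  simp [entryNorm, vecNorm, topMat, Fin.sum_univ_castSucc, Finset.sum_add_distrib]

omit [CharZero F] [TopologicalSpace F] [IsLocalField F] [MeasurableSpace F] in
theorem entryNorm_conj_le {n : ℕ} (k : GL (Fin n) E) (X : Matrix (Fin n) (Fin n) E) :
    entryNorm N (((k⁻¹ : GL (Fin n) E) : Matrix (Fin n) (Fin n) E) * X *
      (k : Matrix (Fin n) (Fin n) E)) ≤
      height N k * entryNorm N X := by
  have h1 := entryNorm_nonneg (N := N) (k : Matrix (Fin n) (Fin n) E)
  have h2 := entryNorm_nonneg (N := N) ((k⁻¹ : GL (Fin n) E) : Matrix (Fin n) (Fin n) E)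
  have h3 := entryNorm_nonneg (N := N) X
  have h4 : entryNorm N (k : Matrix (Fin n) (Fin n) E) *
      entryNorm N ((k⁻¹ : GL (Fin n) E) : Matrix (Fin n) (Fin n) E) ≤ height N k := by
    rw [height]
    nlinarith
  refine (entryNorm_mul_le _ _).trans ?_
  refine (mul_le_mul_of_nonneg_right (entryNorm_mul_le _ _) h1).trans ?_
  calc _ = entryNorm N (k : Matrix (Fin n) (Fin n) E) *
      entryNorm N ((k⁻¹ : GL (Fin n) E) : Matrix (Fin n) (Fin n) E) * entryNorm N X := by ring
    _ ≤ _ := mul_le_mul_of_nonneg_right h4 h3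

omit [CharZero F] [TopologicalSpace F] [IsLocalField F] [MeasurableSpace F] in
theorem triSnoc_add_single_inl {n : ℕ} (s : TriIdx n → F) (v : Fin n → F) (t : TriIdx n) (x : F) :
    triSnoc s v + Pi.single (M := fun _ : TriIdx (n + 1) => F) (Sum.inl t) x =
      triSnoc (s + Pi.single t x) v := by
  funext u
  rcases u with u | u
  · exact congrArg (s u + ·) ((Pi.single_apply (ι := TriIdx (n + 1)) (M := F) (Sum.inl t) x
      (Sum.inl u)).trans ((if_congr Sum.inl_injective.eq_iff rfl rfl).trans
        (Pi.single_apply (M := F) t x u).symm))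
  · exact (congrArg (v u + ·) ((Pi.single_apply (ι := TriIdx (n + 1)) (M := F) (Sum.inl t)
      x (Sum.inr u)).trans (if_neg fun h => Sum.inr_ne_inl h))).trans (add_zero _)

omit [CharZero F] [TopologicalSpace F] [IsLocalField F] [MeasurableSpace F] in
theorem triSnoc_add_single_inr {n : ℕ} (s : TriIdx n → F) (v : Fin n → F) (i : Fin n) (x : F) :
    triSnoc s v + Pi.single (M := fun _ : TriIdx (n + 1) => F) (Sum.inr i) x =
      triSnoc s (v + Pi.single i x) := by
  funext u
  rcases u with u | u
  · exact (congrArg (s u + ·) ((Pi.single_apply (ι := TriIdx (n + 1)) (M := F) (Sum.inr i)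
      x (Sum.inl u)).trans (if_neg fun h => Sum.inl_ne_inr h))).trans (add_zero _)
  · exact congrArg (v u + ·) ((Pi.single_apply (ι := TriIdx (n + 1)) (M := F) (Sum.inr i) x
      (Sum.inr u)).trans ((if_congr Sum.inr_injective.eq_iff rfl rfl).trans
        (Pi.single_apply (M := F) i x u).symm))

omit [CharZero F] in
/-- Moving one coordinate of `s` multiplies `A_Y(s)` on the right by a line `1 + x X` of unipotent
matrices, with `X` of polynomial size in `s`. -/
theorem exists_twist_add_single (n : ℕ) : ∃ C, 1 ≤ C ∧ ∃ r : ℕ, ∀ (Y s : TriIdx n → F)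
    (t : TriIdx n), ∃ X : Matrix (Fin n) (Fin n) E, X * X = 0 ∧
      entryNorm N X ≤ C * prodHeight (N.restrict F) s ^ r ∧
      ∀ x : F, (twist S.k τ n Y (s + Pi.single t x) : Matrix (Fin n) (Fin n) E) =
        twist S.k τ n Y s * (1 + algebraMap F E x • X) := by
  induction n with
  | zero => exact ⟨1, le_rfl, 0, fun Y s t => t.elim⟩
  | succ n ih =>
    obtain ⟨C, hC, r, hr⟩ := ih
    obtain ⟨B, hB, hk⟩ := S.exists_height_baseChangeGL_le n
    have hτ := N.nonneg τ
    set L : ℝ := 1 + n * N τ with hL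
    have hL1 : 1 ≤ L := by
      have : (0 : ℝ) ≤ n * N τ := by positivity
      linarith
    refine ⟨B * C * L + N τ, ?_, r + 1, fun Y s t => ?_⟩
    · have := one_le_mul_of_one_le_of_one_le (one_le_mul_of_one_le_of_one_le hB hC) hL1
      linarith
    obtain ⟨Y, y, rfl⟩ : ∃ Y' y, Y = triSnoc Y' y := ⟨_, _, (triSnoc_init_last Y).symm⟩
    obtain ⟨s, v, rfl⟩ : ∃ s' v, s = triSnoc s' v := ⟨_, _, (triSnoc_init_last s).symm⟩
    rw [prodHeight_triSnoc, twist_succ]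
    set k := baseChangeGL n F E (S.k n y) with hkdef
    set P := prodHeight (N.restrict F) s
    set Q := prodHeight (N.restrict F) v with hQ
    have hP1 : 1 ≤ P := one_le_prodHeight s
    have hQ1 : 1 ≤ Q := one_le_prodHeight v
    -- the coordinate `t` lies in an earlier block, or in the last column
    rcases t with t | i
    · obtain ⟨X, hX0, hXn, hX⟩ := hr Y s t
      set Z := ((k⁻¹ : GL (Fin n) E) : Matrix (Fin n) (Fin n) E) * X *
        (k : Matrix (Fin n) (Fin n) E) with hZ
      have hZn : entryNorm N Z ≤ B * (C * P ^ r) :=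
        (entryNorm_conj_le _ _).trans (mul_le_mul (hk y) hXn (entryNorm_nonneg _) (by positivity))
      have hZ0 : Z * Z = 0 := by
        have h1 : (k : Matrix (Fin n) (Fin n) E) * ((k⁻¹ : GL (Fin n) E) :
            Matrix (Fin n) (Fin n) E) = 1 := k.mul_inv
        calc Z * Z = ((k⁻¹ : GL (Fin n) E) : Matrix (Fin n) (Fin n) E) * X *
              ((k : Matrix (Fin n) (Fin n) E) * ((k⁻¹ : GL (Fin n) E) :
                Matrix (Fin n) (Fin n) E)) * X * k := by
              rw [hZ]
              simp only [mul_assoc]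
          _ = 0 := by rw [h1, mul_one, mul_assoc _ X X, hX0, mul_zero, zero_mul]
      refine ⟨topMat Z (Z *ᵥ tauVec τ v), ?_, ?_, fun x => ?_⟩
      · rw [topMat_mul, mulVec_mulVec, hZ0, zero_mulVec, topMat_zero]
      · rw [entryNorm_topMat]
        have h1 := vecNorm_mulVec_le (N := N) Z (tauVec τ v)
        have h2 := vecNorm_tauVec_le (N := N) τ v
        have h3 := entryNorm_nonneg (N := N) Z
        have hn : 0 ≤ n * N τ := by positivity
        have h4 : 1 + vecNorm N (tauVec τ v) ≤ L * Q := by nlinarith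
        calc entryNorm N Z + vecNorm N (Z *ᵥ tauVec τ v)
            ≤ entryNorm N Z * (1 + vecNorm N (tauVec τ v)) := by linarith
          _ ≤ B * (C * P ^ r) * (L * Q) := mul_le_mul hZn h4
              (by linarith [vecNorm_nonneg (N := N) (tauVec τ v)]) (by positivity)
          _ = B * C * L * ((P ^ r * 1) * (1 * Q)) := by ring
          _ ≤ B * C * L * ((P ^ r * P) * (Q ^ r * Q)) := by
              gcongr
              exact one_le_pow₀ hQ1
          _ = B * C * L * (P * Q) ^ (r + 1) := by ring
          _ ≤ _ := mul_le_mul_of_nonneg_right (by linarith) (by positivity)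
      · rw [triSnoc_add_single_inl, twist_succ, ← hkdef]
        have h3 : (k : Matrix (Fin n) (Fin n) E) * (1 + algebraMap F E x • Z) =
            (1 + algebraMap F E x • X) * k := by
          rw [hZ, mul_add, add_mul, mul_one, one_mul, Matrix.mul_smul, Matrix.smul_mul,
            ← mul_assoc, ← mul_assoc, k.mul_inv, one_mul]
        have h5 : algebraMap F E x • (Z *ᵥ tauVec τ v) + tauVec τ v =
            (1 + algebraMap F E x • Z) *ᵥ tauVec τ v := by
          rw [add_mulVec, one_mulVec, smul_mulVec, add_comm]
        simp only [Units.val_mul, coe_aff, one_add_smul_topMat, affMat_mul, hX, Units.val_one,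
          mul_one, add_zero]
        rw [← mulVec_add, h5, mulVec_mulVec]
        simp only [mul_assoc, h3]
    · have hs : vecNorm N (tauVec τ (Pi.single i 1 : Fin n → F)) = N τ := by
        rw [vecNorm, Finset.sum_eq_single i]
        · simp [tauVec]
        · intro j _ hj
          simp [tauVec, hj]
        · simp
      refine ⟨topMat 0 (tauVec τ (Pi.single i 1 : Fin n → F)), ?_, ?_, fun x => ?_⟩
      · rw [topMat_mul, mul_zero, zero_mulVec, topMat_zero]
      · rw [entryNorm_topMat, entryNorm_zero, zero_add, hs]
        have h1 : 1 ≤ (P * Q) ^ (r + 1) :=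
          one_le_pow₀ (one_le_mul_of_one_le_of_one_le hP1 hQ1)
        have h2 : 0 ≤ B * C * L := by positivity
        nlinarith
      · rw [triSnoc_add_single_inr, twist_succ, ← hkdef]
        have h3 : algebraMap F E x • tauVec τ (Pi.single i 1 : Fin n → F) + tauVec τ v =
            tauVec τ (v + Pi.single i x) := by
          funext j
          by_cases hj : j = i
          · subst hj
            simp [tauVec, Algebra.smul_def]
            ring
          · simp [tauVec, hj]
        simp only [Units.val_mul, coe_aff, one_add_smul_topMat, affMat_mul, Units.val_one,
          mul_one, add_zero, smul_zero, mul_assoc]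
        rw [← h3, mulVec_add]

end Size

/-! ### Derivatives along one-parameter subgroups of `GL_n(ℂ)` -/

section Complex

open Matrix

variable {n : ℕ}

/-- The extension of a function on `GL_n(ℂ)` by zero, on the space of all matrices. -/
def extendGL (f : GL (Fin n) ℂ → ℂ) (M : Fin n → Fin n → ℂ) : ℂ :=
  open Classical in if h : IsUnit (Matrix.of M) then f h.unit else 0

/-- The entries of an invertible matrix. -/
def matEntries (g : Matrix (Fin n) (Fin n) ℂ) : Fin n → Fin n → ℂ := fun i j => g i j

theorem extendGL_matEntries (f : GL (Fin n) ℂ → ℂ) (g : GL (Fin n) ℂ) :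
    extendGL f (matEntries (g : Matrix (Fin n) (Fin n) ℂ)) = f g := by
  have h : IsUnit (Matrix.of (matEntries (g : Matrix (Fin n) (Fin n) ℂ))) := g.isUnit
  rw [extendGL, dif_pos h]
  exact congrArg f (Units.ext rfl)

theorem isOpen_isUnit_of : IsOpen {M : Fin n → Fin n → ℂ | IsUnit (Matrix.of M)} := by
  have h : {M : Fin n → Fin n → ℂ | IsUnit (Matrix.of M)} = {M | (Matrix.of M).det ≠ 0} := by
    ext M
    change IsUnit (Matrix.of M) ↔ _
    rw [Matrix.isUnit_iff_isUnit_det, isUnit_iff_ne_zero]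
    rfl
  rw [h]
  have hc : Continuous fun M : Fin n → Fin n → ℂ => (Matrix.of M).det := by
    refine Continuous.matrix_det ?_
    exact continuous_id
  exact isOpen_ne_fun hc continuous_const

theorem isUnit_of_entries (g : GL (Fin n) ℂ) :
    matEntries (g : Matrix (Fin n) (Fin n) ℂ) ∈ {M | IsUnit (Matrix.of M)} := g.isUnit

theorem IsSmoothGL.contDiffOn {f : GL (Fin n) ℂ → ℂ} (hf : IsSmoothGL f) :
    ContDiffOn ℝ ((⊤ : ℕ∞) : WithTop ℕ∞) (extendGL f) {M | IsUnit (Matrix.of M)} := hf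

theorem IsSmoothGL.continuous {f : GL (Fin n) ℂ → ℂ} (hf : IsSmoothGL f) : Continuous f := by
  have h1 := hf.contDiffOn.continuousOn
  have h2 : Continuous fun g : GL (Fin n) ℂ => matEntries (g : Matrix (Fin n) (Fin n) ℂ) :=
    continuous_pi fun i => continuous_pi fun j => Units.continuous_val.matrix_elem i j
  have h3 := h1.comp_continuous h2 isUnit_of_entries
  exact h3.congr fun g => extendGL_matEntries f g

theorem coe_expGL (X : Matrix (Fin n) (Fin n) ℂ) :
    (expGL X : Matrix (Fin n) (Fin n) ℂ) = NormedSpace.exp X := rfl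

theorem expGL_zero : expGL (0 : Matrix (Fin n) (Fin n) ℂ) = 1 :=
  Units.ext (by rw [coe_expGL, NormedSpace.exp_zero, Units.val_one])

theorem expGL_add_smul (X : Matrix (Fin n) (Fin n) ℂ) (s t : ℝ) :
    expGL ((s + t) • X) = expGL (s • X) * expGL (t • X) := by
  refine Units.ext ?_
  rw [Units.val_mul, coe_expGL, coe_expGL, coe_expGL, add_smul]
  exact Matrix.exp_add_of_commute _ _ (((Commute.refl X).smul_left s).smul_right t)

section

open scoped Matrix.Norms.Operator

theorem hasDerivAt_entries_mul_expGL (X : Matrix (Fin n) (Fin n) ℂ) (g : GL (Fin n) ℂ) :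
    HasDerivAt (fun t : ℝ => matEntries ((g * expGL (t • X) : GL (Fin n) ℂ) :
      Matrix (Fin n) (Fin n) ℂ)) (matEntries ((g : Matrix (Fin n) (Fin n) ℂ) * X)) 0 := by
  have h1 : HasDerivAt (fun t : ℝ => NormedSpace.exp (t • X)) X 0 := by
    have := hasDerivAt_exp_smul_const (𝕂 := ℝ) X (0 : ℝ)
    rwa [zero_smul, NormedSpace.exp_zero, one_mul] at this
  let L : Matrix (Fin n) (Fin n) ℂ →ₗ[ℝ] (Fin n → Fin n → ℂ) :=
    { toFun := fun M => matEntries ((g : Matrix (Fin n) (Fin n) ℂ) * M)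
      map_add' := fun M M' => by rw [mul_add]; rfl
      map_smul' := fun c M => by rw [Matrix.mul_smul]; rfl }
  exact (LinearMap.toContinuousLinearMap L).hasFDerivAt.comp_hasDerivAt 0 h1

theorem expGL_smul_of_sq_eq_zero {X : Matrix (Fin n) (Fin n) ℂ} (hX : X * X = 0) (t : ℝ) :
    (expGL (t • X) : Matrix (Fin n) (Fin n) ℂ) = 1 + (t : ℂ) • X := by
  rw [coe_expGL, NormedSpace.exp_eq_tsum ℝ]
  dsimp only
  rw [tsum_eq_sum (s := Finset.range 2)]
  · simp [Finset.sum_range_succ]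
  · intro k hk
    obtain ⟨m, rfl⟩ : ∃ m, k = m + 2 := ⟨k - 2, by simp at hk; omega⟩
    have h2 : (t • X) * (t • X) = 0 := by
      rw [Matrix.smul_mul, Matrix.mul_smul, hX, smul_zero, smul_zero]
    have : (t • X) ^ (m + 2) = 0 := by
      rw [pow_add, sq, h2, mul_zero]
    rw [this, smul_zero]

end

theorem IsSmoothGL.hasDerivAt {f : GL (Fin n) ℂ → ℂ} (hf : IsSmoothGL f)
    (X : Matrix (Fin n) (Fin n) ℂ) (g : GL (Fin n) ℂ) :
    HasDerivAt (fun t : ℝ => f (g * expGL (t • X)))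
      (fderiv ℝ (extendGL f) (matEntries (g : Matrix (Fin n) (Fin n) ℂ))
        (matEntries ((g : Matrix (Fin n) (Fin n) ℂ) * X))) 0 := by
  have h1 := hasDerivAt_entries_mul_expGL X g
  have h2 : DifferentiableAt ℝ (extendGL f) (matEntries ((g * expGL ((0 : ℝ) • X) : GL (Fin n) ℂ) :
      Matrix (Fin n) (Fin n) ℂ)) :=
    (hf.contDiffOn.contDiffAt (isOpen_isUnit_of.mem_nhds (isUnit_of_entries _))).differentiableAt
      (by simp)
  have h3 := h2.hasFDerivAt.comp_hasDerivAt (0 : ℝ) h1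
  rw [zero_smul, expGL_zero, mul_one] at h3
  refine h3.congr_of_eventuallyEq (Eventually.of_forall fun t => ?_)
  exact (extendGL_matEntries f _).symm

theorem IsSmoothGL.rightDeriv_eq {f : GL (Fin n) ℂ → ℂ} (hf : IsSmoothGL f)
    (X : Matrix (Fin n) (Fin n) ℂ) (g : GL (Fin n) ℂ) :
    rightDeriv X f g = fderiv ℝ (extendGL f) (matEntries (g : Matrix (Fin n) (Fin n) ℂ))
        (matEntries ((g : Matrix (Fin n) (Fin n) ℂ) * X)) := (hf.hasDerivAt X g).deriv

theorem IsSmoothGL.hasDerivAt_mul_expGL {f : GL (Fin n) ℂ → ℂ} (hf : IsSmoothGL f)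
    (X : Matrix (Fin n) (Fin n) ℂ) (g : GL (Fin n) ℂ) (t : ℝ) :
    HasDerivAt (fun t : ℝ => f (g * expGL (t • X))) (rightDeriv X f (g * expGL (t • X))) t := by
  have h1 := hf.hasDerivAt X (g * expGL (t • X))
  rw [← hf.rightDeriv_eq] at h1
  have h2 : HasDerivAt (fun s : ℝ => f (g * expGL (t • X) * expGL ((s - t) • X)))
      (rightDeriv X f (g * expGL (t • X))) t := by
    refine HasDerivAt.comp_sub_const t t (f := fun s : ℝ => f (g * expGL (t • X) * expGL (s • X))) ?_
    rwa [sub_self]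
  refine h2.congr_of_eventuallyEq (Eventually.of_forall fun s => ?_)
  dsimp only
  rw [mul_assoc, ← expGL_add_smul, add_sub_cancel]

theorem IsSmoothGL.rightDeriv {f : GL (Fin n) ℂ → ℂ} (hf : IsSmoothGL f)
    (X : Matrix (Fin n) (Fin n) ℂ) : IsSmoothGL (rightDeriv X f) := by
  have h1 : ContDiffOn ℝ ((⊤ : ℕ∞) : WithTop ℕ∞) (fderiv ℝ (extendGL f))
      {M | IsUnit (Matrix.of M)} := hf.contDiffOn.fderiv_of_isOpen isOpen_isUnit_of (by simp)
  let L : (Fin n → Fin n → ℂ) →ₗ[ℝ] (Fin n → Fin n → ℂ) :=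
    { toFun := fun M => matEntries (Matrix.of M * X)
      map_add' := fun M M' => by
        have : Matrix.of (M + M') = Matrix.of M + Matrix.of M' := rfl
        rw [this, add_mul]
        rfl
      map_smul' := fun c M => by
        have : Matrix.of (c • M) = c • Matrix.of M := rfl
        rw [this, Matrix.smul_mul]
        rfl }
  have h2 := h1.clm_apply ((LinearMap.toContinuousLinearMap L).contDiff.contDiffOn)
  refine h2.congr fun M hM => ?_
  have h3 : M = matEntries ((IsUnit.unit hM : GL (Fin n) ℂ) : Matrix (Fin n) (Fin n) ℂ) := rfl
  refine (congrArg (extendGL (_root_.rightDeriv X f)) h3).trans ?_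
  rw [extendGL_matEntries, hf.rightDeriv_eq]
  rfl

theorem IsSmoothGL.iterate_rightDeriv {f : GL (Fin n) ℂ → ℂ} (hf : IsSmoothGL f)
    (X : Matrix (Fin n) (Fin n) ℂ) : ∀ K : ℕ, IsSmoothGL ((_root_.rightDeriv X)^[K] f)
  | 0 => hf
  | K + 1 => by
    rw [Function.iterate_succ_apply']
    exact (hf.iterate_rightDeriv X K).rightDeriv X

theorem iterate_rightDeriv_sum {ι : Type*} [Fintype ι] (X : Matrix (Fin n) (Fin n) ℂ)
    {f : ι → GL (Fin n) ℂ → ℂ} (hf : ∀ i, IsSmoothGL (f i)) (c : ι → ℝ) : ∀ K : ℕ,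
    (rightDeriv X)^[K] (fun g => ∑ i, c i • f i g) =
      fun g => ∑ i, c i • (rightDeriv X)^[K] (f i) g
  | 0 => rfl
  | K + 1 => by
    funext g
    rw [Function.iterate_succ_apply', iterate_rightDeriv_sum X hf c K]
    simp only [Function.iterate_succ_apply']
    refine HasDerivAt.deriv ?_
    refine HasDerivAt.fun_sum fun i _ => HasDerivAt.fun_const_smul _ ?_
    have := ((hf i).iterate_rightDeriv X K).hasDerivAt_mul_expGL X g 0
    rwa [zero_smul, expGL_zero, mul_one] at this

/-- The real coordinates of a complex matrix. -/
def realCoord (X : Matrix (Fin n) (Fin n) ℂ) (p : (Fin n × Fin n) × Bool) : ℝ :=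
  if p.2 then (X p.1.1 p.1.2).re else (X p.1.1 p.1.2).im

/-- The real basis of the space of complex matrices. -/
def realBasis (p : (Fin n × Fin n) × Bool) : Matrix (Fin n) (Fin n) ℂ :=
  Matrix.single p.1.1 p.1.2 (if p.2 then 1 else Complex.I)

theorem sum_realCoord (X : Matrix (Fin n) (Fin n) ℂ) :
    X = ∑ p, realCoord X p • realBasis p := by
  ext i j
  rw [Fintype.sum_prod_type, Matrix.sum_apply, Finset.sum_eq_single (i, j)]
  · simp [realCoord, realBasis, Complex.re_add_im]
  · rintro ⟨a, b⟩ - h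
    have : ¬(a = i ∧ b = j) := fun h' => h (by rw [h'.1, h'.2])
    simp [realCoord, realBasis, this]
  · simp

theorem abs_realCoord_le (X : Matrix (Fin n) (Fin n) ℂ) (p : (Fin n × Fin n) × Bool) :
    |realCoord X p| ≤ entryNorm (NormedField.toAbsoluteValue ℂ) X := by
  have h := le_entryNorm (N := NormedField.toAbsoluteValue ℂ) X p.1.1 p.1.2
  refine le_trans ?_ h
  rw [realCoord]
  split_ifs
  · exact Complex.abs_re_le_norm _
  · exact Complex.abs_im_le_norm _

theorem IsSmoothGL.rightDeriv_eq_sum {f : GL (Fin n) ℂ → ℂ} (hf : IsSmoothGL f)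
    (X : Matrix (Fin n) (Fin n) ℂ) :
    _root_.rightDeriv X f = fun g => ∑ p, realCoord X p • _root_.rightDeriv (realBasis p) f g := by
  funext g
  simp only [hf.rightDeriv_eq]
  have h : matEntries ((g : Matrix (Fin n) (Fin n) ℂ) * X) =
      ∑ p, realCoord X p • matEntries ((g : Matrix (Fin n) (Fin n) ℂ) * realBasis p) := by
    conv_lhs => rw [sum_realCoord X]
    rw [Finset.mul_sum]
    funext i j
    simp only [matEntries, Matrix.sum_apply, Finset.sum_apply, Pi.smul_apply, Matrix.mul_smul,
      Matrix.smul_apply]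
  rw [h, map_sum]
  simp only [map_smul]

/-- Uniform decay of the iterated derivatives in all directions. -/
theorem exists_norm_iterate_rightDeriv_le : ∀ (K : ℕ) {f : GL (Fin n) ℂ → ℂ}, IsSmoothGL f →
    (∀ (Xs : List (Matrix (Fin n) (Fin n) ℂ)) (M : ℕ), ∃ C : ℝ, ∀ g,
      ‖Xs.foldr rightDeriv f g‖ * glNorm g ^ M ≤ C) → ∀ M : ℕ, ∃ C, 0 ≤ C ∧ ∀ X g,
        ‖(rightDeriv X)^[K] f g‖ * glNorm g ^ M ≤
          C * entryNorm (NormedField.toAbsoluteValue ℂ) X ^ K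
  | 0, f, _, h, M => by
    obtain ⟨C, hC⟩ := h [] M
    refine ⟨max C 0, le_max_right _ _, fun X g => ?_⟩
    rw [pow_zero, mul_one]
    exact (hC g).trans (le_max_left _ _)
  | K + 1, f, hf, h, M => by
    have h1 : ∀ p : (Fin n × Fin n) × Bool, ∃ C, 0 ≤ C ∧ ∀ X g,
        ‖(rightDeriv X)^[K] (rightDeriv (realBasis p) f) g‖ * glNorm g ^ M ≤
          C * entryNorm (NormedField.toAbsoluteValue ℂ) X ^ K := fun p =>
      exists_norm_iterate_rightDeriv_le K (hf.rightDeriv _) (fun Xs M => by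
        obtain ⟨C, hC⟩ := h (Xs ++ [realBasis p]) M
        refine ⟨C, fun g => ?_⟩
        have := hC g
        rwa [List.foldr_append] at this) M
    choose C hC hb using h1
    refine ⟨∑ p, C p, Finset.sum_nonneg fun p _ => hC p, fun X g => ?_⟩
    have hX := entryNorm_nonneg (N := NormedField.toAbsoluteValue ℂ) X
    have hg : 0 ≤ glNorm g ^ M := by
      refine pow_nonneg ?_ _
      rw [glNorm]
      positivity
    rw [Function.iterate_succ_apply, hf.rightDeriv_eq_sum X,
      iterate_rightDeriv_sum X (fun p => hf.rightDeriv _) _ K]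
    calc _ ≤ (∑ p, ‖realCoord X p • (rightDeriv X)^[K] (rightDeriv (realBasis p) f) g‖) *
          glNorm g ^ M := mul_le_mul_of_nonneg_right (norm_sum_le _ _) hg
      _ = ∑ p, |realCoord X p| *
          (‖(rightDeriv X)^[K] (rightDeriv (realBasis p) f) g‖ * glNorm g ^ M) := by
          rw [Finset.sum_mul]
          refine Finset.sum_congr rfl fun p _ => ?_
          rw [norm_smul, Real.norm_eq_abs, mul_assoc]
      _ ≤ ∑ p, entryNorm (NormedField.toAbsoluteValue ℂ) X *
          (C p * entryNorm (NormedField.toAbsoluteValue ℂ) X ^ K) :=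
          Finset.sum_le_sum fun p _ => mul_le_mul (abs_realCoord_le X p) (hb p X g)
            (by positivity) hX
      _ = _ := by
          rw [Finset.sum_mul]
          refine Finset.sum_congr rfl fun p _ => ?_
          ring

end Complex

/-- A finite difference is bounded by the derivative of the same order. -/
theorem norm_fwdDiff_iter_le_of_hasDerivAt {B : ℝ} : ∀ (K : ℕ) {φ : ℕ → ℝ → ℂ} (a : ℝ),
    (∀ k t, HasDerivAt (φ k) (φ (k + 1) t) t) → (∀ t ∈ Set.Icc a (a + K), ‖φ K t‖ ≤ B) →
      ‖(fwdDiff (1 : ℝ))^[K] (φ 0) a‖ ≤ B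
  | 0, φ, a, _, hB => hB a (by simp)
  | K + 1, φ, a, hφ, hB => by
    rw [Function.iterate_succ_apply]
    refine norm_fwdDiff_iter_le_of_hasDerivAt K (φ := fun k => fwdDiff 1 (φ k)) a ?_ ?_
    · intro k t
      exact ((hφ k (t + 1)).comp_add_const t 1).sub (hφ k t)
    · intro t ht
      have h1 : ∀ x ∈ Set.Icc t (t + 1), HasDerivWithinAt (φ K) (φ (K + 1) x)
          (Set.Icc t (t + 1)) x := fun x _ => (hφ K x).hasDerivWithinAt
      have h2 : ∀ x ∈ Set.Ico t (t + 1), ‖φ (K + 1) x‖ ≤ B := fun x hx => by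
        refine hB x ⟨ht.1.trans hx.1, ?_⟩
        push_cast
        linarith [hx.2, ht.2]
      have h3 := norm_image_sub_le_of_norm_deriv_le_segment' h1 h2 (t + 1) (by simp)
      simpa [fwdDiff] using h3


/-! ### Bounds for Schwartz functions -/

section Bounds

open Matrix

variable {E : Type*} [Field E] {n : ℕ}

/-- Continuous functions on `GL_n(E)` which decay faster than any power of the height. -/
structure IsDecayingGL [TopologicalSpace E] (N : AbsoluteValue E ℝ) (f : GL (Fin n) E → ℂ) :
    Prop where
  continuous : Continuous f
  exists_le : ∀ M, ∃ C, 0 ≤ C ∧ ∀ g, ‖f g‖ ≤ C * heightDecay N M g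

/-- The properties of Schwartz functions which are used: `f` decays faster than any power of the
height, and so do its finite differences along lines of unipotent matrices `1 + j X` with `X² = 0`,
those of order `K` being moreover of order `‖X‖ ^ K` for bounded `X`. -/
structure IsRapidGL [TopologicalSpace E] (N : AbsoluteValue E ℝ) (f : GL (Fin n) E → ℂ) : Prop
    extends IsDecayingGL N f where
  exists_fwdDiff_le : ∀ M K, ∃ C, 0 ≤ C ∧ ∀ (g : GL (Fin n) E)
    (X : Matrix (Fin n) (Fin n) E) (γ : ℤ → GL (Fin n) E), X * X = 0 → entryNorm N X ≤ 1 →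
      (∀ j, (γ j : Matrix (Fin n) (Fin n) E) = 1 + (j : E) • X) →
        ‖(fwdDiff (1 : ℤ))^[K] (fun j => f (g * γ j)) 0‖ ≤
          C * heightDecay N M g * entryNorm N X ^ K

theorem coe_inv_one_add {X : Matrix (Fin n) (Fin n) E} (hX : X * X = 0) {a : E}
    {u : GL (Fin n) E} (hu : (u : Matrix (Fin n) (Fin n) E) = 1 + a • X) :
    ((u⁻¹ : GL (Fin n) E) : Matrix (Fin n) (Fin n) E) = 1 + (-a) • X := by
  have h1 : (u : Matrix (Fin n) (Fin n) E) * (1 + (-a) • X) = 1 := by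
    rw [hu, add_mul, one_mul, mul_add, mul_one, Matrix.smul_mul, Matrix.mul_smul, hX]
    simp
  calc ((u⁻¹ : GL (Fin n) E) : Matrix (Fin n) (Fin n) E)
      = ((u⁻¹ : GL (Fin n) E) : Matrix (Fin n) (Fin n) E) *
          ((u : Matrix (Fin n) (Fin n) E) * (1 + (-a) • X)) := by rw [h1, mul_one]
    _ = _ := by rw [← mul_assoc, u.inv_mul, one_mul]

theorem height_one_add_le {N : AbsoluteValue E ℝ} {X : Matrix (Fin n) (Fin n) E} (hX : X * X = 0)
    (hX1 : entryNorm N X ≤ 1) {a : E} {u : GL (Fin n) E}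
    (hu : (u : Matrix (Fin n) (Fin n) E) = 1 + a • X) {c : ℝ} (ha : N a ≤ c) :
    height N u ≤ (1 + n + c) ^ 2 := by
  have h0 := entryNorm_nonneg (N := N) X
  have hc : 0 ≤ c := (N.nonneg a).trans ha
  have h1 : ∀ b : E, N b ≤ c → 1 + entryNorm N (1 + b • X) ≤ 1 + n + c := by
    intro b hb
    have h2 := entryNorm_add_le (N := N) 1 (b • X)
    rw [entryNorm_one, entryNorm_smul] at h2
    have h3 := mul_le_mul hb hX1 h0 hc
    linarith
  rw [height, coe_inv_one_add hX hu, hu, sq]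
  refine mul_le_mul (h1 a ha) (h1 (-a) (by rwa [N.map_neg])) ?_ (by positivity)
  linarith [entryNorm_nonneg (N := N) (1 + (-a) • X)]

theorem heightDecay_mul_one_add_le {N : AbsoluteValue E ℝ} {X : Matrix (Fin n) (Fin n) E}
    (hX : X * X = 0) (hX1 : entryNorm N X ≤ 1) {a : E} {u : GL (Fin n) E}
    (hu : (u : Matrix (Fin n) (Fin n) E) = 1 + a • X) {c : ℝ} (ha : N a ≤ c) (M : ℕ)
    (g : GL (Fin n) E) : heightDecay N M (g * u) ≤
      (1 + n + c) ^ (2 * M) * heightDecay N M g := by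
  refine (heightDecay_mul_le_right M g u).trans ?_
  have h1 := pow_le_pow_left₀ (height_pos u).le (height_one_add_le hX hX1 hu ha) M
  rw [← pow_mul] at h1
  rw [mul_comm]
  exact mul_le_mul_of_nonneg_right h1 (heightDecay_pos M g).le

/-- Locally constant functions with compact support are uniformly locally constant. -/
theorem eventually_forall_mul_eq {G : Type*} [Group G] [TopologicalSpace G] [IsTopologicalGroup G]
    {f : G → ℂ} (hf : IsLocallyConstant f) (hc : HasCompactSupport f) :
    ∀ᶠ u in 𝓝 (1 : G), ∀ g, f (g * u) = f g := by
  have h1 : ∀ᶠ u in 𝓝 (1 : G), ∀ g ∈ tsupport f, f (g * u) = f g := by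
    refine IsCompact.eventually_forall_of_forall_eventually hc fun g _ => ?_
    have h2 : IsLocallyConstant fun p : G × G => f (p.2 * p.1) :=
      hf.comp_continuous (continuous_snd.mul continuous_fst)
    have h3 : IsLocallyConstant fun p : G × G => f p.2 := hf.comp_continuous continuous_snd
    filter_upwards [h2.eventually_eq (1, g), h3.eventually_eq (1, g)] with p hp1 hp2
    rw [hp1, hp2, mul_one]
  have h4 : ∀ᶠ u in 𝓝 (1 : G), ∀ g ∈ tsupport f, f (g * u⁻¹) = f g := by
    have : Tendsto (fun u : G => u⁻¹) (𝓝 1) (𝓝 1) := by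
      have := continuous_inv.tendsto (1 : G)
      rwa [inv_one] at this
    exact this.eventually h1
  filter_upwards [h1, h4] with u hu1 hu2 g
  by_cases hg : g ∈ tsupport f
  · exact hu1 g hg
  rw [image_eq_zero_of_notMem_tsupport hg]
  by_contra hne
  have h5 : g * u ∈ tsupport f := subset_tsupport f hne
  have h6 := hu2 (g * u) h5
  rw [mul_inv_cancel_right, image_eq_zero_of_notMem_tsupport hg] at h6
  exact hne h6.symm

variable [TopologicalSpace E] [IsLocalField E] {N : AbsoluteValue E ℝ}

theorem IsProperAbs.exists_forall_entryNorm_le (hN : IsProperAbs N) {p : GL (Fin n) E → Prop}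
    (hp : ∀ᶠ u in 𝓝 1, p u) : ∃ ε, 0 < ε ∧ ∀ u : GL (Fin n) E,
      entryNorm N ((u : Matrix (Fin n) (Fin n) E) - 1) ≤ ε → p u := by
  by_contra! hne
  choose u hu hpu using fun k : ℕ => hne (1 / ((k : ℝ) + 1)) Nat.one_div_pos_of_nat
  have hlim : Tendsto u atTop (𝓝 1) := by
    rw [isEmbedding_GL_val.tendsto_nhds_iff]
    refine tendsto_pi_nhds.2 fun i => tendsto_pi_nhds.2 fun j => ?_
    rw [← tendsto_sub_nhds_zero_iff]
    intro U hU
    obtain ⟨ε, hε, hball⟩ := hN.exists_ball_subset hU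
    have h1 := (tendsto_one_div_add_atTop_nhds_zero_nat (𝕜 := ℝ)).eventually (gt_mem_nhds hε)
    rw [mem_map]
    filter_upwards [h1] with k hk
    exact hball (((le_entryNorm (N := N) ((u k : Matrix (Fin n) (Fin n) E) - 1) i j).trans
      (hu k)).trans_lt hk)
  obtain ⟨k, hk⟩ := (hlim.eventually hp).exists
  exact hpu k hk

/-- A locally constant function of compact support is uniformly invariant under right translation by
matrices close to `1`, so that the differences vanish for small `X`; for the other `X` the factor
`‖X‖ ^ K` is bounded below. -/
theorem isRapidGL_of_locallyConstant (hN : IsProperAbs N) {f : GL (Fin n) E → ℂ}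
    (hf : IsLocallyConstant f) (hc : HasCompactSupport f) : IsRapidGL N f := by
  have hle : ∀ M, ∃ C, 0 ≤ C ∧ ∀ g, ‖f g‖ ≤ C * heightDecay N M g := by
    intro M
    have h1 : Continuous fun g => f g * ((height N g ^ M : ℝ) : ℂ) :=
      hf.continuous.mul (Complex.continuous_ofReal.comp (hN.continuous_height.pow M))
    obtain ⟨C, hC⟩ := h1.bounded_above_of_compact_support hc.mul_right
    refine ⟨max C 0, le_max_right _ _, fun g => ?_⟩
    have h2 := (hC g).trans (le_max_left C 0)
    have h3 : 0 < height N g ^ M := pow_pos (height_pos g) M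
    rw [norm_mul, Complex.norm_real, Real.norm_of_nonneg h3.le] at h2
    rwa [heightDecay, ← div_eq_mul_inv, le_div_iff₀ h3]
  refine ⟨⟨hf.continuous, hle⟩, fun M K => ?_⟩
  obtain ⟨C, hC0, hC⟩ := hle M
  rcases K with _ | K
  · refine ⟨C, hC0, fun g X γ hX _ hγ => ?_⟩
    have h1 : γ 0 = 1 := Units.ext (by rw [hγ 0]; simp)
    simpa [h1] using hC g
  obtain ⟨ε, hε, hball⟩ := hN.exists_forall_entryNorm_le (eventually_forall_mul_eq hf hc)
  have hn : (0 : ℝ) ≤ n := by positivity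
  refine ⟨2 ^ (K + 1) * C * (1 + n + (K + 1)) ^ (2 * M) * ((K + 1) / ε) ^ (K + 1), by positivity,
    fun g X γ hX hX1 hγ => ?_⟩
  have hX0 := entryNorm_nonneg (N := N) X
  have hnat : ∀ j : ℕ, j ≤ K + 1 → N ((((0 : ℤ) + j • (1 : ℤ) : ℤ)) : E) ≤ K + 1 := by
    intro j hj
    have h1 : (((0 : ℤ) + j • (1 : ℤ) : ℤ) : E) = (j : E) := by simp
    rw [h1]
    exact (N.apply_nat_le_self j).trans (by exact_mod_cast hj)
  have hD := heightDecay_pos (N := N) M g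
  by_cases hsmall : (K + 1) * entryNorm N X ≤ ε
  · have h1 : ∀ j : ℕ, j ≤ K + 1 → f (g * γ (0 + j • 1)) = f g := by
      intro j hj
      refine hball _ ?_ g
      rw [hγ, add_sub_cancel_left, entryNorm_smul]
      exact (mul_le_mul_of_nonneg_right (hnat j hj) hX0).trans hsmall
    rw [Function.iterate_succ_apply]
    have h2 := norm_fwdDiff_iter_le (1 : ℤ) (f := fwdDiff (1 : ℤ) fun j => f (g * γ j)) (s := 0)
      (B := 0) K fun j hj => by
        have h3 := h1 (j + 1) (by omega)
        rw [succ_nsmul, ← add_assoc] at h3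
        rw [fwdDiff, h3, h1 j (by omega), sub_self, norm_zero]
    rw [mul_zero] at h2
    exact h2.trans (by positivity)
  · push Not at hsmall
    have h1 : 1 ≤ ((K + 1) / ε) ^ (K + 1) * entryNorm N X ^ (K + 1) := by
      rw [← mul_pow]
      refine one_le_pow₀ ?_
      rw [div_mul_eq_mul_div, one_le_div hε]
      exact hsmall.le
    have h2 : ∀ j ≤ K + 1, ‖f (g * γ (0 + j • 1))‖ ≤ C * ((1 + n + (K + 1)) ^ (2 * M) *
        heightDecay N M g) := fun j hj =>
      (hC _).trans (mul_le_mul_of_nonneg_left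
        (heightDecay_mul_one_add_le hX hX1 (hγ _) (hnat j hj) M g) hC0)
    refine (norm_fwdDiff_iter_le (1 : ℤ) (K + 1) h2).trans ?_
    set A := 2 ^ (K + 1) * (C * ((1 + n + (K + 1)) ^ (2 * M) *
        heightDecay N M g)) with hA
    have hA0 : 0 ≤ A := by positivity
    calc A ≤ A * (((K + 1) / ε) ^ (K + 1) * entryNorm N X ^ (K + 1)) :=
          le_mul_of_one_le_right hA0 h1
      _ = _ := by
          rw [hA]
          ring

omit [TopologicalSpace E] [IsLocalField E] in
theorem height_map {L : Type*} [Field L] {N : AbsoluteValue E ℝ} {N' : AbsoluteValue L ℝ}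
    (e : E ≃+* L) (he : ∀ x, N x = N' (e x)) (g : GL (Fin n) E) :
    height N' (GeneralLinearGroup.map (e : E →+* L) g) = height N g := by
  have h : ∀ X : Matrix (Fin n) (Fin n) E, entryNorm N' (X.map e) = entryNorm N X := fun X => by
    simp [entryNorm, he]
  rw [height, height, ← map_inv]
  exact congrArg₂ _ (congrArg _ (h _)) (congrArg _ (h _))

theorem isRapidGL_of_complex {N : AbsoluteValue E ℝ} {f : GL (Fin n) E → ℂ} (e : E ≃+* ℂ)
    (he : IsHomeomorph e) (hNe : ∀ x, N x = ‖e x‖)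
    (hf : IsSchwartzComplex fun g => f (GeneralLinearGroup.map (e.symm : ℂ →+* E) g)) :
    IsRapidGL N f := by
  set F : GL (Fin n) ℂ → ℂ := fun g => f (GeneralLinearGroup.map (e.symm : ℂ →+* E) g) with hF
  set φ : GL (Fin n) E →* GL (Fin n) ℂ := GeneralLinearGroup.map (e : E →+* ℂ) with hφ
  have hFφ : ∀ g, f g = F (φ g) := fun g => by
    rw [hF]
    refine congrArg f (Units.ext ?_)
    ext i j
    simp [hφ]
  set A := NormedField.toAbsoluteValue ℂ with hA
  have hheight : ∀ g, height A (φ g) = height N g := fun g => height_map e hNe g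
  have hentry : ∀ X : Matrix (Fin n) (Fin n) E, entryNorm A (X.map e) = entryNorm N X := fun X => by
    simp only [entryNorm, hNe]
    rfl
  obtain ⟨hsm, hdec⟩ := hf
  have hglpos : ∀ g : GL (Fin n) ℂ, 0 < glNorm g := fun g => by
    rw [glNorm]
    positivity
  set c : ℝ := 1 + n * n * n.factorial with hc
  have hc0 : 0 < c := by positivity
  have hgl : ∀ g : GL (Fin n) ℂ, height A g ≤ c * glNorm g ^ (n + 2) := fun g =>
    height_le_of_det (N := A) g
  have hder := fun K => exists_norm_iterate_rightDeriv_le K hsm fun Xs M => hdec Xs [] M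
  -- the same bounds, in terms of the height
  have hder' : ∀ K M, ∃ C, 0 ≤ C ∧ ∀ X g, ‖(rightDeriv X)^[K] F g‖ ≤
      C * heightDecay A M g * entryNorm A X ^ K := by
    intro K M
    obtain ⟨C, hC0, hC⟩ := hder K ((n + 2) * M)
    refine ⟨C * c ^ M, by positivity, fun X g => ?_⟩
    have h1 := pow_le_pow_left₀ (height_pos g).le (hgl g) M
    rw [mul_pow, ← pow_mul] at h1
    have h2 := hC X g
    have h3 : 0 < height A g ^ M := pow_pos (height_pos g) M
    have h4 : ‖(rightDeriv X)^[K] F g‖ * height A g ^ M ≤ C * c ^ M * entryNorm A X ^ K := by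
      calc _ ≤ ‖(rightDeriv X)^[K] F g‖ * (c ^ M * glNorm g ^ ((n + 2) * M)) := by gcongr
        _ = c ^ M * (‖(rightDeriv X)^[K] F g‖ * glNorm g ^ ((n + 2) * M)) := by ring
        _ ≤ c ^ M * (C * entryNorm A X ^ K) := by gcongr
        _ = _ := by ring
    rw [← le_div_iff₀ h3] at h4
    refine h4.trans_eq ?_
    rw [heightDecay]
    ring
  have hcont : Continuous φ :=
    Continuous.units_map ((e : E →+* ℂ).mapMatrix (m := Fin n)).toMonoidHom
      (continuous_id.matrix_map he.continuous)
  refine ⟨⟨?_, fun M => ?_⟩, fun M K => ?_⟩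
  · exact (hsm.continuous.comp hcont).congr fun g => (hFφ g).symm
  · obtain ⟨C, hC0, hC⟩ := hder' 0 M
    refine ⟨C, hC0, fun g => ?_⟩
    have h1 := hC 0 (φ g)
    rw [pow_zero, mul_one, heightDecay, hheight] at h1
    rw [hFφ]
    exact h1
  · obtain ⟨C, hC0, hC⟩ := hder' K M
    refine ⟨C * (1 + n + K) ^ (2 * M), by positivity, fun g X γ hX hX1 hγ => ?_⟩
    set Z := X.map e with hZ
    have hZ0 : Z * Z = 0 := by
      have := congrArg (fun W : Matrix (Fin n) (Fin n) E => W.map (e : E →+* ℂ)) hX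
      simpa [Matrix.map_mul] using this
    have h0 : (fun j : ℤ => f (g * γ j)) = fun j : ℤ => F (φ g * expGL ((j : ℝ) • Z)) := by
      funext j
      rw [hFφ, map_mul]
      congr 2
      refine Units.ext ?_
      rw [expGL_smul_of_sq_eq_zero hZ0]
      change (γ j : Matrix (Fin n) (Fin n) E).map (e : E →+* ℂ) = _
      rw [hγ j]
      ext a b
      simp [hZ, Matrix.one_apply, apply_ite e]
    have h1 : (fwdDiff (1 : ℤ))^[K] (fun j : ℤ => f (g * γ j)) 0 =
        (fwdDiff (1 : ℝ))^[K] (fun t : ℝ => F (φ g * expGL (t • Z))) 0 := by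
      rw [h0, fwdDiff_iter_eq_sum_shift, fwdDiff_iter_eq_sum_shift]
      simp
    rw [← hentry X] at hX1 ⊢
    rw [h1]
    refine norm_fwdDiff_iter_le_of_hasDerivAt K
      (φ := fun k t => (rightDeriv Z)^[k] F (φ g * expGL (t • Z))) 0 ?_ ?_
    · intro k t
      have := (hsm.iterate_rightDeriv Z k).hasDerivAt_mul_expGL Z (φ g) t
      rwa [← Function.iterate_succ_apply' (rightDeriv Z) k F] at this
    · intro t ht
      rw [zero_add] at ht
      have h2 := heightDecay_mul_one_add_le (N := A) hZ0 hX1 (a := (t : ℂ))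
        (expGL_smul_of_sq_eq_zero hZ0 t) (c := K) (by
          change ‖(t : ℂ)‖ ≤ K
          rw [Complex.norm_real, Real.norm_of_nonneg ht.1]
          exact ht.2) M (φ g)
      have h3 : heightDecay A M (φ g) = heightDecay N M g := by rw [heightDecay, hheight, heightDecay]
      rw [h3] at h2
      have hZn := entryNorm_nonneg (N := A) Z
      calc _ ≤ C * heightDecay A M (φ g * expGL (t • Z)) * entryNorm A Z ^ K := hC _ _
        _ ≤ C * ((1 + n + K) ^ (2 * M) * heightDecay N M g) *
            entryNorm A Z ^ K := by gcongr
        _ = _ := by ring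

/-- A Schwartz function has rapid decay, with respect to a suitable absolute value. -/
theorem IsSchwartzGL.exists_isRapidGL {f : GL (Fin n) E → ℂ} (hf : IsSchwartzGL f) :
    ∃ N : AbsoluteValue E ℝ, IsProperAbs N ∧ IsRapidGL N f := by
  rcases hf with ⟨-, h1, h2⟩ | ⟨e, he, h⟩
  · obtain ⟨N, hN⟩ := exists_isProperAbs E
    exact ⟨N, hN, isRapidGL_of_locallyConstant hN h1 h2⟩
  · obtain ⟨N, hN, hNe⟩ := exists_isProperAbs_of_normed e he
    exact ⟨N, hN, isRapidGL_of_complex e he hNe h⟩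

end Bounds

/-! ### Fourier coefficients along the twisted unipotent matrices -/

section Fourier

open Matrix

variable {F E : Type*} [Field F] [TopologicalSpace F] [IsLocalField F] [MeasurableSpace F]
  [BorelSpace F] [Field E] [TopologicalSpace E] [IsLocalField E] [Algebra F E]
  [ContinuousSMul F E] [CharZero F] {N : AbsoluteValue E ℝ} (hN : IsProperAbs N)
  (S : RowSection (N.restrict F)) {τ : E} {σ : E ≃ₐ[F] E}
  (h : IsTraceZeroGenerator τ σ) {n : ℕ}

include hN h

theorem exists_heightDecay_twist_le (M : ℕ) : ∃ M' : ℕ, ∃ C, 0 ≤ C ∧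
    ∀ (Y s : TriIdx n → F) (g : GL (Fin n) F),
      heightDecay N M' (twist S.k τ n Y s * baseChangeGL n F E g) ≤
        C * (prodHeight (N.restrict F) s ^ M)⁻¹ *
          heightDecay N M (baseChangeGL n F E g) := by
  obtain ⟨D, hD, hσ⟩ := h.exists_conj_le hN
  obtain ⟨C, hC, r, hr⟩ := h.exists_prodHeight_mul_height_le S hD hσ n
  refine ⟨r * M, C ^ M, by positivity, fun Y s g => ?_⟩
  have h1 := pow_le_pow_left₀ (mul_pos (prodHeight_pos s) (height_pos _)).le (hr Y s g) M
  rw [mul_pow, mul_pow, ← pow_mul] at h1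
  have hP := pow_pos (prodHeight_pos (N := N.restrict F) s) M
  have hg := pow_pos (height_pos (N := N) (baseChangeGL n F E g)) M
  have hH := pow_pos (height_pos (N := N) (twist S.k τ n Y s * baseChangeGL n F E g)) (r * M)
  rw [heightDecay, heightDecay, mul_assoc, ← mul_inv, ← div_eq_mul_inv, inv_eq_one_div,
    div_le_div_iff₀ hH (by positivity), one_mul]
  exact h1

theorem IsDecayingGL.exists_norm_twist_le {f : GL (Fin n) E → ℂ} (hf : IsDecayingGL N f) (M : ℕ) :
    ∃ C, 0 ≤ C ∧ ∀ (Y s : TriIdx n → F) (g : GL (Fin n) F),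
      ‖f (twist S.k τ n Y s * baseChangeGL n F E g)‖ ≤
        C * (prodHeight (N.restrict F) s ^ M)⁻¹ *
          heightDecay N M (baseChangeGL n F E g) := by
  obtain ⟨M', C, hC, hle⟩ := exists_heightDecay_twist_le hN S h (n := n) M
  obtain ⟨B, hB, hb⟩ := hf.exists_le M'
  refine ⟨B * C, by positivity, fun Y s g => (hb _).trans ?_⟩
  refine (mul_le_mul_of_nonneg_left (hle Y s g) hB).trans_eq (by ring)

omit [TopologicalSpace F] [IsLocalField F] [MeasurableSpace F] [BorelSpace F] [CharZero F]
  [TopologicalSpace E] [IsLocalField E] [ContinuousSMul F E] hN h in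
theorem prodHeight_le_add_single (s : TriIdx n → F) (t : TriIdx n) {x : F} {a : ℝ}
    (hx : N.restrict F x ≤ a) :
    prodHeight (N.restrict F) s ≤
      (1 + a) * prodHeight (N.restrict F) (s + Pi.single t x) := by
  set A := N.restrict F
  have ha : 0 ≤ a := (A.nonneg x).trans hx
  obtain ⟨y, hy⟩ : ∃ y, y = s + Pi.single t x := ⟨_, rfl⟩
  rw [← hy, prodHeight, prodHeight, ← Finset.mul_prod_erase _ _ (Finset.mem_univ t),
    ← Finset.mul_prod_erase _ (fun i => max 1 (A (y i))) (Finset.mem_univ t), ← mul_assoc]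
  have h1 : ∏ i ∈ Finset.univ.erase t, max 1 (A (s i)) =
      ∏ i ∈ Finset.univ.erase t, max 1 (A (y i)) :=
    Finset.prod_congr rfl fun i hi => by
      rw [hy, Pi.add_apply, Pi.single_eq_of_ne (Finset.ne_of_mem_erase hi), add_zero]
  rw [h1]
  refine mul_le_mul_of_nonneg_right ?_ (Finset.prod_nonneg fun _ _ => by positivity)
  rw [hy, Pi.add_apply, Pi.single_eq_same]
  have h2 : A (s t) ≤ A (s t + x) + A x := by
    have := A.add_le (s t + x) (-x)
    rwa [add_neg_cancel_right, A.map_neg] at this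
  have h3 := le_max_left 1 (A (s t + x))
  have h4 := le_max_right 1 (A (s t + x))
  refine max_le ?_ ?_ <;> nlinarith

/-- Finite differences of `s ↦ f(A_Y(s) g)`. -/
theorem IsRapidGL.exists_norm_fwdDiff_twist_le {f : GL (Fin n) E → ℂ} (hf : IsRapidGL N f) :
    ∃ r : ℕ, ∀ (M K : ℕ) (a : ℝ), 0 ≤ a → ∃ C, 0 ≤ C ∧
      ∀ (Y s : TriIdx n → F) (g : GL (Fin n) F) (t : TriIdx n) (x : F),
        N.restrict F x ≤ a →
          ‖(fwdDiff (Pi.single t x))^[K]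
            (fun s => f (twist S.k τ n Y s * baseChangeGL n F E g)) s‖ ≤
          C * (prodHeight (N.restrict F) s ^ M)⁻¹ *
            heightDecay N M (baseChangeGL n F E g) *
            (N.restrict F x * height N (baseChangeGL n F E g) *
              prodHeight (N.restrict F) s ^ r) ^ K := by
  obtain ⟨B, hB, r, hr⟩ := exists_twist_add_single S (τ := τ) (N := N) n
  refine ⟨r, fun M K a ha => ?_⟩
  obtain ⟨M', C₁, hC₁, hle⟩ := exists_heightDecay_twist_le hN S h (n := n) M
  obtain ⟨C₂, hC₂, hdiff⟩ := hf.exists_fwdDiff_le M' K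
  obtain ⟨C₃, hC₃, hval⟩ := hf.toIsDecayingGL.exists_norm_twist_le hN S h M
  refine ⟨(C₂ * C₁ + 2 ^ K * (C₃ * (1 + K * a) ^ M)) * B ^ K, by positivity,
    fun Y s g t x hx => ?_⟩
  obtain ⟨X, hX0, hXn, hX⟩ := hr Y s t
  set b := baseChangeGL n F E g with hb
  set P := prodHeight (N.restrict F) s
  have hP : 0 < P := prodHeight_pos s
  have hH : 0 < height N b := height_pos b
  have hD := heightDecay_pos (N := N) M b
  set Z := algebraMap F E x • (((b⁻¹ : GL (Fin n) E) : Matrix (Fin n) (Fin n) E) * X *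
    (b : Matrix (Fin n) (Fin n) E)) with hZ
  have hZn0 := entryNorm_nonneg (N := N) Z
  have hbb : (b : Matrix (Fin n) (Fin n) E) * ((b⁻¹ : GL (Fin n) E) : Matrix (Fin n) (Fin n) E) =
      1 := b.mul_inv
  have hZ0 : Z * Z = 0 := by
    rw [hZ, Matrix.smul_mul, Matrix.mul_smul]
    have h1 : ((b⁻¹ : GL (Fin n) E) : Matrix (Fin n) (Fin n) E) * X * b *
        (((b⁻¹ : GL (Fin n) E) : Matrix (Fin n) (Fin n) E) * X * b) =
        ((b⁻¹ : GL (Fin n) E) : Matrix (Fin n) (Fin n) E) * X *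
          ((b : Matrix (Fin n) (Fin n) E) *
            ((b⁻¹ : GL (Fin n) E) : Matrix (Fin n) (Fin n) E)) * X * b := by
      simp only [mul_assoc]
    rw [h1, hbb, mul_one, mul_assoc _ X X, hX0, mul_zero, zero_mul, smul_zero, smul_zero]
  have hZn : entryNorm N Z ≤ B * (N.restrict F x * height N b * P ^ r) := by
    rw [hZ, entryNorm_smul]
    have h1 := (entryNorm_conj_le (N := N) b X).trans (mul_le_mul_of_nonneg_left hXn hH.le)
    calc _ ≤ N.restrict F x * (height N b * (B * P ^ r)) := mul_le_mul_of_nonneg_left h1 (N.nonneg _)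
      _ = _ := by ring
  have hZK := pow_le_pow_left₀ hZn0 hZn K
  rw [mul_pow] at hZK
  -- both estimates below are of this form
  suffices hs : ‖(fwdDiff (Pi.single t x))^[K] (fun s => f (twist S.k τ n Y s * b)) s‖ ≤
      (C₂ * C₁ + 2 ^ K * (C₃ * (1 + K * a) ^ M)) * ((P ^ M)⁻¹ * heightDecay N M b) *
        entryNorm N Z ^ K by
    refine hs.trans ?_
    calc _ ≤ (C₂ * C₁ + 2 ^ K * (C₃ * (1 + K * a) ^ M)) * ((P ^ M)⁻¹ * heightDecay N M b) *
          (B ^ K * (N.restrict F x * height N b * P ^ r) ^ K) := by gcongr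
      _ = _ := by ring
  -- for small `Z` the Schwartz bound along the line `1 + j Z` applies; for large `Z` it suffices to
  -- bound each of the `2 ^ K` values
  rcases le_or_gt (entryNorm N Z) 1 with h1 | h1
  · have hline : ∀ j : ℤ, ((b⁻¹ * (twist S.k τ n Y s)⁻¹ *
        twist S.k τ n Y (s + Pi.single t (j * x)) * b : GL (Fin n) E) :
          Matrix (Fin n) (Fin n) E) = 1 + (j : E) • Z := by
      intro j
      have h2 : ((twist S.k τ n Y s)⁻¹ * twist S.k τ n Y (s + Pi.single t (j * x)) :
          GL (Fin n) E) = (1 + algebraMap F E (j * x) • X : Matrix (Fin n) (Fin n) E) := by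
        rw [Units.val_mul, hX, ← mul_assoc, Units.inv_mul, one_mul]
      rw [mul_assoc b⁻¹, Units.val_mul, Units.val_mul, h2, mul_add, add_mul, mul_one,
        Units.inv_mul, hZ, map_mul, map_intCast, Matrix.mul_smul, Matrix.smul_mul, smul_smul]
    have h2 := hdiff (twist S.k τ n Y s * b) Z _ hZ0 h1 hline
    have h3 : (fwdDiff (Pi.single t x))^[K] (fun s => f (twist S.k τ n Y s * b)) s =
        (fwdDiff (1 : ℤ))^[K] (fun j : ℤ => f (twist S.k τ n Y s * b * (b⁻¹ *
          (twist S.k τ n Y s)⁻¹ * twist S.k τ n Y (s + Pi.single t (j * x)) * b))) 0 := by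
      rw [fwdDiff_iter_eq_sum_shift, fwdDiff_iter_eq_sum_shift]
      refine Finset.sum_congr rfl fun k _ => ?_
      congr 2
      have h4 : k • (Pi.single t x : TriIdx n → F) =
          Pi.single t ((((0 : ℤ) + k • (1 : ℤ) : ℤ) : F) * x) := by
        rw [← Pi.single_smul]
        simp
      rw [h4]
      group
    rw [h3]
    refine h2.trans ?_
    have h5 := hle Y s g
    rw [← hb] at h5
    calc _ ≤ C₂ * (C₁ * (P ^ M)⁻¹ * heightDecay N M b) * entryNorm N Z ^ K := by gcongr
      _ = C₂ * C₁ * ((P ^ M)⁻¹ * heightDecay N M b) * entryNorm N Z ^ K := by ring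
      _ ≤ _ := by
          gcongr
          exact le_add_of_nonneg_right (by positivity)
  · have h2 : ∀ j ≤ K, ‖f (twist S.k τ n Y (s + j • Pi.single t x) * b)‖ ≤
        C₃ * (1 + K * a) ^ M * ((P ^ M)⁻¹ * heightDecay N M b) := by
      intro j hj
      refine (hval Y _ g).trans ?_
      have hjx : N.restrict F (j • x) ≤ K * a := by
        rw [nsmul_eq_mul, map_mul]
        exact mul_le_mul (((N.restrict F).apply_nat_le_self j).trans (by exact_mod_cast hj)) hx ((N.restrict F).nonneg _)
          (by positivity)
      have h3 := prodHeight_le_add_single (N := N) s t hjx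
      rw [Pi.single_smul] at h3
      set Q := prodHeight (N.restrict F) (s + j • Pi.single t x) with hQ
      have hQ0 : 0 < Q := prodHeight_pos _
      have h4 : (Q ^ M)⁻¹ ≤ (1 + K * a) ^ M * (P ^ M)⁻¹ := by
        rw [← div_eq_mul_inv, inv_eq_one_div, div_le_div_iff₀ (by positivity) (by positivity),
          one_mul, ← mul_pow]
        exact pow_le_pow_left₀ hP.le h3 M
      calc _ ≤ C₃ * ((1 + K * a) ^ M * (P ^ M)⁻¹) * heightDecay N M b := by gcongr
        _ = _ := by ring
    refine (norm_fwdDiff_iter_le _ K h2).trans ?_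
    have h3 : 1 ≤ entryNorm N Z ^ K := one_le_pow₀ h1.le
    calc _ = 2 ^ K * (C₃ * (1 + K * a) ^ M) * ((P ^ M)⁻¹ * heightDecay N M b) * 1 := by ring
      _ ≤ _ := by
          refine mul_le_mul ?_ h3 zero_le_one (by positivity)
          gcongr
          exact le_add_of_nonneg_left (by positivity)

end Fourier

section FourierBound

open Matrix

variable {F E : Type*} [Field F] [TopologicalSpace F] [IsLocalField F] [MeasurableSpace F]
  [BorelSpace F] [Field E] [TopologicalSpace E] [IsLocalField E] [Algebra F E]
  [ContinuousSMul F E] [CharZero F] {N : AbsoluteValue E ℝ} (hN : IsProperAbs N)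
  (S : RowSection (N.restrict F)) {τ : E} {σ : E ≃ₐ[F] E}
  (h : IsTraceZeroGenerator τ σ) {n : ℕ} (μ : Measure F) [μ.IsAddHaarMeasure]

/-- The character `s ↦ ψ(d ∑ Y_t s_t)`. -/
def pairChar {ι : Type*} [Fintype ι] (ψ : AddChar F Circle) (d : F) (Y : ι → F) :
    AddChar (ι → F) Circle :=
  ψ.compAddMonoidHom
    { toFun := fun s => d * ∑ t, Y t * s t
      map_zero' := by simp
      map_add' := fun s s' => by simp [mul_add, Finset.sum_add_distrib] }

theorem pairChar_apply {ι : Type*} [Fintype ι] (ψ : AddChar F Circle) (d : F) (Y s : ι → F) :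
    pairChar ψ d Y s = ψ (d * ∑ t, Y t * s t) := rfl

theorem measurable_sum_mul {ι : Type*} [Fintype ι] (d : F) :
    Measurable fun p : (ι → F) × (ι → F) => d * ∑ t, p.1 t * p.2 t :=
  measurable_const.mul (Finset.measurable_sum _ fun t _ =>
    ((measurable_pi_apply t).comp measurable_fst).mul ((measurable_pi_apply t).comp measurable_snd))

theorem measurable_pairChar {ι : Type*} [Fintype ι] {ψ : AddChar F Circle} (hψ : Continuous ψ)
    (d : F) (Y : ι → F) : Measurable fun s => (pairChar ψ d Y s : ℂ) :=
  measurable_coe_addChar hψ ((measurable_sum_mul d).comp measurable_prodMk_left)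

theorem IsProperAbs.exists_integrable_prodHeight {A : AbsoluteValue F ℝ} (hA : IsProperAbs A) :
    ∃ M : ℕ, ∀ {ι : Type} [Fintype ι],
      Integrable (fun s : ι → F => (prodHeight A s ^ M)⁻¹) (Measure.pi fun _ => μ) := by
  obtain ⟨M, hM⟩ := hA.exists_integrable_prod_decay μ
  refine ⟨M, fun {ι} _ => ?_⟩
  simpa only [prod_decay_eq] using hM (ι := ι)

include hN h

theorem IsDecayingGL.integrable_twist {f : GL (Fin n) E → ℂ} (hf : IsDecayingGL N f)
    (Y : TriIdx n → F) (g : GL (Fin n) F) :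
    Integrable (fun s => f (twist S.k τ n Y s * baseChangeGL n F E g)) (triMeasure μ n) := by
  obtain ⟨M, hM⟩ := (h.isProperAbs_restrict hN).exists_integrable_prodHeight μ
  obtain ⟨C, hC, hle⟩ := hf.exists_norm_twist_le hN S h M
  refine ((hM (ι := TriIdx n)).const_mul (C * heightDecay N M (baseChangeGL n F E g))).mono'
    (hf.continuous.comp ((continuous_twist τ n Y).mul continuous_const)).aestronglyMeasurable
    (Eventually.of_forall fun s => (hle Y s g).trans_eq (by ring))

/-- The Fourier coefficients of `s ↦ f(A_Y(s) g)` at `Y` decay rapidly in `Y` and in `g`: this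
follows by taking finite differences in the direction of the largest coordinate of `Y`. -/
theorem IsRapidGL.exists_norm_integral_twist_le {f : GL (Fin n) E → ℂ} (hf : IsRapidGL N f)
    {ψ : AddChar F Circle} (hψ : Continuous ψ) (hψ1 : ψ ≠ 1) {d : F} (hd : d ≠ 0) (M : ℕ) :
    ∃ C, 0 ≤ C ∧ ∀ (Y : TriIdx n → F) (g : GL (Fin n) F),
      ‖∫ s, f (twist S.k τ n Y s * baseChangeGL n F E g) * (pairChar ψ d Y s : ℂ)
        ∂(triMeasure μ n)‖ ≤
        C * (∏ t, decay (N.restrict F) M (Y t)) *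
          heightDecay N M (baseChangeGL n F E g) := by
  have hNF := h.isProperAbs_restrict hN
  obtain ⟨M₀, hM₀⟩ := hNF.exists_integrable_prodHeight μ
  have hI := hM₀ (ι := TriIdx n)
  set J := ∫ s, (prodHeight (N.restrict F) s ^ M₀)⁻¹ ∂(triMeasure μ n) with hJ
  have hJ0 : 0 ≤ J := integral_nonneg fun s => by
    have := prodHeight_pos (N := N.restrict F) s
    positivity
  -- each difference with step `(d Y_t)⁻¹ x₀` in the direction `t` multiplies the coefficient by the
  -- non-zero constant `ψ (-x₀) - 1` and gains a factor `|Y_t|⁻¹`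
  obtain ⟨x₀, hx₀⟩ : ∃ x₀, ψ (-x₀) ≠ 1 := by
    by_contra! hall
    exact hψ1 (DFunLike.ext _ _ fun x => by simpa using hall (-x))
  set δ := ‖((ψ (-x₀) : Circle) : ℂ) - 1‖ with hδ
  have hδ0 : 0 < δ := norm_pos_iff.2 (sub_ne_zero.2 fun h1 => hx₀ (Circle.ext h1))
  set a := N.restrict F (d⁻¹ * x₀) with ha
  have ha0 : 0 ≤ a := (N.restrict F).nonneg _
  set K := M * Fintype.card (TriIdx n) with hK
  obtain ⟨r, hr⟩ := hf.exists_norm_fwdDiff_twist_le hN S h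
  obtain ⟨C₁, hC₁, hdiff⟩ := hr (M + M₀ + K + r * K) K a ha0
  obtain ⟨C₂, hC₂, hval⟩ := hf.toIsDecayingGL.exists_norm_twist_le hN S h (M + M₀)
  refine ⟨C₂ * J + (δ ^ K)⁻¹ * (C₁ * a ^ K * J), by positivity, fun Y g => ?_⟩
  set b := baseChangeGL n F E g with hb
  have hD := heightDecay_pos (N := N) M b
  have hint : Integrable (fun s => f (twist S.k τ n Y s * b)) (triMeasure μ n) :=
    hf.toIsDecayingGL.integrable_twist hN S h μ Y g
  have hdec0 : 0 ≤ ∏ t, decay (N.restrict F) M (Y t) :=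
    Finset.prod_nonneg fun t _ => (decay_pos M _).le
  by_cases hY : ∀ t, N.restrict F (Y t) ≤ 1
  · have h1 : ∏ t, decay (N.restrict F) M (Y t) = 1 :=
      Finset.prod_eq_one fun t _ => by
        rw [decay, max_eq_left (hY t), one_pow, inv_one]
    rw [h1, mul_one]
    calc _ ≤ ∫ s, C₂ * heightDecay N M b *
          (prodHeight (N.restrict F) s ^ M₀)⁻¹ ∂(triMeasure μ n) := by
          refine norm_integral_le_of_norm_le (hI.const_mul _) (Eventually.of_forall fun s => ?_)
          rw [norm_mul, Circle.norm_coe, mul_one]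
          refine (hval Y s g).trans ?_
          have hP := one_le_prodHeight (N := N.restrict F) s
          have h2 : (prodHeight (N.restrict F) s ^ (M + M₀))⁻¹ ≤
              (prodHeight (N.restrict F) s ^ M₀)⁻¹ :=
            inv_anti₀ (by positivity) (pow_le_pow_right₀ hP (by omega))
          have h3 : heightDecay N (M + M₀) b ≤ heightDecay N M b :=
            heightDecay_anti (Nat.le_add_right M M₀) b
          calc _ ≤ C₂ * (prodHeight (N.restrict F) s ^ M₀)⁻¹ *
                heightDecay N M b := by
                  gcongr
                  exact (heightDecay_pos _ _).le
            _ = _ := by ring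
      _ = C₂ * J * heightDecay N M b := by rw [integral_const_mul, ← hJ]; ring
      _ ≤ _ := mul_le_mul_of_nonneg_right (le_add_of_nonneg_right (by positivity)) hD.le
  · push Not at hY
    obtain ⟨t₀, ht₀⟩ := hY
    obtain ⟨t, -, ht⟩ := Finset.exists_max_image Finset.univ
      (fun t => N.restrict F (Y t)) ⟨t₀, Finset.mem_univ _⟩
    set H := N.restrict F (Y t) with hH
    have hH1 : 1 < H := ht₀.trans_le (ht t₀ (Finset.mem_univ _))
    have hYt : Y t ≠ 0 := fun h0 => by
      rw [hH, h0, map_zero] at hH1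
      linarith
    set x := (Y t)⁻¹ * (d⁻¹ * x₀) with hx
    have hNx : N.restrict F x = H⁻¹ * a := by
      rw [hx, map_mul, map_inv₀]
    have hNxa : N.restrict F x ≤ a := by
      rw [hNx]
      exact mul_le_of_le_one_left ha0 (inv_le_one_of_one_le₀ hH1.le)
    have hχ : pairChar ψ d Y (-Pi.single t x) = ψ (-x₀) := by
      rw [pairChar_apply]
      congr 1
      have h1 : ∀ u, Y u * (-Pi.single t x : TriIdx n → F) u = if u = t then -(d⁻¹ * x₀) else 0 := by
        intro u
        by_cases hu : u = t
        · subst hu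
          simp [hx, mul_inv_cancel_left₀ hYt]
        · simp [hu]
      simp only [h1, Finset.sum_ite_eq', Finset.mem_univ, if_true]
      rw [mul_neg, mul_inv_cancel_left₀ hd]
    have hw : ∀ s, ‖(fwdDiff (Pi.single t x))^[K] (fun s => f (twist S.k τ n Y s * b)) s‖ ≤
        C₁ * (H⁻¹ * a) ^ K * heightDecay N M b *
          (prodHeight (N.restrict F) s ^ M₀)⁻¹ := by
      intro s
      refine (hdiff Y s g t x hNxa).trans ?_
      rw [← hb, hNx]
      set P := prodHeight (N.restrict F) s
      have hP1 : 1 ≤ P := one_le_prodHeight s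
      have hP0 : 0 < P := prodHeight_pos s
      have hh1 : 1 ≤ height N b := one_le_height b
      have hh0 : 0 < height N b := height_pos b
      have h1 : (P ^ (M + M₀ + K + r * K))⁻¹ * (P ^ r) ^ K ≤ (P ^ M₀)⁻¹ := by
        rw [← pow_mul, inv_mul_le_iff₀ (by positivity), ← div_eq_mul_inv, le_div_iff₀ (by positivity),
          ← pow_add]
        exact pow_le_pow_right₀ hP1 (by omega)
      have h2 : heightDecay N (M + M₀ + K + r * K) b * height N b ^ K ≤ heightDecay N M b := by
        rw [heightDecay, heightDecay, inv_mul_le_iff₀ (by positivity), ← div_eq_mul_inv,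
          le_div_iff₀ (by positivity), ← pow_add]
        exact pow_le_pow_right₀ hh1 (by nlinarith [Nat.zero_le (r * K)])
      calc _ = C₁ * (H⁻¹ * a) ^ K * (heightDecay N (M + M₀ + K + r * K) b * height N b ^ K) *
            ((P ^ (M + M₀ + K + r * K))⁻¹ * (P ^ r) ^ K) := by
            rw [mul_pow, mul_pow]
            ring
        _ ≤ _ := by
            have h3 : 0 ≤ (P ^ (M + M₀ + K + r * K))⁻¹ * (P ^ r) ^ K := by positivity
            gcongr
    have hmain := norm_integral_mul_addChar_le (Pi.single t x) hint (χ := pairChar ψ d Y)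
      (measurable_pairChar hψ d Y) K
      (hI.const_mul (C₁ * (H⁻¹ * a) ^ K * heightDecay N M b)) hw
    rw [hχ, ← hδ, integral_const_mul, ← hJ, ← le_inv_mul_iff₀ (by positivity)] at hmain
    have hle : ∀ u, N.restrict F (Y u) ≤ H := fun u =>
      ht u (Finset.mem_univ u)
    have hdecay := inv_pow_le_prod_decay (x := Y) hH1.le hle M
    rw [← hK] at hdecay
    calc _ ≤ _ := hmain
      _ = (δ ^ K)⁻¹ * (C₁ * a ^ K * J) * (H ^ K)⁻¹ * heightDecay N M b := by
          rw [mul_pow, inv_pow]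
          ring
      _ ≤ (δ ^ K)⁻¹ * (C₁ * a ^ K * J) *
          (∏ t, decay (N.restrict F) M (Y t)) * heightDecay N M b := by
          gcongr
      _ ≤ _ := by
          gcongr
          exact le_add_of_nonneg_left (by positivity)

end FourierBound

/-! ### Fourier inversion along the twisted unipotent matrices -/

section Inversion

open Matrix

variable {F E : Type*} [Field F] [TopologicalSpace F] [IsLocalField F] [MeasurableSpace F]
  [BorelSpace F] [Field E] [TopologicalSpace E] [IsLocalField E] [Algebra F E]
  [ContinuousSMul F E] [CharZero F] {N : AbsoluteValue E ℝ} (hN : IsProperAbs N)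
  (S : RowSection (N.restrict F)) {τ : E} {σ : E ≃ₐ[F] E}
  (h : IsTraceZeroGenerator τ σ) {n : ℕ}

include h in
/-- The height of a step of the recursion controls both the new coordinates `v` and the height of the
previous matrix. -/
theorem exists_heightDecay_twistStep_le (M : ℕ) : ∃ M' : ℕ, ∃ C, 0 ≤ C ∧
    ∀ (y : Fin n → F) (X : GL (Fin n) E) (v : Fin n → F),
      heightDecay N M' (twistStep S τ y X v) ≤
        C * (prodHeight (N.restrict F) v ^ M)⁻¹ * heightDecay N M X := by
  obtain ⟨B, hB, hk⟩ := S.exists_height_baseChangeGL_le n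
  have hτ : 0 < N τ := N.pos h.ne_zero
  refine ⟨(2 * n + 1) * M, ((1 + (N τ)⁻¹) ^ n * B ^ 2) ^ M, by positivity, fun y X v => ?_⟩
  set k := baseChangeGL n F E (S.k n y) with hkdef
  set g := k⁻¹ * X * k with hg
  set w := tauVec τ v with hw
  set P := prodHeight (N.restrict F) v
  have hP0 : 0 < P := prodHeight_pos v
  have hstep : twistStep S τ y X v = aff g ((g : Matrix (Fin n) (Fin n) E) *ᵥ w) := by
    rw [twistStep, aff_mul, ← hkdef, ← hg, mul_one, add_zero]
  set H := height N (twistStep S τ y X v) with hH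
  have hH1 : 1 ≤ H := one_le_height _
  have hgH : height N g ≤ H := by
    rw [hH, hstep]
    exact height_le_height_aff _ _
  have hXH : height N X ≤ B ^ 2 * H := by
    have h1 : X = (k⁻¹)⁻¹ * g * k⁻¹ := by
      rw [hg]
      group
    calc height N X = height N ((k⁻¹)⁻¹ * g * k⁻¹) := by rw [← h1]
      _ ≤ _ := height_conj_le _ _
      _ ≤ _ := by
          rw [height_inv]
          exact mul_le_mul (pow_le_pow_left₀ (height_pos _).le (hk y) 2) hgH (height_pos _).le
            (by positivity)
  have hv : ∀ i, max 1 (N.restrict F (v i)) ≤ (1 + (N τ)⁻¹) * H ^ 2 := by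
    intro i
    have h3 : w = ((g⁻¹ : GL (Fin n) E) : Matrix (Fin n) (Fin n) E) *ᵥ
        ((g : Matrix (Fin n) (Fin n) E) *ᵥ w) := by
      rw [mulVec_mulVec, ← Units.val_mul, inv_mul_cancel, Units.val_one, one_mulVec]
    have h4 : N (algebraMap F E (v i)) * N τ ≤ H ^ 2 := by
      calc N (algebraMap F E (v i)) * N τ = N (w i) := by rw [hw, tauVec, map_mul]
        _ ≤ vecNorm N w := le_vecNorm _ _
        _ ≤ entryNorm N ((g⁻¹ : GL (Fin n) E) : Matrix (Fin n) (Fin n) E) *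
            vecNorm N ((g : Matrix (Fin n) (Fin n) E) *ᵥ w) := by
            conv_lhs => rw [h3]
            exact vecNorm_mulVec_le _ _
        _ ≤ height N g * H := by
            refine mul_le_mul ?_ ?_ (vecNorm_nonneg _) (height_pos _).le
            · have := one_add_entryNorm_le_height (N := N) g⁻¹
              rw [height_inv] at this
              linarith
            · rw [hH, hstep]
              linarith [vecNorm_le_height_aff (N := N) g ((g : Matrix (Fin n) (Fin n) E) *ᵥ w)]
        _ ≤ H ^ 2 := by
            rw [sq]
            gcongr
    have hτ0 : 0 ≤ (N τ)⁻¹ := by positivity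
    have hH2 : 1 ≤ H ^ 2 := one_le_pow₀ hH1
    refine max_le (by nlinarith) ?_
    rw [← le_div_iff₀ hτ, div_eq_mul_inv] at h4
    exact (show N (algebraMap F E (v i)) ≤ _ from h4).trans (by nlinarith)
  have hmain : P * height N X ≤ (1 + (N τ)⁻¹) ^ n * B ^ 2 * H ^ (2 * n + 1) := by
    have hP := prodHeight_le hv
    rw [Fintype.card_fin] at hP
    calc P * height N X ≤ ((1 + (N τ)⁻¹) * H ^ 2) ^ n * (B ^ 2 * H) :=
          mul_le_mul hP hXH (height_pos _).le (by positivity)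
      _ = _ := by
          rw [mul_pow, ← pow_mul, pow_succ H]
          ring
  have h1 := pow_le_pow_left₀ (mul_pos hP0 (height_pos _)).le hmain M
  rw [mul_pow, mul_pow, ← pow_mul] at h1
  have hX := height_pos (N := N) X
  rw [heightDecay, heightDecay, mul_assoc, ← mul_inv, ← div_eq_mul_inv, inv_eq_one_div,
    div_le_div_iff₀ (by positivity) (by positivity), one_mul]
  exact h1

theorem Continuous.twistStep {X : Type*} [TopologicalSpace X] (y : Fin n → F)
    {A : X → GL (Fin n) E} {v : X → Fin n → F} (hA : Continuous A) (hv : Continuous v) :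
    Continuous fun x => twistStep S τ y (A x) (v x) :=
  (Continuous.aff ((continuous_const.mul hA).mul continuous_const)
    continuous_const).mul (continuous_const.aff ((continuous_tauVec τ).comp hv))

variable (μ : Measure F) [μ.IsAddHaarMeasure]

include hN h in
/-- Integration over the last column preserves the decay. -/
theorem IsDecayingGL.integral_twistStep {Φ : GL (Fin (n + 1)) E → ℂ} (hΦ : IsDecayingGL N Φ)
    (y : Fin n → F) {χ : (Fin n → F) → ℂ} (hχ : Measurable χ) (hχ1 : ∀ v, ‖χ v‖ = 1) :
    IsDecayingGL N fun X : GL (Fin n) E =>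
      ∫ v, Φ (twistStep S τ y X v) * χ v ∂(Measure.pi fun _ => μ) := by
  obtain ⟨M₀, hM₀⟩ := (h.isProperAbs_restrict hN).exists_integrable_prodHeight μ
  have hI := hM₀ (ι := Fin n)
  have hbound : ∀ M, ∃ C, 0 ≤ C ∧ ∀ X v, ‖Φ (twistStep S τ y X v) * χ v‖ ≤
      C * heightDecay N M X * (prodHeight (N.restrict F) v ^ M₀)⁻¹ := by
    intro M
    obtain ⟨M', C₁, hC₁, h1⟩ := exists_heightDecay_twistStep_le S h (n := n) (M + M₀)
    obtain ⟨C₂, hC₂, h2⟩ := hΦ.exists_le M'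
    refine ⟨C₂ * C₁, by positivity, fun X v => ?_⟩
    rw [norm_mul, hχ1, mul_one]
    have hP := one_le_prodHeight (N := N.restrict F) v
    have h3 : (prodHeight (N.restrict F) v ^ (M + M₀))⁻¹ ≤
        (prodHeight (N.restrict F) v ^ M₀)⁻¹ :=
      inv_anti₀ (by positivity) (pow_le_pow_right₀ hP (by omega))
    have h4 : heightDecay N (M + M₀) X ≤ heightDecay N M X :=
      heightDecay_anti (Nat.le_add_right M M₀) X
    have h5 := heightDecay_pos (N := N) (M + M₀) X
    calc _ ≤ C₂ * (C₁ * (prodHeight (N.restrict F) v ^ (M + M₀))⁻¹ *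
          heightDecay N (M + M₀) X) :=
          (h2 _).trans (mul_le_mul_of_nonneg_left (h1 y X v) hC₂)
      _ ≤ C₂ * (C₁ * (prodHeight (N.restrict F) v ^ M₀)⁻¹ *
          heightDecay N M X) := by gcongr
      _ = _ := by ring
  refine ⟨?_, fun M => ?_⟩
  · obtain ⟨C, hC, hle⟩ := hbound 0
    refine continuous_of_dominated (bound := fun v =>
      C * (prodHeight (N.restrict F) v ^ M₀)⁻¹) ?_ ?_ (hI.const_mul C) ?_
    · intro X
      have h1 : Continuous fun v => twistStep S τ y X v :=
        .twistStep S y continuous_const continuous_id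
      exact ((hΦ.continuous.comp h1).measurable.mul hχ).aestronglyMeasurable
    · refine fun X => Eventually.of_forall fun v => (hle X v).trans_eq ?_
      simp [heightDecay]
    · refine Eventually.of_forall fun v => Continuous.mul ?_ continuous_const
      have h1 : Continuous fun X => twistStep S τ y X v :=
        .twistStep S y continuous_id continuous_const
      exact hΦ.continuous.comp h1
  · obtain ⟨C, hC, hle⟩ := hbound M
    refine ⟨C * ∫ v : Fin n → F, (prodHeight (N.restrict F) v ^ M₀)⁻¹
      ∂(Measure.pi fun _ => μ), mul_nonneg hC (integral_nonneg fun v => ?_), fun X => ?_⟩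
    · have := prodHeight_pos (N := N.restrict F) v
      positivity
    · refine (norm_integral_le_of_norm_le (hI.const_mul (C * heightDecay N M X))
        (Eventually.of_forall (hle X))).trans_eq ?_
      rw [integral_const_mul]
      ring

include hN h in
/-- Fourier inversion for the functions `s ↦ Φ(A_Y(s))`, which depend on the dual variable `Y`: as
`A_Y(s)` only involves the blocks `Y_j` with `j > i` of `Y` in the block `i` of `s`, one may invert
one block at a time. -/
theorem IsDecayingGL.integral_integral_twist {ψ : AddChar F Circle} (hψ : Continuous ψ)
    (hμ : IsSelfDual ψ μ) {d : F} (hd : d ≠ 0) (n : ℕ) {Φ : GL (Fin n) E → ℂ}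
    (hΦ : IsDecayingGL N Φ)
    (hint : Integrable (fun Y => ∫ s, Φ (twist S.k τ n Y s) * (pairChar ψ d Y s : ℂ)
      ∂(triMeasure μ n)) (triMeasure μ n)) :
    ∫ Y, ∫ s, Φ (twist S.k τ n Y s) * (pairChar ψ d Y s : ℂ) ∂(triMeasure μ n) ∂(triMeasure μ n) =
      (((normAbs d)⁻¹ : ℝ) : ℂ) ^ Fintype.card (TriIdx n) * Φ 1 := by
  induction n with
  | zero =>
    have h1 : ∀ Y s : TriIdx 0 → F, Φ (twist S.k τ 0 Y s) * (pairChar ψ d Y s : ℂ) = Φ 1 :=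
      fun Y s => by
        rw [Subsingleton.elim (twist S.k τ 0 Y s) 1, pairChar_apply]
        simp
    simp only [h1]
    simp [triMeasure, Measure.real]
  | succ n ih =>
    have hNF := h.isProperAbs_restrict hN
    obtain ⟨M₀, hM₀⟩ := hNF.exists_integrable_decay μ
    have hmp := measurePreserving_triSnoc (n := n) μ
    have hmpe : MeasurableEmbedding fun p : (TriIdx n → F) × (Fin n → F) => triSnoc p.1 p.2 :=
      (MeasurableEquiv.sumPiEquivProdPi fun _ : TriIdx n ⊕ Fin n => F).symm.measurableEmbedding
    have hκ : (((normAbs d)⁻¹ : ℝ) : ℂ) ≠ 0 :=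
      Complex.ofReal_ne_zero.2 (inv_ne_zero (normAbs_pos hd).ne')
    -- the integral over the last column
    set Ψ : (Fin n → F) → GL (Fin n) E → ℂ := fun y X =>
      ∫ v, Φ (twistStep S τ y X v) * (pairChar ψ d y v : ℂ) ∂(Measure.pi fun _ => μ) with hΨ
    have hΨd : ∀ y, IsDecayingGL N (Ψ y) := fun y =>
      hΦ.integral_twistStep hN S h μ y (measurable_pairChar hψ d y) fun v => Circle.norm_coe _
    have hpair : ∀ (Y s : TriIdx n → F) (y v : Fin n → F),
        (pairChar ψ d (triSnoc Y y) (triSnoc s v) : ℂ) = pairChar ψ d Y s * pairChar ψ d y v := by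
      intro Y s y v
      rw [← Circle.coe_mul, pairChar_apply, pairChar_apply, pairChar_apply,
        ← AddChar.map_add_eq_mul, ← mul_add, sum_triIdx_succ]
      rfl
    have hsplit : ∀ (Y : TriIdx n → F) (y : Fin n → F),
        ∫ s, Φ (twist S.k τ (n + 1) (triSnoc Y y) s) * (pairChar ψ d (triSnoc Y y) s : ℂ)
          ∂(triMeasure μ (n + 1)) =
        ∫ s, Ψ y (twist S.k τ n Y s) * (pairChar ψ d Y s : ℂ) ∂(triMeasure μ n) := by
      intro Y y
      have hi : Integrable (fun s => Φ (twist S.k τ (n + 1) (triSnoc Y y) s) *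
          (pairChar ψ d (triSnoc Y y) s : ℂ)) (triMeasure μ (n + 1)) := by
        have h1 := hΦ.integrable_twist hN S h μ (triSnoc Y y) 1
        simp only [map_one, mul_one] at h1
        exact integrable_mul_addChar h1 (measurable_pairChar hψ d _)
      have hi2 := (hmp.integrable_comp_emb hmpe).2 hi
      refine (hmp.integral_comp hmpe _).symm.trans ((integral_prod _ hi2).trans ?_)
      refine integral_congr_ae (Eventually.of_forall fun s => ?_)
      dsimp only
      rw [hΨ, ← integral_mul_const]
      refine integral_congr_ae (Eventually.of_forall fun v => ?_)
      dsimp only [Function.comp_apply]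
      have ht : twist S.k τ (n + 1) (triSnoc Y y) (triSnoc s v) =
          twistStep S τ y (twist S.k τ n Y s) v := rfl
      rw [ht, hpair]
      ring
    have hint2 := (hmp.integrable_comp_emb hmpe).2 hint
    have hint3 : Integrable (fun p : (TriIdx n → F) × (Fin n → F) =>
        ∫ s, Ψ p.2 (twist S.k τ n p.1 s) * (pairChar ψ d p.1 s : ℂ) ∂(triMeasure μ n))
        ((triMeasure μ n).prod (Measure.pi fun _ => μ)) :=
      hint2.congr (Eventually.of_forall fun p => hsplit p.1 p.2)
    have hinner : ∀ᵐ y ∂(Measure.pi fun _ : Fin n => μ), ∫ Y, ∫ s, Ψ y (twist S.k τ n Y s) *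
        (pairChar ψ d Y s : ℂ) ∂(triMeasure μ n) ∂(triMeasure μ n) =
          (((normAbs d)⁻¹ : ℝ) : ℂ) ^ Fintype.card (TriIdx n) * Ψ y 1 := by
      filter_upwards [hint3.prod_left_ae] with y hy
      exact ih (hΨd y) hy
    have hone : ∀ y v : Fin n → F, twistStep S τ y 1 v = aff 1 (tauVec τ v) := fun y v => by
      rw [twistStep, mul_one, inv_mul_cancel, aff_one_zero, one_mul]
    have hG : IsRapid (N.restrict F) M₀ fun v : Fin n → F =>
        Φ (aff 1 (tauVec τ v)) := by
      obtain ⟨M', C₁, hC₁, h1⟩ := exists_heightDecay_twistStep_le S h (n := n) M₀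
      obtain ⟨C₂, hC₂, h2⟩ := hΦ.exists_le M'
      refine ⟨hΦ.continuous.comp (continuous_const.aff (continuous_tauVec τ)), C₂ * C₁,
        by positivity, fun v => (h2 _).trans ?_⟩
      have hP := prodHeight_pos (N := N.restrict F) v
      have h3 := (h1 0 1 v).trans
        (mul_le_of_le_one_right (by positivity) (heightDecay_le_one _ _))
      rw [hone] at h3
      rw [prod_decay_eq, mul_assoc]
      exact mul_le_mul_of_nonneg_left h3 hC₂
    have hΨ1 : ∀ y, Ψ y 1 = ∫ v, Φ (aff 1 (tauVec τ v)) * (ψ (d * ∑ i, y i * v i) : ℂ)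
        ∂(Measure.pi fun _ => μ) := fun y => by
      simp only [hΨ, hone]
      rfl
    have hI : Integrable (fun y => Ψ y 1) (Measure.pi fun _ : Fin n => μ) := by
      have h1 := (hint3.integral_prod_right.congr hinner).const_mul
        ((((normAbs d)⁻¹ : ℝ) : ℂ) ^ Fintype.card (TriIdx n))⁻¹
      refine h1.congr (Eventually.of_forall fun y => ?_)
      dsimp only
      rw [inv_mul_cancel_left₀ (pow_ne_zero _ hκ)]
    have hfinal := hμ.integral_integral_pi hψ hd hM₀ hNF n hG
      (hI.congr (Eventually.of_forall hΨ1))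
    have h1 := integral_prod_symm _ hint3
    have hfun := funext fun p : (TriIdx n → F) × (Fin n → F) => hsplit p.1 p.2
    rw [← hfun] at h1
    replace h1 := (hmp.integral_comp hmpe fun Y => ∫ s, Φ (twist S.k τ (n + 1) Y s) *
      (pairChar ψ d Y s : ℂ) ∂(triMeasure μ (n + 1))).symm.trans h1
    have h2 := integral_congr_ae hinner
    have h3 : ∫ y, Ψ y 1 ∂(Measure.pi fun _ : Fin n => μ) = _ :=
      congrArg (fun g : (Fin n → F) → ℂ => ∫ y, g y ∂(Measure.pi fun _ => μ)) (funext hΨ1)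
    rw [integral_const_mul, h3, hfinal, tauVec_zero, aff_one_zero, ← mul_assoc, ← pow_add,
      ← TriIdx.card_eq] at h2
    exact h1.trans h2

end Inversion

/-! ### The function `W_f` -/

section UnipotentLeft

open Matrix

variable {K : Type*} [Field K] [TopologicalSpace K] [IsLocalField K] [MeasurableSpace K]
  [BorelSpace K] (μ : Measure K) [μ.IsAddHaarMeasure]

/-- `du` is left invariant. -/
theorem lintegral_uni_mul_left : ∀ (n : ℕ) (x₀ : TriIdx n → K) {φ : GL (Fin n) K → ℝ≥0∞},
    Measurable φ → ∫⁻ x, φ (uni n x₀ * uni n x) ∂(triMeasure μ n) =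
      ∫⁻ x, φ (uni n x) ∂(triMeasure μ n)
  | 0, x₀, φ, _ => by simp [uni]
  | n + 1, x₀, φ, hφ => by
    have hm : Measurable fun p : GL (Fin n) K × (Fin n → K) => φ (aff p.1 p.2) :=
      hφ.comp (measurable_fst.aff measurable_snd)
    rw [lintegral_tri_succ μ (φ := fun x => φ (uni (n + 1) x₀ * uni (n + 1) x))
        (hφ.comp ((measurable_uni _).const_mul _)),
      lintegral_tri_succ μ (φ := fun x => φ (uni (n + 1) x)) (hφ.comp (measurable_uni _))]
    have hdet : (uni n (triInit x₀) : Matrix (Fin n) (Fin n) K).det = 1 := det_uni n _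
    have h2 : ∀ x, ∫⁻ v, φ (uni (n + 1) x₀ * uni (n + 1) (triSnoc x v)) ∂(Measure.pi fun _ => μ) =
        ∫⁻ v, φ (aff (uni n (triInit x₀) * uni n x) v) ∂(Measure.pi fun _ => μ) := by
      intro x
      have h1 : ∀ v, φ (uni (n + 1) x₀ * uni (n + 1) (triSnoc x v)) =
          φ (aff (uni n (triInit x₀) * uni n x)
            ((uni n (triInit x₀) : Matrix (Fin n) (Fin n) K) *ᵥ v + triLast x₀)) := by
        intro v
        rw [uni_succ, ← triSnoc_init_last x₀, uni_succ, aff_mul]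
        simp
      have hm2 : Measurable fun v : Fin n → K =>
          φ (aff (uni n (triInit x₀) * uni n x) (v + triLast x₀)) :=
        hφ.comp (measurable_const.aff (measurable_id.add_const _))
      have h3 := lintegral_comp_mulVec μ (by rw [hdet]; exact one_ne_zero) hm2
      rw [hdet, normAbs_one, inv_one, ENNReal.ofReal_one, one_mul] at h3
      rw [lintegral_congr h1, h3]
      exact lintegral_add_right_eq_self (μ := Measure.pi fun _ : Fin n => μ)
        (fun v => φ (aff (uni n (triInit x₀) * uni n x) v)) _
    rw [lintegral_congr h2]
    exact lintegral_uni_mul_left n (triInit x₀)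
      (φ := fun g => ∫⁻ v, φ (aff g v) ∂(Measure.pi fun _ => μ)) hm.lintegral_prod_right'

/-- The measure `du` as a measure on `GL_n`. -/
def uniMeasure (n : ℕ) : Measure (GL (Fin n) K) := (triMeasure μ n).map (uni n)

theorem lintegral_uniMeasure (n : ℕ) {φ : GL (Fin n) K → ℝ≥0∞} (hφ : Measurable φ) :
    ∫⁻ g, φ g ∂(uniMeasure μ n) = ∫⁻ x, φ (uni n x) ∂(triMeasure μ n) :=
  lintegral_map hφ (measurable_uni n)

theorem integral_uniMeasure (n : ℕ) {φ : GL (Fin n) K → ℂ} (hφ : Measurable φ) :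
    ∫ g, φ g ∂(uniMeasure μ n) = ∫ x, φ (uni n x) ∂(triMeasure μ n) :=
  integral_map (measurable_uni n).aemeasurable hφ.aestronglyMeasurable

theorem map_mul_left_uniMeasure {n : ℕ} (x : TriIdx n → K) :
    (uniMeasure μ n).map (uni n x * ·) = uniMeasure μ n :=
  Measure.ext_of_lintegral _ fun φ hφ => by
    rw [lintegral_map hφ (measurable_const_mul _), lintegral_uniMeasure μ n hφ,
      lintegral_uniMeasure μ n (φ := fun g => φ (uni n x * g))
        (hφ.comp (measurable_const_mul (uni n x)))]
    exact lintegral_uni_mul_left μ n x hφ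

theorem map_mul_right_uniMeasure {n : ℕ} (x : TriIdx n → K) :
    (uniMeasure μ n).map (· * uni n x) = uniMeasure μ n :=
  Measure.ext_of_lintegral _ fun φ hφ => by
    rw [lintegral_map hφ (measurable_mul_const _), lintegral_uniMeasure μ n hφ,
      lintegral_uniMeasure μ n (φ := fun g => φ (g * uni n x))
        (hφ.comp (measurable_mul_const (uni n x)))]
    exact lintegral_uni_mul_right μ n x hφ

end UnipotentLeft

section Superdiagonal

open Matrix

theorem lastCoord_add {R : Type*} [AddZeroClass R] : ∀ {n : ℕ} (v w : Fin n → R),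
    lastCoord (v + w) = lastCoord v + lastCoord w
  | 0, _, _ => (add_zero _).symm
  | _ + 1, _, _ => rfl

theorem superdiag_uni_mul {K : Type*} [Field K] : ∀ (n : ℕ) (x y : TriIdx n → K),
    superdiag (uni n x * uni n y : Matrix (Fin n) (Fin n) K) = superSum n x + superSum n y
  | 0, _, _ => by simp [superdiag, superSum]
  | n + 1, x, y => by
    rw [← triSnoc_init_last x, ← triSnoc_init_last y, uni_succ, uni_succ, ← Units.val_mul, aff_mul,
      coe_aff, superdiag_affMat, Units.val_mul, superdiag_uni_mul n, lastCoord_add,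
      lastCoord_mulVec (unipotentSubgroup_le_mirabolicSubgroup _ _ (uni_mem _ _)), superSum_succ,
      superSum_succ]
    abel

theorem superdiag_uni {K : Type*} [Field K] : ∀ (n : ℕ) (x : TriIdx n → K),
    superdiag (uni n x : Matrix (Fin n) (Fin n) K) = superSum n x
  | 0, _ => by simp [superdiag, superSum]
  | n + 1, x => by
    rw [uni, coe_aff, superdiag_affMat, superdiag_uni n]
    rfl

theorem superSum_comp {F E : Type*} [Field F] [Field E] (φ : F →+* E) :
    ∀ (n : ℕ) (x : TriIdx n → F), superSum n (φ ∘ x) = φ (superSum n x)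
  | 0, _ => (map_zero φ).symm
  | n + 1, x => by
    have h1 : lastCoord (φ ∘ triLast x) = φ (lastCoord (triLast x)) := by
      rcases n with _ | n
      · exact (map_zero φ).symm
      · rfl
    rw [superSum, superSum, map_add, ← superSum_comp φ n, ← h1]
    rfl

end Superdiagonal

section Whittaker

open Matrix

variable {E : Type*} [Field E] {n : ℕ}

/-- The integrand of `W_f(g₁, g₂)`, as a function on `GL_n`. -/
def whittakerKernel (ψ : AddChar E Circle) (f : GL (Fin n) E → ℂ) (g₁ g₂ g : GL (Fin n) E) : ℂ :=
  f (g₁⁻¹ * g * g₂) *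
    (((ψ ((-1) ^ n * superdiag (g : Matrix (Fin n) (Fin n) E)))⁻¹ : Circle) : ℂ)

variable [TopologicalSpace E] [IsLocalField E] [MeasurableSpace E] [BorelSpace E]
  {N : AbsoluteValue E ℝ} (hN : IsProperAbs N) (μ : Measure E) [μ.IsAddHaarMeasure]
  {ψ : AddChar E Circle} (hψ : Continuous ψ) {f : GL (Fin n) E → ℂ} 

include hψ in
theorem measurable_whittakerKernel (hf : Continuous f) : Measurable
    fun p : (GL (Fin n) E × GL (Fin n) E) × GL (Fin n) E =>
      whittakerKernel ψ f p.1.1 p.1.2 p.2 := by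
  have h1 : Measurable fun p : (GL (Fin n) E × GL (Fin n) E) × GL (Fin n) E =>
      p.1.1⁻¹ * p.2 * p.1.2 :=
    ((measurable_fst.comp measurable_fst).inv.mul measurable_snd).mul
      (measurable_snd.comp measurable_fst)
  have h2 : Measurable fun g : GL (Fin n) E => superdiag (g : Matrix (Fin n) (Fin n) E) := by
    refine Finset.measurable_sum _ fun i _ => ?_
    by_cases h : (i : ℕ) + 1 < n
    · simp only [dif_pos h]
      exact measurable_GL_apply _ _
    · simp only [dif_neg h]
      exact measurable_const
  have h3 : Measurable fun p : (GL (Fin n) E × GL (Fin n) E) × GL (Fin n) E =>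
      (ψ (-((-1) ^ n * superdiag (p.2 : Matrix (Fin n) (Fin n) E))) : ℂ) :=
    measurable_coe_addChar hψ (measurable_const.mul (h2.comp measurable_snd)).neg
  simp only [AddChar.map_neg_eq_inv] at h3
  exact (hf.measurable.comp h1).mul h3

include hψ in
theorem measurable_whittakerKernel_right (hf : Continuous f) (g₁ g₂ : GL (Fin n) E) :
    Measurable (whittakerKernel ψ f g₁ g₂) := by
  have h1 : Measurable fun g : GL (Fin n) E => ((g₁, g₂), g) := measurable_const.prodMk measurable_id
  have h2 := (measurable_whittakerKernel hψ hf).comp h1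
  simpa only [Function.comp_def] using h2

include hN hψ

theorem IsDecayingGL.integrable_whittakerKernel (hf : IsDecayingGL N f) (g₁ g₂ : GL (Fin n) E) :
    Integrable (whittakerKernel ψ f g₁ g₂) (uniMeasure μ n) := by
  obtain ⟨M, hM⟩ := hN.exists_lintegral_heightDecay_uni μ n
  obtain ⟨C, hC, hle⟩ := hf.exists_le M
  have hmeas := measurable_whittakerKernel_right hψ hf.continuous g₁ g₂
  have hd : Measurable fun g : GL (Fin n) E => heightDecay N M g :=
    (hN.continuous_heightDecay M).measurable
  have hI : Integrable (fun g : GL (Fin n) E => heightDecay N M g) (uniMeasure μ n) := by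
    refine ⟨hd.aestronglyMeasurable, ?_⟩
    rw [hasFiniteIntegral_iff_ofReal (Eventually.of_forall fun g => (heightDecay_pos M g).le),
      lintegral_uniMeasure μ n hd.ennreal_ofReal]
    exact hM
  refine (hI.const_mul (C * (height N g₁⁻¹ ^ M * height N g₂ ^ M))).mono'
    hmeas.aestronglyMeasurable (Eventually.of_forall fun g => ?_)
  have h1 := height_pos (N := N) g₁⁻¹
  have h2 := height_pos (N := N) g₂
  rw [whittakerKernel, norm_mul, Circle.norm_coe, mul_one]
  calc _ ≤ C * heightDecay N M (g₁⁻¹ * g * g₂) := hle _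
    _ ≤ C * (height N g₁⁻¹ ^ M * heightDecay N M g * height N g₂ ^ M) := by
        refine mul_le_mul_of_nonneg_left ((heightDecay_mul_le_right M _ _).trans ?_) hC
        exact mul_le_mul_of_nonneg_right (heightDecay_mul_le_left M _ _) (by positivity)
    _ = _ := by ring

omit hN in
theorem whittaker_eq (hf : Continuous f) (g₁ g₂ : GL (Fin n) E) :
    whittaker ψ μ f g₁ g₂ = ∫ g, whittakerKernel ψ f g₁ g₂ g ∂(uniMeasure μ n) := by
  have hmeas := measurable_whittakerKernel_right hψ hf g₁ g₂
  rw [uniMeasure, ← map_unipotentMeasure, integral_map measurable_subtype_coe.aemeasurable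
    hmeas.aestronglyMeasurable]
  rfl

theorem IsDecayingGL.integrable_whittakerIntegrand (hf : IsDecayingGL N f)
    (g₁ g₂ : GL (Fin n) E) :
    Integrable (whittakerIntegrand ψ f g₁ g₂) (unipotentMeasure n μ) := by
  have h1 := hf.integrable_whittakerKernel hN μ hψ g₁ g₂
  rw [uniMeasure, ← map_unipotentMeasure] at h1
  exact h1.comp_measurable measurable_subtype_coe

omit hN in
theorem measurable_whittaker (hf : Continuous f) : Measurable
    fun p : GL (Fin n) E × GL (Fin n) E => whittaker ψ μ f p.1 p.2 := by
  have h1 := (measurable_whittakerKernel hψ hf).stronglyMeasurable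
  have hs : SFinite (uniMeasure μ n) := by
    rw [uniMeasure]
    infer_instance
  have h2 := (h1.integral_prod_right' (ν := uniMeasure μ n)).measurable
  simpa only [whittaker_eq μ hψ hf] using h2

variable {F : Type*} [Field F] [Algebra F E] (hψF : ∀ x : F, ψ (algebraMap F E x) = 1)
include hψF

omit hN hψ [TopologicalSpace E] [IsLocalField E] [MeasurableSpace E] [BorelSpace E] in
theorem apply_superSum_comp (x : TriIdx n → F) :
    ψ ((-1) ^ n * superSum n (algebraMap F E ∘ x)) = 1 := by
  rw [superSum_comp, ← hψF ((-1) ^ n * superSum n x)]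
  simp

omit hN in
theorem whittaker_mul_left (hf : Continuous f) (x : TriIdx n → F) (g₁ g₂ : GL (Fin n) E) :
    whittaker ψ μ f (baseChangeGL n F E (uni n x) * g₁) g₂ = whittaker ψ μ f g₁ g₂ := by
  have hm := measurable_whittakerKernel_right hψ hf
  set x' : TriIdx n → E := algebraMap F E ∘ x with hx'
  have hmul : Measurable fun g : GL (Fin n) E => uni n x' * g := measurable_const_mul _
  have h1 : ∫ g, whittakerKernel ψ f (uni n x' * g₁) g₂ g ∂(uniMeasure μ n) =
      ∫ g, whittakerKernel ψ f (uni n x' * g₁) g₂ (uni n x' * g) ∂(uniMeasure μ n) := by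
    rw [← integral_map (φ := fun g => uni n x' * g) hmul.aemeasurable
      (hm _ _).aestronglyMeasurable, map_mul_left_uniMeasure]
  rw [whittaker_eq μ hψ hf, whittaker_eq μ hψ hf, baseChangeGL_uni, h1,
    integral_uniMeasure μ n (hm g₁ g₂), integral_uniMeasure μ n
      (φ := fun g => whittakerKernel ψ f (uni n x' * g₁) g₂ (uni n x' * g)) ((hm _ _).comp hmul)]
  refine integral_congr_ae (Eventually.of_forall fun y => ?_)
  dsimp only
  rw [whittakerKernel, whittakerKernel, Units.val_mul, superdiag_uni_mul, superdiag_uni, mul_add,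
    AddChar.map_add_eq_mul, hx', apply_superSum_comp hψF, one_mul]
  congr 2
  group

omit hN in
theorem whittaker_mul_right (hf : Continuous f) (x : TriIdx n → F) (g₁ g₂ : GL (Fin n) E) :
    whittaker ψ μ f g₁ (baseChangeGL n F E (uni n x) * g₂) = whittaker ψ μ f g₁ g₂ := by
  have hm := measurable_whittakerKernel_right hψ hf
  set x' : TriIdx n → E := algebraMap F E ∘ x with hx'
  have hmul : Measurable fun g : GL (Fin n) E => g * uni n x' := measurable_mul_const _
  have h1 : ∫ g, whittakerKernel ψ f g₁ g₂ g ∂(uniMeasure μ n) =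
      ∫ g, whittakerKernel ψ f g₁ g₂ (g * uni n x') ∂(uniMeasure μ n) := by
    rw [← integral_map (φ := fun g => g * uni n x') hmul.aemeasurable
      (hm _ _).aestronglyMeasurable, map_mul_right_uniMeasure]
  rw [whittaker_eq μ hψ hf, whittaker_eq μ hψ hf, baseChangeGL_uni, h1,
    integral_uniMeasure μ n (hm _ _), integral_uniMeasure μ n
      (φ := fun g => whittakerKernel ψ f g₁ g₂ (g * uni n x')) ((hm _ _).comp hmul)]
  refine integral_congr_ae (Eventually.of_forall fun y => ?_)
  dsimp only
  rw [whittakerKernel, whittakerKernel, Units.val_mul, superdiag_uni_mul, superdiag_uni, mul_add,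
    AddChar.map_add_eq_mul, hx', apply_superSum_comp hψF, mul_one]
  congr 2
  group

end Whittaker

/-! ### Integrals over the slice -/

section SliceIntegral

open Matrix

variable {F E : Type*} [Field F] [TopologicalSpace F] [IsLocalField F] [MeasurableSpace F]
  [BorelSpace F] [Field E] [TopologicalSpace E] [IsLocalField E] [Algebra F E]
  [ContinuousSMul F E] {n : ℕ}

/-- The integral of `f(g₁⁻¹ σ(s) g₂) ψ_n(σ(s))⁻¹` over the slice `σ(s)`, whose translates under
`N_n(F)` fill up `N_n(E)`. -/
def sliceIntegral (τ : E) (ψ' : AddChar F Circle) (d : F) (μ : Measure F) (f : GL (Fin n) E → ℂ)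
    (g₁ g₂ : GL (Fin n) E) : ℂ :=
  ∫ s, f (g₁⁻¹ * slice τ n s * g₂) * (ψ' (d * superSum n s) : ℂ) ∂(triMeasure μ n)

variable {τ : E} {ψ' : AddChar F Circle} (hψ' : Continuous ψ') (d : F) (μF : Measure F)
  [μF.IsAddHaarMeasure] {f : GL (Fin n) E → ℂ} (hf : Continuous f)

include hψ' hf

theorem measurable_sliceIntegrand :
    Measurable fun p : (GL (Fin n) E × GL (Fin n) E) × (TriIdx n → F) =>
      f (p.1.1⁻¹ * slice τ n p.2 * p.1.2) * (ψ' (d * superSum n p.2) : ℂ) := by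
  borelize E
  have h1 : Measurable fun p : (GL (Fin n) E × GL (Fin n) E) × (TriIdx n → F) =>
      p.1.1⁻¹ * slice τ n p.2 * p.1.2 :=
    ((measurable_fst.comp measurable_fst).inv.mul ((measurable_slice τ n).comp measurable_snd)).mul
      (measurable_snd.comp measurable_fst)
  have h2 : Measurable fun p : (GL (Fin n) E × GL (Fin n) E) × (TriIdx n → F) =>
      d * superSum n p.2 := measurable_const.mul ((measurable_superSum n).comp measurable_snd)
  exact (hf.measurable.comp h1).mul (measurable_coe_addChar hψ' h2)

theorem measurable_sliceIntegral :
    Measurable fun p : GL (Fin n) E × GL (Fin n) E => sliceIntegral τ ψ' d μF f p.1 p.2 :=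
  ((measurable_sliceIntegrand hψ' d hf).stronglyMeasurable.integral_prod_right'
    (ν := triMeasure μF n)).measurable

variable [MeasurableSpace E] [BorelSpace E] [CharZero F] {σ : E ≃ₐ[F] E}
  (h : IsTraceZeroGenerator τ σ) (μE : Measure E) [μE.IsAddHaarMeasure] {c : ℝ}
  (hc : μE = ENNReal.ofReal c • (μF.prod μF).map h.homeomorph)

omit hψ' hf in
include h hc in
/-- The Haar measure of `N_n(E)` in the coordinates `σ(s) u` with `u ∈ N_n(F)`. -/
theorem IsTraceZeroGenerator.uniMeasure_eq : uniMeasure μE n =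
    ENNReal.ofReal c ^ Fintype.card (TriIdx n) •
      ((triMeasure μF n).prod (triMeasure μF n)).map
        fun p => slice τ n p.1 * baseChangeGL n F E (uni n p.2) := by
  have hm : Measurable fun p : (TriIdx n → F) × (TriIdx n → F) =>
      slice τ n p.1 * baseChangeGL n F E (uni n p.2) :=
    ((measurable_slice τ n).comp measurable_fst).mul
      (((measurable_baseChangeGL n).comp (measurable_uni n)).comp measurable_snd)
  refine Measure.ext_of_lintegral _ fun φ hφ => ?_
  have hφm : Measurable fun p : (TriIdx n → F) × (TriIdx n → F) =>
      φ (slice τ n p.1 * baseChangeGL n F E (uni n p.2)) := hφ.comp hm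
  rw [lintegral_uniMeasure μE n hφ, h.lintegral_slice μF μE hc n hφ, lintegral_smul_measure,
    lintegral_map hφ hm, lintegral_prod _ hφm.aemeasurable, smul_eq_mul]

variable {ψ : AddChar E Circle} (hψ : Continuous ψ) (hψF : ∀ x : F, ψ (algebraMap F E x) = 1)
  (hτ : ∀ z : E, ψ z = ψ' (Algebra.trace F E (τ * z))) {d₀ : F}
  (hd₀ : algebraMap F E d₀ = τ ^ 2)

omit [TopologicalSpace F] [IsLocalField F] [MeasurableSpace F] [BorelSpace F] [TopologicalSpace E]
  [IsLocalField E] [ContinuousSMul F E] [MeasurableSpace E] [BorelSpace E] hψ' hf in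
include h hψF hτ hd₀ in
/-- The restriction of the Whittaker character to `σ(s) u`. -/
theorem whittakerKernel_slice_mul (g₁ g₂ : GL (Fin n) E) (s a : TriIdx n → F) :
    whittakerKernel ψ f g₁ g₂ (slice τ n s * baseChangeGL n F E (uni n a)) =
      f (g₁⁻¹ * slice τ n s * (baseChangeGL n F E (uni n a) * g₂)) *
        (ψ' (-((-1) ^ n * (2 * d₀)) * superSum n s) : ℂ) := by
  have h1 : τ * -((-1) ^ n * (algebraMap F E (superSum n s) * τ)) =
      algebraMap F E (-((-1) ^ n * (d₀ * superSum n s))) := by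
    rw [map_neg, map_mul, map_mul, hd₀, map_pow, map_neg, map_one]
    ring
  have h2 : (ψ ((-1) ^ n * superdiag (slice τ n s * baseChangeGL n F E (uni n a) :
      Matrix (Fin n) (Fin n) E)))⁻¹ = ψ' (-((-1) ^ n * (2 * d₀)) * superSum n s) := by
    have h3 : ((-1) ^ n * algebraMap F E (superSum n a) : E) =
        algebraMap F E ((-1) ^ n * superSum n a) := by simp
    rw [superdiag_slice_mul, mul_add, AddChar.map_add_eq_mul, h3, hψF, mul_one,
      ← AddChar.map_neg_eq_inv, hτ, h1, h.trace_algebraMap]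
    congr 1
    ring
  rw [whittakerKernel, Units.val_mul, h2]
  congr 2
  group

include h hc hψ hψF hτ hd₀

/-- `W_f` as the sum over an `N_n(F)`-orbit of the integrals over the slice. -/
theorem IsDecayingGL.whittaker_eq_sliceIntegral {N : AbsoluteValue E ℝ} (hN : IsProperAbs N)
    (hfd : IsDecayingGL N f) (hc0 : 0 < c) (g₁ g₂ : GL (Fin n) E) :
    whittaker ψ μE f g₁ g₂ = ((c ^ Fintype.card (TriIdx n) : ℝ) : ℂ) *
      ∫ a, sliceIntegral τ ψ' (-((-1) ^ n * (2 * d₀))) μF f g₁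
        (baseChangeGL n F E (uni n a) * g₂) ∂(triMeasure μF n) := by
  have hm : Measurable fun p : (TriIdx n → F) × (TriIdx n → F) =>
      slice τ n p.1 * baseChangeGL n F E (uni n p.2) :=
    ((measurable_slice τ n).comp measurable_fst).mul
      (((measurable_baseChangeGL n).comp (measurable_uni n)).comp measurable_snd)
  have hk := measurable_whittakerKernel_right hψ hf g₁ g₂
  have hc1 : ENNReal.ofReal c ^ Fintype.card (TriIdx n) ≠ 0 :=
    pow_ne_zero _ (ENNReal.ofReal_pos.2 hc0).ne'
  have hc2 : ENNReal.ofReal c ^ Fintype.card (TriIdx n) ≠ ⊤ :=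
    ENNReal.pow_ne_top ENNReal.ofReal_ne_top
  have hI := hfd.integrable_whittakerKernel hN μE hψ g₁ g₂
  have heq := h.uniMeasure_eq (n := n) μF μE hc
  rw [heq, integrable_smul_measure hc1 hc2, integrable_map_measure hk.aestronglyMeasurable
    hm.aemeasurable] at hI
  rw [whittaker_eq μE hψ hf, heq, integral_smul_measure, integral_map hm.aemeasurable
    hk.aestronglyMeasurable]
  have h1 := integral_prod_symm _ hI
  simp only [Function.comp_apply] at h1
  rw [h1, ENNReal.toReal_pow, ENNReal.toReal_ofReal hc0.le, Complex.real_smul]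
  congr 1
  refine integral_congr_ae (Eventually.of_forall fun a => ?_)
  refine integral_congr_ae (Eventually.of_forall fun s => ?_)
  exact whittakerKernel_slice_mul h hψF hτ hd₀ g₁ g₂ s a

end SliceIntegral

section Coordinates

open Matrix

variable {F E : Type*} [Field F] [TopologicalSpace F] [IsLocalField F] [MeasurableSpace F]
  [BorelSpace F] [Field E] [TopologicalSpace E] [IsLocalField E] [Algebra F E]
  [ContinuousSMul F E] {N : AbsoluteValue F ℝ} (S : RowSection N) (μ : Measure F)
  [μ.IsAddHaarMeasure] {n : ℕ}

/-- In the variables `Y` of the mirabolic group, the slice integral becomes a Fourier coefficient: the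
character of the superdiagonal sum turns into the pairing with `Y`. -/
theorem RowSection.dens_mul_sliceIntegral (τ : E) {ψ' : AddChar F Circle} (hψ' : Continuous ψ')
    (d : F) {f : GL (Fin n) E → ℂ} (hf : Continuous f) {Y : TriIdx n → F}
    (hY : BlocksNonzero n Y) (g : GL (Fin n) F) :
    (S.dens n Y : ℂ) * sliceIntegral τ ψ' d μ f (baseChangeGL n F E (S.point n Y))
        (baseChangeGL n F E (S.point n Y * g)) =
      ∫ s, f (twist S.k τ n Y s * baseChangeGL n F E g) * (pairChar ψ' d Y s : ℂ)
        ∂(triMeasure μ n) := by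
  borelize E
  set p := baseChangeGL n F E (S.point n Y) with hp
  let A : (TriIdx n → F) → GL (Fin n) E × F := fun s => (p⁻¹ * slice τ n s * p, superSum n s)
  let B : (TriIdx n → F) → GL (Fin n) E × F := fun s => (twist S.k τ n Y s, ∑ t, Y t * s t)
  have hA : Measurable A :=
    ((measurable_const.mul (measurable_slice τ n)).mul measurable_const).prodMk
      (measurable_superSum n)
  have hB : Measurable B := (continuous_twist τ n Y).measurable.prodMk
    (Finset.measurable_sum _ fun t _ => measurable_const.mul (measurable_pi_apply t))
  have hAB : ENNReal.ofReal (S.dens n Y) • (triMeasure μ n).map A = (triMeasure μ n).map B :=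
    Measure.ext_of_lintegral _ fun φ hφ => by
      rw [lintegral_smul_measure, lintegral_map hφ hA, lintegral_map hφ hB, smul_eq_mul]
      exact lintegral_conj_point S τ μ n Y hY hφ
  let Φ : GL (Fin n) E × F → ℂ := fun q => f (q.1 * baseChangeGL n F E g) * (ψ' (d * q.2) : ℂ)
  have hΦ : Measurable Φ := by
    have h1 : Measurable fun q : GL (Fin n) E × F => q.1 * baseChangeGL n F E g :=
      measurable_fst.mul_const _
    have h2 : Measurable fun q : GL (Fin n) E × F => d * q.2 := measurable_snd.const_mul d
    exact (hf.measurable.comp h1).mul (measurable_coe_addChar hψ' h2)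
  have h1 := congrArg (fun ν => ∫ q, Φ q ∂ν) hAB
  rw [integral_smul_measure, integral_map hA.aemeasurable hΦ.aestronglyMeasurable,
    integral_map hB.aemeasurable hΦ.aestronglyMeasurable,
    ENNReal.toReal_ofReal (S.dens_nonneg n Y), Complex.real_smul] at h1
  refine Eq.trans ?_ h1
  congr 1
  refine integral_congr_ae (Eventually.of_forall fun s => ?_)
  simp only [Φ, A, map_mul, ← hp, mul_assoc]

theorem RowSection.dens_pos : ∀ (n : ℕ) (Y : TriIdx n → F), 0 < S.dens n Y
  | 0, _ => one_pos
  | n + 1, Y => mul_pos (dens_pos n _) (inv_pos.2 (normAbs_pos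
      ((isUnit_iff_isUnit_det _).1 (S.point n (triInit Y) * S.g n (triLast Y)).isUnit).ne_zero))

/-- The class of `p_Y`. -/
def RowSection.pointClass (n : ℕ) (Y : TriIdx n → F) : LeftQuotient (unipotentToMirabolic n F) :=
  Quotient.mk (QuotientGroup.rightRel (unipotentToMirabolic n F).range)
    (⟨S.point n Y, S.point_mem n Y⟩ : mirabolicSubgroup n F)

theorem RowSection.measurable_pointClass (n : ℕ) : Measurable (S.pointClass n) :=
  measurable_leftQuotient_mk.comp (S.measurable_point n).subtype_mk

/-- The quotient measure on `N_n \ P_n` in the coordinates `p_Y`. -/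
theorem RowSection.quotientMeasure_eq {m : ℕ}
    {ν : Measure (LeftQuotient (unipotentToMirabolic (m + 1) F))}
    (hν : IsQuotientMeasure (unipotentToMirabolic (m + 1) F) (unipotentMeasure (m + 1) μ)
      (mirabolicMeasure (m + 1) μ) ν) :
    ν = ((triMeasure μ (m + 1)).withDensity fun Y => ENNReal.ofReal (S.dens (m + 1) Y)).map
      (S.pointClass (m + 1)) := by
  obtain ⟨w, hw⟩ := exists_isCutoff_generalLinear μ (m + 1)
  refine Measure.ext fun A hA => ?_
  set L : mirabolicSubgroup (m + 1) F → ℝ≥0∞ := fun p => A.indicator 1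
    (Quotient.mk (QuotientGroup.rightRel (unipotentToMirabolic (m + 1) F).range) p) with hL
  have hLm : Measurable L := (measurable_one.indicator hA).comp measurable_leftQuotient_mk
  have hLi : LeftInvariantUnder (unipotentToMirabolic (m + 1) F) L := by
    intro u p
    have h1 : (Quotient.mk (QuotientGroup.rightRel (unipotentToMirabolic (m + 1) F).range)
        (unipotentToMirabolic (m + 1) F u * p)) = Quotient.mk _ p := by
      refine Quotient.sound ?_
      change QuotientGroup.rightRel _ _ _
      rw [QuotientGroup.rightRel_apply]
      exact ⟨u⁻¹, by rw [map_inv]; group⟩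
    simp only [hL, h1]
  obtain ⟨L', hL'm, hL'⟩ := (MeasurableEmbedding.subtype_coe
    (isClosed_mirabolicSubgroup (K := F) (m + 1)).measurableSet).exists_measurable_extend hLm
      fun _ => ⟨0⟩
  have hLe : ∀ p : mirabolicSubgroup (m + 1) F, L' p = L p := fun p => congrFun hL' p
  have h1 : ∀ x : LeftQuotient (unipotentToMirabolic (m + 1) F), L x.out = A.indicator 1 x :=
    fun x => by rw [hL]; exact congrArg _ (Quotient.out_eq x)
  have h2 : ∀ Y x, w (uni (m + 1) x * S.point (m + 1) Y) * L' (uni (m + 1) x * S.point (m + 1) Y) =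
      w (uni (m + 1) x * S.point (m + 1) Y) * A.indicator 1 (S.pointClass (m + 1) Y) := by
    intro Y x
    have h3 := hLe (unipotentToMirabolic (m + 1) F ⟨uni (m + 1) x, uni_mem _ x⟩ *
      ⟨S.point (m + 1) Y, S.point_mem (m + 1) Y⟩)
    rw [hLi] at h3
    exact congrArg _ h3
  have hwm : Measurable fun g => w g * L' g := hw.measurable.mul hL'm
  have h4 : ∀ Y, ∫⁻ x, w (uni (m + 1) x * S.point (m + 1) Y) ∂(triMeasure μ (m + 1)) = 1 :=
    fun Y => (lintegral_unipotentMeasure μ (m + 1) (φ := fun g => w (g * S.point (m + 1) Y))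
      (hw.measurable.comp (measurable_mul_const _))).symm.trans (hw.orbitSum_eq _)
  have h5 : ∀ Y, ∫⁻ x, w (uni (m + 1) x * S.point (m + 1) Y) *
      L' (uni (m + 1) x * S.point (m + 1) Y) ∂(triMeasure μ (m + 1)) =
        A.indicator 1 (S.pointClass (m + 1) Y) := fun Y => by
    rw [lintegral_congr (h2 Y), lintegral_mul_const, h4, one_mul]
    exact hw.measurable.comp ((measurable_uni _).mul_const _)
  calc ν A = ∫⁻ x, A.indicator 1 x ∂ν := (lintegral_indicator_one hA).symm
    _ = ∫⁻ x, L x.out ∂ν := lintegral_congr fun x => (h1 x).symm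
    _ = ∫⁻ p, w p * L p ∂(mirabolicMeasure (m + 1) μ) :=
        hν.lintegral_eq (hw.mirabolic μ) hLm hLi measurable_unipotentToMirabolic
    _ = ∫⁻ p, w p * L' p ∂(mirabolicMeasure (m + 1) μ) :=
        lintegral_congr fun p => by rw [hLe]
    _ = ∫⁻ Y, ENNReal.ofReal (S.dens (m + 1) Y) * A.indicator 1 (S.pointClass (m + 1) Y)
        ∂(triMeasure μ (m + 1)) := by
        rw [S.lintegral_mirabolicMeasure_point μ m hwm]
        exact lintegral_congr fun Y => congrArg _ (h5 Y)
    _ = ∫⁻ Y, A.indicator 1 (S.pointClass (m + 1) Y) ∂((triMeasure μ (m + 1)).withDensity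
        fun Y => ENNReal.ofReal (S.dens (m + 1) Y)) :=
        (lintegral_withDensity_eq_lintegral_mul _ (S.measurable_dens _).ennreal_ofReal
          ((measurable_one.indicator hA).comp (S.measurable_pointClass _))).symm
    _ = ∫⁻ x, A.indicator 1 x ∂(((triMeasure μ (m + 1)).withDensity
        fun Y => ENNReal.ofReal (S.dens (m + 1) Y)).map (S.pointClass (m + 1))) :=
        (lintegral_map (measurable_one.indicator hA) (S.measurable_pointClass _)).symm
    _ = _ := lintegral_indicator_one hA

end Coordinates

/-! ### Unfolding of the double integral -/

section Unfolding

open Matrix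

variable {F E : Type*} [Field F] [TopologicalSpace F] [IsLocalField F] [MeasurableSpace F]
  [BorelSpace F] [Field E] [TopologicalSpace E] [IsLocalField E] [Algebra F E]
  [ContinuousSMul F E] [CharZero F] {N : AbsoluteValue E ℝ} {n : ℕ} {f : GL (Fin n) E → ℂ}

theorem IsDecayingGL.comp_mul_right (hf : IsDecayingGL N f) (g₀ : GL (Fin n) E) :
    IsDecayingGL N fun g => f (g * g₀) := by
  refine ⟨hf.continuous.comp (continuous_mul_const g₀), fun M => ?_⟩
  obtain ⟨C, hC, hle⟩ := hf.exists_le M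
  have h0 := height_pos (N := N) g₀
  refine ⟨C * height N g₀ ^ M, by positivity, fun g => (hle _).trans ?_⟩
  refine (mul_le_mul_of_nonneg_left (heightDecay_mul_le_right M g g₀) hC).trans_eq ?_
  ring

variable (hN : IsProperAbs N) (S : RowSection (N.restrict F)) {τ : E}
  {σ : E ≃ₐ[F] E} (h : IsTraceZeroGenerator τ σ) (μ : Measure F) [μ.IsAddHaarMeasure]

include hN h in
theorem IsProperAbs.exists_integrable_heightDecay_baseChangeGL (n : ℕ) : ∃ M, Integrable
    (fun g : GL (Fin n) F => heightDecay N M (baseChangeGL n F E g))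
      (generalLinearMeasure n μ) := by
  have hNF := h.isProperAbs_restrict hN
  obtain ⟨M, hM⟩ := hNF.exists_lintegral_heightDecay_generalLinear μ n
  have h1 : (fun g : GL (Fin n) F => heightDecay N M (baseChangeGL n F E g)) =
      heightDecay (N.restrict F) M := by
    funext g
    rw [heightDecay, height_baseChangeGL, heightDecay]
  refine ⟨M, ?_⟩
  rw [h1]
  refine ⟨(hNF.continuous_heightDecay M).aestronglyMeasurable, ?_⟩
  rw [hasFiniteIntegral_iff_ofReal (Eventually.of_forall fun g => (heightDecay_pos M g).le)]
  exact hM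

include hN h in
theorem IsDecayingGL.integrable_baseChangeGL (hf : IsDecayingGL N f) :
    Integrable (fun g => f (baseChangeGL n F E g)) (generalLinearMeasure n μ) := by
  obtain ⟨M, hM⟩ := hN.exists_integrable_heightDecay_baseChangeGL h μ n
  obtain ⟨C, hC, hle⟩ := hf.exists_le M
  exact (hM.const_mul C).mono' (hf.continuous.comp (continuous_baseChangeGL n)).aestronglyMeasurable
    (Eventually.of_forall fun g => hle _)

/-- The Fourier transform of `s ↦ f(A_Y(s) g)` at `Y`. -/
def twistIntegral (τ : E) (ψ' : AddChar F Circle) (d : F) (f : GL (Fin n) E → ℂ)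
    (Y : TriIdx n → F) (g : GL (Fin n) F) : ℂ :=
  ∫ s, f (twist S.k τ n Y s * baseChangeGL n F E g) * (pairChar ψ' d Y s : ℂ) ∂(triMeasure μ n)

variable {ψ' : AddChar F Circle} (hψ' : Continuous ψ') (d : F)

include hψ' in
theorem measurable_twistIntegral (hf : Continuous f) :
    Measurable fun p : (TriIdx n → F) × GL (Fin n) F => twistIntegral S μ τ ψ' d f p.1 p.2 := by
  borelize E
  have h1 : Measurable fun p : ((TriIdx n → F) × GL (Fin n) F) × (TriIdx n → F) =>
      twist S.k τ n p.1.1 p.2 :=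
    (measurable_twist τ S.measurable_k n).comp
      ((measurable_fst.comp measurable_fst).prodMk measurable_snd)
  have h2 : Measurable fun p : ((TriIdx n → F) × GL (Fin n) F) × (TriIdx n → F) =>
      baseChangeGL n F E p.1.2 :=
    (measurable_baseChangeGL n).comp (measurable_snd.comp measurable_fst)
  have h3 : Measurable fun p : ((TriIdx n → F) × GL (Fin n) F) × (TriIdx n → F) =>
      d * ∑ t, p.1.1 t * p.2 t :=
    (measurable_sum_mul d).comp ((measurable_fst.comp measurable_fst).prodMk measurable_snd)
  have h4 : Measurable fun p : ((TriIdx n → F) × GL (Fin n) F) × (TriIdx n → F) =>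
      f (twist S.k τ n p.1.1 p.2 * baseChangeGL n F E p.1.2) *
        (pairChar ψ' d p.1.1 p.2 : ℂ) :=
    (hf.measurable.comp (h1.mul h2)).mul (measurable_coe_addChar hψ' h3)
  exact (h4.stronglyMeasurable.integral_prod_right' (ν := triMeasure μ n)).measurable

include hN h hψ' in
theorem IsRapidGL.integrable_twistIntegral (hf : IsRapidGL N f) (hψ'1 : ψ' ≠ 1) (hd : d ≠ 0) :
    Integrable (fun p : (TriIdx n → F) × GL (Fin n) F => twistIntegral S μ τ ψ' d f p.1 p.2)
      ((triMeasure μ n).prod (generalLinearMeasure n μ)) := by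
  obtain ⟨M₁, h1⟩ := (h.isProperAbs_restrict hN).exists_integrable_prodHeight μ
  obtain ⟨M₂, h2⟩ := hN.exists_integrable_heightDecay_baseChangeGL h μ n
  obtain ⟨C, hC, hle⟩ := hf.exists_norm_integral_twist_le hN S h μ hψ' hψ'1 hd (M₁ + M₂)
  refine (((h1 (ι := TriIdx n)).mul_prod h2).const_mul C).mono'
    (measurable_twistIntegral S μ hψ' d hf.continuous).aestronglyMeasurable
      (Eventually.of_forall fun p => (hle p.1 p.2).trans ?_)
  have hP := one_le_prodHeight (N := N.restrict F) p.1
  have h3 := heightDecay_anti (N := N) (Nat.le_add_left M₂ M₁) (baseChangeGL n F E p.2)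
  have h4 := heightDecay_pos (N := N) (M₁ + M₂) (baseChangeGL n F E p.2)
  rw [prod_decay_eq, mul_assoc]
  refine mul_le_mul_of_nonneg_left (mul_le_mul ?_ h3 h4.le (by positivity)) hC
  exact inv_anti₀ (by positivity) (pow_le_pow_right₀ hP (by omega))

include hN h hψ' in
/-- Fourier inversion on the slice, at a fixed point of `GL_n(F)`. -/
theorem IsDecayingGL.integral_twistIntegral (hf : IsDecayingGL N f) (hμ : IsSelfDual ψ' μ)
    (hd : d ≠ 0) (g : GL (Fin n) F)
    (hint : Integrable (fun Y => twistIntegral S μ τ ψ' d f Y g) (triMeasure μ n)) :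
    ∫ Y, twistIntegral S μ τ ψ' d f Y g ∂(triMeasure μ n) =
      (((normAbs d)⁻¹ : ℝ) : ℂ) ^ Fintype.card (TriIdx n) * f (baseChangeGL n F E g) := by
  have h1 := (hf.comp_mul_right (baseChangeGL n F E g)).integral_integral_twist hN S h μ hψ' hμ hd
    n hint
  rwa [one_mul] at h1

end Unfolding

/-! ### The double integral over the quotients -/

section DoubleIntegral

open Matrix

variable {F E : Type*} [Field F] [TopologicalSpace F] [IsLocalField F] [MeasurableSpace F]
  [BorelSpace F] [Field E] [TopologicalSpace E] [IsLocalField E] [Algebra F E]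
  [ContinuousSMul F E] {n : ℕ} {f : GL (Fin n) E → ℂ}

theorem measurable_unipotentSubgroup_subtype : Measurable (unipotentSubgroup n F).subtype :=
  measurable_subtype_coe

section Point

variable {N : AbsoluteValue F ℝ} (S : RowSection N) (τ : E) {ψ' : AddChar F Circle}
  (hψ' : Continuous ψ') (d : F) (μ : Measure F) [μ.IsAddHaarMeasure] (hf : Continuous f)
  {Y : TriIdx n → F} (hY : BlocksNonzero n Y)

include hψ' hf hY

/-- Translation of the variable `h` by `p_Y`. -/
theorem dens_mul_lintegral_sliceIntegral :
    ENNReal.ofReal (S.dens n Y) * ∫⁻ g, ‖sliceIntegral τ ψ' d μ f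
        (baseChangeGL n F E (S.point n Y)) (baseChangeGL n F E g)‖ₑ ∂(generalLinearMeasure n μ) =
      ∫⁻ g, ‖∫ s, f (twist S.k τ n Y s * baseChangeGL n F E g) * (pairChar ψ' d Y s : ℂ)
        ∂(triMeasure μ n)‖ₑ ∂(generalLinearMeasure n μ) := by
  have h1 := lintegral_mul_left_eq_self (μ := generalLinearMeasure n μ)
    (fun g => ‖sliceIntegral τ ψ' d μ f (baseChangeGL n F E (S.point n Y))
      (baseChangeGL n F E g)‖ₑ) (S.point n Y)
  rw [← h1, ← lintegral_const_mul' _ _ ENNReal.ofReal_ne_top]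
  refine lintegral_congr fun g => ?_
  rw [← S.dens_mul_sliceIntegral μ τ hψ' d hf hY g, enorm_mul]
  congr 1
  rw [← ofReal_norm, Complex.norm_of_nonneg (S.dens_nonneg n Y)]

theorem dens_mul_integral_sliceIntegral :
    (S.dens n Y : ℂ) * ∫ g, sliceIntegral τ ψ' d μ f
        (baseChangeGL n F E (S.point n Y)) (baseChangeGL n F E g) ∂(generalLinearMeasure n μ) =
      ∫ g, ∫ s, f (twist S.k τ n Y s * baseChangeGL n F E g) * (pairChar ψ' d Y s : ℂ)
        ∂(triMeasure μ n) ∂(generalLinearMeasure n μ) := by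
  have h1 := integral_mul_left_eq_self (μ := generalLinearMeasure n μ)
    (fun g => sliceIntegral τ ψ' d μ f (baseChangeGL n F E (S.point n Y))
      (baseChangeGL n F E g)) (S.point n Y)
  rw [← h1, ← integral_const_mul]
  exact congrArg (fun φ : GL (Fin n) F → ℂ => ∫ g, φ g ∂(generalLinearMeasure n μ))
    (funext fun g => S.dens_mul_sliceIntegral μ τ hψ' d hf hY g)

end Point

variable [CharZero F] [MeasurableSpace E] [BorelSpace E] {N : AbsoluteValue E ℝ}
  (hN : IsProperAbs N) (S : RowSection (N.restrict F)) {τ : E}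
  {σ : E ≃ₐ[F] E} (h : IsTraceZeroGenerator τ σ) (μF : Measure F) [μF.IsAddHaarMeasure]
  (μE : Measure E) [μE.IsAddHaarMeasure] {c : ℝ} (hc0 : 0 < c)
  (hc : μE = ENNReal.ofReal c • (μF.prod μF).map h.homeomorph)
  {ψ' : AddChar F Circle} (hψ' : Continuous ψ') {ψ : AddChar E Circle} (hψ : Continuous ψ)
  (hψF : ∀ x : F, ψ (algebraMap F E x) = 1)
  (hτ : ∀ z : E, ψ z = ψ' (Algebra.trace F E (τ * z))) {d₀ : F}
  (hd₀ : algebraMap F E d₀ = τ ^ 2)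
  {νG : Measure (LeftQuotient (unipotentSubgroup n F).subtype)}
  (hνG : IsQuotientMeasure (unipotentSubgroup n F).subtype (unipotentMeasure n μF)
    (generalLinearMeasure n μF) νG)

include hψ' in
theorem measurable_sliceIntegral_baseChangeGL (hf : Continuous f) (d : F) (g₁ : GL (Fin n) E) :
    Measurable fun g : GL (Fin n) F =>
      sliceIntegral τ ψ' d μF f g₁ (baseChangeGL n F E g) := by
  have h1 : Measurable fun g : GL (Fin n) F => (g₁, baseChangeGL n F E g) :=
    measurable_const.prodMk (measurable_baseChangeGL n)
  have h2 := (measurable_sliceIntegral (τ := τ) hψ' d μF hf).comp h1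
  simpa only [Function.comp_def] using h2

include hN h hc0 hc hψ' hψ hψF hτ hd₀

theorem IsDecayingGL.whittaker_eq_integral_unipotentMeasure (hf : IsDecayingGL N f)
    (g₁ : GL (Fin n) E) (g : GL (Fin n) F) :
    whittaker ψ μE f g₁ (baseChangeGL n F E g) = ((c ^ Fintype.card (TriIdx n) : ℝ) : ℂ) *
      ∫ u, sliceIntegral τ ψ' (-((-1) ^ n * (2 * d₀))) μF f g₁
        (baseChangeGL n F E ((unipotentSubgroup n F).subtype u * g)) ∂(unipotentMeasure n μF) := by
  have hm : Measurable fun u : GL (Fin n) F => sliceIntegral τ ψ' (-((-1) ^ n * (2 * d₀))) μF f g₁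
      (baseChangeGL n F E (u * g)) :=
    (measurable_sliceIntegral_baseChangeGL μF hψ' hf.continuous _ g₁).comp (measurable_mul_const g)
  rw [hf.whittaker_eq_sliceIntegral hψ' μF hf.continuous h μE hc hψ hψF hτ hd₀ hN hc0]
  congr 1
  have h1 := integral_uniMeasure μF n hm
  rw [uniMeasure, ← map_unipotentMeasure, integral_map measurable_subtype_coe.aemeasurable
    hm.aestronglyMeasurable] at h1
  simp only [map_mul] at h1 ⊢
  exact h1.symm

include hνG

theorem IsDecayingGL.lintegral_whittaker_le (hf : IsDecayingGL N f) (g₁ : GL (Fin n) E) :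
    ∫⁻ x, ‖whittaker ψ μE f g₁ (baseChangeGL n F E x.out)‖ₑ ∂νG ≤
      ENNReal.ofReal (c ^ Fintype.card (TriIdx n)) *
        ∫⁻ g, ‖sliceIntegral τ ψ' (-((-1) ^ n * (2 * d₀))) μF f g₁ (baseChangeGL n F E g)‖ₑ
          ∂(generalLinearMeasure n μF) := by
  have hm := (measurable_sliceIntegral_baseChangeGL (τ := τ) μF hψ' hf.continuous
    (-((-1) ^ n * (2 * d₀))) g₁).enorm
  rw [hνG _ hm, ← lintegral_const_mul' _ _ ENNReal.ofReal_ne_top]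
  refine lintegral_mono fun x => ?_
  dsimp only
  rw [hf.whittaker_eq_integral_unipotentMeasure hN h μF μE hc0 hc hψ' hψ hψF hτ hd₀, enorm_mul,
    ← ofReal_norm, Complex.norm_of_nonneg (by positivity)]
  exact mul_le_mul_right (enorm_integral_le_lintegral_enorm _) _

theorem IsDecayingGL.integral_whittaker (hf : IsDecayingGL N f) (g₁ : GL (Fin n) E)
    (hI : Integrable (fun g : GL (Fin n) F => sliceIntegral τ ψ' (-((-1) ^ n * (2 * d₀))) μF f g₁
      (baseChangeGL n F E g)) (generalLinearMeasure n μF)) :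
    ∫ x, whittaker ψ μE f g₁ (baseChangeGL n F E x.out) ∂νG =
      ((c ^ Fintype.card (TriIdx n) : ℝ) : ℂ) *
        ∫ g, sliceIntegral τ ψ' (-((-1) ^ n * (2 * d₀))) μF f g₁ (baseChangeGL n F E g)
          ∂(generalLinearMeasure n μF) := by
  have hm := measurable_sliceIntegral_baseChangeGL (τ := τ) μF hψ' hf.continuous
    (-((-1) ^ n * (2 * d₀))) g₁
  rw [← hνG.integral_orbit measurable_unipotentSubgroup_subtype hm hI, ← integral_const_mul]
  exact congrArg (fun φ : LeftQuotient (unipotentSubgroup n F).subtype → ℂ => ∫ x, φ x ∂νG)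
    (funext fun x => hf.whittaker_eq_integral_unipotentMeasure hN h μF μE hc0 hc hψ' hψ hψF hτ
      hd₀ g₁ x.out)

end DoubleIntegral

section Assembly

open Matrix

variable {F E : Type*} [Field F] [TopologicalSpace F] [IsLocalField F] [MeasurableSpace F]
  [BorelSpace F] [Field E] [TopologicalSpace E] [IsLocalField E] [Algebra F E]
  [ContinuousSMul F E] [MeasurableSpace E] [BorelSpace E] (μE : Measure E) [μE.IsAddHaarMeasure]

section Invariance

variable {n : ℕ} {f : GL (Fin n) E → ℂ} {ψ : AddChar E Circle} (hψ : Continuous ψ)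
  (hψF : ∀ x : F, ψ (algebraMap F E x) = 1) (hf : Continuous f)

include hψ hψF hf

theorem leftInvariantUnder_whittaker_left (g₂ : GL (Fin n) E) :
    LeftInvariantUnder (unipotentToMirabolic n F) fun p : mirabolicSubgroup n F =>
      whittaker ψ μE f (baseChangeGL n F E p) g₂ := by
  intro u p
  have h1 := whittaker_mul_left μE hψ hψF hf (triCoord (u : GL (Fin n) F))
    (baseChangeGL n F E p) g₂
  rw [uni_triCoord u.2, ← map_mul] at h1
  exact h1

theorem leftInvariantUnder_whittaker_right (g₁ : GL (Fin n) E) :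
    LeftInvariantUnder (unipotentSubgroup n F).subtype fun g : GL (Fin n) F =>
      whittaker ψ μE f g₁ (baseChangeGL n F E g) := by
  intro u g
  have h1 := whittaker_mul_right μE hψ hψF hf (triCoord (u : GL (Fin n) F)) g₁
    (baseChangeGL n F E g)
  rw [uni_triCoord u.2, ← map_mul] at h1
  exact h1

theorem measurable_whittakerOnQuotients : Measurable
    fun ph : LeftQuotient (unipotentToMirabolic n F) ×
      LeftQuotient (unipotentSubgroup n F).subtype =>
        whittakerOnQuotients ψ μE f ph.1 ph.2 := by
  obtain ⟨w, hw⟩ := exists_isCutoff_generalLinear (Measure.addHaar : Measure F) n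
  have h1 : Measurable fun q : mirabolicSubgroup n F × GL (Fin n) F =>
      (baseChangeGL n F E q.1, baseChangeGL n F E q.2) :=
    ((measurable_baseChangeGL n).comp (measurable_subtype_coe.comp measurable_fst)).prodMk
      ((measurable_baseChangeGL n).comp measurable_snd)
  have h2 := (measurable_whittaker (n := n) μE hψ hf).comp h1
  exact measurable_out_prod measurable_unipotentToMirabolic measurable_unipotentSubgroup_subtype
    (hw.mirabolic Measure.addHaar) hw
    (L := fun (p : mirabolicSubgroup n F) (g : GL (Fin n) F) =>
      whittaker ψ μE f (baseChangeGL n F E p) (baseChangeGL n F E g)) h2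
    (fun g => leftInvariantUnder_whittaker_left μE hψ hψF hf _)
    fun p => leftInvariantUnder_whittaker_right μE hψ hψF hf _

/-- The representative of the class of `p_Y` may be replaced by `p_Y`. -/
theorem whittakerOnQuotients_pointClass {N : AbsoluteValue F ℝ} (S : RowSection N) (Y : TriIdx n → F)
    (y : LeftQuotient (unipotentSubgroup n F).subtype) :
    whittakerOnQuotients ψ μE f (S.pointClass n Y) y =
      whittaker ψ μE f (baseChangeGL n F E (S.point n Y)) (baseChangeGL n F E y.out) :=
  (leftInvariantUnder_whittaker_left μE hψ hψF hf (baseChangeGL n F E y.out)).out_eq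
    ⟨S.point n Y, S.point_mem n Y⟩

end Invariance

variable [CharZero F] {N : AbsoluteValue E ℝ}
  (hN : IsProperAbs N) (S : RowSection (N.restrict F)) {τ : E}
  {σ : E ≃ₐ[F] E} (h : IsTraceZeroGenerator τ σ) (μF : Measure F) [μF.IsAddHaarMeasure]
  {c : ℝ} (hc0 : 0 < c)
  (hc : μE = ENNReal.ofReal c • (μF.prod μF).map h.homeomorph)
  {ψ' : AddChar F Circle} (hψ' : Continuous ψ') (hψ'1 : ψ' ≠ 1)
  {ψ : AddChar E Circle} (hψ : Continuous ψ)
  (hψF : ∀ x : F, ψ (algebraMap F E x) = 1)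
  (hτ : ∀ z : E, ψ z = ψ' (Algebra.trace F E (τ * z))) {d₀ : F} (hd₀0 : d₀ ≠ 0)
  (hd₀ : algebraMap F E d₀ = τ ^ 2) {m : ℕ} {f : GL (Fin (m + 1)) E → ℂ} (hf : IsRapidGL N f)
  {νP : Measure (LeftQuotient (unipotentToMirabolic (m + 1) F))}
  (hνP : IsQuotientMeasure (unipotentToMirabolic (m + 1) F) (unipotentMeasure (m + 1) μF)
    (mirabolicMeasure (m + 1) μF) νP)
  {νG : Measure (LeftQuotient (unipotentSubgroup (m + 1) F).subtype)}
  (hνG : IsQuotientMeasure (unipotentSubgroup (m + 1) F).subtype (unipotentMeasure (m + 1) μF)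
    (generalLinearMeasure (m + 1) μF) νG)

include hN S h hc0 hc hψ' hψ'1 hψ hψF hτ hd₀0 hd₀ hf hνP hνG

/-- Absolute convergence: the unfolded integral is bounded by the integral over `(Y, g)` of the
absolute values of the Fourier coefficients of `s ↦ f(A_Y(s) g)`. -/
theorem IsRapidGL.integrable_whittakerOnQuotients : Integrable
    (fun ph : LeftQuotient (unipotentToMirabolic (m + 1) F) ×
        LeftQuotient (unipotentSubgroup (m + 1) F).subtype =>
      whittakerOnQuotients ψ μE f ph.1 ph.2) (νP.prod νG) := by
  have hm := measurable_whittakerOnQuotients (F := F) μE hψ hψF hf.continuous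
  have hσ := hνG.sigmaFinite measurable_unipotentSubgroup_subtype
  set d : F := -((-1) ^ (m + 1) * (2 * d₀)) with hd
  have hd0 : d ≠ 0 := by
    rw [hd, neg_ne_zero]
    exact mul_ne_zero (pow_ne_zero _ (neg_ne_zero.2 one_ne_zero)) (mul_ne_zero two_ne_zero hd₀0)
  have hJ := hf.integrable_twistIntegral hN S h μF hψ' d hψ'1 hd0
  refine ⟨hm.aestronglyMeasurable, ?_⟩
  set Q : LeftQuotient (unipotentToMirabolic (m + 1) F) → ℝ≥0∞ := fun x =>
    ∫⁻ y, ‖whittakerOnQuotients ψ μE f x y‖ₑ ∂νG with hQ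
  have hQm : Measurable Q := hm.enorm.lintegral_prod_right'
  have hle : ∀ᵐ Y ∂(triMeasure μF (m + 1)),
      ENNReal.ofReal (S.dens (m + 1) Y) * Q (S.pointClass (m + 1) Y) ≤
        ENNReal.ofReal (c ^ Fintype.card (TriIdx (m + 1))) *
          ∫⁻ g, ‖twistIntegral S μF τ ψ' d f Y g‖ₑ ∂(generalLinearMeasure (m + 1) μF) := by
    filter_upwards [ae_blocksNonzero μF (m + 1)] with Y hY
    have h1 := hf.lintegral_whittaker_le hN h μF μE hc0 hc hψ' hψ hψF hτ hd₀ hνG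
      (baseChangeGL (m + 1) F E (S.point (m + 1) Y))
    have h2 := dens_mul_lintegral_sliceIntegral S τ hψ' d μF hf.continuous hY
    have h3 : Q (S.pointClass (m + 1) Y) = ∫⁻ y, ‖whittaker ψ μE f
        (baseChangeGL (m + 1) F E (S.point (m + 1) Y)) (baseChangeGL (m + 1) F E y.out)‖ₑ ∂νG :=
      lintegral_congr fun y => by
        rw [whittakerOnQuotients_pointClass μE hψ hψF hf.continuous S Y y]
    rw [h3]
    refine (mul_le_mul_right h1 _).trans_eq ?_
    rw [mul_left_comm, h2]
    rfl
  rw [hasFiniteIntegral_iff_enorm, lintegral_prod _ hm.enorm.aemeasurable]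
  change ∫⁻ x, Q x ∂νP < ⊤
  have hQp : Measurable fun Y => Q (S.pointClass (m + 1) Y) :=
    hQm.comp (S.measurable_pointClass _)
  rw [S.quotientMeasure_eq μF hνP, lintegral_map hQm (S.measurable_pointClass _),
    lintegral_withDensity_eq_lintegral_mul _ (S.measurable_dens _).ennreal_ofReal hQp]
  refine (lintegral_mono_ae hle).trans_lt ?_
  rw [lintegral_const_mul' _ _ ENNReal.ofReal_ne_top]
  refine ENNReal.mul_lt_top ENNReal.ofReal_lt_top ?_
  have hJ2 := hJ.hasFiniteIntegral
  rwa [hasFiniteIntegral_iff_enorm, lintegral_prod _ hJ.aestronglyMeasurable.enorm] at hJ2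

/-- The double integral: after unfolding, it is the integral over `g` of the integral over `Y` of the
Fourier coefficients of `s ↦ f(A_Y(s) g)`, which is computed by Fourier inversion. -/
theorem IsRapidGL.integral_whittakerOnQuotients (hμF : IsSelfDual ψ' μF) :
    ∫ p, ∫ g, whittakerOnQuotients ψ μE f p g ∂νG ∂νP =
      (((c * (normAbs (2 * d₀))⁻¹) ^ Fintype.card (TriIdx (m + 1)) : ℝ) : ℂ) *
        ∫ g, f (baseChangeGL (m + 1) F E g) ∂(generalLinearMeasure (m + 1) μF) := by
  have hm := measurable_whittakerOnQuotients (F := F) μE hψ hψF hf.continuous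
  have hσ := hνG.sigmaFinite measurable_unipotentSubgroup_subtype
  set d : F := -((-1) ^ (m + 1) * (2 * d₀)) with hd
  have hd0 : d ≠ 0 := by
    rw [hd, neg_ne_zero]
    exact mul_ne_zero (pow_ne_zero _ (neg_ne_zero.2 one_ne_zero)) (mul_ne_zero two_ne_zero hd₀0)
  have hdabs : normAbs d = normAbs (2 * d₀) := by
    rw [hd, normAbs_neg, normAbs_mul, normAbs_pow, normAbs_neg, normAbs_one, one_pow, one_mul]
  have hJ := hf.integrable_twistIntegral hN S h μF hψ' d hψ'1 hd0
  set R : LeftQuotient (unipotentToMirabolic (m + 1) F) → ℂ := fun x =>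
    ∫ y, whittakerOnQuotients ψ μE f x y ∂νG with hR
  have hRm : StronglyMeasurable R := hm.stronglyMeasurable.integral_prod_right'
  have heq : ∀ᵐ Y ∂(triMeasure μF (m + 1)),
      (ENNReal.ofReal (S.dens (m + 1) Y)).toReal • R (S.pointClass (m + 1) Y) =
        ((c ^ Fintype.card (TriIdx (m + 1)) : ℝ) : ℂ) *
          ∫ g, twistIntegral S μF τ ψ' d f Y g ∂(generalLinearMeasure (m + 1) μF) := by
    filter_upwards [ae_blocksNonzero μF (m + 1), hJ.prod_right_ae] with Y hY hJY
    have h2 := dens_mul_lintegral_sliceIntegral S τ hψ' d μF hf.continuous hY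
    have hI : Integrable (fun g : GL (Fin (m + 1)) F => sliceIntegral τ ψ' d μF f
        (baseChangeGL (m + 1) F E (S.point (m + 1) Y)) (baseChangeGL (m + 1) F E g))
          (generalLinearMeasure (m + 1) μF) := by
      refine ⟨(measurable_sliceIntegral_baseChangeGL μF hψ' hf.continuous d
        _).aestronglyMeasurable, ?_⟩
      rw [hasFiniteIntegral_iff_enorm]
      refine ENNReal.lt_top_of_mul_ne_top_right (a := ENNReal.ofReal (S.dens (m + 1) Y)) ?_
        (ENNReal.ofReal_pos.2 (S.dens_pos _ _)).ne'
      rw [h2]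
      exact hJY.hasFiniteIntegral.ne
    have h1 := hf.integral_whittaker hN h μF μE hc0 hc hψ' hψ hψF hτ hd₀ hνG
      (baseChangeGL (m + 1) F E (S.point (m + 1) Y)) hI
    have h3 : R (S.pointClass (m + 1) Y) = ∫ y, whittaker ψ μE f
        (baseChangeGL (m + 1) F E (S.point (m + 1) Y)) (baseChangeGL (m + 1) F E y.out) ∂νG :=
      congrArg (fun φ : LeftQuotient (unipotentSubgroup (m + 1) F).subtype → ℂ => ∫ y, φ y ∂νG)
        (funext fun y => whittakerOnQuotients_pointClass μE hψ hψF hf.continuous S Y y)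
    have h4 := dens_mul_integral_sliceIntegral S τ hψ' d μF hf.continuous hY
    rw [h3, h1, ENNReal.toReal_ofReal (S.dens_nonneg _ _), Complex.real_smul, mul_left_comm]
    exact congrArg _ h4
  have hinv : ∀ᵐ g ∂(generalLinearMeasure (m + 1) μF),
      ∫ Y, twistIntegral S μF τ ψ' d f Y g ∂(triMeasure μF (m + 1)) =
        (((normAbs d)⁻¹ : ℝ) : ℂ) ^ Fintype.card (TriIdx (m + 1)) *
          f (baseChangeGL (m + 1) F E g) := by
    filter_upwards [hJ.prod_left_ae] with g hg
    exact hf.integral_twistIntegral hN S h μF hψ' d hμF hd0 g hg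
  have h1 : ∫ x, R x ∂νP = ∫ Y, ((c ^ Fintype.card (TriIdx (m + 1)) : ℝ) : ℂ) *
      ∫ g, twistIntegral S μF τ ψ' d f Y g ∂(generalLinearMeasure (m + 1) μF)
        ∂(triMeasure μF (m + 1)) := by
    rw [S.quotientMeasure_eq μF hνP, integral_map (S.measurable_pointClass _).aemeasurable
      hRm.aestronglyMeasurable, integral_withDensity_eq_integral_toReal_smul
        (S.measurable_dens _).ennreal_ofReal
          (Eventually.of_forall fun _ => ENNReal.ofReal_lt_top)]
    exact integral_congr_ae heq
  have h2 := integral_integral_swap (f := fun Y g => twistIntegral S μF τ ψ' d f Y g) hJ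
  refine h1.trans ?_
  rw [integral_const_mul, h2, integral_congr_ae hinv, integral_const_mul, ← mul_assoc, hdabs,
    mul_pow]
  push_cast
  rfl

end Assembly

end

theorem mainTheorem9
    {F E : Type*} [Field F] [TopologicalSpace F] [IsLocalField F] [CharZero F]
    [MeasurableSpace F] [BorelSpace F]
    [Field E] [TopologicalSpace E] [IsLocalField E] [MeasurableSpace E] [BorelSpace E]
    [Algebra F E] [ContinuousSMul F E] [Algebra.IsQuadraticExtension F E]
    (ψ' : AddChar F Circle) (hψ'_cont : Continuous ψ') (hψ'_ne : ψ' ≠ 1)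
    (ψ : AddChar E Circle) (hψ_cont : Continuous ψ) (hψ_ne : ψ ≠ 1)
    (hψ_triv : ∀ x : F, ψ (algebraMap F E x) = 1)
    (τ : E) (hτ_trace : Algebra.trace F E τ = 0)
    (hτ : ∀ z : E, ψ z = ψ' (Algebra.trace F E (τ * z)))
    (μF : Measure F) (hμF : IsSelfDual ψ' μF)
    (μE : Measure E)
    (hμE : IsSelfDual (ψ'.compAddMonoidHom (Algebra.trace F E).toAddMonoidHom) μE)
    (n : ℕ) (hn : 1 ≤ n)
    (νP : Measure (LeftQuotient (unipotentToMirabolic n F)))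
    (hνP : IsQuotientMeasure (unipotentToMirabolic n F)
      (unipotentMeasure n μF) (mirabolicMeasure n μF) νP)
    (νG : Measure (LeftQuotient (unipotentSubgroup n F).subtype))
    (hνG : IsQuotientMeasure (unipotentSubgroup n F).subtype
      (unipotentMeasure n μF) (generalLinearMeasure n μF) νG)
    (f : GL (Fin n) E → ℂ) (hf : IsSchwartzGL f) :
    Integrable (fun h => f (baseChangeGL n F E h)) (generalLinearMeasure n μF) ∧
    (∀ g₁ g₂ : GL (Fin n) E,
      Integrable (whittakerIntegrand ψ f g₁ g₂) (unipotentMeasure n μE)) ∧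
    Integrable (fun ph : LeftQuotient (unipotentToMirabolic n F) ×
        LeftQuotient (unipotentSubgroup n F).subtype => whittakerOnQuotients ψ μE f ph.1 ph.2)
      (νP.prod νG) ∧
    ∫ h, f (baseChangeGL n F E h) ∂(generalLinearMeasure n μF) =
      ((normAbs τ ^ ((n : ℝ) * ((n : ℝ) - 1) / 4) : ℝ) : ℂ) *
        ∫ p, ∫ h, whittakerOnQuotients ψ μE f p h ∂νG ∂νP := by
  have hF := hμF.isAddHaarMeasure
  have hE := hμE.isAddHaarMeasure
  have hτ0 : τ ≠ 0 := by
    rintro rfl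
    refine hψ_ne (DFunLike.ext _ _ fun z => ?_)
    rw [hτ, zero_mul, map_zero, AddChar.map_zero_eq_one, AddChar.one_apply]
  obtain ⟨σ, hσ⟩ := exists_isTraceZeroGenerator (F := F) hτ0 hτ_trace
  obtain ⟨N, hN, hfN⟩ := hf.exists_isRapidGL
  obtain ⟨S⟩ := (hσ.isProperAbs_restrict hN).nonempty_rowSection
  obtain ⟨c, hc0, hc⟩ := hσ.exists_measure_eq μF μE
  obtain ⟨d, hd0, hd⟩ := hσ.exists_sq
  obtain ⟨m, rfl⟩ : ∃ m, n = m + 1 := ⟨n - 1, by omega⟩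
  refine ⟨hfN.integrable_baseChangeGL hN hσ μF, hfN.integrable_whittakerIntegrand hN μE hψ_cont,
    hfN.integrable_whittakerOnQuotients μE hN S hσ μF hc0 hc hψ'_cont hψ'_ne hψ_cont hψ_triv hτ
      hd0 hd hνP hνG, ?_⟩
  rw [hfN.integral_whittakerOnQuotients μE hN S hσ μF hc0 hc hψ'_cont hψ'_ne hψ_cont hψ_triv hτ
    hd0 hd hνP hνG hμF, ← mul_assoc, ← Complex.ofReal_mul]
  have hone := hσ.mul_eq_one hψ'_cont hψ'_ne hμF hμE hd hc0 hc
  -- `n (n - 1) / 4` is half the number of entries above the diagonal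
  have hpow : normAbs τ ^ (((m + 1 : ℕ) : ℝ) * (((m + 1 : ℕ) : ℝ) - 1) / 4) =
      Real.sqrt (normAbs τ) ^ Fintype.card (TriIdx (m + 1)) := by
    have h1 : ((m + 1 : ℕ) : ℝ) * (((m + 1 : ℕ) : ℝ) - 1) =
        2 * (Fintype.card (TriIdx (m + 1)) : ℝ) := by
      have h2 := congrArg (Nat.cast : ℕ → ℝ) (TriIdx.two_mul_card (m + 1))
      rw [Nat.add_sub_cancel] at h2
      push_cast at h2 ⊢
      rw [h2]
      ring
    rw [h1, Real.sqrt_eq_rpow, ← Real.rpow_mul_natCast (normAbs_nonneg τ)]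
    congr 1
    ring
  rw [hpow, ← mul_pow, mul_comm (Real.sqrt _), hone, one_pow, Complex.ofReal_one, one_mul]
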